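/- \textbf{Setting.} For $k\in\mathbb R$, $t\ge1$ let $\bar\mu_\alpha(k,t)=\frac1{1+(|k|t)^\alpha}$, $\tilde\mu_\alpha(k,t)=\frac1{1+(|k|t^2)^\alpha}$. For $p,q\in\mathbb R\cup\{\infty\}$ let $\mathcal B_{\alpha,p,q}$ be the space of continuous $\hat f:(\mathbb R\setminus\{0\})\times[1,\infty)\to\mathbb C$ with $$\|\hat f;\mathcal B_{\alpha,p,q}\|=\sup_{t\ge1}\sup_{k\ne0}\frac{|\hat f(k,t)|}{t^{-p}\bar\mu_\alpha(k,t)+t^{-q}\tilde\mu_\alpha(k,t)}<\infty,$$ where $t^{-\infty}$ is read as $0$. Let $\boldsymbol F=(F_1,F_2)\in C_c^\infty(\Omega_+;\mathbb R^2)$, $\Omega_+=\{(x,y):y>1\}$, $\hat F_i(k,t)=\int_{\mathbb R}e^{ikx}F_i(x,t)\,dx$, and $(\hat f*\hat g)(k,t)=\frac1{2\pi}\int_{\mathbb R}\hat f(k-k',t)\hat g(k',t)\,dk'$. Put $\kappa=\sqrt{k^2-ik}$ (principal branch). Given $\hat\omega,\hat u,\hat v$ set $$\hat Q_0=\hat u*\hat\omega+\hat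 F_2,\qquad \hat Q_1=\hat v*\hat\omega-\hat F_1,$$ and, for $n=1,2,3$, $m=0,1$, with $\tau=t-1$, $\sigma=s-1$, $I_1=[1,t]$, $I_2=I_3=[t,\infty)$, $$\hat\omega_{n,m}=K_n\!\int_{I_n}\! f_{n,m}(k,\sigma)\hat Q_m(k,s)ds,\quad \hat\eta_{n,m}=K_n\!\int_{I_n}\! g_{n,m}(k,\sigma)\hat Q_m(k,s)ds,$$ $$\hat\psi_{n,m}=H_n\!\int_{I_n}\! h_{n,m}(k,\sigma)\hat Q_m(k,s)ds,\quad \hat\varphi_{n,m}=H_n\!\int_{I_n}\! k_{n,m}(k,\sigma)\hat Q_m(k,s)ds,$$ where $K_1=K_2=\frac12e^{-\kappa\tau}$, $K_3=\frac12\frac{\kappa}{ik}(e^{\kappa\tau}-e^{-\kappa\tau})$, $H_1=H_2=\frac12e^{-|k|\tau}$, $H_3=\frac12\frac{|k|}{ik}(e^{|k|\tau}-e^{-|k|\tau})$ and, writing $P=|k|+\kappa$, $E=e^{-\kappa\sigma}$, $D=e^{-|k|\sigma}$, \begin{align*} f_{1,0}&=\tfrac{ik}{\kappa}e^{\kappa\sigma}-\tfrac{P^2}{\kappa}E+2PD,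 & f_{1,1}&=e^{\kappa\sigma}+\tfrac{P^2}{ik}E-2\tfrac{|k|P}{ik}D,\\ f_{2,0}&=\bigl(\tfrac{ik}{\kappa}-\tfrac{P^2}{\kappa}\bigr)E+2PD, & f_{2,1}&=\bigl(-1+\tfrac{P^2}{ik}\bigr)E-2\tfrac{|k|P}{ik}D,\\ f_{3,0}&=\bigl(\tfrac{ik}{\kappa}\bigr)^2E, & f_{3,1}&=-\tfrac{ik}{\kappa}E,\\ g_{1,m}&=\tfrac{\kappa}{ik}f_{1,m}, & g_{3,0}&=-\tfrac{ik}{\kappa}E,\qquad g_{3,1}=E,\\ g_{2,0}&=-\bigl(1+\tfrac{P^2}{ik}\bigr)E+2\tfrac{\kappa P}{ik}D, & g_{2,1}&=\tfrac{\kappa}{ik}\bigl[\bigl(1+\tfrac{P^2}{ik}\bigr)E-2\tfrac{|k|P}{ik}D\bigr],\\ h_{1,0}&=-\tfrac{ik}{|k|}e^{|k|\sigma}-\tfrac{P^2}{|k|}D+2PE, & h_{1,1}&=-e^{|k|\sigma}+\tfrac{P^2}{ik}D-2\tfrac{\kappa P}{ik}E,\\ h_{2,0}&=-\bigl(\tfrac{ik}{|k|}+\tfrac{P^2}{|k|}\bigr)D+2PE,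 & h_{2,1}&=\bigl(1+\tfrac{P^2}{ik}\bigr)D-2\tfrac{\kappa P}{ik}E,\\ h_{3,0}&=D, & h_{3,1}&=\tfrac{ik}{|k|}D,\\ k_{1,m}&=-\tfrac{|k|}{ik}h_{1,m}, & k_{3,0}&=-\tfrac{ik}{|k|}D,\qquad k_{3,1}=D,\\ k_{2,0}&=\bigl(-1+\tfrac{P^2}{ik}\bigr)D-2\tfrac{|k|P}{ik}E, & k_{2,1}&=\tfrac{|k|}{ik}\bigl[\bigl(1-\tfrac{P^2}{ik}\bigr)D+2\tfrac{\kappa P}{ik}E\bigr]. \end{align*} Let $\hat\omega$ etc. without indices denote sums over $n,m$ of components. A \emph{solution} is a triple $(\hat\omega,\hat u,\hat v)\in\mathcal V_\alpha=\mathcal B_{\alpha,\frac52,1}\times\mathcal B_{\alpha,\frac12,0}\times\mathcal B_{\alpha,\frac12,1}$ such that, for $k\neq0$ and $t\ge1$, $\hat\omega=\sum\hat\omega_{n,m}$, $\hat u=-\hat\eta+\hat\varphi$, $\hat v=\hat\omega+\hat\psi$, where $\hat\eta=\sum\hat\eta_{n,m}$, $\hat\varphi=\sum\hat\varphi_{n,m}$,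 $\hat\psi=\sum\hat\psi_{n,m}$. (These are the functional equations, in Fourier variables, of the stationary Navier--Stokes equations in $\Omega_+$ with drift, force $\boldsymbol F$ and zero boundary conditions.) Finally put $$c_1=\int_1^\infty(s-1)\hat Q_1(0,s)\,ds,\quad \hat\omega_{\mathrm{as},1}=c_1\sqrt{-ik}\,e^{-\sqrt{-ik}\,t},\quad \hat\eta_{\mathrm{as},1}=-c_1e^{-\sqrt{-ik}\,t}.$$ \textbf{Proposition.} Let $\alpha'=\alpha-1>1$. There is $\varepsilon>0$ (depending only on $\alpha$) such that for every $\boldsymbol F$ as above and every solution $(\hat\omega,\hat u,\hat v)\in\mathcal V_\alpha$ for which $\hat F_1,\hat F_2$ have norm at most $\varepsilon$ in $\mathcal B_{\alpha,\frac72,\frac52}$ and $\hat\omega,\hat u,\hat v$ have norm at most $\varepsilon$ in the respective factors of $\mathcal V_\alpha$, the following holds. (i) $\hat Q_1\in\mathcal B_{\alpha',4,4}$ and $\hat Q_0\in\mathcal B_{\alpha',4,3}$. (ii) For every $\delta>0$, \begin{align*} &\hat\psi_{1,0},\hat\varphi_{1,0}\in\mathcal B_{\alpha',\frac32-\delta,2},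 &&\hat\psi_{1,1},\hat\varphi_{1,1}\in\mathcal B_{\alpha',\frac12,3},\\ &\hat\psi_{2,0},\hat\psi_{3,0},\hat\varphi_{2,0},\hat\varphi_{3,0}\in\mathcal B_{\alpha',3,2}, &&\hat\psi_{2,1},\hat\psi_{3,1},\hat\varphi_{2,1},\hat\varphi_{3,1}\in\mathcal B_{\alpha',3,3},\\ &\hat\omega_{1,0}\in\mathcal B_{\alpha',4,3-\delta},\ \hat\omega_{2,0}\in\mathcal B_{\alpha',\infty,3},\ \hat\omega_{3,0}\in\mathcal B_{\alpha',4,3}, &&\hat\omega_{1,1}\in\mathcal B_{\alpha',3,1},\ \hat\omega_{2,1}\in\mathcal B_{\alpha',\infty,3},\ \hat\omega_{3,1}\in\mathcal B_{\alpha',3,3},\\ &\hat\eta_{1,0}\in\mathcal B_{\alpha',3,2-\delta},\ \hat\eta_{2,0}\in\mathcal B_{\alpha',\infty,2},\ \hat\eta_{3,0}\in\mathcal B_{\alpha',3,2}, &&\hat\eta_{1,1}\in\mathcal B_{\alpha',2,0},\ \hat\eta_{2,1}\in\mathcal B_{\alpha',\infty,3},\ \hat\eta_{3,1}\in\mathcal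 B_{\alpha',2,2}. \end{align*} (iii) $\hat\omega-\hat\omega_{\mathrm{as},1}\in\mathcal B_{\alpha',3,2}$ and $\hat\eta-\hat\eta_{\mathrm{as},1}\in\mathcal B_{\alpha',2,1}$. -/

import Mathlib

open MeasureTheory Complex
open scoped ENNReal

noncomputable section

namespace WallFlow

/-- `μ_{α,r}(k,t) = 1 / (1 + (|k| t^r)^α)`. -/
def mu (α r k t : ℝ) : ℝ := 1 / (1 + (|k| * t ^ r) ^ α)

/-- `t^{-p}` for a decay index `p ∈ ℝ ∪ {∞}`, with `t^{-∞} = 0` (that term is absent). -/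
def decay : WithTop ℝ → ℝ → ℝ
  | ⊤, _ => 0
  | (p : ℝ), t => 1 / t ^ p

/-- The weight `t^{-p} μ_{α,1}(k,t) + t^{-q} μ_{α,2}(k,t)`. -/
def weight (α : ℝ) (p q : WithTop ℝ) (k t : ℝ) : ℝ :=
  decay p t * mu α 1 k t + decay q t * mu α 2 k t

/-- The norm of `𝓑_{α,p,q}`, with values in `[0, ∞]`. -/
def normB (α : ℝ) (p q : WithTop ℝ) (f : ℝ → ℝ → ℂ) : ℝ≥0∞ :=
  ⨆ (t : ℝ) (_ : 1 ≤ t) (k : ℝ) (_ : k ≠ 0),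
    ENNReal.ofReal ‖f k t‖ / ENNReal.ofReal (weight α p q k t)

/-- The space `𝓑_{α,p,q}` of functions `f(k,t)`, continuous on `(ℝ ∖ {0}) × [1,∞)` and of
finite norm. Values outside of this domain play no role. -/
def BSpace (α : ℝ) (p q : WithTop ℝ) : Set (ℝ → ℝ → ℂ) :=
  {f | ContinuousOn (fun z : ℝ × ℝ => f z.1 z.2) {z | z.1 ≠ 0 ∧ 1 ≤ z.2} ∧
    normB α p q f < ∞}

/-- The Fourier transform in the first variable, `∫ e^{ikx} f(x,t) dx`. -/
def fourierX (f : ℝ × ℝ → ℝ) (k t : ℝ) : ℂ :=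
  ∫ x : ℝ, cexp (I * k * x) * (f (x, t) : ℂ)

/-- The convolution in `k`, with the factor `1 / (2π)`. -/
def conv (f g : ℝ → ℝ → ℂ) (k t : ℝ) : ℂ :=
  (1 / (2 * (Real.pi : ℂ))) * ∫ k' : ℝ, f (k - k') t * g k' t

/-- `κ = √(k² - ik)` (principal branch). -/
def kappa (k : ℝ) : ℂ := ((k : ℂ) ^ 2 - I * k) ^ (1 / 2 : ℂ)

/-- `√(-ik)` (principal branch). -/
def sqrtNegI (k : ℝ) : ℂ := (-(I * k)) ^ (1 / 2 : ℂ)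

/-- The nonlinear terms `Q₀ = u ∗ ω + F₂` (index 0) and `Q₁ = v ∗ ω - F₁` (index 1). -/
def Q (F₁ F₂ : ℝ × ℝ → ℝ) (ω u v : ℝ → ℝ → ℂ) : Fin 2 → ℝ → ℝ → ℂ
  | 0, k, t => conv u ω k t + fourierX F₂ k t
  | 1, k, t => conv v ω k t - fourierX F₁ k t

/-- The three parts of each component: `n = 1` carries the integral over `[1,t]`, and
`n = 2, 3` carry integrals over `[t,∞)`. -/
inductive Part
  | one
  | two
  | three

/-- The domain of the `s`-integral of a part. -/
def Part.dom : Part → ℝ → Set ℝ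
  | .one, t => Set.Icc 1 t
  | .two, t => Set.Ici t
  | .three, t => Set.Ici t

/-- The prefactor in `ω_{n,m}` and `η_{n,m}`, at `τ = t - 1`. -/
def preK : Part → ℝ → ℝ → ℂ
  | .one, k, τ => 1 / 2 * cexp (-(kappa k * τ))
  | .two, k, τ => 1 / 2 * cexp (-(kappa k * τ))
  | .three, k, τ =>
      1 / 2 * (kappa k / (I * k)) * (cexp (kappa k * τ) - cexp (-(kappa k * τ)))

/-- The prefactor in `ψ_{n,m}` and `φ_{n,m}`, at `τ = t - 1`. -/
def preH : Part → ℝ → ℝ → ℂ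
  | .one, k, τ => 1 / 2 * cexp (-((|k| : ℝ) * τ))
  | .two, k, τ => 1 / 2 * cexp (-((|k| : ℝ) * τ))
  | .three, k, τ =>
      1 / 2 * ((|k| : ℝ) / (I * k)) * (cexp ((|k| : ℝ) * τ) - cexp (-((|k| : ℝ) * τ)))

/-- The kernels `f_{n,m}(k,σ)` of `ω_{n,m}`. -/
def kerF : Part → Fin 2 → ℝ → ℝ → ℂ
  | .one, 0, k, σ =>
      I * k / kappa k * cexp (kappa k * σ)
        - ((|k| : ℝ) + kappa k) ^ 2 / kappa k * cexp (-(kappa k * σ))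
        + 2 * ((|k| : ℝ) + kappa k) * cexp (-((|k| : ℝ) * σ))
  | .one, 1, k, σ =>
      cexp (kappa k * σ)
        + ((|k| : ℝ) + kappa k) ^ 2 / (I * k) * cexp (-(kappa k * σ))
        - 2 * ((|k| : ℝ) * ((|k| : ℝ) + kappa k) / (I * k)) * cexp (-((|k| : ℝ) * σ))
  | .two, 0, k, σ =>
      (I * k / kappa k - ((|k| : ℝ) + kappa k) ^ 2 / kappa k) * cexp (-(kappa k * σ))
        + 2 * ((|k| : ℝ) + kappa k) * cexp (-((|k| : ℝ) * σ))
  | .two, 1, k, σ =>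
      (-1 + ((|k| : ℝ) + kappa k) ^ 2 / (I * k)) * cexp (-(kappa k * σ))
        - 2 * ((|k| : ℝ) * ((|k| : ℝ) + kappa k) / (I * k)) * cexp (-((|k| : ℝ) * σ))
  | .three, 0, k, σ => (I * k / kappa k) ^ 2 * cexp (-(kappa k * σ))
  | .three, 1, k, σ => -(I * k / kappa k) * cexp (-(kappa k * σ))

/-- The kernels `g_{n,m}(k,σ)` of `η_{n,m}`. -/
def kerG : Part → Fin 2 → ℝ → ℝ → ℂ
  | .one, m, k, σ => kappa k / (I * k) * kerF .one m k σ
  | .two, 0, k, σ =>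
      -(1 + ((|k| : ℝ) + kappa k) ^ 2 / (I * k)) * cexp (-(kappa k * σ))
        + 2 * (kappa k * ((|k| : ℝ) + kappa k) / (I * k)) * cexp (-((|k| : ℝ) * σ))
  | .two, 1, k, σ =>
      kappa k / (I * k) *
        ((1 + ((|k| : ℝ) + kappa k) ^ 2 / (I * k)) * cexp (-(kappa k * σ))
          - 2 * ((|k| : ℝ) * ((|k| : ℝ) + kappa k) / (I * k)) * cexp (-((|k| : ℝ) * σ)))
  | .three, 0, k, σ => -(I * k / kappa k) * cexp (-(kappa k * σ))
  | .three, 1, k, σ => cexp (-(kappa k * σ))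

/-- The kernels `h_{n,m}(k,σ)` of `ψ_{n,m}`. -/
def kerH : Part → Fin 2 → ℝ → ℝ → ℂ
  | .one, 0, k, σ =>
      -(I * k / (|k| : ℝ)) * cexp ((|k| : ℝ) * σ)
        - ((|k| : ℝ) + kappa k) ^ 2 / (|k| : ℝ) * cexp (-((|k| : ℝ) * σ))
        + 2 * ((|k| : ℝ) + kappa k) * cexp (-(kappa k * σ))
  | .one, 1, k, σ =>
      -cexp ((|k| : ℝ) * σ)
        + ((|k| : ℝ) + kappa k) ^ 2 / (I * k) * cexp (-((|k| : ℝ) * σ))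
        - 2 * (kappa k * ((|k| : ℝ) + kappa k) / (I * k)) * cexp (-(kappa k * σ))
  | .two, 0, k, σ =>
      -(I * k / (|k| : ℝ) + ((|k| : ℝ) + kappa k) ^ 2 / (|k| : ℝ)) * cexp (-((|k| : ℝ) * σ))
        + 2 * ((|k| : ℝ) + kappa k) * cexp (-(kappa k * σ))
  | .two, 1, k, σ =>
      (1 + ((|k| : ℝ) + kappa k) ^ 2 / (I * k)) * cexp (-((|k| : ℝ) * σ))
        - 2 * (kappa k * ((|k| : ℝ) + kappa k) / (I * k)) * cexp (-(kappa k * σ))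
  | .three, 0, k, σ => cexp (-((|k| : ℝ) * σ))
  | .three, 1, k, σ => I * k / (|k| : ℝ) * cexp (-((|k| : ℝ) * σ))

/-- The kernels `k_{n,m}(k,σ)` of `φ_{n,m}`. -/
def kerK : Part → Fin 2 → ℝ → ℝ → ℂ
  | .one, m, k, σ => -((|k| : ℝ) / (I * k)) * kerH .one m k σ
  | .two, 0, k, σ =>
      (-1 + ((|k| : ℝ) + kappa k) ^ 2 / (I * k)) * cexp (-((|k| : ℝ) * σ))
        - 2 * ((|k| : ℝ) * ((|k| : ℝ) + kappa k) / (I * k)) * cexp (-(kappa k * σ))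
  | .two, 1, k, σ =>
      (|k| : ℝ) / (I * k) *
        ((1 - ((|k| : ℝ) + kappa k) ^ 2 / (I * k)) * cexp (-((|k| : ℝ) * σ))
          + 2 * (kappa k * ((|k| : ℝ) + kappa k) / (I * k)) * cexp (-(kappa k * σ)))
  | .three, 0, k, σ => -(I * k / (|k| : ℝ)) * cexp (-((|k| : ℝ) * σ))
  | .three, 1, k, σ => cexp (-((|k| : ℝ) * σ))

/-- `ω_{n,m}` for given `(Q₀, Q₁)`. -/
def omegaC (n : Part) (m : Fin 2) (q : Fin 2 → ℝ → ℝ → ℂ) (k t : ℝ) : ℂ :=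
  preK n k (t - 1) * ∫ s in n.dom t, kerF n m k (s - 1) * q m k s

/-- `η_{n,m}` for given `(Q₀, Q₁)`. -/
def etaC (n : Part) (m : Fin 2) (q : Fin 2 → ℝ → ℝ → ℂ) (k t : ℝ) : ℂ :=
  preK n k (t - 1) * ∫ s in n.dom t, kerG n m k (s - 1) * q m k s

/-- `ψ_{n,m}` for given `(Q₀, Q₁)`. -/
def psiC (n : Part) (m : Fin 2) (q : Fin 2 → ℝ → ℝ → ℂ) (k t : ℝ) : ℂ :=
  preH n k (t - 1) * ∫ s in n.dom t, kerH n m k (s - 1) * q m k s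

/-- `φ_{n,m}` for given `(Q₀, Q₁)`. -/
def phiC (n : Part) (m : Fin 2) (q : Fin 2 → ℝ → ℝ → ℂ) (k t : ℝ) : ℂ :=
  preH n k (t - 1) * ∫ s in n.dom t, kerK n m k (s - 1) * q m k s

/-- The sum of the six components of a function. -/
def total (c : Part → Fin 2 → (Fin 2 → ℝ → ℝ → ℂ) → ℝ → ℝ → ℂ)
    (q : Fin 2 → ℝ → ℝ → ℂ) (k t : ℝ) : ℂ :=
  ∑ m : Fin 2, (c .one m q k t + c .two m q k t + c .three m q k t)

/-- A force field `(F₁, F₂)` that is smooth with compact support in `{(x,y) | y > 1}`. -/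
structure IsForce (F₁ F₂ : ℝ × ℝ → ℝ) : Prop where
  smooth₁ : ContDiff ℝ ((⊤ : ℕ∞) : WithTop ℕ∞) F₁
  smooth₂ : ContDiff ℝ ((⊤ : ℕ∞) : WithTop ℕ∞) F₂
  compact₁ : HasCompactSupport F₁
  compact₂ : HasCompactSupport F₂
  support₁ : tsupport F₁ ⊆ {z | 1 < z.2}
  support₂ : tsupport F₂ ⊆ {z | 1 < z.2}

/-- `(ω, u, v)` is a fixed point, in `𝓑_{α,5/2,1} × 𝓑_{α,1/2,0} × 𝓑_{α,1/2,1}`, of the map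
`(ω, u, v) ↦ (ω', u', v')` with `ω' = Σ ω_{n,m}`, `u' = -Σ η_{n,m} + Σ φ_{n,m}` and
`v' = Σ ω_{n,m} + Σ ψ_{n,m}`. -/
structure IsSolution (α : ℝ) (F₁ F₂ : ℝ × ℝ → ℝ) (ω u v : ℝ → ℝ → ℂ) : Prop where
  mem_ω : ω ∈ BSpace α (5 / 2 : ℝ) (1 : ℝ)
  mem_u : u ∈ BSpace α (1 / 2 : ℝ) (0 : ℝ)
  mem_v : v ∈ BSpace α (1 / 2 : ℝ) (1 : ℝ)
  eq_ω : ∀ k t : ℝ, k ≠ 0 → 1 ≤ t → ω k t = total omegaC (Q F₁ F₂ ω u v) k t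
  eq_u : ∀ k t : ℝ, k ≠ 0 → 1 ≤ t →
    u k t = -total etaC (Q F₁ F₂ ω u v) k t + total phiC (Q F₁ F₂ ω u v) k t
  eq_v : ∀ k t : ℝ, k ≠ 0 → 1 ≤ t →
    v k t = total omegaC (Q F₁ F₂ ω u v) k t + total psiC (Q F₁ F₂ ω u v) k t

/-- The force and the solution have norm at most `ε` in `(𝓑_{α,7/2,5/2})²` and
`𝓑_{α,5/2,1} × 𝓑_{α,1/2,0} × 𝓑_{α,1/2,1}`, respectively. -/
structure IsSmall (α ε : ℝ) (F₁ F₂ : ℝ × ℝ → ℝ) (ω u v : ℝ → ℝ → ℂ) : Prop where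
  small_F₁ : normB α (7 / 2 : ℝ) (5 / 2 : ℝ) (fourierX F₁) ≤ ENNReal.ofReal ε
  small_F₂ : normB α (7 / 2 : ℝ) (5 / 2 : ℝ) (fourierX F₂) ≤ ENNReal.ofReal ε
  small_ω : normB α (5 / 2 : ℝ) (1 : ℝ) ω ≤ ENNReal.ofReal ε
  small_u : normB α (1 / 2 : ℝ) (0 : ℝ) u ≤ ENNReal.ofReal ε
  small_v : normB α (1 / 2 : ℝ) (1 : ℝ) v ≤ ENNReal.ofReal ε

/-- `c₁ = ∫_1^∞ (s - 1) Q₁(0,s) ds`. -/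
def c₁ (q : Fin 2 → ℝ → ℝ → ℂ) : ℂ := ∫ s in Set.Ici (1 : ℝ), ((s : ℂ) - 1) * q 1 0 s

/-- `ω_{as,1}(k,t) = c₁ √(-ik) e^{-√(-ik) t}`. -/
def omegaAs (q : Fin 2 → ℝ → ℝ → ℂ) (k t : ℝ) : ℂ :=
  c₁ q * sqrtNegI k * cexp (-(sqrtNegI k * t))

/-- `η_{as,1}(k,t) = -c₁ e^{-√(-ik) t}`. -/
def etaAs (q : Fin 2 → ℝ → ℝ → ℂ) (k t : ℝ) : ℂ := -c₁ q * cexp (-(sqrtNegI k * t))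

end WallFlow

end

/-!
The components of a solution are integral operators in `s` applied to the nonlinear terms `Q₀` and
`Q₁`. A direct estimate of the convolutions gives `Q₁ ∈ 𝓑_{α,7/2,7/2}` and `Q₀ ∈ 𝓑_{α,7/2,3}`
(`hasBound_Q_one`, `hasBound_Q_zero`). The claims need the exponent `4` in place of `7/2`, and
follow from it by estimates of the kernels; the missing half power comes from a cancellation.

*Kernels.* Let `W = (|k| + κ)(e^{-κσ} - e^{-|k|σ})`. Since
`(|k| + κ)² / (ik) = -1 - 2i sgn(k)(|k| + κ)`, every kernel is a propagator, `e^{-κ|t-s|}` or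
`e^{-|k||t-s|}`, times a combination of exponentials and `W` with bounded coefficients (up to one
factor `ik / κ` or `κ / (ik)` in some of them), and `W` is of size `|k|σ e^{-|k|σ}`. This gives size
bounds in the scaled frequency `√|k| s`, hence the bounds `hasBound_omega_one_one` and its
companions on the components. They hold for sources that decay like `t^{-p}`, and are used twice:
with `p = 7/2` and with `p = 4`.

*Hölder continuity.* The kernels are Hölder continuous in `k` with exponent `1/2`. If the vorticity
`ω` has this property up to an error `η`, then so do `Q₀` and `Q₁`, with a constant that is
proportional to the size of `u` and `v`, and therefore `ω` has it, for small data, with the error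
`η / 2`. Iterating, `ω` is Hölder continuous (`exists_hol_omega`). This is the only place where
smallness is used. As a consequence `ψ`, `φ` and `Q₁` are Hölder continuous, the last one up to
`k = 0`, where it defines `c₁`.

*Asymptotics.* For `s ≤ t/2` the kernel of `ω_{1,1}` is `(s-1) √(-ik) e^{-√(-ik)t}` up to an error
of second order in `√|k| s`. With the Hölder continuity of `Q₁` at `k = 0` this shows that
`ω - ω_as` gains a power of `t` over `ω` in the fast weight (`hasBound_total_omega_sub`), and
similarly for `η`.

*Cancellation.* The profile `ω_as` has mean zero in `k` (`integral_profile`). In the convolution of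
`ω` with the slowly decaying part `a₂` of the velocity (`ψ` for `v`, and `φ` for `u`) one may
therefore replace `a₂(k-l) ω_as(l)` by `(a₂(k-l) - a₂(k)) ω_as(l)`, and the factor `√|l|` from the
Hölder continuity of `a₂` is worth one power of `t` against `e^{-√(-il)t}`. This is
`hasBound_conv_of_meanZero`; it yields the improved bounds on `Q₀` and `Q₁`, and a second pass
through the bounds on the components and the asymptotics concludes.

No step loses decay in `k`: all bounds hold with the weights of exponent `α`, which are bounded by
twice those of exponent `α - 1`.
-/

namespace WallFlow

section

/-! ### The bracket `1 / (1 + x ^ α)` -/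

/-- The decreasing profile `1 / (1 + x ^ α)`, from which both weights `mu α 1` and `mu α 2` arise by
rescaling. -/
noncomputable def br (α x : ℝ) : ℝ := 1 / (1 + x ^ α)

lemma br_pos {α x : ℝ} (hx : 0 ≤ x) : 0 < br α x := by
  have := Real.rpow_nonneg hx α
  unfold br; positivity

lemma br_le_one {α x : ℝ} (hx : 0 ≤ x) : br α x ≤ 1 := by
  have := Real.rpow_nonneg hx α
  unfold br
  rw [div_le_one (by positivity)]; linarith

lemma br_anti {α x y : ℝ} (hα : 0 ≤ α) (hx : 0 ≤ x) (hxy : x ≤ y) : br α y ≤ br α x := by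
  have h0 := Real.rpow_nonneg hx α
  have h1 := Real.rpow_le_rpow hx hxy hα
  unfold br
  exact one_div_le_one_div_of_le (by positivity) (by linarith)

lemma add_rpow_le_two_rpow {α x y : ℝ} (hα : 0 ≤ α) (hx : 0 ≤ x) (hy : 0 ≤ y) :
    (x + y) ^ α ≤ 2 ^ α * (x ^ α + y ^ α) := by
  have hx' := Real.rpow_nonneg hx α
  have hy' := Real.rpow_nonneg hy α
  have h2 : (0 : ℝ) ≤ 2 ^ α := Real.rpow_nonneg (by norm_num) _
  rcases le_total x y with h | h
  · calc (x + y) ^ α ≤ (2 * y) ^ α := Real.rpow_le_rpow (by positivity) (by linarith) hα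
      _ = 2 ^ α * y ^ α := Real.mul_rpow (by norm_num) hy
      _ ≤ _ := by gcongr; linarith
  · calc (x + y) ^ α ≤ (2 * x) ^ α := Real.rpow_le_rpow (by positivity) (by linarith) hα
      _ = 2 ^ α * x ^ α := Real.mul_rpow (by norm_num) hx
      _ ≤ _ := by gcongr; linarith

lemma one_le_two_rpow {α : ℝ} (hα : 0 ≤ α) : (1 : ℝ) ≤ 2 ^ α :=
  Real.one_le_rpow (by norm_num) hα

/-- Submultiplicativity of the bracket. -/
lemma br_mul_br_le {α x y : ℝ} (hα : 0 ≤ α) (hx : 0 ≤ x) (hy : 0 ≤ y) :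
    br α x * br α y ≤ 2 ^ α * br α (x + y) := by
  have hx' := Real.rpow_nonneg hx α
  have hy' := Real.rpow_nonneg hy α
  have hxy' := Real.rpow_nonneg (add_nonneg hx hy) α
  have h1 := add_rpow_le_two_rpow hα hx hy
  have h2 := one_le_two_rpow hα
  unfold br
  rw [div_mul_div_comm, mul_one_div, div_le_div_iff₀ (by positivity) (by positivity)]
  have : 0 ≤ 2 ^ α * (x ^ α * y ^ α) := by positivity
  nlinarith

/-- Peetre's inequality for the bracket: one of the two factors survives. -/
lemma br_mul_br_le_add {α x y : ℝ} (hα : 0 ≤ α) (hx : 0 ≤ x) (hy : 0 ≤ y) :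
    br α x * br α y ≤ 2 ^ α * br α (x + y) * (br α x + br α y) := by
  have hx' := Real.rpow_nonneg hx α
  have hy' := Real.rpow_nonneg hy α
  have hxy' := Real.rpow_nonneg (add_nonneg hx hy) α
  have h1 := add_rpow_le_two_rpow hα hx hy
  have h2 := one_le_two_rpow hα
  have e : br α x + br α y = br α x * br α y * ((1 + x ^ α) + (1 + y ^ α)) := by
    unfold br; field_simp; ring
  have e2 : (1 : ℝ) = br α (x + y) * (1 + (x + y) ^ α) := by
    unfold br; field_simp
  have p1 := br_pos (α := α) hx
  have p2 := br_pos (α := α) hy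
  have p3 := br_pos (α := α) (add_nonneg hx hy)
  rw [e]
  calc br α x * br α y = br α x * br α y * (br α (x + y) * (1 + (x + y) ^ α)) := by
        rw [← e2, mul_one]
    _ ≤ br α x * br α y * (br α (x + y) * (2 ^ α * ((1 + x ^ α) + (1 + y ^ α)))) := by
        gcongr; nlinarith
    _ = _ := by ring

lemma br_mul_le {α c x : ℝ} (hα : 0 ≤ α) (hc : 1 ≤ c) (hx : 0 ≤ x) :
    br α x ≤ c ^ α * br α (c * x) := by
  have hx' := Real.rpow_nonneg hx α
  have h2 : (1 : ℝ) ≤ c ^ α := Real.one_le_rpow hc hα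
  unfold br
  rw [Real.mul_rpow (by linarith) hx, mul_one_div, div_le_div_iff₀ (by positivity) (by positivity)]
  nlinarith

lemma br_sqrt {α x : ℝ} (hx : 0 ≤ x) : br (2 * α) (√x) = br α x := by
  unfold br
  rw [Real.sqrt_eq_rpow, ← Real.rpow_mul hx]
  congr 3; ring

/-- Passing from the exponent `α` to `α - 1` enlarges the bracket up to a factor `2`. -/
lemma br_le_two_mul_br_sub_one {α x : ℝ} (hα : 1 ≤ α) (hx : 0 ≤ x) :
    br α x ≤ 2 * br (α - 1) x := by
  have hx' := Real.rpow_nonneg hx α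
  have hx'' := Real.rpow_nonneg hx (α - 1)
  unfold br
  rw [mul_one_div, div_le_div_iff₀ (by positivity) (by positivity)]
  rcases le_total x 1 with h | h
  · have := Real.rpow_le_one hx h (by linarith : 0 ≤ α - 1)
    nlinarith
  · have := Real.rpow_le_rpow_of_exponent_le h (by linarith : α - 1 ≤ α)
    nlinarith

/-! ### Powers against exponentials -/

lemma exists_rpow_mul_exp_le {a c : ℝ} (ha : 0 ≤ a) (hc : 0 < c) :
    ∃ C, 0 < C ∧ ∀ x : ℝ, 0 ≤ x → x ^ a * Real.exp (-(c * x)) ≤ C := by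
  rcases ha.eq_or_lt with rfl | ha
  · refine ⟨1, one_pos, fun x hx => ?_⟩
    rw [Real.rpow_zero, one_mul, Real.exp_le_one_iff]
    have : 0 ≤ c * x := by positivity
    linarith
  · refine ⟨(a / c) ^ a, by positivity, fun x hx => ?_⟩
    have h1 : c * x / a ≤ Real.exp (c * x / a) := by
      linarith [Real.add_one_le_exp (c * x / a)]
    have h2 := Real.rpow_le_rpow (by positivity) h1 ha.le
    rw [← Real.exp_mul, div_mul_cancel₀ _ ha.ne'] at h2
    rw [Real.exp_neg, ← div_eq_mul_inv, div_le_iff₀ (Real.exp_pos _)]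
    calc x ^ a = (a / c) ^ a * (c * x / a) ^ a := by
          rw [← Real.mul_rpow (by positivity) (by positivity)]; congr 1; field_simp
      _ ≤ _ := by gcongr

/-- An exponential absorbs any power and any bracket. -/
lemma exists_rpow_mul_exp_le_br {a c α : ℝ} (ha : 0 ≤ a) (hc : 0 < c) (hα : 0 ≤ α) :
    ∃ C, 0 < C ∧ ∀ x : ℝ, 0 ≤ x → x ^ a * Real.exp (-(c * x)) ≤ C * br α x := by
  obtain ⟨C1, h1, H1⟩ := exists_rpow_mul_exp_le ha hc
  obtain ⟨C2, h2, H2⟩ := exists_rpow_mul_exp_le (add_nonneg ha hα) hc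
  refine ⟨C1 + C2, by positivity, fun x hx => ?_⟩
  have hx' := Real.rpow_nonneg hx α
  unfold br
  rw [mul_one_div, le_div_iff₀ (by positivity)]
  have e1 := H1 x hx
  have e2 := H2 x hx
  rcases hx.eq_or_lt with rfl | hx
  · by_cases h : α = 0
    · subst h; simp only [add_zero, Real.rpow_zero] at *; linarith
    · rw [Real.zero_rpow h]; linarith
  · rw [Real.rpow_add hx] at e2; nlinarith

lemma exists_exp_le_br {c α : ℝ} (hc : 0 < c) (hα : 0 ≤ α) :
    ∃ C, 0 < C ∧ ∀ x : ℝ, 0 ≤ x → Real.exp (-(c * x)) ≤ C * br α x := by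
  obtain ⟨C, h, H⟩ := exists_rpow_mul_exp_le_br le_rfl hc hα
  exact ⟨C, h, fun x hx => by simpa using H x hx⟩

lemma mul_exp_neg_le_one (x : ℝ) : x * Real.exp (-x) ≤ 1 := by
  rw [Real.exp_neg, ← div_eq_mul_inv, div_le_one (Real.exp_pos _)]
  linarith [Real.add_one_le_exp x]

/-- Propagation of a bracket by the heat-like factor `e^{-cy(t-s)}`. -/
lemma exists_exp_mul_br_le {c α : ℝ} (hc : 0 < c) (hα : 0 ≤ α) :
    ∃ C, 1 ≤ C ∧ ∀ y s t : ℝ, 0 ≤ y → 1 ≤ s → 1 ≤ t →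
      Real.exp (-(c * (y * max (t - s) 0))) * br α (y * s) ≤ C * br α (y * t) := by
  obtain ⟨C, h, H⟩ := exists_exp_le_br hc hα
  refine ⟨max 1 (C * 2 ^ α), le_max_left _ _, fun y s t hy hs ht => ?_⟩
  have ht0 : 0 ≤ y * t := by positivity
  have hs0 : 0 ≤ y * s := by positivity
  rcases le_total t s with hst | hst
  · rw [max_eq_right (by linarith)]
    simp only [mul_zero, neg_zero, Real.exp_zero, one_mul]
    calc br α (y * s) ≤ 1 * br α (y * t) := by
          rw [one_mul]; exact br_anti hα ht0 (by gcongr)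
      _ ≤ _ := by gcongr; exacts [(br_pos ht0).le, le_max_left _ _]
  · rw [max_eq_left (by linarith)]
    have h0 : 0 ≤ y * (t - s) := mul_nonneg hy (by linarith)
    calc Real.exp (-(c * (y * (t - s)))) * br α (y * s)
        ≤ (C * br α (y * (t - s))) * br α (y * s) := by
          gcongr; exacts [(br_pos hs0).le, H _ h0]
      _ = C * (br α (y * (t - s)) * br α (y * s)) := by ring
      _ ≤ C * (2 ^ α * br α (y * (t - s) + y * s)) :=
          mul_le_mul_of_nonneg_left (br_mul_br_le hα h0 hs0) h.le
      _ = C * 2 ^ α * br α (y * t) := by rw [← mul_add, sub_add_cancel]; ring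
      _ ≤ _ := by gcongr; exacts [(br_pos ht0).le, le_max_right _ _]

/-! ### The two weights -/

/-- The slow weight `mu α 1`, written with the bracket. -/
noncomputable def wB (α k t : ℝ) : ℝ := br α (|k| * t)

/-- The fast weight `mu α 2`, written with the bracket. -/
noncomputable def wT (α k t : ℝ) : ℝ := br α (|k| * t ^ 2)

lemma mu_one (α k t : ℝ) : mu α 1 k t = wB α k t := by simp [mu, wB, br]

lemma mu_two (α k t : ℝ) : mu α 2 k t = wT α k t := by
  simp [mu, wT, br]

lemma wT_eq {α k t : ℝ} (ht : 0 ≤ t) : wT α k t = br (2 * α) (√|k| * t) := by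
  unfold wT
  rw [← br_sqrt (by positivity), Real.sqrt_mul (abs_nonneg k), Real.sqrt_sq ht]

variable {α k s t : ℝ}

lemma wB_pos (ht : 1 ≤ t) : 0 < wB α k t := br_pos (by positivity)
lemma wT_pos (ht : 1 ≤ t) : 0 < wT α k t := br_pos (by positivity)
lemma wB_le_one (ht : 1 ≤ t) : wB α k t ≤ 1 := br_le_one (by positivity)
lemma wT_le_one (ht : 1 ≤ t) : wT α k t ≤ 1 := br_le_one (by positivity)

lemma wT_le_wB (hα : 0 ≤ α) (ht : 1 ≤ t) : wT α k t ≤ wB α k t :=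
  br_anti hα (by positivity) (by gcongr; nlinarith)

lemma wB_anti (hα : 0 ≤ α) (hs : 1 ≤ s) (hst : s ≤ t) : wB α k t ≤ wB α k s :=
  br_anti hα (by positivity) (by gcongr)

lemma wT_anti (hα : 0 ≤ α) (hs : 1 ≤ s) (hst : s ≤ t) : wT α k t ≤ wT α k s :=
  br_anti hα (by positivity) (by gcongr)

lemma wB_le_of_le_two_mul (hα : 0 ≤ α) (ht : 1 ≤ t) (hst : t ≤ 2 * s) :
    wB α k s ≤ 2 ^ α * wB α k t := by
  unfold wB
  have hs : 0 ≤ s := by linarith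
  refine (br_mul_le hα (by norm_num : (1:ℝ) ≤ 2) (by positivity)).trans ?_
  gcongr
  exact br_anti hα (by positivity) (by nlinarith [abs_nonneg k])

lemma wT_le_of_le_two_mul (hα : 0 ≤ α) (ht : 1 ≤ t) (hst : t ≤ 2 * s) :
    wT α k s ≤ 4 ^ α * wT α k t := by
  unfold wT
  refine (br_mul_le hα (by norm_num : (1:ℝ) ≤ 4) (by positivity)).trans ?_
  gcongr
  refine br_anti hα (by positivity) ?_
  have : t ^ 2 ≤ 4 * s ^ 2 := by nlinarith
  nlinarith [abs_nonneg k]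

end

section

/-! ### The root `κ` -/

variable {k : ℝ}

lemma kappa_sq (k : ℝ) : kappa k ^ 2 = (k : ℂ) ^ 2 - I * k := by
  unfold kappa
  rw [one_div]
  exact Complex.cpow_ofNat_inv_pow _ 2

lemma re_kappa_radicand (k : ℝ) : ((k : ℂ) ^ 2 - I * k).re = k ^ 2 := by
  simp [pow_two]

lemma im_kappa_radicand (k : ℝ) : ((k : ℂ) ^ 2 - I * k).im = -k := by
  simp [pow_two]

lemma norm_kappa_sq (k : ℝ) : ‖kappa k‖ ^ 2 = ‖(k : ℂ) ^ 2 - I * k‖ := by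
  rw [← norm_pow, kappa_sq]

lemma norm_kappa_pow_four (k : ℝ) : (‖kappa k‖ ^ 2) ^ 2 = k ^ 4 + k ^ 2 := by
  rw [norm_kappa_sq, ← Complex.normSq_eq_norm_sq, Complex.normSq_apply, re_kappa_radicand,
    im_kappa_radicand]
  ring

lemma re_kappa_nonneg (k : ℝ) : 0 ≤ (kappa k).re := by
  unfold kappa
  rw [one_div, Complex.cpow_inv_two_re]
  positivity

lemma re_kappa_sq (k : ℝ) : (kappa k).re ^ 2 = (‖kappa k‖ ^ 2 + k ^ 2) / 2 := by
  rw [norm_kappa_sq]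
  unfold kappa
  rw [one_div, Complex.cpow_inv_two_re, re_kappa_radicand, Real.sq_sqrt (by positivity)]

lemma sq_le_norm_kappa_sq (k : ℝ) : k ^ 2 ≤ ‖kappa k‖ ^ 2 := by
  rw [norm_kappa_sq]
  have := Complex.abs_re_le_norm ((k : ℂ) ^ 2 - I * k)
  rw [re_kappa_radicand] at this
  exact (le_abs_self _).trans this

lemma abs_le_norm_kappa_sq (k : ℝ) : |k| ≤ ‖kappa k‖ ^ 2 := by
  rw [norm_kappa_sq]
  have := Complex.abs_im_le_norm ((k : ℂ) ^ 2 - I * k)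
  rwa [im_kappa_radicand, abs_neg] at this

lemma norm_kappa_sq_le (k : ℝ) : ‖kappa k‖ ^ 2 ≤ |k| + k ^ 2 := by
  rw [norm_kappa_sq]
  refine (norm_sub_le _ _).trans ?_
  simp [add_comm]

lemma abs_le_norm_kappa (k : ℝ) : |k| ≤ ‖kappa k‖ :=
  abs_le_of_sq_le_sq (sq_le_norm_kappa_sq k) (norm_nonneg _)

lemma sqrt_le_norm_kappa (k : ℝ) : √|k| ≤ ‖kappa k‖ := by
  rw [Real.sqrt_le_left (norm_nonneg _)]; exact abs_le_norm_kappa_sq k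

lemma norm_kappa_le (k : ℝ) : ‖kappa k‖ ≤ √|k| + |k| := by
  refine abs_le_of_sq_le_sq' ?_ (by positivity) |>.2
  have := norm_kappa_sq_le k
  have h : √|k| ^ 2 = |k| := Real.sq_sqrt (abs_nonneg k)
  nlinarith [sq_abs k, mul_nonneg (Real.sqrt_nonneg |k|) (abs_nonneg k)]

lemma abs_le_re_kappa (k : ℝ) : |k| ≤ (kappa k).re := by
  rw [← sq_le_sq₀ (abs_nonneg _) (re_kappa_nonneg k), re_kappa_sq, sq_abs]
  linarith [sq_le_norm_kappa_sq k]

lemma norm_kappa_le_two_mul_re (k : ℝ) : ‖kappa k‖ ≤ 2 * (kappa k).re := by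
  rw [← sq_le_sq₀ (norm_nonneg _) (by linarith [re_kappa_nonneg k]), mul_pow, re_kappa_sq]
  nlinarith [sq_nonneg ‖kappa k‖, sq_nonneg k]

lemma sqrt_le_two_mul_re_kappa (k : ℝ) : √|k| ≤ 2 * (kappa k).re :=
  (sqrt_le_norm_kappa k).trans (norm_kappa_le_two_mul_re k)

lemma norm_kappa_mono {k k' : ℝ} (h : |k| ≤ |k'|) : ‖kappa k‖ ≤ ‖kappa k'‖ := by
  have h2 : k ^ 2 ≤ k' ^ 2 := sq_le_sq.2 h
  have h4 : (‖kappa k‖ ^ 2) ^ 2 ≤ (‖kappa k'‖ ^ 2) ^ 2 := by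
    rw [norm_kappa_pow_four, norm_kappa_pow_four]
    nlinarith [sq_nonneg k, sq_nonneg k']
  rw [sq_le_sq₀ (by positivity) (by positivity)] at h4
  rwa [sq_le_sq₀ (by positivity) (by positivity)] at h4

lemma norm_kappa_pos (hk : k ≠ 0) : 0 < ‖kappa k‖ :=
  (abs_pos.2 hk).trans_le (abs_le_norm_kappa k)

lemma kappa_ne_zero (hk : k ≠ 0) : kappa k ≠ 0 := norm_pos_iff.1 (norm_kappa_pos hk)

lemma abs_div_norm_kappa_le_sqrt (hk : k ≠ 0) : |k| / ‖kappa k‖ ≤ √|k| := by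
  rw [div_le_iff₀ (norm_kappa_pos hk)]
  calc |k| = √|k| * √|k| := (Real.mul_self_sqrt (abs_nonneg k)).symm
    _ ≤ _ := by gcongr; exact sqrt_le_norm_kappa k

lemma abs_div_norm_kappa_le_one (hk : k ≠ 0) : |k| / ‖kappa k‖ ≤ 1 := by
  rw [div_le_one (norm_kappa_pos hk)]; exact abs_le_norm_kappa k

lemma norm_kappa_div_abs_le (hk : k ≠ 0) : ‖kappa k‖ / |k| ≤ 1 / √|k| + 1 := by
  have h0 : 0 < √|k| := Real.sqrt_pos.2 (abs_pos.2 hk)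
  rw [div_le_iff₀ (abs_pos.2 hk)]
  calc ‖kappa k‖ ≤ √|k| + |k| := norm_kappa_le k
    _ = (1 / √|k| + 1) * |k| := by
      rw [add_mul, one_mul, one_div_mul_eq_div, Real.div_sqrt]

lemma continuousAt_kappa (hk : k ≠ 0) : ContinuousAt kappa k := by
  unfold kappa
  refine ContinuousAt.cpow (by fun_prop) continuousAt_const (Or.inr ?_)
  rw [im_kappa_radicand]; simpa using hk

/-- `κ` is Hölder continuous of exponent `1/2` at distances up to `1`. -/
lemma norm_kappa_sub_le {k k' : ℝ} (h : |k - k'| ≤ 1) :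
    ‖kappa k - kappa k'‖ ≤ 3 * √|k - k'| := by
  have r1 := re_kappa_nonneg k
  have r2 := re_kappa_nonneg k'
  have a1 := abs_le_re_kappa k
  have a2 := abs_le_re_kappa k'
  have s1 := sqrt_le_two_mul_re_kappa k
  have s2 := sqrt_le_two_mul_re_kappa k'
  set S := ‖kappa k + kappa k'‖ with hS
  have hSre : (kappa k).re + (kappa k').re ≤ S := by
    simpa using Complex.re_le_norm (kappa k + kappa k')
  set d := √|k - k'| with hd
  have d0 : 0 ≤ d := Real.sqrt_nonneg _
  have dd : d ^ 2 = |k - k'| := Real.sq_sqrt (abs_nonneg _)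
  have d1 : d ≤ 1 := by rw [hd]; exact Real.sqrt_le_one.2 h
  have hdS : d ≤ 2 * S := by
    have : d ≤ √|k| + √|k'| := by
      rw [hd, Real.sqrt_le_left (by positivity)]
      have e1 : √|k| ^ 2 = |k| := Real.sq_sqrt (abs_nonneg k)
      have e2 : √|k'| ^ 2 = |k'| := Real.sq_sqrt (abs_nonneg k')
      nlinarith [abs_sub k k', mul_nonneg (Real.sqrt_nonneg |k|) (Real.sqrt_nonneg |k'|)]
    linarith
  rcases (norm_nonneg (kappa k + kappa k')).eq_or_lt with h0 | h0
  · have S0 : S = 0 := h0.symm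
    have e1 : |k| = 0 := le_antisymm (by linarith) (abs_nonneg _)
    have e2 : |k'| = 0 := le_antisymm (by linarith) (abs_nonneg _)
    rw [abs_eq_zero] at e1 e2
    subst e1; subst e2; simp [d0]
  · have key : ‖kappa k - kappa k'‖ * S = |k - k'| * ‖((k + k' : ℝ) : ℂ) - I‖ := by
      have e1 := kappa_sq k
      have e2 := kappa_sq k'
      have e : (kappa k - kappa k') * (kappa k + kappa k')
          = ((k - k' : ℝ) : ℂ) * (((k + k' : ℝ) : ℂ) - I) := by
        push_cast
        linear_combination e1 - e2
      rw [hS, ← norm_mul, e, norm_mul, Complex.norm_real, Real.norm_eq_abs]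
    have n1 : ‖((k + k' : ℝ) : ℂ) - I‖ ≤ S + 1 := by
      refine (norm_sub_le _ _).trans ?_
      rw [Complex.norm_real, norm_I, Real.norm_eq_abs]
      linarith [abs_add_le k k']
    have : ‖kappa k - kappa k'‖ * S ≤ 3 * d * S := by
      rw [key, ← dd]
      calc d ^ 2 * ‖((k + k' : ℝ) : ℂ) - I‖ ≤ d ^ 2 * (S + 1) := by gcongr
        _ = d * (d * S) + d * d := by ring
        _ ≤ 1 * (d * S) + d * (2 * S) := by gcongr
        _ = _ := by ring
    exact le_of_mul_le_mul_right this h0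

/-! ### Exponentials with exponents in the right half plane -/

lemma norm_exp_sub_one_le_of_re_nonpos {z : ℂ} (hz : z.re ≤ 0) : ‖cexp z - 1‖ ≤ 2 * ‖z‖ := by
  rcases le_total ‖z‖ 1 with h | h
  · exact Complex.norm_exp_sub_one_le h
  · refine (norm_sub_le _ _).trans ?_
    rw [Complex.norm_exp, norm_one]
    have := Real.exp_le_one_iff.2 hz
    linarith

lemma norm_exp_sub_one_sub_id_le_of_re_nonpos {z : ℂ} (hz : z.re ≤ 0) :
    ‖cexp z - 1 - z‖ ≤ 3 * ‖z‖ ^ 2 := by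
  rcases le_total ‖z‖ 1 with h | h
  · have := Complex.norm_exp_sub_one_sub_id_le h
    nlinarith [sq_nonneg ‖z‖]
  · refine (norm_sub_le _ _).trans ?_
    have h2 : ‖cexp z - 1‖ ≤ 2 := by
      refine (norm_sub_le _ _).trans ?_
      rw [Complex.norm_exp, norm_one]
      have := Real.exp_le_one_iff.2 hz
      linarith
    nlinarith

lemma norm_exp_neg_mul (a : ℂ) (x : ℝ) : ‖cexp (-(a * x))‖ = Real.exp (-(a.re * x)) := by
  rw [Complex.norm_exp]; simp

/-- Lipschitz dependence of `e^{-ax}` on `a`, with the decay of the slower exponential. -/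
lemma norm_exp_neg_mul_sub_le {a b : ℂ} {x m : ℝ} (hx : 0 ≤ x) (ha : m ≤ a.re) (hb : m ≤ b.re) :
    ‖cexp (-(a * x)) - cexp (-(b * x))‖ ≤ 2 * ‖a - b‖ * x * Real.exp (-(m * x)) := by
  wlog hab : b.re ≤ a.re generalizing a b
  · rw [norm_sub_rev, norm_sub_rev a b]
    exact this hb ha (le_of_not_ge hab)
  have e : cexp (-(a * x)) - cexp (-(b * x))
      = cexp (-(b * x)) * (cexp (-((a - b) * x)) - 1) := by
    rw [mul_sub, ← Complex.exp_add, mul_one]; congr 2; ring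
  rw [e, norm_mul, norm_exp_neg_mul]
  have h1 : (-((a - b) * (x : ℂ))).re ≤ 0 := by
    simp only [neg_re, mul_re, sub_re, ofReal_re, ofReal_im, mul_zero, sub_zero]
    nlinarith
  have h2 := norm_exp_sub_one_le_of_re_nonpos h1
  rw [norm_neg, norm_mul, Complex.norm_real, Real.norm_of_nonneg hx] at h2
  have h3 : Real.exp (-(b.re * x)) ≤ Real.exp (-(m * x)) :=
    Real.exp_le_exp.2 (by nlinarith)
  calc _ ≤ Real.exp (-(m * x)) * (2 * (‖a - b‖ * x)) := by gcongr
    _ = _ := by ring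

end

section

variable {k : ℝ}

/-! ### Normal forms of the kernels -/

/-- `e^{-κx}`. -/
noncomputable def eK (k x : ℝ) : ℂ := cexp (-(kappa k * x))

/-- `e^{-|k|x}`. -/
noncomputable def eA (k x : ℝ) : ℂ := cexp (-((|k| : ℝ) * x))

/-- The sign of `k`, as a complex number. -/
noncomputable def sg (k : ℝ) : ℂ := (k : ℂ) / (|k| : ℝ)

/-- The combination `(|k| + κ)(e^{-κσ} - e^{-|k|σ})`, through which all cancellations between the two
exponentials in the kernels take place. -/
noncomputable def wW (k σ : ℝ) : ℂ := ((|k| : ℝ) + kappa k) * (eK k σ - eA k σ)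

lemma ofReal_abs_ne_zero (hk : k ≠ 0) : ((|k| : ℝ) : ℂ) ≠ 0 := by
  exact_mod_cast abs_ne_zero.2 hk

lemma ofReal_abs_sq (k : ℝ) : ((|k| : ℝ) : ℂ) ^ 2 = (k : ℂ) ^ 2 := by
  exact_mod_cast sq_abs k

lemma norm_sg (hk : k ≠ 0) : ‖sg k‖ = 1 := by
  unfold sg
  rw [norm_div, Complex.norm_real, Complex.norm_real, Real.norm_eq_abs, Real.norm_eq_abs, abs_abs,
    div_self (abs_ne_zero.2 hk)]

lemma abs_div_I_mul (hk : k ≠ 0) : ((|k| : ℝ) : ℂ) / (I * k) = -(I * sg k) := by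
  have h1 := ofReal_abs_ne_zero hk
  have h2 : (k : ℂ) ≠ 0 := by exact_mod_cast hk
  have h3 := ofReal_abs_sq k
  unfold sg
  field_simp
  rw [I_sq]; linear_combination h3

lemma I_mul_div_abs (k : ℝ) : I * k / ((|k| : ℝ) : ℂ) = I * sg k := by
  unfold sg; ring

lemma sg_mul_sg (hk : k ≠ 0) : sg k * sg k = 1 := by
  have h1 := ofReal_abs_ne_zero hk
  unfold sg
  field_simp
  exact (ofReal_abs_sq k).symm

lemma sg_mul_abs (hk : k ≠ 0) : sg k * ((|k| : ℝ) : ℂ) = k := by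
  have h1 := ofReal_abs_ne_zero hk
  unfold sg
  field_simp

lemma sumsq_div_I_mul (hk : k ≠ 0) :
    (((|k| : ℝ) : ℂ) + kappa k) ^ 2 / (I * k)
      = -1 - 2 * I * sg k * (((|k| : ℝ) : ℂ) + kappa k) := by
  have h1 := ofReal_abs_ne_zero hk
  have h2 : (k : ℂ) ≠ 0 := by exact_mod_cast hk
  have h3 := ofReal_abs_sq k
  have h4 := kappa_sq k
  unfold sg
  rw [div_eq_iff (mul_ne_zero I_ne_zero h2)]
  field_simp
  linear_combination ((|k| : ℝ) : ℂ) * h4 + (((|k| : ℝ) : ℂ) + 2 * kappa k) * h3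
    + 2 * ((|k| : ℝ) + kappa k) * k ^ 2 * I_sq

lemma abs_mul_sum_div_I_mul (hk : k ≠ 0) :
    ((|k| : ℝ) : ℂ) * (((|k| : ℝ) : ℂ) + kappa k) / (I * k)
      = -(I * sg k) * (((|k| : ℝ) : ℂ) + kappa k) := by
  rw [mul_div_right_comm, abs_div_I_mul hk]

lemma kappa_mul_sum_div_I_mul (hk : k ≠ 0) :
    kappa k * (((|k| : ℝ) : ℂ) + kappa k) / (I * k)
      = -1 - I * sg k * (((|k| : ℝ) : ℂ) + kappa k) := by
  have h1 := sumsq_div_I_mul hk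
  have h2 := abs_mul_sum_div_I_mul hk
  have : kappa k * (((|k| : ℝ) : ℂ) + kappa k) / (I * k)
      = (((|k| : ℝ) : ℂ) + kappa k) ^ 2 / (I * k)
        - ((|k| : ℝ) : ℂ) * (((|k| : ℝ) : ℂ) + kappa k) / (I * k) := by ring
  rw [this, h1, h2]; ring

lemma sumsq_div_kappa (hk : k ≠ 0) :
    (((|k| : ℝ) : ℂ) + kappa k) ^ 2 / kappa k
      = I * k / kappa k + 2 * (((|k| : ℝ) : ℂ) + kappa k) := by
  have h1 := kappa_ne_zero hk
  have h3 := ofReal_abs_sq k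
  have h4 := kappa_sq k
  field_simp
  linear_combination h3 - h4

/-- The sum `|k| + κ` is `ik / κ` up to a bounded factor. -/
lemma sum_eq (hk : k ≠ 0) :
    (((|k| : ℝ) : ℂ) + kappa k)
      = I * k / kappa k * (-1 - I * sg k * (((|k| : ℝ) : ℂ) + kappa k)) := by
  have h2 : (k : ℂ) ≠ 0 := by exact_mod_cast hk
  have h1 := kappa_ne_zero hk
  rw [← kappa_mul_sum_div_I_mul hk]
  field_simp

lemma sumsq_div_abs (hk : k ≠ 0) :
    (((|k| : ℝ) : ℂ) + kappa k) ^ 2 / ((|k| : ℝ) : ℂ)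
      = -(I * sg k) + 2 * (((|k| : ℝ) : ℂ) + kappa k) := by
  have h2 : (k : ℂ) ≠ 0 := by exact_mod_cast hk
  have h1 := ofReal_abs_ne_zero hk
  have e : (((|k| : ℝ) : ℂ) + kappa k) ^ 2 / ((|k| : ℝ) : ℂ)
      = (((|k| : ℝ) : ℂ) + kappa k) ^ 2 / (I * k) * (I * k / ((|k| : ℝ) : ℂ)) := by
    field_simp
  rw [e, sumsq_div_I_mul hk, I_mul_div_abs]
  linear_combination (-2 * (((|k| : ℝ) : ℂ) + kappa k)) * (sg k * sg k) * I_sq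
    + 2 * (((|k| : ℝ) : ℂ) + kappa k) * sg_mul_sg hk

lemma eK_mul_exp (k x : ℝ) : eK k x * cexp (kappa k * x) = 1 := by
  unfold eK; rw [← Complex.exp_add]; simp

lemma eA_mul_exp (k x : ℝ) : eA k x * cexp ((|k| : ℝ) * x) = 1 := by
  unfold eA; rw [← Complex.exp_add]; simp

lemma eK_sub_one_mul_exp (k t s : ℝ) :
    eK k (t - 1) * cexp (kappa k * ((s - 1 : ℝ) : ℂ)) = eK k (t - s) := by
  unfold eK; rw [← Complex.exp_add]; congr 1; push_cast; ring

lemma eA_sub_one_mul_exp (k t s : ℝ) :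
    eA k (t - 1) * cexp ((|k| : ℝ) * ((s - 1 : ℝ) : ℂ)) = eA k (t - s) := by
  unfold eA; rw [← Complex.exp_add]; congr 1; push_cast; ring

/-- The bounded factor left in the kernels of `ω` and `η` with `n = 1` once the propagator `e^{-κ(t-s)}`
has been taken out. -/
noncomputable def bOmega : Fin 2 → ℝ → ℝ → ℂ
  | 0, k, σ => 1 + eK k σ ^ 2 - 2 * (eK k σ * eA k σ) + 2 * (I * sg k) * (eK k σ * wW k σ)
  | 1, k, σ => 1 - eK k σ ^ 2 - 2 * (I * sg k) * (eK k σ * wW k σ)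

/-- The bounded factor left in the kernels of `ψ` and `φ` with `n = 1` once the propagator
`e^{-|k|(t-s)}` has been taken out. -/
noncomputable def bPsi : Fin 2 → ℝ → ℝ → ℂ
  | 0, k, σ => -(I * sg k) * (1 - eA k σ ^ 2) + 2 * (eA k σ * wW k σ)
  | 1, k, σ => -1 + 2 * (eA k σ * eK k σ) - eA k σ ^ 2 + 2 * (I * sg k) * (eA k σ * wW k σ)

variable {t s : ℝ}

lemma kerOmega_one_zero (hk : k ≠ 0) : preK .one k (t - 1) * kerF .one 0 k (s - 1)
    = 1 / 2 * (I * k / kappa k) * (eK k (t - s) * bOmega 0 k (s - 1)) := by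
  have h1 := sumsq_div_kappa hk
  have h2 := sum_eq hk
  have hE := eK_mul_exp k (s - 1)
  rw [← eK_sub_one_mul_exp]
  simp only [preK, kerF, bOmega, wW]
  rw [h1]
  simp only [← eK.eq_1, ← eA.eq_1]
  set P := ((|k| : ℝ) : ℂ) + kappa k
  set U := eK k (t - 1)
  set E := eK k (s - 1)
  set D := eA k (s - 1)
  set X := cexp (kappa k * ((s - 1 : ℝ) : ℂ))
  linear_combination (-U * (E - D)) * h2
    - 1 / 2 * (I * k / kappa k) * U * (E - 2 * D + 2 * (I * sg k) * (P * (E - D))) * hE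

lemma kerOmega_one_one (hk : k ≠ 0) : preK .one k (t - 1) * kerF .one 1 k (s - 1)
    = 1 / 2 * (eK k (t - s) * bOmega 1 k (s - 1)) := by
  have h1 := sumsq_div_I_mul hk
  have h2 := abs_mul_sum_div_I_mul hk
  have hE := eK_mul_exp k (s - 1)
  rw [← eK_sub_one_mul_exp]
  simp only [preK, kerF, bOmega, wW]
  rw [h1, h2]
  simp only [← eK.eq_1, ← eA.eq_1]
  set P := ((|k| : ℝ) : ℂ) + kappa k
  set U := eK k (t - 1)
  set E := eK k (s - 1)
  set D := eA k (s - 1)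
  set X := cexp (kappa k * ((s - 1 : ℝ) : ℂ))
  linear_combination (1 / 2 * U * (E + 2 * (I * sg k) * (P * (E - D)))) * hE

lemma kerOmega_two_zero (hk : k ≠ 0) : preK .two k (t - 1) * kerF .two 0 k (s - 1)
    = -(eK k (t - 1) * wW k (s - 1)) := by
  simp only [preK, kerF, wW, sumsq_div_kappa hk, ← eK.eq_1, ← eA.eq_1]
  ring

lemma kerOmega_two_one (hk : k ≠ 0) : preK .two k (t - 1) * kerF .two 1 k (s - 1)
    = -(eK k (t - 1) * (eK k (s - 1) + I * sg k * wW k (s - 1))) := by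
  simp only [preK, kerF, wW, sumsq_div_I_mul hk, abs_mul_sum_div_I_mul hk, ← eK.eq_1, ← eA.eq_1]
  ring

lemma exp_sub_mul_eK (k t s : ℝ) :
    (cexp (kappa k * ((t - 1 : ℝ) : ℂ)) - eK k (t - 1)) * eK k (s - 1)
      = eK k (s - t) * (1 - eK k (t - 1) ^ 2) := by
  rw [← eK_sub_one_mul_exp k s t]
  linear_combination (eK k (t - 1) * eK k (s - 1)) * eK_mul_exp k (t - 1)

lemma exp_sub_mul_eA (k t s : ℝ) :
    (cexp ((|k| : ℝ) * ((t - 1 : ℝ) : ℂ)) - eA k (t - 1)) * eA k (s - 1)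
      = eA k (s - t) * (1 - eA k (t - 1) ^ 2) := by
  rw [← eA_sub_one_mul_exp k s t]
  linear_combination (eA k (t - 1) * eA k (s - 1)) * eA_mul_exp k (t - 1)

lemma kerOmega_three_zero (hk : k ≠ 0) : preK .three k (t - 1) * kerF .three 0 k (s - 1)
    = 1 / 2 * (I * k / kappa k) * (eK k (s - t) * (1 - eK k (t - 1) ^ 2)) := by
  have h2 : (k : ℂ) ≠ 0 := by exact_mod_cast hk
  have h1 := kappa_ne_zero hk
  rw [← exp_sub_mul_eK]
  simp only [preK, kerF, ← eK.eq_1]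
  field_simp

lemma kerOmega_three_one (hk : k ≠ 0) : preK .three k (t - 1) * kerF .three 1 k (s - 1)
    = -(1 / 2) * (eK k (s - t) * (1 - eK k (t - 1) ^ 2)) := by
  have h2 : (k : ℂ) ≠ 0 := by exact_mod_cast hk
  have h1 := kappa_ne_zero hk
  rw [← exp_sub_mul_eK]
  simp only [preK, kerF, ← eK.eq_1]
  field_simp

lemma kerEta_one (m : Fin 2) : preK .one k (t - 1) * kerG .one m k (s - 1)
    = kappa k / (I * k) * (preK .one k (t - 1) * kerF .one m k (s - 1)) := by
  simp only [kerG]; ring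

lemma kerEta_one_zero (hk : k ≠ 0) : preK .one k (t - 1) * kerG .one 0 k (s - 1)
    = 1 / 2 * (eK k (t - s) * bOmega 0 k (s - 1)) := by
  have h2 : (k : ℂ) ≠ 0 := by exact_mod_cast hk
  have h1 := kappa_ne_zero hk
  rw [kerEta_one, kerOmega_one_zero hk]
  field_simp

lemma kerEta_two_zero (hk : k ≠ 0) : preK .two k (t - 1) * kerG .two 0 k (s - 1)
    = eK k (t - 1) * (-eA k (s - 1) + I * sg k * wW k (s - 1)) := by
  simp only [preK, kerG, wW, sumsq_div_I_mul hk, kappa_mul_sum_div_I_mul hk, ← eK.eq_1, ← eA.eq_1]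
  ring

lemma kerEta_two_one (hk : k ≠ 0) : preK .two k (t - 1) * kerG .two 1 k (s - 1)
    = -(kappa k / (|k| : ℝ) * (eK k (t - 1) * wW k (s - 1))) := by
  have h2 : (k : ℂ) ≠ 0 := by exact_mod_cast hk
  have h1 := ofReal_abs_ne_zero hk
  have e : sg k * (1 / (k : ℂ)) = 1 / ((|k| : ℝ) : ℂ) := by unfold sg; field_simp
  simp only [preK, kerG, wW, sumsq_div_I_mul hk, abs_mul_sum_div_I_mul hk, ← eK.eq_1, ← eA.eq_1]
  have e2 : kappa k / (I * k) = -I * kappa k * (1 / (k : ℂ)) := by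
    field_simp; rw [I_sq]; ring
  rw [e2, div_eq_mul_one_div (kappa k), ← e]
  linear_combination ((1 / (k : ℂ)) * kappa k * sg k * (eK k (t - 1) *
     (((|k| : ℝ) + kappa k) * (eK k (s - 1) - eA k (s - 1))))) * I_sq

lemma kerEta_three_zero (hk : k ≠ 0) : preK .three k (t - 1) * kerG .three 0 k (s - 1)
    = -(1 / 2) * (eK k (s - t) * (1 - eK k (t - 1) ^ 2)) := by
  rw [← kerOmega_three_one hk]; rfl

lemma kerEta_three_one : preK .three k (t - 1) * kerG .three 1 k (s - 1)
    = kappa k / (I * k) * (1 / 2 * (eK k (s - t) * (1 - eK k (t - 1) ^ 2))) := by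
  rw [← exp_sub_mul_eK]
  simp only [preK, kerG, ← eK.eq_1]
  ring

lemma kerPsi_one_zero (hk : k ≠ 0) : preH .one k (t - 1) * kerH .one 0 k (s - 1)
    = 1 / 2 * (eA k (t - s) * bPsi 0 k (s - 1)) := by
  have hE := eA_mul_exp k (s - 1)
  rw [← eA_sub_one_mul_exp]
  simp only [preH, kerH, bPsi, wW]
  rw [sumsq_div_abs hk, I_mul_div_abs]
  simp only [← eK.eq_1, ← eA.eq_1]
  set P := ((|k| : ℝ) : ℂ) + kappa k
  set U := eA k (t - 1)
  set E := eK k (s - 1)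
  set D := eA k (s - 1)
  set X := cexp ((|k| : ℝ) * ((s - 1 : ℝ) : ℂ))
  linear_combination (-1 / 2 * U * (2 * P * (E - D) + I * sg k * D)) * hE

lemma kerPsi_one_one (hk : k ≠ 0) : preH .one k (t - 1) * kerH .one 1 k (s - 1)
    = 1 / 2 * (eA k (t - s) * bPsi 1 k (s - 1)) := by
  have hE := eA_mul_exp k (s - 1)
  rw [← eA_sub_one_mul_exp]
  simp only [preH, kerH, bPsi, wW]
  rw [sumsq_div_I_mul hk, kappa_mul_sum_div_I_mul hk]
  simp only [← eK.eq_1, ← eA.eq_1]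
  set P := ((|k| : ℝ) : ℂ) + kappa k
  set U := eA k (t - 1)
  set E := eK k (s - 1)
  set D := eA k (s - 1)
  set X := cexp ((|k| : ℝ) * ((s - 1 : ℝ) : ℂ))
  linear_combination (-1 / 2 * U * (2 * E - D + 2 * (I * sg k) * (P * (E - D)))) * hE

lemma kerPsi_two_zero (hk : k ≠ 0) : preH .two k (t - 1) * kerH .two 0 k (s - 1)
    = eA k (t - 1) * wW k (s - 1) := by
  simp only [preH, kerH, wW, sumsq_div_abs hk, I_mul_div_abs, ← eK.eq_1, ← eA.eq_1]
  ring

lemma kerPsi_two_one (hk : k ≠ 0) : preH .two k (t - 1) * kerH .two 1 k (s - 1)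
    = eA k (t - 1) * (eK k (s - 1) + I * sg k * wW k (s - 1)) := by
  simp only [preH, kerH, wW, sumsq_div_I_mul hk, kappa_mul_sum_div_I_mul hk, ← eK.eq_1, ← eA.eq_1]
  ring

lemma kerPsi_three_zero (hk : k ≠ 0) : preH .three k (t - 1) * kerH .three 0 k (s - 1)
    = -(I * sg k) * (1 / 2 * (eA k (s - t) * (1 - eA k (t - 1) ^ 2))) := by
  rw [← exp_sub_mul_eA]
  simp only [preH, kerH, abs_div_I_mul hk, ← eA.eq_1]
  ring

lemma kerPsi_three_one (hk : k ≠ 0) : preH .three k (t - 1) * kerH .three 1 k (s - 1)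
    = 1 / 2 * (eA k (s - t) * (1 - eA k (t - 1) ^ 2)) := by
  have h2 : (k : ℂ) ≠ 0 := by exact_mod_cast hk
  have h1 := ofReal_abs_ne_zero hk
  rw [← exp_sub_mul_eA]
  simp only [preH, kerH, ← eA.eq_1]
  field_simp

lemma kerPhi_one (hk : k ≠ 0) (m : Fin 2) : preH .one k (t - 1) * kerK .one m k (s - 1)
    = I * sg k * (preH .one k (t - 1) * kerH .one m k (s - 1)) := by
  simp only [kerK, abs_div_I_mul hk]; ring

lemma kerPhi_two_zero (hk : k ≠ 0) : preH .two k (t - 1) * kerK .two 0 k (s - 1)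
    = eA k (t - 1) * (-eA k (s - 1) + I * sg k * wW k (s - 1)) := by
  simp only [preH, kerK, wW, sumsq_div_I_mul hk, abs_mul_sum_div_I_mul hk, ← eK.eq_1, ← eA.eq_1]
  ring

lemma kerPhi_two_one (hk : k ≠ 0) : preH .two k (t - 1) * kerK .two 1 k (s - 1)
    = eA k (t - 1) * (I * sg k * (eK k (s - 1) - eA k (s - 1)) - wW k (s - 1)) := by
  simp only [preH, kerK, wW, sumsq_div_I_mul hk, kappa_mul_sum_div_I_mul hk, abs_div_I_mul hk,
    ← eK.eq_1, ← eA.eq_1]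
  linear_combination (eA k (t - 1) * (((|k| : ℝ) + kappa k) * (eK k (s - 1) - eA k (s - 1)))) *
    ((sg k * sg k) * I_sq - sg_mul_sg hk)

lemma kerPhi_three_zero (hk : k ≠ 0) : preH .three k (t - 1) * kerK .three 0 k (s - 1)
    = -(1 / 2) * (eA k (s - t) * (1 - eA k (t - 1) ^ 2)) := by
  rw [neg_mul, ← kerPsi_three_one hk]
  simp only [kerK, kerH]; ring

lemma kerPhi_three_one (hk : k ≠ 0) : preH .three k (t - 1) * kerK .three 1 k (s - 1)
    = -(I * sg k) * (1 / 2 * (eA k (s - t) * (1 - eA k (t - 1) ^ 2))) := by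
  rw [← kerPsi_three_zero hk]; rfl

end

section

variable {k t s σ x : ℝ}

/-! ### Size of the kernels -/

lemma norm_eK (k x : ℝ) : ‖eK k x‖ = Real.exp (-((kappa k).re * x)) := norm_exp_neg_mul _ _

lemma norm_eA (k x : ℝ) : ‖eA k x‖ = Real.exp (-(|k| * x)) := by
  unfold eA; rw [norm_exp_neg_mul, ofReal_re]

lemma norm_eK_le_one (hx : 0 ≤ x) : ‖eK k x‖ ≤ 1 := by
  rw [norm_eK, Real.exp_le_one_iff]
  have := mul_nonneg (re_kappa_nonneg k) hx
  linarith

lemma norm_eA_le_one (hx : 0 ≤ x) : ‖eA k x‖ ≤ 1 := by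
  rw [norm_eA, Real.exp_le_one_iff]
  have := mul_nonneg (abs_nonneg k) hx
  linarith

lemma norm_eK_le_exp_abs (hx : 0 ≤ x) : ‖eK k x‖ ≤ Real.exp (-(|k| * x)) := by
  rw [norm_eK]
  apply Real.exp_le_exp.2
  have := mul_le_mul_of_nonneg_right (abs_le_re_kappa k) hx
  linarith

lemma norm_one_sub_eK_le (hx : 0 ≤ x) : ‖1 - eK k x‖ ≤ 2 * (‖kappa k‖ * x) := by
  rw [norm_sub_rev]
  refine (norm_exp_sub_one_le_of_re_nonpos ?_).trans (le_of_eq ?_)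
  · have := mul_nonneg (re_kappa_nonneg k) hx
    simpa using this
  · rw [norm_neg, norm_mul, Complex.norm_real, Real.norm_of_nonneg hx]

lemma norm_one_sub_eA_le (hx : 0 ≤ x) : ‖1 - eA k x‖ ≤ 2 * (|k| * x) := by
  rw [norm_sub_rev]
  refine (norm_exp_sub_one_le_of_re_nonpos ?_).trans (le_of_eq ?_)
  · have := mul_nonneg (abs_nonneg k) hx
    simpa using this
  · rw [norm_neg, norm_mul, Complex.norm_real, Complex.norm_real, Real.norm_of_nonneg hx,
      Real.norm_of_nonneg (abs_nonneg k)]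

lemma eK_sq (k x : ℝ) : eK k x ^ 2 = eK k (2 * x) := by
  unfold eK; rw [← Complex.exp_nat_mul]; congr 1; push_cast; ring

lemma eA_sq (k x : ℝ) : eA k x ^ 2 = eA k (2 * x) := by
  unfold eA; rw [← Complex.exp_nat_mul]; congr 1; push_cast; ring

lemma norm_one_sub_eK_sq_le (hx : 0 ≤ x) : ‖1 - eK k x ^ 2‖ ≤ 4 * (‖kappa k‖ * x) := by
  rw [eK_sq]
  refine (norm_one_sub_eK_le (by positivity)).trans (le_of_eq (by ring))

lemma norm_one_sub_eA_sq_le (hx : 0 ≤ x) : ‖1 - eA k x ^ 2‖ ≤ 4 * (|k| * x) := by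
  rw [eA_sq]
  refine (norm_one_sub_eA_le (by positivity)).trans (le_of_eq (by ring))

lemma norm_one_sub_eK_sq_le_two (hx : 0 ≤ x) : ‖1 - eK k x ^ 2‖ ≤ 2 := by
  refine (norm_sub_le _ _).trans ?_
  rw [norm_one, norm_pow]
  nlinarith [norm_eK_le_one (k := k) hx, norm_nonneg (eK k x)]

lemma norm_one_sub_eA_sq_le_two (hx : 0 ≤ x) : ‖1 - eA k x ^ 2‖ ≤ 2 := by
  refine (norm_sub_le _ _).trans ?_
  rw [norm_one, norm_pow]
  nlinarith [norm_eA_le_one (k := k) hx, norm_nonneg (eA k x)]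

lemma sum_mul_sub (k : ℝ) :
    (((|k| : ℝ) : ℂ) + kappa k) * (kappa k - ((|k| : ℝ) : ℂ)) = -(I * k) := by
  linear_combination kappa_sq k - ofReal_abs_sq k

lemma norm_sum_le (k : ℝ) : ‖((|k| : ℝ) : ℂ) + kappa k‖ ≤ 2 * ‖kappa k‖ := by
  refine (norm_add_le _ _).trans ?_
  rw [Complex.norm_real, Real.norm_eq_abs, abs_abs]
  linarith [abs_le_norm_kappa k]

lemma norm_sum_mul_norm_sub (k : ℝ) :
    ‖((|k| : ℝ) : ℂ) + kappa k‖ * ‖kappa k - ((|k| : ℝ) : ℂ)‖ = |k| := by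
  rw [← norm_mul, sum_mul_sub]; simp

lemma norm_eK_sub_eA_le (hσ : 0 ≤ σ) :
    ‖eK k σ - eA k σ‖ ≤ 2 * ‖kappa k - ((|k| : ℝ) : ℂ)‖ * σ * Real.exp (-(|k| * σ)) := by
  refine norm_exp_neg_mul_sub_le hσ (abs_le_re_kappa k) ?_
  simp

lemma norm_eK_sub_eA_le_two (hσ : 0 ≤ σ) : ‖eK k σ - eA k σ‖ ≤ 2 := by
  refine (norm_sub_le _ _).trans ?_
  linarith [norm_eK_le_one (k := k) hσ, norm_eA_le_one (k := k) hσ]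

/-- The factor `|k| + κ` cancels against `κ - |k| = -ik / (|k| + κ)`. -/
lemma norm_wW_le_exp (hσ : 0 ≤ σ) : ‖wW k σ‖ ≤ 2 * (|k| * σ * Real.exp (-(|k| * σ))) := by
  unfold wW
  rw [norm_mul]
  calc _ ≤ ‖((|k| : ℝ) : ℂ) + kappa k‖ *
        (2 * ‖kappa k - ((|k| : ℝ) : ℂ)‖ * σ * Real.exp (-(|k| * σ))) := by
        gcongr; exact norm_eK_sub_eA_le hσ
    _ = 2 * ((‖((|k| : ℝ) : ℂ) + kappa k‖ * ‖kappa k - ((|k| : ℝ) : ℂ)‖) * σ *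
          Real.exp (-(|k| * σ))) := by ring
    _ = _ := by rw [norm_sum_mul_norm_sub]

lemma norm_wW_le (hσ : 0 ≤ σ) : ‖wW k σ‖ ≤ 2 * (|k| * σ) := by
  refine (norm_wW_le_exp hσ).trans ?_
  have h : Real.exp (-(|k| * σ)) ≤ 1 :=
    Real.exp_le_one_iff.2 (by have := mul_nonneg (abs_nonneg k) hσ; linarith)
  have := mul_nonneg (abs_nonneg k) hσ
  nlinarith

lemma norm_wW_le_two (hσ : 0 ≤ σ) : ‖wW k σ‖ ≤ 2 := by
  refine (norm_wW_le_exp hσ).trans ?_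
  linarith [mul_exp_neg_le_one (|k| * σ)]

lemma norm_wW_le_kappa (hσ : 0 ≤ σ) : ‖wW k σ‖ ≤ 4 * ‖kappa k‖ := by
  unfold wW
  rw [norm_mul]
  nlinarith [norm_sum_le k, norm_eK_sub_eA_le_two (k := k) hσ, norm_nonneg (eK k σ - eA k σ),
    norm_nonneg (((|k| : ℝ) : ℂ) + kappa k)]

lemma norm_kappa_le_two_sqrt (h : |k| ≤ 1) : ‖kappa k‖ ≤ 2 * √|k| := by
  have h1 := norm_kappa_le k
  have h2 : |k| ≤ √|k| := by
    rw [Real.le_sqrt (abs_nonneg k) (abs_nonneg k)]; nlinarith [abs_nonneg k]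
  linarith

lemma norm_I_mul_sg (hk : k ≠ 0) : ‖I * sg k‖ = 1 := by rw [norm_mul, norm_I, norm_sg hk, one_mul]

lemma norm_two_mul_I_sg_mul (hk : k ≠ 0) (z : ℂ) : ‖2 * (I * sg k) * z‖ = 2 * ‖z‖ := by
  rw [norm_mul, norm_mul, norm_I_mul_sg hk]; simp

/-- Pointwise size bounds for the scaled frequency variable `√|k| s` below `1`. -/
lemma small_of_sqrt_mul_le_one (hs : 1 ≤ s) (h : √|k| * s ≤ 1) :
    |k| ≤ 1 ∧ ‖kappa k‖ ≤ 2 * √|k| ∧ |k| * s ≤ (√|k| * s) ^ 2 := by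
  have h0 := Real.sqrt_nonneg |k|
  have h1 : √|k| ≤ 1 := by nlinarith
  have h2 : |k| = √|k| ^ 2 := (Real.sq_sqrt (abs_nonneg k)).symm
  have h3 : |k| ≤ 1 := by rw [h2]; nlinarith
  refine ⟨h3, norm_kappa_le_two_sqrt h3, ?_⟩
  nth_rewrite 1 [h2]
  rw [mul_pow]
  have : s ≤ s ^ 2 := by nlinarith
  gcongr

lemma norm_bOmega_one_le (hk : k ≠ 0) (hs : 1 ≤ s) :
    ‖bOmega 1 k (s - 1)‖ ≤ 16 * min 1 (√|k| * s) := by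
  have hσ : 0 ≤ s - 1 := by linarith
  have hE := norm_eK_le_one (k := k) hσ
  have e : ‖bOmega 1 k (s - 1)‖ ≤ ‖1 - eK k (s - 1) ^ 2‖ + 2 * ‖wW k (s - 1)‖ := by
    unfold bOmega
    refine (norm_sub_le _ _).trans ?_
    rw [norm_two_mul_I_sg_mul hk, norm_mul]
    nlinarith [norm_nonneg (wW k (s - 1))]
  rcases le_total 1 (√|k| * s) with h | h
  · rw [min_eq_left h]
    linarith [norm_one_sub_eK_sq_le_two (k := k) hσ, norm_wW_le_two (k := k) hσ]
  · rw [min_eq_right h]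
    obtain ⟨h1, h2, h3⟩ := small_of_sqrt_mul_le_one hs h
    have a1 := norm_one_sub_eK_sq_le (k := k) hσ
    have a2 := norm_wW_le (k := k) hσ
    have h0 := Real.sqrt_nonneg |k|
    have a3 : ‖kappa k‖ * (s - 1) ≤ 2 * (√|k| * s) := by
      calc _ ≤ 2 * √|k| * s := by gcongr; linarith
        _ = _ := by ring
    have a4 : |k| * (s - 1) ≤ √|k| * s := by
      nlinarith [abs_nonneg k, mul_nonneg h0 (by linarith : 0 ≤ s)]
    linarith [mul_nonneg h0 (by linarith : 0 ≤ s)]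

/-- The second-order cancellation in the kernel of `ω_{1,0}`. -/
lemma norm_bOmega_zero_le (hk : k ≠ 0) (hs : 1 ≤ s) :
    ‖bOmega 0 k (s - 1)‖ ≤ 24 * min 1 (√|k| * s) ^ 2 := by
  have hσ : 0 ≤ s - 1 := by linarith
  have hE := norm_eK_le_one (k := k) hσ
  have hD := norm_eA_le_one (k := k) hσ
  have e : ‖bOmega 0 k (s - 1)‖ ≤
      ‖1 - eK k (s - 1)‖ ^ 2 + 2 * ‖1 - eA k (s - 1)‖ + 2 * ‖wW k (s - 1)‖ := by
    have : bOmega 0 k (s - 1) = (1 - eK k (s - 1)) ^ 2 + 2 * (eK k (s - 1) * (1 - eA k (s - 1)))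
        + 2 * (I * sg k) * (eK k (s - 1) * wW k (s - 1)) := by unfold bOmega; ring
    rw [this]
    refine (norm_add₃_le).trans ?_
    rw [norm_two_mul_I_sg_mul hk, norm_mul, norm_pow, norm_mul, norm_mul]
    simp only [Complex.norm_ofNat]
    nlinarith [norm_nonneg (wW k (s - 1)), norm_nonneg (1 - eA k (s - 1))]
  rcases le_total 1 (√|k| * s) with h | h
  · rw [min_eq_left h]
    have h1 : ‖1 - eK k (s - 1)‖ ≤ 2 := (norm_sub_le _ _).trans (by rw [norm_one]; linarith)
    have h2 : ‖1 - eA k (s - 1)‖ ≤ 2 := (norm_sub_le _ _).trans (by rw [norm_one]; linarith)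
    nlinarith [norm_wW_le_two (k := k) hσ, norm_nonneg (1 - eK k (s - 1))]
  · rw [min_eq_right h]
    obtain ⟨h1, h2, h3⟩ := small_of_sqrt_mul_le_one hs h
    have a1 := norm_one_sub_eK_le (k := k) hσ
    have a2 := norm_wW_le (k := k) hσ
    have a5 := norm_one_sub_eA_le (k := k) hσ
    have h0 := Real.sqrt_nonneg |k|
    have a3 : ‖kappa k‖ * (s - 1) ≤ 2 * (√|k| * s) := by
      calc _ ≤ 2 * √|k| * s := by gcongr; linarith
        _ = _ := by ring
    have a6 : ‖1 - eK k (s - 1)‖ ^ 2 ≤ (4 * (√|k| * s)) ^ 2 := by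
      gcongr; linarith
    nlinarith [abs_nonneg k]

lemma norm_bPsi_one_le (hk : k ≠ 0) (hs : 1 ≤ s) :
    ‖bPsi 1 k (s - 1)‖ ≤ 16 * min 1 (√|k| * s) := by
  have hσ : 0 ≤ s - 1 := by linarith
  have hE := norm_eK_le_one (k := k) hσ
  have hD := norm_eA_le_one (k := k) hσ
  have e : ‖bPsi 1 k (s - 1)‖ ≤
      ‖1 - eA k (s - 1)‖ ^ 2 + 2 * ‖1 - eK k (s - 1)‖ + 2 * ‖wW k (s - 1)‖ := by
    have : bPsi 1 k (s - 1) = -(1 - eA k (s - 1)) ^ 2 + (-2) * (eA k (s - 1) * (1 - eK k (s - 1)))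
        + 2 * (I * sg k) * (eA k (s - 1) * wW k (s - 1)) := by unfold bPsi; ring
    rw [this]
    refine (norm_add₃_le).trans ?_
    rw [norm_two_mul_I_sg_mul hk, norm_mul, norm_neg, norm_pow, norm_mul, norm_mul, norm_neg]
    simp only [Complex.norm_ofNat]
    nlinarith [norm_nonneg (wW k (s - 1)), norm_nonneg (1 - eK k (s - 1))]
  rcases le_total 1 (√|k| * s) with h | h
  · rw [min_eq_left h]
    have h1 : ‖1 - eK k (s - 1)‖ ≤ 2 := (norm_sub_le _ _).trans (by rw [norm_one]; linarith)
    have h2 : ‖1 - eA k (s - 1)‖ ≤ 2 := (norm_sub_le _ _).trans (by rw [norm_one]; linarith)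
    nlinarith [norm_wW_le_two (k := k) hσ, norm_nonneg (1 - eA k (s - 1))]
  · rw [min_eq_right h]
    obtain ⟨h1, h2, h3⟩ := small_of_sqrt_mul_le_one hs h
    have a1 := norm_one_sub_eK_le (k := k) hσ
    have a2 := norm_wW_le (k := k) hσ
    have a5 := norm_one_sub_eA_le (k := k) hσ
    have h0 := mul_nonneg (Real.sqrt_nonneg |k|) (by linarith : 0 ≤ s)
    have a3 : ‖kappa k‖ * (s - 1) ≤ 2 * (√|k| * s) := by
      calc _ ≤ 2 * √|k| * s := by gcongr; linarith
        _ = _ := by ring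
    have a4 : |k| * (s - 1) ≤ √|k| * s := by nlinarith [abs_nonneg k]
    have a7 : 0 ≤ |k| * (s - 1) := by positivity
    have a6 : ‖1 - eA k (s - 1)‖ ^ 2 ≤ (2 * (|k| * (s - 1))) ^ 2 := by gcongr
    have a8 : (|k| * (s - 1)) ^ 2 ≤ √|k| * s := by nlinarith
    nlinarith [abs_nonneg k]

/-- In the kernel of `ψ_{1,0}` the terms linear in `σ` cancel, which leaves the order
`|k|^{3/2} σ²`. -/
lemma norm_bPsi_zero_le (hk : k ≠ 0) (hs : 1 ≤ s) :
    ‖bPsi 0 k (s - 1)‖ ≤ 212 * min 1 (√|k| ^ 3 * s ^ 2) := by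
  have hσ : 0 ≤ s - 1 := by linarith
  have hE := norm_eK_le_one (k := k) hσ
  have hD := norm_eA_le_one (k := k) hσ
  have h00 := Real.sqrt_nonneg |k|
  have hl : √|k| ^ 2 = |k| := Real.sq_sqrt (abs_nonneg k)
  rcases le_total 1 (√|k| ^ 3 * s ^ 2) with h | h
  · rw [min_eq_left h]
    have e : ‖bPsi 0 k (s - 1)‖ ≤ ‖1 - eA k (s - 1) ^ 2‖ + 2 * ‖wW k (s - 1)‖ := by
      unfold bPsi
      refine (norm_add_le _ _).trans ?_
      rw [norm_mul, norm_neg, norm_I_mul_sg hk, norm_mul, norm_mul]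
      simp only [Complex.norm_ofNat]
      nlinarith [norm_nonneg (wW k (s - 1))]
    linarith [norm_one_sub_eA_sq_le_two (k := k) hσ, norm_wW_le_two (k := k) hσ]
  · rw [min_eq_right h]
    have hlam : √|k| ≤ 1 := by
      by_contra hc
      push Not at hc
      have : 1 < √|k| ^ 3 := one_lt_pow₀ hc (by norm_num)
      nlinarith [sq_nonneg (s - 1)]
    have hk1 : |k| ≤ 1 := by rw [← hl]; nlinarith
    have hkap := norm_kappa_le_two_sqrt hk1
    set σ := s - 1 with hσd
    set a : ℂ := ((|k| : ℝ) : ℂ) with ha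
    set c := kappa k with hc
    have na : ‖a‖ = |k| := by rw [ha, Complex.norm_real, Real.norm_eq_abs, abs_abs]
    set r1 := cexp (-(2 * a * σ)) - 1 - (-(2 * a * σ)) with hr1
    set r2 := cexp (-(c * σ)) - 1 - (-(c * σ)) with hr2
    set r3 := cexp (-(a * σ)) - 1 - (-(a * σ)) with hr3
    have aσ : 0 ≤ |k| * σ := by positivity
    have b1 : ‖r1‖ ≤ 12 * (|k| * σ) ^ 2 := by
      refine (norm_exp_sub_one_sub_id_le_of_re_nonpos ?_).trans (le_of_eq ?_)
      · simp [ha]; linarith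
      · rw [norm_neg, norm_mul, norm_mul, na, Complex.norm_real, Real.norm_of_nonneg hσ]
        simp only [Complex.norm_ofNat]; ring
    have b2 : ‖r2‖ ≤ 3 * (‖c‖ * σ) ^ 2 := by
      refine (norm_exp_sub_one_sub_id_le_of_re_nonpos ?_).trans (le_of_eq ?_)
      · have := mul_nonneg (re_kappa_nonneg k) hσ
        simpa using this
      · rw [norm_neg, norm_mul, Complex.norm_real, Real.norm_of_nonneg hσ]
    have b3 : ‖r3‖ ≤ 3 * (|k| * σ) ^ 2 := by
      refine (norm_exp_sub_one_sub_id_le_of_re_nonpos ?_).trans (le_of_eq ?_)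
      · simp [ha]; linarith
      · rw [norm_neg, norm_mul, na, Complex.norm_real, Real.norm_of_nonneg hσ]
    have hsgn : I * sg k * a = I * k := by rw [mul_assoc, ha, sg_mul_abs hk]
    have e : bPsi 0 k σ = I * sg k * r1 + 2 * ((a + c) * (r2 - r3))
        + 2 * ((eA k σ - 1) * wW k σ) := by
      have e1 : eA k σ ^ 2 = 1 - 2 * a * σ + r1 := by
        rw [eA_sq, hr1, ha]; unfold eA; push_cast; ring_nf
      have e2 : wW k σ = (a + c) * ((a - c) * σ + (r2 - r3)) := by
        rw [hr2, hr3]; unfold wW eK eA; ring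
      have e3 := sum_mul_sub k
      have e4 : bPsi 0 k σ = -(I * sg k) * (1 - eA k σ ^ 2) + 2 * wW k σ
          + 2 * ((eA k σ - 1) * wW k σ) := by unfold bPsi; ring
      rw [e4, e1]
      nth_rewrite 1 [e2]
      linear_combination (-2 * (σ : ℂ)) * hsgn - 2 * (σ : ℂ) * e3
    have e' : ‖bPsi 0 k σ‖ ≤ ‖r1‖ + 2 * (2 * ‖c‖ * (‖r2‖ + ‖r3‖))
        + 2 * (2 * (|k| * σ) * (2 * (|k| * σ))) := by
      rw [e]
      refine (norm_add₃_le).trans ?_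
      rw [norm_mul, norm_I_mul_sg hk, norm_mul 2, norm_mul (a + c), norm_mul 2, norm_mul (_ - _),
        norm_sub_rev (eA k σ)]
      simp only [Complex.norm_ofNat, one_mul]
      gcongr
      · exact norm_sum_le k
      · exact norm_sub_le _ _
      · exact norm_one_sub_eA_le hσ
      · exact norm_wW_le hσ
    have c1 : (|k| * σ) ^ 2 ≤ √|k| ^ 3 * s ^ 2 := by
      have hl2 : |k| ^ 2 = √|k| ^ 3 * √|k| := by nth_rewrite 1 [← hl]; ring
      rw [mul_pow, hl2]
      calc √|k| ^ 3 * √|k| * σ ^ 2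
          ≤ √|k| ^ 3 * 1 * s ^ 2 := by gcongr; linarith
        _ = _ := by ring
    have c3 : ‖c‖ * (|k| * σ) ^ 2 ≤ ‖c‖ * (‖c‖ * σ) ^ 2 := by
      gcongr; exact abs_le_norm_kappa k
    have c2 : ‖c‖ * (‖c‖ * σ) ^ 2 ≤ 8 * (√|k| ^ 3 * s ^ 2) := by
      calc _ ≤ (2 * √|k|) * ((2 * √|k|) * s) ^ 2 := by gcongr; linarith
        _ = _ := by ring
    have c4 : ‖c‖ * (‖r2‖ + ‖r3‖) ≤ ‖c‖ * (3 * (‖c‖ * σ) ^ 2 + 3 * (|k| * σ) ^ 2) := by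
      gcongr
    nlinarith

lemma norm_bPsi_zero_le' (hk : k ≠ 0) (hs : 1 ≤ s) :
    ‖bPsi 0 k (s - 1)‖ ≤ 8 * min 1 (√|k| * s) := by
  have hσ : 0 ≤ s - 1 := by linarith
  have hD := norm_eA_le_one (k := k) hσ
  have e : ‖bPsi 0 k (s - 1)‖ ≤ ‖1 - eA k (s - 1) ^ 2‖ + 2 * ‖wW k (s - 1)‖ := by
    unfold bPsi
    refine (norm_add_le _ _).trans ?_
    rw [norm_mul, norm_neg, norm_I_mul_sg hk, norm_mul, norm_mul]
    simp only [Complex.norm_ofNat]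
    nlinarith [norm_nonneg (wW k (s - 1))]
  rcases le_total 1 (√|k| * s) with h | h
  · rw [min_eq_left h]
    linarith [norm_one_sub_eA_sq_le_two (k := k) hσ, norm_wW_le_two (k := k) hσ]
  · rw [min_eq_right h]
    obtain ⟨h1, h2, h3⟩ := small_of_sqrt_mul_le_one hs h
    have a1 := norm_one_sub_eA_sq_le (k := k) hσ
    have a2 := norm_wW_le (k := k) hσ
    have h0 := mul_nonneg (Real.sqrt_nonneg |k|) (by linarith : 0 ≤ s)
    have a4 : |k| * (s - 1) ≤ √|k| * s := by nlinarith [abs_nonneg k]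
    linarith

end

section

variable {k k' t s σ x : ℝ}

lemma norm_half_mul (z : ℂ) : ‖1 / 2 * z‖ = 1 / 2 * ‖z‖ := by
  rw [norm_mul]; norm_num

lemma norm_neg_half_mul (z : ℂ) : ‖-(1 / 2) * z‖ = 1 / 2 * ‖z‖ := by
  rw [norm_mul]; norm_num

lemma norm_I_mul_div_kappa (k : ℝ) : ‖I * k / kappa k‖ = |k| / ‖kappa k‖ := by
  rw [norm_div, norm_mul, norm_I, one_mul, Complex.norm_real, Real.norm_eq_abs]

lemma norm_kappa_div_I_mul (k : ℝ) : ‖kappa k / (I * k)‖ = ‖kappa k‖ / |k| := by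
  rw [norm_div, norm_mul, norm_I, one_mul, Complex.norm_real, Real.norm_eq_abs]

lemma norm_kerOmega_one_one_le (hk : k ≠ 0) (hs : 1 ≤ s) :
    ‖preK .one k (t - 1) * kerF .one 1 k (s - 1)‖
      ≤ 8 * (min 1 (√|k| * s) * Real.exp (-((kappa k).re * (t - s)))) := by
  rw [kerOmega_one_one hk, norm_half_mul, norm_mul, norm_eK]
  nlinarith [norm_bOmega_one_le hk hs, Real.exp_pos (-((kappa k).re * (t - s)))]

lemma norm_kerEta_one_zero_le (hk : k ≠ 0) (hs : 1 ≤ s) :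
    ‖preK .one k (t - 1) * kerG .one 0 k (s - 1)‖
      ≤ 12 * (min 1 (√|k| * s) ^ 2 * Real.exp (-((kappa k).re * (t - s)))) := by
  rw [kerEta_one_zero hk, norm_half_mul, norm_mul, norm_eK]
  nlinarith [norm_bOmega_zero_le hk hs, Real.exp_pos (-((kappa k).re * (t - s)))]

lemma norm_kerOmega_one_zero_le (hk : k ≠ 0) (hs : 1 ≤ s) :
    ‖preK .one k (t - 1) * kerF .one 0 k (s - 1)‖
      ≤ 12 * (|k| / ‖kappa k‖ *
        (min 1 (√|k| * s) ^ 2 * Real.exp (-((kappa k).re * (t - s))))) := by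
  have h : preK .one k (t - 1) * kerF .one 0 k (s - 1)
      = I * k / kappa k * (preK .one k (t - 1) * kerG .one 0 k (s - 1)) := by
    rw [kerOmega_one_zero hk, kerEta_one_zero hk]; ring
  rw [h, norm_mul, norm_I_mul_div_kappa]
  calc _ ≤ |k| / ‖kappa k‖ *
        (12 * (min 1 (√|k| * s) ^ 2 * Real.exp (-((kappa k).re * (t - s))))) := by
        gcongr; exact norm_kerEta_one_zero_le hk hs
    _ = _ := by ring

lemma norm_kerEta_one_one_le (hk : k ≠ 0) (hs : 1 ≤ s) :
    ‖preK .one k (t - 1) * kerG .one 1 k (s - 1)‖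
      ≤ 16 * (s * Real.exp (-((kappa k).re * (t - s)))) := by
  rw [kerEta_one, norm_mul, norm_kappa_div_I_mul]
  have h0 : 0 < √|k| := Real.sqrt_pos.2 (abs_pos.2 hk)
  have h1 : ‖kappa k‖ / |k| * min 1 (√|k| * s) ≤ 2 * s := by
    calc _ ≤ (1 / √|k| + 1) * min 1 (√|k| * s) := by
          gcongr; exact norm_kappa_div_abs_le hk
      _ = 1 / √|k| * min 1 (√|k| * s) + min 1 (√|k| * s) := by ring
      _ ≤ 1 / √|k| * (√|k| * s) + 1 := by gcongr; exacts [min_le_right _ _, min_le_left _ _]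
      _ ≤ _ := by rw [← mul_assoc, one_div_mul_cancel h0.ne']; linarith
  calc _ ≤ ‖kappa k‖ / |k| *
        (8 * (min 1 (√|k| * s) * Real.exp (-((kappa k).re * (t - s))))) := by
        gcongr; exact norm_kerOmega_one_one_le hk hs
    _ = 8 * ((‖kappa k‖ / |k| * min 1 (√|k| * s)) * Real.exp (-((kappa k).re * (t - s)))) := by
        ring
    _ ≤ 8 * ((2 * s) * Real.exp (-((kappa k).re * (t - s)))) := by gcongr
    _ = _ := by ring

lemma norm_kerPsi_one_one_le (hk : k ≠ 0) (hs : 1 ≤ s) :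
    ‖preH .one k (t - 1) * kerH .one 1 k (s - 1)‖
      ≤ 8 * (min 1 (√|k| * s) * Real.exp (-(|k| * (t - s)))) := by
  rw [kerPsi_one_one hk, norm_half_mul, norm_mul, norm_eA]
  nlinarith [norm_bPsi_one_le hk hs, Real.exp_pos (-(|k| * (t - s)))]

lemma norm_kerPsi_one_zero_le (hk : k ≠ 0) (hs : 1 ≤ s) :
    ‖preH .one k (t - 1) * kerH .one 0 k (s - 1)‖
      ≤ 106 * (min 1 (√|k| ^ 3 * s ^ 2) * Real.exp (-(|k| * (t - s)))) := by
  rw [kerPsi_one_zero hk, norm_half_mul, norm_mul, norm_eA]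
  nlinarith [norm_bPsi_zero_le hk hs, Real.exp_pos (-(|k| * (t - s)))]

lemma norm_wW_le_min (hs : 1 ≤ s) : ‖wW k (s - 1)‖ ≤ 8 * min 1 √|k| := by
  have hσ : 0 ≤ s - 1 := by linarith
  rcases le_total 1 √|k| with h | h
  · rw [min_eq_left h]; linarith [norm_wW_le_two (k := k) hσ]
  · rw [min_eq_right h]
    have : |k| ≤ 1 := by
      rw [← Real.sqrt_le_one]; exact h
    linarith [norm_wW_le_kappa (k := k) hσ, norm_kappa_le_two_sqrt this]

lemma norm_kerOmega_two_zero_le (hk : k ≠ 0) (hs : 1 ≤ s) :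
    ‖preK .two k (t - 1) * kerF .two 0 k (s - 1)‖
      ≤ 8 * (min 1 √|k| * Real.exp (-((kappa k).re * (t - 1)))) := by
  rw [kerOmega_two_zero hk, norm_neg, norm_mul, norm_eK]
  nlinarith [norm_wW_le_min (k := k) hs, Real.exp_pos (-((kappa k).re * (t - 1)))]

lemma norm_kerOmega_two_one_le (hk : k ≠ 0) (hs : 1 ≤ s) :
    ‖preK .two k (t - 1) * kerF .two 1 k (s - 1)‖
      ≤ 3 * Real.exp (-((kappa k).re * (t - 1))) := by
  have hσ : 0 ≤ s - 1 := by linarith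
  rw [kerOmega_two_one hk, norm_neg, norm_mul, norm_eK]
  have : ‖eK k (s - 1) + I * sg k * wW k (s - 1)‖ ≤ 3 := by
    refine (norm_add_le _ _).trans ?_
    rw [norm_mul (I * sg k), norm_I_mul_sg hk]
    linarith [norm_eK_le_one (k := k) hσ, norm_wW_le_two (k := k) hσ]
  nlinarith [Real.exp_pos (-((kappa k).re * (t - 1)))]

lemma norm_neg_eA_add_le (hk : k ≠ 0) (hs : 1 ≤ s) :
    ‖-eA k (s - 1) + I * sg k * wW k (s - 1)‖ ≤ 3 := by
  have hσ : 0 ≤ s - 1 := by linarith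
  refine (norm_add_le _ _).trans ?_
  rw [norm_mul (I * sg k), norm_I_mul_sg hk, norm_neg]
  linarith [norm_eA_le_one (k := k) hσ, norm_wW_le_two (k := k) hσ]

lemma norm_kerEta_two_zero_le (hk : k ≠ 0) (hs : 1 ≤ s) :
    ‖preK .two k (t - 1) * kerG .two 0 k (s - 1)‖
      ≤ 3 * Real.exp (-((kappa k).re * (t - 1))) := by
  rw [kerEta_two_zero hk, norm_mul, norm_eK]
  nlinarith [norm_neg_eA_add_le hk hs, Real.exp_pos (-((kappa k).re * (t - 1)))]

/-- `|κ| ≤ 2|k|` for `|k| ≥ 1` and `|κ|² ≤ 2|k|` for `|k| ≤ 1`. -/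
lemma norm_kappa_div_abs_mul_le (hk : k ≠ 0) {z : ℂ} {A B : ℝ} (hA : ‖z‖ ≤ A)
    (hB : ‖z‖ ≤ B * ‖kappa k‖) (hB0 : 0 ≤ B) :
    ‖kappa k‖ / |k| * ‖z‖ ≤ 2 * max A B := by
  have hk0 := abs_pos.2 hk
  rcases le_total 1 |k| with h | h
  · have h1 : ‖kappa k‖ / |k| ≤ 2 := by
      rw [div_le_iff₀ hk0]
      have := norm_kappa_le k
      have h2 : √|k| ≤ |k| := by
        rw [Real.sqrt_le_left (abs_nonneg k)]; nlinarith
      linarith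
    calc _ ≤ 2 * A := by gcongr
      _ ≤ _ := by gcongr; exact le_max_left _ _
  · have h1 : ‖kappa k‖ ^ 2 / |k| ≤ 2 := by
      rw [div_le_iff₀ hk0]
      have := norm_kappa_sq_le k
      nlinarith [sq_abs k]
    calc _ ≤ ‖kappa k‖ / |k| * (B * ‖kappa k‖) := by gcongr
      _ = ‖kappa k‖ ^ 2 / |k| * B := by ring
      _ ≤ 2 * B := by gcongr
      _ ≤ _ := by gcongr; exact le_max_right _ _

lemma norm_kerEta_two_one_le (hk : k ≠ 0) (hs : 1 ≤ s) :
    ‖preK .two k (t - 1) * kerG .two 1 k (s - 1)‖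
      ≤ 8 * Real.exp (-((kappa k).re * (t - 1))) := by
  have hσ : 0 ≤ s - 1 := by linarith
  rw [kerEta_two_one hk, norm_neg, norm_mul, norm_mul, norm_div, norm_eK, Complex.norm_real,
    Real.norm_eq_abs, abs_abs]
  have := norm_kappa_div_abs_mul_le hk (norm_wW_le_two hσ) (norm_wW_le_kappa hσ)
    (by norm_num)
  norm_num at this
  nlinarith [Real.exp_pos (-((kappa k).re * (t - 1)))]

lemma norm_kerPsi_two_zero_le (hk : k ≠ 0) (ht : 1 ≤ t) (hs : 1 ≤ s) :
    ‖preH .two k (t - 1) * kerH .two 0 k (s - 1)‖ ≤ 2 := by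
  have hσ : 0 ≤ s - 1 := by linarith
  have hτ : 0 ≤ t - 1 := by linarith
  rw [kerPsi_two_zero hk, norm_mul]
  nlinarith [norm_eA_le_one (k := k) hτ, norm_wW_le_two (k := k) hσ, norm_nonneg (wW k (s - 1))]

lemma norm_kerPsi_two_one_le (hk : k ≠ 0) (ht : 1 ≤ t) (hs : 1 ≤ s) :
    ‖preH .two k (t - 1) * kerH .two 1 k (s - 1)‖ ≤ 3 := by
  have hσ : 0 ≤ s - 1 := by linarith
  have hτ : 0 ≤ t - 1 := by linarith
  rw [kerPsi_two_one hk, norm_mul]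
  have : ‖eK k (s - 1) + I * sg k * wW k (s - 1)‖ ≤ 3 := by
    refine (norm_add_le _ _).trans ?_
    rw [norm_mul (I * sg k), norm_I_mul_sg hk]
    linarith [norm_eK_le_one (k := k) hσ, norm_wW_le_two (k := k) hσ]
  nlinarith [norm_eA_le_one (k := k) hτ, norm_nonneg (eK k (s - 1) + I * sg k * wW k (s - 1))]

lemma norm_kerPhi_two_zero_le (hk : k ≠ 0) (ht : 1 ≤ t) (hs : 1 ≤ s) :
    ‖preH .two k (t - 1) * kerK .two 0 k (s - 1)‖ ≤ 3 := by
  have hτ : 0 ≤ t - 1 := by linarith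
  rw [kerPhi_two_zero hk, norm_mul]
  nlinarith [norm_eA_le_one (k := k) hτ, norm_neg_eA_add_le hk hs,
    norm_nonneg (-eA k (s - 1) + I * sg k * wW k (s - 1))]

lemma norm_kerPhi_two_one_le (hk : k ≠ 0) (ht : 1 ≤ t) (hs : 1 ≤ s) :
    ‖preH .two k (t - 1) * kerK .two 1 k (s - 1)‖ ≤ 4 := by
  have hσ : 0 ≤ s - 1 := by linarith
  have hτ : 0 ≤ t - 1 := by linarith
  rw [kerPhi_two_one hk, norm_mul]
  have : ‖I * sg k * (eK k (s - 1) - eA k (s - 1)) - wW k (s - 1)‖ ≤ 4 := by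
    refine (norm_sub_le _ _).trans ?_
    rw [norm_mul (I * sg k), norm_I_mul_sg hk]
    linarith [norm_eK_sub_eA_le_two (k := k) hσ, norm_wW_le_two (k := k) hσ]
  nlinarith [norm_eA_le_one (k := k) hτ,
    norm_nonneg (I * sg k * (eK k (s - 1) - eA k (s - 1)) - wW k (s - 1))]

lemma norm_half_eK_mul_le (ht : 1 ≤ t) :
    1 / 2 * ‖eK k (s - t) * (1 - eK k (t - 1) ^ 2)‖ ≤ Real.exp (-((kappa k).re * (s - t))) := by
  have hτ : 0 ≤ t - 1 := by linarith
  rw [norm_mul, norm_eK]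
  nlinarith [norm_one_sub_eK_sq_le_two (k := k) hτ, Real.exp_pos (-((kappa k).re * (s - t)))]

lemma norm_half_eA_mul_le (ht : 1 ≤ t) (hst : t ≤ s) :
    1 / 2 * ‖eA k (s - t) * (1 - eA k (t - 1) ^ 2)‖ ≤ 1 := by
  have hτ : 0 ≤ t - 1 := by linarith
  have hτ' : 0 ≤ s - t := by linarith
  rw [norm_mul]
  nlinarith [norm_one_sub_eA_sq_le_two (k := k) hτ, norm_eA_le_one (k := k) hτ',
    norm_nonneg (1 - eA k (t - 1) ^ 2)]

lemma norm_kerOmega_three_zero_le (hk : k ≠ 0) (ht : 1 ≤ t) :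
    ‖preK .three k (t - 1) * kerF .three 0 k (s - 1)‖
      ≤ |k| / ‖kappa k‖ * Real.exp (-((kappa k).re * (s - t))) := by
  rw [kerOmega_three_zero hk, mul_comm (1 / 2 : ℂ), mul_assoc, norm_mul, norm_I_mul_div_kappa,
    norm_half_mul]
  gcongr
  exact norm_half_eK_mul_le ht

lemma exp_re_kappa_le_one (hst : t ≤ s) : Real.exp (-((kappa k).re * (s - t))) ≤ 1 := by
  rw [Real.exp_le_one_iff]
  have := mul_nonneg (re_kappa_nonneg k) (by linarith : 0 ≤ s - t)
  linarith

lemma norm_kerOmega_three_one_le (hk : k ≠ 0) (ht : 1 ≤ t) (hst : t ≤ s) :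
    ‖preK .three k (t - 1) * kerF .three 1 k (s - 1)‖ ≤ 1 := by
  rw [kerOmega_three_one hk, norm_neg_half_mul]
  exact (norm_half_eK_mul_le ht).trans (exp_re_kappa_le_one hst)

lemma norm_kerEta_three_zero_le (hk : k ≠ 0) (ht : 1 ≤ t) (hst : t ≤ s) :
    ‖preK .three k (t - 1) * kerG .three 0 k (s - 1)‖ ≤ 1 := by
  rw [kerEta_three_zero hk, norm_neg_half_mul]
  exact (norm_half_eK_mul_le ht).trans (exp_re_kappa_le_one hst)

lemma norm_kerEta_three_one_le (hk : k ≠ 0) (ht : 1 ≤ t) (hst : t ≤ s) :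
    ‖preK .three k (t - 1) * kerG .three 1 k (s - 1)‖ ≤ 4 * t := by
  have hτ : 0 ≤ t - 1 := by linarith
  have hτ' : 0 ≤ s - t := by linarith
  rw [kerEta_three_one, norm_mul, norm_kappa_div_I_mul, norm_half_mul, norm_mul]
  have h1 := norm_one_sub_eK_sq_le (k := k) hτ
  have h2 := norm_kappa_div_abs_mul_le hk (norm_one_sub_eK_sq_le_two hτ)
    (h1.trans_eq (by ring : _ = (4 * (t - 1)) * ‖kappa k‖)) (by linarith)
  have h3 : max 2 (4 * (t - 1)) ≤ 4 * t := max_le (by linarith) (by linarith)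
  have h4 := norm_eK_le_one (k := k) hτ'
  have h5 : 0 ≤ ‖kappa k‖ / |k| * ‖1 - eK k (t - 1) ^ 2‖ := by positivity
  nlinarith [norm_nonneg (eK k (s - t))]

lemma norm_kerPsi_three_zero_le (hk : k ≠ 0) (ht : 1 ≤ t) (hst : t ≤ s) :
    ‖preH .three k (t - 1) * kerH .three 0 k (s - 1)‖ ≤ 1 := by
  rw [kerPsi_three_zero hk, norm_mul, norm_neg, norm_I_mul_sg hk, one_mul, norm_half_mul]
  exact norm_half_eA_mul_le ht hst

lemma norm_kerPsi_three_one_le (hk : k ≠ 0) (ht : 1 ≤ t) (hst : t ≤ s) :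
    ‖preH .three k (t - 1) * kerH .three 1 k (s - 1)‖ ≤ 1 := by
  rw [kerPsi_three_one hk, norm_half_mul]
  exact norm_half_eA_mul_le ht hst

lemma norm_kerPhi_three_zero_le (hk : k ≠ 0) (ht : 1 ≤ t) (hst : t ≤ s) :
    ‖preH .three k (t - 1) * kerK .three 0 k (s - 1)‖ ≤ 1 := by
  rw [kerPhi_three_zero hk, norm_neg_half_mul]
  exact norm_half_eA_mul_le ht hst

lemma norm_kerPhi_three_one_le (hk : k ≠ 0) (ht : 1 ≤ t) (hst : t ≤ s) :
    ‖preH .three k (t - 1) * kerK .three 1 k (s - 1)‖ ≤ 1 := by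
  rw [kerPhi_three_one hk, norm_mul, norm_neg, norm_I_mul_sg hk, one_mul, norm_half_mul]
  exact norm_half_eA_mul_le ht hst

end

section

variable {k k' t s σ x : ℝ}

/-! ### Hölder continuity of the kernels in `k` -/

lemma norm_mul_sub_mul_le {a b a' b' : ℂ} {p B A q : ℝ} (h1 : ‖a - a'‖ ≤ p) (h2 : ‖b‖ ≤ B)
    (h3 : ‖a'‖ ≤ A) (h4 : ‖b - b'‖ ≤ q) : ‖a * b - a' * b'‖ ≤ p * B + A * q := by
  have e : a * b - a' * b' = (a - a') * b + a' * (b - b') := by ring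
  rw [e]
  refine (norm_add_le _ _).trans ?_
  rw [norm_mul, norm_mul]
  have := (norm_nonneg _).trans h1
  have := (norm_nonneg _).trans h3
  gcongr

lemma sg_eq_or_abs_add_abs (k k' : ℝ) (hk : k ≠ 0) (hk' : k' ≠ 0) :
    sg k = sg k' ∨ |k| + |k'| = |k - k'| := by
  unfold sg
  rcases lt_or_gt_of_ne hk with h | h <;> rcases lt_or_gt_of_ne hk' with h' | h'
  · left
    have : (k : ℂ) ≠ 0 := by exact_mod_cast hk
    have : (k' : ℂ) ≠ 0 := by exact_mod_cast hk'
    rw [abs_of_neg h, abs_of_neg h']; push_cast; field_simp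
  · right; rw [abs_of_neg h, abs_of_pos h', abs_of_neg (by linarith)]; ring
  · right; rw [abs_of_pos h, abs_of_neg h', abs_of_pos (by linarith)]; ring
  · left
    have : (k : ℂ) ≠ 0 := by exact_mod_cast hk
    have : (k' : ℂ) ≠ 0 := by exact_mod_cast hk'
    rw [abs_of_pos h, abs_of_pos h']; field_simp

/-- The jump of the sign at `0` does no harm to a Hölder continuous factor that vanishes there. -/
lemma norm_sg_mul_sub_le {f f' : ℂ} {A B : ℝ} (hk : k ≠ 0) (hk' : k' ≠ 0) (h : ‖f - f'‖ ≤ A)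
    (h1 : ‖f‖ ≤ B * √|k|) (h2 : ‖f'‖ ≤ B * √|k'|) (hB : 0 ≤ B) :
    ‖I * sg k * f - I * sg k' * f'‖ ≤ A + 2 * B * √|k - k'| := by
  have hA := (norm_nonneg _).trans h
  rcases sg_eq_or_abs_add_abs k k' hk hk' with e | e
  · rw [e, ← mul_sub, norm_mul, norm_I_mul_sg hk', one_mul]
    have : 0 ≤ 2 * B * √|k - k'| := by positivity
    linarith
  · refine (norm_sub_le _ _).trans ?_
    rw [norm_mul (I * sg k), norm_I_mul_sg hk, norm_mul (I * sg k'), norm_I_mul_sg hk']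
    have a1 : √|k| ≤ √|k - k'| := Real.sqrt_le_sqrt (by linarith [abs_nonneg k'])
    have a2 : √|k'| ≤ √|k - k'| := Real.sqrt_le_sqrt (by linarith [abs_nonneg k])
    nlinarith

lemma abs_sub_le_sqrt (h : |k - k'| ≤ 1) : |k - k'| ≤ √|k - k'| := by
  rw [Real.le_sqrt (abs_nonneg _) (abs_nonneg _)]; nlinarith [abs_nonneg (k - k')]

lemma norm_ofReal_abs_sub_le (k k' : ℝ) : ‖((|k| : ℝ) : ℂ) - ((|k'| : ℝ) : ℂ)‖ ≤ |k - k'| := by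
  rw [← ofReal_sub, Complex.norm_real, Real.norm_eq_abs]
  exact abs_abs_sub_abs_le k k'

lemma norm_eK_sub_eK_le_exp {m : ℝ} (h : |k - k'| ≤ 1) (hx : 0 ≤ x) (hm : m ≤ (kappa k).re)
    (hm' : m ≤ (kappa k').re) :
    ‖eK k x - eK k' x‖ ≤ 6 * (√|k - k'| * x * Real.exp (-(m * x))) := by
  refine (norm_exp_neg_mul_sub_le hx hm hm').trans ?_
  calc _ ≤ 2 * (3 * √|k - k'|) * x * Real.exp (-(m * x)) := by
        gcongr; exact norm_kappa_sub_le h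
    _ = _ := by ring

lemma norm_eA_sub_eA_le_exp {m : ℝ} (h : |k - k'| ≤ 1) (hx : 0 ≤ x) (hm : m ≤ |k|)
    (hm' : m ≤ |k'|) :
    ‖eA k x - eA k' x‖ ≤ 2 * (√|k - k'| * x * Real.exp (-(m * x))) := by
  refine (norm_exp_neg_mul_sub_le hx (by simpa using hm) (by simpa using hm')).trans ?_
  calc _ ≤ 2 * √|k - k'| * x * Real.exp (-(m * x)) := by
        gcongr; exact (norm_ofReal_abs_sub_le k k').trans (abs_sub_le_sqrt h)
    _ = _ := by ring

lemma norm_eK_sub_eK_le (h : |k - k'| ≤ 1) (hx : 0 ≤ x) :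
    ‖eK k x - eK k' x‖ ≤ 6 * (√|k - k'| * x) := by
  simpa using norm_eK_sub_eK_le_exp h hx (re_kappa_nonneg k) (re_kappa_nonneg k')

lemma norm_eA_sub_eA_le (h : |k - k'| ≤ 1) (hx : 0 ≤ x) :
    ‖eA k x - eA k' x‖ ≤ 2 * (√|k - k'| * x) := by
  simpa using norm_eA_sub_eA_le_exp h hx (abs_nonneg k) (abs_nonneg k')

lemma norm_wW_sub_wW_le (h : |k - k'| ≤ 1) (hs : 1 ≤ s) :
    ‖wW k (s - 1) - wW k' (s - 1)‖ ≤ 40 * (√|k - k'| * s) := by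
  have hσ : 0 ≤ s - 1 := by linarith
  set m := min |k| |k'| with hm
  set d := √|k - k'| with hd
  have d0 : 0 ≤ d := Real.sqrt_nonneg _
  set e := Real.exp (-(m * (s - 1))) with he
  have e0 : 0 < e := Real.exp_pos _
  have e1 : e ≤ 1 := by
    rw [he, Real.exp_le_one_iff]
    have : 0 ≤ m * (s - 1) := mul_nonneg (le_min (abs_nonneg _) (abs_nonneg _)) hσ
    linarith
  have e2 : m * (s - 1) * e ≤ 1 := mul_exp_neg_le_one _
  have hP : ‖(((|k| : ℝ) : ℂ) + kappa k) - (((|k'| : ℝ) : ℂ) + kappa k')‖ ≤ 4 * d := by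
    rw [add_sub_add_comm]
    refine (norm_add_le _ _).trans ?_
    linarith [norm_ofReal_abs_sub_le k k', abs_sub_le_sqrt h, norm_kappa_sub_le h]
  have hP' : ‖((|k'| : ℝ) : ℂ) + kappa k'‖ ≤ 3 * m + 4 := by
    refine (norm_add_le _ _).trans ?_
    rw [Complex.norm_real, Real.norm_eq_abs, abs_abs]
    have h1 : |k'| ≤ m + 1 := by
      rw [hm, ← sub_le_iff_le_add, le_min_iff]
      constructor
      · have := abs_sub_abs_le_abs_sub k' k
        rw [abs_sub_comm] at this; linarith
      · linarith
    have h2 := norm_kappa_le k'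
    have h3 : √|k'| ≤ |k'| + 1 := by
      rw [Real.sqrt_le_left (by positivity)]; nlinarith [abs_nonneg k']
    linarith
  have hE : ‖(eK k (s - 1) - eA k (s - 1)) - (eK k' (s - 1) - eA k' (s - 1))‖
      ≤ 8 * (d * (s - 1) * e) := by
    rw [sub_sub_sub_comm]
    refine (norm_sub_le _ _).trans ?_
    have a1 := norm_eK_sub_eK_le_exp h hσ ((min_le_left _ _).trans (abs_le_re_kappa k))
      ((min_le_right _ _).trans (abs_le_re_kappa k'))
    have a2 := norm_eA_sub_eA_le_exp h hσ (min_le_left |k| |k'|) (min_le_right |k| |k'|)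
    linarith
  unfold wW
  refine (norm_mul_sub_mul_le hP (norm_eK_sub_eA_le_two hσ) hP' hE).trans ?_
  have : (3 * m + 4) * (8 * (d * (s - 1) * e)) ≤ 8 * d * (3 + 4 * (s - 1)) := by
    calc _ = 8 * d * (3 * (m * (s - 1) * e) + 4 * ((s - 1) * e)) := by ring
      _ ≤ 8 * d * (3 * 1 + 4 * ((s - 1) * 1)) := by gcongr
      _ = _ := by ring
  nlinarith

lemma norm_wW_le_sqrt (hs : 1 ≤ s) : ‖wW k (s - 1)‖ ≤ 8 * s * √|k| := by
  have h := norm_wW_le_min (k := k) hs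
  have h2 := min_le_right 1 √|k|
  nlinarith [Real.sqrt_nonneg |k|]

lemma norm_sg_mul_wW_sub_le (hk : k ≠ 0) (hk' : k' ≠ 0) (h : |k - k'| ≤ 1) (hs : 1 ≤ s) :
    ‖I * sg k * wW k (s - 1) - I * sg k' * wW k' (s - 1)‖ ≤ 56 * (√|k - k'| * s) := by
  refine (norm_sg_mul_sub_le hk hk' (norm_wW_sub_wW_le h hs) (norm_wW_le_sqrt hs)
    (norm_wW_le_sqrt hs) (by linarith)).trans (le_of_eq (by ring))

/-- Hölder continuity of `k / κ`. -/
lemma norm_div_kappa_sub_le (hk : k ≠ 0) (hk' : k' ≠ 0) (hkk : |k| ≤ |k'|) (h : |k - k'| ≤ 1) :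
    ‖I * k / kappa k - I * k' / kappa k'‖ ≤ 5 * √|k - k'| := by
  have h1 := kappa_ne_zero hk
  have h2 := kappa_ne_zero hk'
  have n1 := norm_kappa_pos hk
  have n2 := norm_kappa_pos hk'
  have e : I * k / kappa k - I * k' / kappa k'
      = I * (((k - k' : ℝ) : ℂ) / kappa k' + k / kappa k * ((kappa k' - kappa k) / kappa k')) := by
    push_cast; field_simp; ring
  rw [e, norm_mul, norm_I, one_mul]
  refine (norm_add_le _ _).trans ?_
  rw [norm_div, norm_mul, norm_div, norm_div, Complex.norm_real, Complex.norm_real,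
    Real.norm_eq_abs, Real.norm_eq_abs]
  set d := √|k - k'| with hd
  have d0 : 0 ≤ d := Real.sqrt_nonneg _
  have dd : |k - k'| = d * d := (Real.mul_self_sqrt (abs_nonneg _)).symm
  have hd2 : d ≤ 2 * ‖kappa k'‖ := by
    rw [hd, Real.sqrt_le_left (by positivity)]
    have a1 : |k - k'| ≤ |k| + |k'| := abs_sub _ _
    nlinarith [abs_le_norm_kappa_sq k']
  have a1 : |k - k'| / ‖kappa k'‖ ≤ 2 * d := by
    rw [div_le_iff₀ n2, dd]; nlinarith
  have a2 : |k| / ‖kappa k‖ * (‖kappa k' - kappa k‖ / ‖kappa k'‖) ≤ 3 * d := by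
    rw [mul_div_assoc', div_le_iff₀ n2]
    calc |k| / ‖kappa k‖ * ‖kappa k' - kappa k‖ ≤ ‖kappa k'‖ * (3 * d) := by
          gcongr
          · exact ((abs_div_norm_kappa_le_sqrt hk).trans (sqrt_le_norm_kappa k)).trans
              (norm_kappa_mono hkk)
          · rw [norm_sub_rev]; exact norm_kappa_sub_le h
      _ = _ := by ring
  linarith

/-- The propagator `e^{-κx}` only Lipschitz in `κ`, with constant `x`, becomes uniformly Hölder
after multiplication by a factor that is small of order `|κ|`. -/
lemma norm_eK_mul_sub_le {B B' : ℂ} {A A' : ℝ} (hkk : |k| ≤ |k'|) (h : |k - k'| ≤ 1)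
    (hx : 0 ≤ x) (hs : 0 ≤ s) (hA0 : 0 ≤ A)
    (hB : ‖B‖ ≤ A * (‖kappa k‖ * s)) (hBB : ‖B - B'‖ ≤ A' * (√|k - k'| * s)) :
    ‖eK k x * B - eK k' x * B'‖
      ≤ (24 * A + A') * (√|k - k'| * s * Real.exp (-(1 / 2 * (|k| * x)))) := by
  set d := √|k - k'| with hd
  have d0 : 0 ≤ d := Real.sqrt_nonneg _
  set r := min (kappa k).re (kappa k').re with hr
  have r0 : 0 ≤ r := le_min (re_kappa_nonneg k) (re_kappa_nonneg k')
  have rk : |k| ≤ r := le_min (abs_le_re_kappa k) (hkk.trans (abs_le_re_kappa k'))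
  have rκ : ‖kappa k‖ ≤ 2 * r := by
    rw [hr, mul_min_of_nonneg _ _ (by norm_num)]
    exact le_min (norm_kappa_le_two_mul_re k)
      ((norm_kappa_mono hkk).trans (norm_kappa_le_two_mul_re k'))
  set e := Real.exp (-(1 / 2 * (|k| * x))) with he
  have h1 : r * x * Real.exp (-(r * x)) ≤ 2 * e := by
    have e1 : Real.exp (-(r * x)) = Real.exp (-(r * x / 2)) * Real.exp (-(r * x / 2)) := by
      rw [← Real.exp_add]; congr 1; ring
    have e2 := mul_exp_neg_le_one (r * x / 2)
    have e3 : Real.exp (-(r * x / 2)) ≤ e := Real.exp_le_exp.2 (by nlinarith)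
    rw [e1]
    calc _ = 2 * ((r * x / 2) * Real.exp (-(r * x / 2))) * Real.exp (-(r * x / 2)) := by ring
      _ ≤ 2 * 1 * e := by gcongr
      _ = _ := by ring
  have h2 := norm_eK_sub_eK_le_exp h hx (min_le_left (kappa k).re (kappa k').re) (min_le_right _ _)
  have h3 : ‖eK k' x‖ ≤ e := (norm_eK_le_exp_abs hx).trans
    (Real.exp_le_exp.2 (by nlinarith [abs_nonneg k]))
  refine (norm_mul_sub_mul_le h2 hB h3 hBB).trans ?_
  have : 6 * (d * x * Real.exp (-(r * x))) * (A * (‖kappa k‖ * s)) ≤ 24 * A * (d * s * e) := by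
    calc _ ≤ 6 * (d * x * Real.exp (-(r * x))) * (A * (2 * r * s)) := by gcongr
      _ = 12 * A * (d * s) * (r * x * Real.exp (-(r * x))) := by ring
      _ ≤ 12 * A * (d * s) * (2 * e) := by gcongr
      _ = _ := by ring
  nlinarith

/-- The analogue of `norm_eK_mul_sub_le` for the propagator `e^{-|k|x}`. -/
lemma norm_eA_mul_sub_le {B B' : ℂ} {A A' : ℝ} (hkk : |k| ≤ |k'|)
    (hx : 0 ≤ x) (hs : 0 ≤ s) (hA0 : 0 ≤ A)
    (hB : ‖B‖ ≤ A * (√|k| * s)) (hBB : ‖B - B'‖ ≤ A' * (√|k - k'| * s)) :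
    ‖eA k x * B - eA k' x * B'‖
      ≤ (2 * A + A') * (√|k - k'| * s * Real.exp (-(1 / 2 * (|k| * x)))) := by
  set d := √|k - k'| with hd
  have d0 : 0 ≤ d := Real.sqrt_nonneg _
  set e := Real.exp (-(1 / 2 * (|k| * x))) with he
  have e0 : 0 < e := Real.exp_pos _
  have ee : Real.exp (-(|k| * x)) = e * e := by rw [he, ← Real.exp_add]; congr 1; ring
  have hkx : 0 ≤ |k| * x := by positivity
  have h3 : ‖eA k' x‖ ≤ Real.exp (-(|k| * x)) := by
    rw [norm_eA]; exact Real.exp_le_exp.2 (by nlinarith)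
  have h2 : ‖eA k x - eA k' x‖ ≤ 2 * (d * √x) * Real.exp (-(|k| * x)) := by
    rcases le_total 1 (|k - k'| * x) with h1 | h1
    · have : 1 ≤ d * √x := by
        rw [hd, ← Real.sqrt_mul (abs_nonneg _)]; exact Real.one_le_sqrt.2 h1
      refine (norm_sub_le _ _).trans ?_
      rw [norm_eA]
      nlinarith [Real.exp_pos (-(|k| * x))]
    · have h4 : |k - k'| * x ≤ d * √x := by
        rw [hd, ← Real.sqrt_mul (abs_nonneg _),
          Real.le_sqrt (by positivity) (by positivity)]
        have : 0 ≤ |k - k'| * x := by positivity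
        nlinarith
      refine (norm_exp_neg_mul_sub_le (m := |k|) hx (by simp) (by simpa using hkk)).trans ?_
      have := norm_ofReal_abs_sub_le k k'
      gcongr ?_ * _
      calc _ ≤ 2 * |k - k'| * x := by gcongr
        _ = 2 * (|k - k'| * x) := by ring
        _ ≤ _ := by gcongr
  have h5 : √x * √|k| * e ≤ 1 := by
    have : √x * √|k| = √(|k| * x) := by rw [Real.sqrt_mul (abs_nonneg _), mul_comm]
    rw [this]
    set y := √(|k| * x) with hy
    have hy2 : |k| * x = y ^ 2 := (Real.sq_sqrt hkx).symm
    rw [he, hy2, Real.exp_neg, ← div_eq_mul_inv, div_le_one (Real.exp_pos _)]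
    nlinarith [Real.add_one_le_exp (1 / 2 * y ^ 2), sq_nonneg (y - 1)]
  have e1 : e ≤ 1 := by
    rw [he, Real.exp_le_one_iff]; linarith
  have hA'0 : 0 ≤ A' * (d * s) := (norm_nonneg _).trans hBB
  refine (norm_mul_sub_mul_le h2 hB h3 hBB).trans ?_
  rw [ee]
  have : 2 * (d * √x) * (e * e) * (A * (√|k| * s)) ≤ 2 * A * (d * s * e) := by
    calc _ = 2 * A * (d * s * e) * (√x * √|k| * e) := by ring
      _ ≤ 2 * A * (d * s * e) * 1 := by gcongr
      _ = _ := by ring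
  have : e * e * (A' * (d * s)) ≤ A' * (d * s) * e := by nlinarith [mul_nonneg hA'0 e0.le]
  nlinarith

lemma norm_bOmega_one_sub_le (hk : k ≠ 0) (hk' : k' ≠ 0) (h : |k - k'| ≤ 1) (hs : 1 ≤ s) :
    ‖bOmega 1 k (s - 1) - bOmega 1 k' (s - 1)‖ ≤ 200 * (√|k - k'| * s) := by
  have hσ : 0 ≤ s - 1 := by linarith
  have d0 : 0 ≤ √|k - k'| := Real.sqrt_nonneg _
  set d := √|k - k'|
  have a1 := norm_eK_sub_eK_le h (x := 2 * (s - 1)) (by linarith)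
  have a2 := norm_eK_sub_eK_le h hσ
  have a3 := norm_sg_mul_wW_sub_le hk hk' h hs
  have a4 : ‖I * sg k * wW k (s - 1)‖ ≤ 2 := by
    rw [norm_mul, norm_I_mul_sg hk, one_mul]; exact norm_wW_le_two hσ
  have a5 := norm_mul_sub_mul_le a2 a4 (norm_eK_le_one (k := k') hσ) a3
  have e : bOmega 1 k (s - 1) - bOmega 1 k' (s - 1)
      = -(eK k (2 * (s - 1)) - eK k' (2 * (s - 1)))
        - 2 * (eK k (s - 1) * (I * sg k * wW k (s - 1))
          - eK k' (s - 1) * (I * sg k' * wW k' (s - 1))) := by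
    simp only [bOmega, eK_sq]; ring
  rw [e]
  refine (norm_sub_le _ _).trans ?_
  rw [norm_neg, norm_mul 2]
  simp only [Complex.norm_ofNat]
  nlinarith

lemma norm_bOmega_zero_sub_le (hk : k ≠ 0) (hk' : k' ≠ 0) (h : |k - k'| ≤ 1) (hs : 1 ≤ s) :
    ‖bOmega 0 k (s - 1) - bOmega 0 k' (s - 1)‖ ≤ 200 * (√|k - k'| * s) := by
  have hσ : 0 ≤ s - 1 := by linarith
  have d0 : 0 ≤ √|k - k'| := Real.sqrt_nonneg _
  set d := √|k - k'|
  have a1 := norm_eK_sub_eK_le h (x := 2 * (s - 1)) (by linarith)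
  have a2 := norm_eK_sub_eK_le h hσ
  have a3 := norm_sg_mul_wW_sub_le hk hk' h hs
  have a4 : ‖I * sg k * wW k (s - 1)‖ ≤ 2 := by
    rw [norm_mul, norm_I_mul_sg hk, one_mul]; exact norm_wW_le_two hσ
  have a5 := norm_mul_sub_mul_le a2 a4 (norm_eK_le_one (k := k') hσ) a3
  have a6 := norm_mul_sub_mul_le a2 (norm_eA_le_one (k := k) hσ) (norm_eK_le_one (k := k') hσ)
    (norm_eA_sub_eA_le h hσ)
  have e : bOmega 0 k (s - 1) - bOmega 0 k' (s - 1)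
      = (eK k (2 * (s - 1)) - eK k' (2 * (s - 1)))
        + -2 * (eK k (s - 1) * eA k (s - 1) - eK k' (s - 1) * eA k' (s - 1))
        + 2 * (eK k (s - 1) * (I * sg k * wW k (s - 1))
          - eK k' (s - 1) * (I * sg k' * wW k' (s - 1))) := by
    simp only [bOmega, eK_sq]; ring
  rw [e]
  refine norm_add₃_le.trans ?_
  rw [norm_mul, norm_mul 2, norm_neg]
  simp only [Complex.norm_ofNat]
  nlinarith

lemma norm_bPsi_one_sub_le (hk : k ≠ 0) (hk' : k' ≠ 0) (h : |k - k'| ≤ 1) (hs : 1 ≤ s) :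
    ‖bPsi 1 k (s - 1) - bPsi 1 k' (s - 1)‖ ≤ 200 * (√|k - k'| * s) := by
  have hσ : 0 ≤ s - 1 := by linarith
  have d0 : 0 ≤ √|k - k'| := Real.sqrt_nonneg _
  set d := √|k - k'|
  have a1 := norm_eA_sub_eA_le h (x := 2 * (s - 1)) (by linarith)
  have a2 := norm_eA_sub_eA_le h hσ
  have a3 := norm_sg_mul_wW_sub_le hk hk' h hs
  have a4 : ‖I * sg k * wW k (s - 1)‖ ≤ 2 := by
    rw [norm_mul, norm_I_mul_sg hk, one_mul]; exact norm_wW_le_two hσ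
  have a5 := norm_mul_sub_mul_le a2 a4 (norm_eA_le_one (k := k') hσ) a3
  have a6 := norm_mul_sub_mul_le a2 (norm_eK_le_one (k := k) hσ) (norm_eA_le_one (k := k') hσ)
    (norm_eK_sub_eK_le h hσ)
  have e : bPsi 1 k (s - 1) - bPsi 1 k' (s - 1)
      = -(eA k (2 * (s - 1)) - eA k' (2 * (s - 1)))
        + 2 * (eA k (s - 1) * eK k (s - 1) - eA k' (s - 1) * eK k' (s - 1))
        + 2 * (eA k (s - 1) * (I * sg k * wW k (s - 1))
          - eA k' (s - 1) * (I * sg k' * wW k' (s - 1))) := by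
    simp only [bPsi, eA_sq]; ring
  rw [e]
  refine norm_add₃_le.trans ?_
  rw [norm_mul, norm_mul 2, norm_neg]
  simp only [Complex.norm_ofNat]
  nlinarith

lemma norm_one_sub_eA_sq_le_sqrt (hs : 1 ≤ s) : ‖1 - eA k (s - 1) ^ 2‖ ≤ 4 * s * √|k| := by
  have hσ : 0 ≤ s - 1 := by linarith
  have h0 := Real.sqrt_nonneg |k|
  have h1 := norm_one_sub_eA_sq_le (k := k) hσ
  have h2 := norm_one_sub_eA_sq_le_two (k := k) hσ
  have e : |k| = √|k| * √|k| := (Real.mul_self_sqrt (abs_nonneg _)).symm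
  rcases le_total 1 √|k| with h | h
  · nlinarith
  · have : |k| ≤ √|k| := by nlinarith
    nlinarith [abs_nonneg k]

lemma norm_one_sub_eA_sq_sub_le (h : |k - k'| ≤ 1) (hs : 1 ≤ s) :
    ‖(1 - eA k (s - 1) ^ 2) - (1 - eA k' (s - 1) ^ 2)‖ ≤ 4 * (√|k - k'| * s) := by
  have a1 := norm_eA_sub_eA_le h (x := 2 * (s - 1)) (by linarith)
  have d0 : 0 ≤ √|k - k'| := Real.sqrt_nonneg _
  rw [sub_sub_sub_cancel_left, norm_sub_rev, eA_sq, eA_sq]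
  nlinarith

lemma norm_one_sub_eK_sq_sub_le (h : |k - k'| ≤ 1) (hs : 1 ≤ s) :
    ‖(1 - eK k (s - 1) ^ 2) - (1 - eK k' (s - 1) ^ 2)‖ ≤ 12 * (√|k - k'| * s) := by
  have a1 := norm_eK_sub_eK_le h (x := 2 * (s - 1)) (by linarith)
  have d0 : 0 ≤ √|k - k'| := Real.sqrt_nonneg _
  rw [sub_sub_sub_cancel_left, norm_sub_rev, eK_sq, eK_sq]
  nlinarith

lemma norm_sg_mul_one_sub_eA_sq_sub_le (hk : k ≠ 0) (hk' : k' ≠ 0) (h : |k - k'| ≤ 1)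
    (hs : 1 ≤ s) :
    ‖I * sg k * (1 - eA k (s - 1) ^ 2) - I * sg k' * (1 - eA k' (s - 1) ^ 2)‖
      ≤ 12 * (√|k - k'| * s) := by
  refine (norm_sg_mul_sub_le hk hk' (norm_one_sub_eA_sq_sub_le h hs)
    (norm_one_sub_eA_sq_le_sqrt hs) (norm_one_sub_eA_sq_le_sqrt hs)
    (by linarith)).trans (le_of_eq (by ring))

lemma norm_bPsi_zero_sub_le (hk : k ≠ 0) (hk' : k' ≠ 0) (h : |k - k'| ≤ 1) (hs : 1 ≤ s) :
    ‖bPsi 0 k (s - 1) - bPsi 0 k' (s - 1)‖ ≤ 200 * (√|k - k'| * s) := by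
  have hσ : 0 ≤ s - 1 := by linarith
  have d0 : 0 ≤ √|k - k'| := Real.sqrt_nonneg _
  set d := √|k - k'|
  have a1 := norm_sg_mul_one_sub_eA_sq_sub_le hk hk' h hs
  have a5 := norm_mul_sub_mul_le (norm_eA_sub_eA_le h hσ) (norm_wW_le_two (k := k) hσ)
    (norm_eA_le_one (k := k') hσ) (norm_wW_sub_wW_le h hs)
  have e : bPsi 0 k (s - 1) - bPsi 0 k' (s - 1)
      = -(I * sg k * (1 - eA k (s - 1) ^ 2) - I * sg k' * (1 - eA k' (s - 1) ^ 2))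
        + 2 * (eA k (s - 1) * wW k (s - 1) - eA k' (s - 1) * wW k' (s - 1)) := by
    simp only [bPsi]; ring
  rw [e]
  refine (norm_add_le _ _).trans ?_
  rw [norm_mul, norm_neg]
  simp only [Complex.norm_ofNat]
  nlinarith

/-- Hölder continuity of exponent `1/2` in `k` of a kernel `K k t s`, with the decay of the
propagator `e^{-|k|(t-s)}` and linear growth in `s`. The smaller of the two wave numbers `k` and `k'`
governs the decay. -/
def KerHolder (n : Part) (K : ℝ → ℝ → ℝ → ℂ) : Prop :=
  ∃ C, 0 ≤ C ∧ ∀ k k' t s : ℝ, k ≠ 0 → k' ≠ 0 → |k| ≤ |k'| → |k - k'| ≤ 1 → 1 ≤ t → 1 ≤ s →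
    s ∈ n.dom t →
    ‖K k t s - K k' t s‖ ≤ C * (√|k - k'| * s * Real.exp (-(1 / 2 * (|k| * max (t - s) 0))))

/-- For `s ≥ t` no decay has to be shown. -/
lemma KerHolder.of_ge {n : Part} (hn : ∀ t, n.dom t = Set.Ici t) {K : ℝ → ℝ → ℝ → ℂ} {C : ℝ}
    (hC : 0 ≤ C)
    (H : ∀ k k' t s : ℝ, k ≠ 0 → k' ≠ 0 → |k| ≤ |k'| → |k - k'| ≤ 1 → 1 ≤ t → 1 ≤ s → t ≤ s →
      ‖K k t s - K k' t s‖ ≤ C * (√|k - k'| * s)) : KerHolder n K := by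
  refine ⟨C, hC, fun k k' t s hk hk' hkk h ht hs hst => ?_⟩
  rw [hn] at hst
  have hst' : t ≤ s := hst
  rw [max_eq_right (by linarith)]
  simpa using H k k' t s hk hk' hkk h ht hs hst'

lemma KerHolder.of_le {K : ℝ → ℝ → ℝ → ℂ} {C : ℝ} (hC : 0 ≤ C)
    (H : ∀ k k' t s : ℝ, k ≠ 0 → k' ≠ 0 → |k| ≤ |k'| → |k - k'| ≤ 1 → 1 ≤ t → 1 ≤ s → s ≤ t →
      ‖K k t s - K k' t s‖ ≤ C * (√|k - k'| * s * Real.exp (-(1 / 2 * (|k| * (t - s)))))) :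
    KerHolder .one K := by
  refine ⟨C, hC, fun k k' t s hk hk' hkk h ht hs hst => ?_⟩
  rw [max_eq_left (by linarith [hst.2])]
  exact H k k' t s hk hk' hkk h ht hs hst.2

lemma kerHolder_omega_one_one :
    KerHolder .one fun k t s => preK .one k (t - 1) * kerF .one 1 k (s - 1) := by
  refine KerHolder.of_le (C := 1000) (by norm_num) fun k k' t s hk hk' hkk h ht hs hst => ?_
  rw [kerOmega_one_one hk, kerOmega_one_one hk', ← mul_sub, norm_half_mul]
  have hB : ‖bOmega 1 k (s - 1)‖ ≤ 16 * (‖kappa k‖ * s) := by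
    refine (norm_bOmega_one_le hk hs).trans ?_
    gcongr
    refine (min_le_right _ _).trans ?_
    gcongr; exact sqrt_le_norm_kappa k
  have := norm_eK_mul_sub_le (x := t - s) hkk h (by linarith) (by linarith) (by norm_num) hB
    (norm_bOmega_one_sub_le hk hk' h hs)
  have h0 : 0 ≤ √|k - k'| * s * Real.exp (-(1 / 2 * (|k| * (t - s)))) := by positivity
  linarith

lemma kerHolder_omega_one_zero :
    KerHolder .one fun k t s => preK .one k (t - 1) * kerF .one 0 k (s - 1) := by
  refine KerHolder.of_le (C := 1000) (by norm_num) fun k k' t s hk hk' hkk h ht hs hst => ?_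
  have e : ∀ k, k ≠ 0 → preK .one k (t - 1) * kerF .one 0 k (s - 1)
      = 1 / 2 * (eK k (t - s) * (I * k / kappa k * bOmega 0 k (s - 1))) := by
    intro k hk; rw [kerOmega_one_zero hk]; ring
  rw [e k hk, e k' hk', ← mul_sub, norm_half_mul]
  have b0 : ‖bOmega 0 k (s - 1)‖ ≤ 24 := by
    refine (norm_bOmega_zero_le hk hs).trans ?_
    have : min 1 (√|k| * s) ^ 2 ≤ 1 := pow_le_one₀ (by positivity) (min_le_left _ _)
    linarith
  have hB : ‖I * k / kappa k * bOmega 0 k (s - 1)‖ ≤ 24 * (‖kappa k‖ * s) := by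
    rw [norm_mul, norm_I_mul_div_kappa]
    calc _ ≤ ‖kappa k‖ * 24 := by
          gcongr; exact (abs_div_norm_kappa_le_sqrt hk).trans (sqrt_le_norm_kappa k)
      _ ≤ ‖kappa k‖ * (24 * s) := by gcongr; linarith
      _ = _ := by ring
  have hBB : ‖I * k / kappa k * bOmega 0 k (s - 1) - I * k' / kappa k' * bOmega 0 k' (s - 1)‖
      ≤ 320 * (√|k - k'| * s) := by
    refine (norm_mul_sub_mul_le (norm_div_kappa_sub_le hk hk' hkk h) b0
      ((norm_I_mul_div_kappa k').trans_le (abs_div_norm_kappa_le_one hk'))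
      (norm_bOmega_zero_sub_le hk hk' h hs)).trans ?_
    nlinarith [Real.sqrt_nonneg |k - k'|]
  have := norm_eK_mul_sub_le (x := t - s) hkk h (by linarith) (by linarith) (by norm_num) hB hBB
  have h0 : 0 ≤ √|k - k'| * s * Real.exp (-(1 / 2 * (|k| * (t - s)))) := by positivity
  linarith

lemma kerHolder_psi_one_one :
    KerHolder .one fun k t s => preH .one k (t - 1) * kerH .one 1 k (s - 1) := by
  refine KerHolder.of_le (C := 1000) (by norm_num) fun k k' t s hk hk' hkk h ht hs hst => ?_
  rw [kerPsi_one_one hk, kerPsi_one_one hk', ← mul_sub, norm_half_mul]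
  have hB : ‖bPsi 1 k (s - 1)‖ ≤ 16 * (√|k| * s) := by
    refine (norm_bPsi_one_le hk hs).trans ?_
    gcongr
    exact min_le_right _ _
  have := norm_eA_mul_sub_le (x := t - s) hkk (by linarith) (by linarith) (by norm_num) hB
    (norm_bPsi_one_sub_le hk hk' h hs)
  have h0 : 0 ≤ √|k - k'| * s * Real.exp (-(1 / 2 * (|k| * (t - s)))) := by positivity
  linarith

lemma kerHolder_psi_one_zero :
    KerHolder .one fun k t s => preH .one k (t - 1) * kerH .one 0 k (s - 1) := by
  refine KerHolder.of_le (C := 1000) (by norm_num) fun k k' t s hk hk' hkk h ht hs hst => ?_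
  rw [kerPsi_one_zero hk, kerPsi_one_zero hk', ← mul_sub, norm_half_mul]
  have hB : ‖bPsi 0 k (s - 1)‖ ≤ 16 * (√|k| * s) := by
    refine (norm_bPsi_zero_le' hk hs).trans ?_
    have := min_le_right 1 (√|k| * s)
    have : 0 ≤ √|k| * s := by positivity
    linarith
  have := norm_eA_mul_sub_le (x := t - s) hkk (by linarith) (by linarith) (by norm_num) hB
    (norm_bPsi_zero_sub_le hk hk' h hs)
  have h0 : 0 ≤ √|k - k'| * s * Real.exp (-(1 / 2 * (|k| * (t - s)))) := by positivity
  linarith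

/-- Passing from a kernel of `ψ_{1,m}` to that of `φ_{1,m}`, which multiplies by a sign. -/
lemma kerHolder_phi_one_of {m : Fin 2}
    (hB : ∀ k s, k ≠ 0 → 1 ≤ s → ‖bPsi m k (s - 1)‖ ≤ 16 * (√|k| * s))
    (hBB : ∀ k k' s, k ≠ 0 → k' ≠ 0 → |k - k'| ≤ 1 → 1 ≤ s →
      ‖bPsi m k (s - 1) - bPsi m k' (s - 1)‖ ≤ 200 * (√|k - k'| * s))
    (e : ∀ k t s, k ≠ 0 → preH .one k (t - 1) * kerH .one m k (s - 1)
      = 1 / 2 * (eA k (t - s) * bPsi m k (s - 1))) :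
    KerHolder .one fun k t s => preH .one k (t - 1) * kerK .one m k (s - 1) := by
  refine KerHolder.of_le (C := 1000) (by norm_num) fun k k' t s hk hk' hkk h ht hs hst => ?_
  have e' : ∀ k, k ≠ 0 → preH .one k (t - 1) * kerK .one m k (s - 1)
      = 1 / 2 * (eA k (t - s) * (I * sg k * bPsi m k (s - 1))) := by
    intro k hk; rw [kerPhi_one hk, e _ _ _ hk]; ring
  rw [e' k hk, e' k' hk', ← mul_sub, norm_half_mul]
  have hB' : ‖I * sg k * bPsi m k (s - 1)‖ ≤ 16 * (√|k| * s) := by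
    rw [norm_mul, norm_I_mul_sg hk, one_mul]; exact hB k s hk hs
  have hBB' := norm_sg_mul_sub_le (B := 16 * s) hk hk' (hBB k k' s hk hk' h hs)
    ((hB k s hk hs).trans_eq (by ring)) ((hB k' s hk' hs).trans_eq (by ring)) (by linarith)
  have := norm_eA_mul_sub_le (A' := 232) (x := t - s) hkk (by linarith) (by linarith)
    (by norm_num) hB' (hBB'.trans_eq (by ring))
  have h0 : 0 ≤ √|k - k'| * s * Real.exp (-(1 / 2 * (|k| * (t - s)))) := by positivity
  linarith

lemma kerHolder_phi_one_one :
    KerHolder .one fun k t s => preH .one k (t - 1) * kerK .one 1 k (s - 1) := by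
  refine kerHolder_phi_one_of (fun k s hk hs => ?_)
    (fun k k' s hk hk' h hs => norm_bPsi_one_sub_le hk hk' h hs) fun k t s hk => kerPsi_one_one hk
  refine (norm_bPsi_one_le hk hs).trans ?_
  gcongr
  exact min_le_right _ _

lemma kerHolder_phi_one_zero :
    KerHolder .one fun k t s => preH .one k (t - 1) * kerK .one 0 k (s - 1) := by
  refine kerHolder_phi_one_of (fun k s hk hs => ?_)
    (fun k k' s hk hk' h hs => norm_bPsi_zero_sub_le hk hk' h hs) fun k t s hk => kerPsi_one_zero hk
  refine (norm_bPsi_zero_le' hk hs).trans ?_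
  have := min_le_right 1 (√|k| * s)
  have : 0 ≤ √|k| * s := by positivity
  linarith

lemma dom_two (t : ℝ) : Part.two.dom t = Set.Ici t := rfl

lemma dom_three (t : ℝ) : Part.three.dom t = Set.Ici t := rfl

lemma norm_eK_sub_one_mul_sub_le {B B' : ℂ} {A A' : ℝ} (h : |k - k'| ≤ 1) (ht : 1 ≤ t)
    (hst : t ≤ s) (hA0 : 0 ≤ A) (hB : ‖B‖ ≤ A) (hBB : ‖B - B'‖ ≤ A' * (√|k - k'| * s)) :
    ‖eK k (t - 1) * B - eK k' (t - 1) * B'‖ ≤ (6 * A + A') * (√|k - k'| * s) := by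
  have hτ : 0 ≤ t - 1 := by linarith
  refine (norm_mul_sub_mul_le (norm_eK_sub_eK_le h hτ) hB (norm_eK_le_one (k := k') hτ) hBB).trans ?_
  have : √|k - k'| * (t - 1) ≤ √|k - k'| * s := by gcongr; linarith
  nlinarith

lemma norm_eA_sub_one_mul_sub_le {B B' : ℂ} {A A' : ℝ} (h : |k - k'| ≤ 1) (ht : 1 ≤ t)
    (hst : t ≤ s) (hA0 : 0 ≤ A) (hB : ‖B‖ ≤ A) (hBB : ‖B - B'‖ ≤ A' * (√|k - k'| * s)) :
    ‖eA k (t - 1) * B - eA k' (t - 1) * B'‖ ≤ (2 * A + A') * (√|k - k'| * s) := by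
  have hτ : 0 ≤ t - 1 := by linarith
  refine (norm_mul_sub_mul_le (norm_eA_sub_eA_le h hτ) hB (norm_eA_le_one (k := k') hτ) hBB).trans ?_
  have : √|k - k'| * (t - 1) ≤ √|k - k'| * s := by gcongr; linarith
  nlinarith

lemma norm_eK_add_sg_sub_le (hk : k ≠ 0) (hk' : k' ≠ 0) (h : |k - k'| ≤ 1) (hs : 1 ≤ s) :
    ‖(eK k (s - 1) + I * sg k * wW k (s - 1)) - (eK k' (s - 1) + I * sg k' * wW k' (s - 1))‖
      ≤ 62 * (√|k - k'| * s) := by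
  rw [add_sub_add_comm]
  refine (norm_add_le _ _).trans ?_
  have a1 := norm_eK_sub_eK_le h (x := s - 1) (by linarith)
  have a2 := norm_sg_mul_wW_sub_le hk hk' h hs
  nlinarith [Real.sqrt_nonneg |k - k'|]

lemma norm_neg_eA_add_sg_sub_le (hk : k ≠ 0) (hk' : k' ≠ 0) (h : |k - k'| ≤ 1) (hs : 1 ≤ s) :
    ‖(-eA k (s - 1) + I * sg k * wW k (s - 1)) - (-eA k' (s - 1) + I * sg k' * wW k' (s - 1))‖
      ≤ 62 * (√|k - k'| * s) := by
  rw [add_sub_add_comm, ← neg_sub']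
  refine (norm_add_le _ _).trans ?_
  have a1 := norm_eA_sub_eA_le h (x := s - 1) (by linarith)
  have a2 := norm_sg_mul_wW_sub_le hk hk' h hs
  rw [norm_neg]
  nlinarith [Real.sqrt_nonneg |k - k'|]

lemma norm_eK_add_sg_le (hk : k ≠ 0) (hs : 1 ≤ s) :
    ‖eK k (s - 1) + I * sg k * wW k (s - 1)‖ ≤ 3 := by
  have hσ : 0 ≤ s - 1 := by linarith
  refine (norm_add_le _ _).trans ?_
  rw [norm_mul (I * sg k), norm_I_mul_sg hk]
  linarith [norm_eK_le_one (k := k) hσ, norm_wW_le_two (k := k) hσ]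

lemma kerHolder_omega_two_zero :
    KerHolder .two fun k t s => preK .two k (t - 1) * kerF .two 0 k (s - 1) := by
  refine KerHolder.of_ge dom_two (C := 52) (by norm_num) fun k k' t s hk hk' hkk h ht hs hst => ?_
  rw [kerOmega_two_zero hk, kerOmega_two_zero hk', neg_sub_neg, norm_sub_rev]
  exact (norm_eK_sub_one_mul_sub_le h ht hst (by norm_num) (norm_wW_le_two (by linarith))
    (norm_wW_sub_wW_le h hs)).trans_eq (by ring)

lemma kerHolder_omega_two_one :
    KerHolder .two fun k t s => preK .two k (t - 1) * kerF .two 1 k (s - 1) := by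
  refine KerHolder.of_ge dom_two (C := 80) (by norm_num) fun k k' t s hk hk' hkk h ht hs hst => ?_
  rw [kerOmega_two_one hk, kerOmega_two_one hk', neg_sub_neg, norm_sub_rev]
  exact (norm_eK_sub_one_mul_sub_le h ht hst (by norm_num) (norm_eK_add_sg_le hk hs)
    (norm_eK_add_sg_sub_le hk hk' h hs)).trans_eq (by ring)

lemma kerHolder_psi_two_zero :
    KerHolder .two fun k t s => preH .two k (t - 1) * kerH .two 0 k (s - 1) := by
  refine KerHolder.of_ge dom_two (C := 44) (by norm_num) fun k k' t s hk hk' hkk h ht hs hst => ?_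
  rw [kerPsi_two_zero hk, kerPsi_two_zero hk']
  exact (norm_eA_sub_one_mul_sub_le h ht hst (by norm_num) (norm_wW_le_two (by linarith))
    (norm_wW_sub_wW_le h hs)).trans_eq (by ring)

lemma kerHolder_psi_two_one :
    KerHolder .two fun k t s => preH .two k (t - 1) * kerH .two 1 k (s - 1) := by
  refine KerHolder.of_ge dom_two (C := 68) (by norm_num) fun k k' t s hk hk' hkk h ht hs hst => ?_
  rw [kerPsi_two_one hk, kerPsi_two_one hk']
  exact (norm_eA_sub_one_mul_sub_le h ht hst (by norm_num) (norm_eK_add_sg_le hk hs)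
    (norm_eK_add_sg_sub_le hk hk' h hs)).trans_eq (by ring)

lemma kerHolder_phi_two_zero :
    KerHolder .two fun k t s => preH .two k (t - 1) * kerK .two 0 k (s - 1) := by
  refine KerHolder.of_ge dom_two (C := 68) (by norm_num) fun k k' t s hk hk' hkk h ht hs hst => ?_
  rw [kerPhi_two_zero hk, kerPhi_two_zero hk']
  exact (norm_eA_sub_one_mul_sub_le h ht hst (by norm_num) (norm_neg_eA_add_le hk hs)
    (norm_neg_eA_add_sg_sub_le hk hk' h hs)).trans_eq (by ring)

lemma norm_eK_sub_eA_le_sqrt (hk : k ≠ 0) (hs : 1 ≤ s) :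
    ‖eK k (s - 1) - eA k (s - 1)‖ ≤ 4 * s * √|k| := by
  have hσ : 0 ≤ s - 1 := by linarith
  have h0 := norm_sum_mul_norm_sub k
  have h1 : √|k| / 2 ≤ ‖((|k| : ℝ) : ℂ) + kappa k‖ := by
    have := Complex.re_le_norm (((|k| : ℝ) : ℂ) + kappa k)
    simp only [add_re, ofReal_re] at this
    linarith [sqrt_le_two_mul_re_kappa k, abs_nonneg k]
  have h2 : ‖kappa k - ((|k| : ℝ) : ℂ)‖ ≤ 2 * √|k| := by
    have hp : 0 < √|k| := Real.sqrt_pos.2 (abs_pos.2 hk)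
    have e : |k| = √|k| * √|k| := (Real.mul_self_sqrt (abs_nonneg _)).symm
    by_contra hc
    push Not at hc
    nlinarith [norm_nonneg (kappa k - ((|k| : ℝ) : ℂ))]
  have h3 : Real.exp (-(|k| * (s - 1))) ≤ 1 :=
    Real.exp_le_one_iff.2 (by have := mul_nonneg (abs_nonneg k) hσ; linarith)
  calc _ ≤ _ := norm_eK_sub_eA_le hσ
    _ ≤ 2 * (2 * √|k|) * (s - 1) * 1 := by gcongr
    _ ≤ 2 * (2 * √|k|) * s * 1 := by gcongr; linarith
    _ = _ := by ring

lemma kerHolder_phi_two_one :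
    KerHolder .two fun k t s => preH .two k (t - 1) * kerK .two 1 k (s - 1) := by
  refine KerHolder.of_ge dom_two (C := 64) (by norm_num) fun k k' t s hk hk' hkk h ht hs hst => ?_
  have hσ : 0 ≤ s - 1 := by linarith
  have d0 : 0 ≤ √|k - k'| := Real.sqrt_nonneg _
  rw [kerPhi_two_one hk, kerPhi_two_one hk']
  have a0 : ‖(eK k (s - 1) - eA k (s - 1)) - (eK k' (s - 1) - eA k' (s - 1))‖
      ≤ 8 * (√|k - k'| * s) := by
    rw [sub_sub_sub_comm]
    refine (norm_sub_le _ _).trans ?_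
    nlinarith [norm_eK_sub_eK_le h hσ, norm_eA_sub_eA_le h hσ]
  have a1 := norm_sg_mul_sub_le hk hk' a0 (norm_eK_sub_eA_le_sqrt hk hs)
    (norm_eK_sub_eA_le_sqrt hk' hs) (by linarith)
  have a2 : ‖I * sg k * (eK k (s - 1) - eA k (s - 1)) - wW k (s - 1)‖ ≤ 4 := by
    refine (norm_sub_le _ _).trans ?_
    rw [norm_mul (I * sg k), norm_I_mul_sg hk]
    linarith [norm_eK_sub_eA_le_two (k := k) hσ, norm_wW_le_two (k := k) hσ]
  have a3 : ‖(I * sg k * (eK k (s - 1) - eA k (s - 1)) - wW k (s - 1))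
      - (I * sg k' * (eK k' (s - 1) - eA k' (s - 1)) - wW k' (s - 1))‖
      ≤ 56 * (√|k - k'| * s) := by
    rw [sub_sub_sub_comm]
    refine (norm_sub_le _ _).trans ?_
    linarith [norm_wW_sub_wW_le h hs]
  exact (norm_eA_sub_one_mul_sub_le h ht hst (by norm_num) a2 a3).trans_eq (by ring)

lemma norm_eK_mul_one_sub_sq_sub_le (h : |k - k'| ≤ 1) (ht : 1 ≤ t) (hst : t ≤ s) :
    ‖eK k (s - t) * (1 - eK k (t - 1) ^ 2) - eK k' (s - t) * (1 - eK k' (t - 1) ^ 2)‖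
      ≤ 24 * (√|k - k'| * s) := by
  have d0 : 0 ≤ √|k - k'| := Real.sqrt_nonneg _
  refine (norm_mul_sub_mul_le (norm_eK_sub_eK_le h (by linarith : 0 ≤ s - t))
    (norm_one_sub_eK_sq_le_two (by linarith)) (norm_eK_le_one (by linarith))
    (norm_one_sub_eK_sq_sub_le h ht)).trans ?_
  nlinarith

lemma norm_eA_mul_one_sub_sq_sub_le (h : |k - k'| ≤ 1) (ht : 1 ≤ t) (hst : t ≤ s) :
    ‖eA k (s - t) * (1 - eA k (t - 1) ^ 2) - eA k' (s - t) * (1 - eA k' (t - 1) ^ 2)‖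
      ≤ 8 * (√|k - k'| * s) := by
  have d0 : 0 ≤ √|k - k'| := Real.sqrt_nonneg _
  refine (norm_mul_sub_mul_le (norm_eA_sub_eA_le h (by linarith : 0 ≤ s - t))
    (norm_one_sub_eA_sq_le_two (by linarith)) (norm_eA_le_one (by linarith))
    (norm_one_sub_eA_sq_sub_le h ht)).trans ?_
  nlinarith

lemma kerHolder_omega_three_one :
    KerHolder .three fun k t s => preK .three k (t - 1) * kerF .three 1 k (s - 1) := by
  refine KerHolder.of_ge dom_three (C := 12) (by norm_num)
    fun k k' t s hk hk' hkk h ht hs hst => ?_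
  rw [kerOmega_three_one hk, kerOmega_three_one hk', ← mul_sub, norm_neg_half_mul]
  linarith [norm_eK_mul_one_sub_sq_sub_le h ht hst]

lemma kerHolder_omega_three_zero :
    KerHolder .three fun k t s => preK .three k (t - 1) * kerF .three 0 k (s - 1) := by
  refine KerHolder.of_ge dom_three (C := 20) (by norm_num)
    fun k k' t s hk hk' hkk h ht hs hst => ?_
  have d0 : 0 ≤ √|k - k'| := Real.sqrt_nonneg _
  rw [kerOmega_three_zero hk, kerOmega_three_zero hk', mul_assoc, mul_assoc, ← mul_sub,
    norm_half_mul]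
  have a1 : ‖eK k (s - t) * (1 - eK k (t - 1) ^ 2)‖ ≤ 2 := by
    linarith [(norm_half_eK_mul_le (k := k) (s := s) ht).trans (exp_re_kappa_le_one hst)]
  have := norm_mul_sub_mul_le (norm_div_kappa_sub_le hk hk' hkk h) a1
      ((norm_I_mul_div_kappa k').trans_le (abs_div_norm_kappa_le_one hk'))
      (norm_eK_mul_one_sub_sq_sub_le h ht hst)
  nlinarith

lemma kerHolder_psi_three_one :
    KerHolder .three fun k t s => preH .three k (t - 1) * kerH .three 1 k (s - 1) := by
  refine KerHolder.of_ge dom_three (C := 4) (by norm_num)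
    fun k k' t s hk hk' hkk h ht hs hst => ?_
  rw [kerPsi_three_one hk, kerPsi_three_one hk', ← mul_sub, norm_half_mul]
  linarith [norm_eA_mul_one_sub_sq_sub_le h ht hst]

lemma kerHolder_psi_three_zero :
    KerHolder .three fun k t s => preH .three k (t - 1) * kerH .three 0 k (s - 1) := by
  refine KerHolder.of_ge dom_three (C := 12) (by norm_num)
    fun k k' t s hk hk' hkk h ht hs hst => ?_
  have d0 : 0 ≤ √|k - k'| := Real.sqrt_nonneg _
  have e : ∀ k, k ≠ 0 → preH .three k (t - 1) * kerH .three 0 k (s - 1)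
      = -(1 / 2) * (eA k (s - t) * (I * sg k * (1 - eA k (t - 1) ^ 2))) := by
    intro k hk; rw [kerPsi_three_zero hk]; ring
  rw [e k hk, e k' hk', ← mul_sub, norm_neg_half_mul]
  have a1 : ‖I * sg k * (1 - eA k (t - 1) ^ 2)‖ ≤ 2 := by
    rw [norm_mul, norm_I_mul_sg hk, one_mul]; exact norm_one_sub_eA_sq_le_two (by linarith)
  have := norm_mul_sub_mul_le (norm_eA_sub_eA_le h (by linarith : 0 ≤ s - t)) a1
    (norm_eA_le_one (k := k') (by linarith)) (norm_sg_mul_one_sub_eA_sq_sub_le hk hk' h ht)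
  nlinarith

lemma kerHolder_phi_three_zero :
    KerHolder .three fun k t s => preH .three k (t - 1) * kerK .three 0 k (s - 1) := by
  refine KerHolder.of_ge dom_three (C := 4) (by norm_num)
    fun k k' t s hk hk' hkk h ht hs hst => ?_
  rw [kerPhi_three_zero hk, kerPhi_three_zero hk', ← mul_sub, norm_neg_half_mul]
  linarith [norm_eA_mul_one_sub_sq_sub_le h ht hst]

lemma kerHolder_phi_three_one :
    KerHolder .three fun k t s => preH .three k (t - 1) * kerK .three 1 k (s - 1) :=
  kerHolder_psi_three_zero

end

section

variable {α k t s p q : ℝ}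

/-! ### Integrals over `[1,t]` and `[t,∞)` -/

/-- Three kinds of bounds on an integrand over `[1,t]`: an integrable power, a constant, and an
approximate identity concentrated at `t`. -/
lemma norm_integral_Icc_le {g : ℝ → ℂ} {a A B D ρ : ℝ} (ht : 1 ≤ t) (ha : 1 < a) (hA : 0 ≤ A)
    (hB : 0 ≤ B) (hD : 0 ≤ D)
    (h : ∀ s, 1 ≤ s → s ≤ t → ‖g s‖ ≤ A * s ^ (-a) + B + D * (ρ * Real.exp (-(ρ * (t - s))))) :
    ‖∫ s in Set.Icc 1 t, g s‖ ≤ A / (a - 1) + B * t + D := by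
  have c1 : ContinuousOn (fun s : ℝ => s ^ (-a)) (Set.Icc 1 t) := fun s hs =>
    (Real.continuousAt_rpow_const _ _ (Or.inl (by linarith [hs.1]))).continuousWithinAt
  have i1 : IntegrableOn (fun s : ℝ => s ^ (-a)) (Set.Icc 1 t) := c1.integrableOn_Icc
  have i2 : IntegrableOn (fun _ : ℝ => B) (Set.Icc 1 t) := continuousOn_const.integrableOn_Icc
  have i3 : IntegrableOn (fun s : ℝ => ρ * Real.exp (-(ρ * (t - s)))) (Set.Icc 1 t) :=
    (Continuous.continuousOn (by fun_prop)).integrableOn_Icc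
  have i := ((i1.const_mul A).add i2).add (i3.const_mul D)
  refine (norm_integral_le_of_norm_le i ?_).trans ?_
  · filter_upwards [ae_restrict_mem measurableSet_Icc] with s hs using h s hs.1 hs.2
  · have e1 : ∫ s in Set.Icc 1 t, s ^ (-a) ≤ 1 / (a - 1) := by
      rw [integral_Icc_eq_integral_Ioc, ← intervalIntegral.integral_of_le ht, integral_rpow
        (Or.inr ⟨by linarith, by rw [Set.uIcc_of_le ht]; simp⟩), Real.one_rpow,
        ← neg_div_neg_eq]
      have : 0 ≤ t ^ (-a + 1) := by positivity
      have e : -(-a + 1) = a - 1 := by ring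
      rw [e]
      gcongr
      linarith
    have e2 : ∫ _ in Set.Icc 1 t, B = (t - 1) * B := by
      rw [setIntegral_const]; simp [ht]
    have e3 : ∫ s in Set.Icc 1 t, ρ * Real.exp (-(ρ * (t - s))) ≤ 1 := by
      rw [integral_Icc_eq_integral_Ioc, ← intervalIntegral.integral_of_le ht,
        intervalIntegral.integral_eq_sub_of_hasDerivAt
          (f := fun s => Real.exp (-(ρ * (t - s))))]
      · have := Real.exp_pos (-(ρ * (t - 1)))
        simp; linarith
      · intro x _
        have h1 : HasDerivAt (fun s : ℝ => -(ρ * (t - s))) ρ x := by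
          have := (((hasDerivAt_id' x).const_sub t).const_mul ρ).fun_neg
          simpa using this
        simpa [mul_comm] using h1.exp
      · exact Continuous.intervalIntegrable (by fun_prop) _ _
    have s1 := integral_add ((i1.const_mul A).add i2) (i3.const_mul D)
    have s2 := integral_add (i1.const_mul A) i2
    simp only [Pi.add_apply] at s1 s2 ⊢
    rw [s1, s2, integral_const_mul, integral_const_mul, e2]
    have : A * ∫ s in Set.Icc 1 t, s ^ (-a) ≤ A * (1 / (a - 1)) := by gcongr
    have : D * ∫ s in Set.Icc 1 t, ρ * Real.exp (-(ρ * (t - s))) ≤ D * 1 := by gcongr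
    have : A * (1 / (a - 1)) = A / (a - 1) := by ring
    nlinarith

lemma norm_integral_Ici_le {g : ℝ → ℂ} {a A D ρ : ℝ} (ht : 1 ≤ t) (ha : 1 < a)
    (hρ : 0 < ρ)
    (h : ∀ s, t ≤ s → ‖g s‖ ≤ A * s ^ (-a) + D * (ρ * Real.exp (-(ρ * (s - t))))) :
    ‖∫ s in Set.Ici t, g s‖ ≤ A / (a - 1) * t ^ (1 - a) + D := by
  have ht0 : 0 < t := by linarith
  have i1 : IntegrableOn (fun s : ℝ => s ^ (-a)) (Set.Ioi t) :=
    integrableOn_Ioi_rpow_of_lt (by linarith) ht0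
  have e3 : ∀ s : ℝ, ρ * Real.exp (-(ρ * (s - t))) = ρ * Real.exp (ρ * t) * Real.exp ((-ρ) * s) := by
    intro s; rw [mul_assoc, ← Real.exp_add]; congr 2; ring
  have i3 : IntegrableOn (fun s : ℝ => ρ * Real.exp (-(ρ * (s - t)))) (Set.Ioi t) := by
    simp_rw [e3]
    exact (integrableOn_exp_mul_Ioi (by linarith) t).const_mul _
  rw [integral_Ici_eq_integral_Ioi]
  refine (norm_integral_le_of_norm_le ((i1.const_mul A).add (i3.const_mul D)) ?_).trans ?_
  · filter_upwards [ae_restrict_mem measurableSet_Ioi] with s hs using h s (le_of_lt hs)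
  · have s1 := integral_add (i1.const_mul A) (i3.const_mul D)
    simp only [Pi.add_apply] at s1 ⊢
    rw [s1, integral_const_mul, integral_const_mul, integral_Ioi_rpow_of_lt (by linarith) ht0]
    simp_rw [e3]
    rw [integral_const_mul, integral_exp_mul_Ioi (by linarith)]
    have e4 : ρ * Real.exp (ρ * t) * (-Real.exp (-ρ * t) / -ρ) = 1 := by
      rw [neg_div_neg_eq]
      field_simp
      rw [← Real.exp_add]; simp
    rw [e4]
    have e5 : -t ^ (-a + 1) / (-a + 1) = t ^ (1 - a) / (a - 1) := by
      rw [show -a + 1 = -(a - 1) by ring, neg_div_neg_eq, show -(a - 1) = 1 - a by ring]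
    rw [e5]
    apply le_of_eq; ring

/-! ### Bounds in the spaces `𝓑_{α,p,q}` -/

/-- A pointwise bound `O(weight α p q)` on the domain `k ≠ 0`, `t ≥ 1`. -/
def HasBound (α : ℝ) (p q : WithTop ℝ) (f : ℝ → ℝ → ℂ) : Prop :=
  ∃ C, 0 ≤ C ∧ ∀ k t, k ≠ 0 → 1 ≤ t → ‖f k t‖ ≤ C * weight α p q k t

lemma weight_coe_coe (ht : 1 ≤ t) :
    weight α p q k t = t ^ (-p) * wB α k t + t ^ (-q) * wT α k t := by
  have h0 : 0 ≤ t := by linarith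
  simp only [weight, decay, mu_one, mu_two, one_div, Real.rpow_neg h0]

lemma weight_top_coe (ht : 1 ≤ t) : weight α ⊤ q k t = t ^ (-q) * wT α k t := by
  have h0 : 0 ≤ t := by linarith
  simp only [weight, decay, mu_two, one_div, Real.rpow_neg h0, zero_mul, zero_add]

lemma rpow_neg_anti {a b : ℝ} (ht : 1 ≤ t) (h : a ≤ b) : t ^ (-b) ≤ t ^ (-a) :=
  Real.rpow_le_rpow_of_exponent_le ht (by linarith)

lemma HasBound.mono {p' q' : ℝ} {f : ℝ → ℝ → ℂ} (h : HasBound α p q f) (hp : p' ≤ p)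
    (hq : q' ≤ q) : HasBound α p' q' f := by
  obtain ⟨C, hC, H⟩ := h
  refine ⟨C, hC, fun k t hk ht => (H k t hk ht).trans ?_⟩
  rw [weight_coe_coe ht, weight_coe_coe ht]
  have := wB_pos (α := α) (k := k) ht
  have := wT_pos (α := α) (k := k) ht
  have := rpow_neg_anti ht hp
  have := rpow_neg_anti ht hq
  gcongr

lemma HasBound.of_top {p' q' : ℝ} {f : ℝ → ℝ → ℂ} (h : HasBound α ⊤ q f)
    (hq : q' ≤ q) : HasBound α p' q' f := by
  obtain ⟨C, hC, H⟩ := h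
  refine ⟨C, hC, fun k t hk ht => (H k t hk ht).trans ?_⟩
  rw [weight_coe_coe ht, weight_top_coe ht]
  have := wB_pos (α := α) (k := k) ht
  have := wT_pos (α := α) (k := k) ht
  have := rpow_neg_anti ht hq
  have : 0 ≤ t ^ (-p') * wB α k t := by positivity
  gcongr
  nlinarith [mul_le_mul_of_nonneg_right ‹t ^ (-q) ≤ t ^ (-q')› (wT_pos (α := α) (k := k) ht).le]

lemma HasBound.add {p q : WithTop ℝ} {f g : ℝ → ℝ → ℂ} (hf : HasBound α p q f)
    (hg : HasBound α p q g) : HasBound α p q (fun k t => f k t + g k t) := by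
  obtain ⟨C, hC, H⟩ := hf
  obtain ⟨C', hC', H'⟩ := hg
  refine ⟨C + C', by positivity, fun k t hk ht => (norm_add_le _ _).trans ?_⟩
  have := H k t hk ht
  have := H' k t hk ht
  linarith

lemma HasBound.sub {p q : WithTop ℝ} {f g : ℝ → ℝ → ℂ} (hf : HasBound α p q f)
    (hg : HasBound α p q g) : HasBound α p q (fun k t => f k t - g k t) := by
  obtain ⟨C, hC, H⟩ := hf
  obtain ⟨C', hC', H'⟩ := hg
  refine ⟨C + C', by positivity, fun k t hk ht => (norm_sub_le _ _).trans ?_⟩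
  have := H k t hk ht
  have := H' k t hk ht
  linarith

lemma HasBound.congr {p q : WithTop ℝ} {f g : ℝ → ℝ → ℂ} (hf : HasBound α p q f)
    (h : ∀ k t, k ≠ 0 → 1 ≤ t → g k t = f k t) : HasBound α p q g := by
  obtain ⟨C, hC, H⟩ := hf
  exact ⟨C, hC, fun k t hk ht => by rw [h k t hk ht]; exact H k t hk ht⟩

/-- A bound by powers of `t` alone. -/
lemma HasBound.norm_le_rpow {f : ℝ → ℝ → ℂ} (h : HasBound α p q f) {r : ℝ} (hp : r ≤ p)
    (hq : r ≤ q) : ∃ C, 0 ≤ C ∧ ∀ k t, k ≠ 0 → 1 ≤ t → ‖f k t‖ ≤ C * t ^ (-r) := by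
  obtain ⟨C, hC, H⟩ := h
  refine ⟨2 * C, by positivity, fun k t hk ht => (H k t hk ht).trans ?_⟩
  rw [weight_coe_coe ht]
  have h1 : t ^ (-p) * wB α k t ≤ t ^ (-r) * 1 :=
    mul_le_mul (rpow_neg_anti ht hp) (wB_le_one ht) (wB_pos ht).le (by positivity)
  have h2 : t ^ (-q) * wT α k t ≤ t ^ (-r) * 1 :=
    mul_le_mul (rpow_neg_anti ht hq) (wT_le_one ht) (wT_pos ht).le (by positivity)
  nlinarith

/-- A bound by the slow weight alone. -/
lemma HasBound.norm_le_wB {f : ℝ → ℝ → ℂ} (hα : 0 ≤ α) (h : HasBound α p q f) {r : ℝ} (hp : r ≤ p)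
    (hq : r ≤ q) :
    ∃ C, 0 ≤ C ∧ ∀ k t, k ≠ 0 → 1 ≤ t → ‖f k t‖ ≤ C * (t ^ (-r) * wB α k t) := by
  obtain ⟨C, hC, H⟩ := h
  refine ⟨2 * C, by positivity, fun k t hk ht => (H k t hk ht).trans ?_⟩
  rw [weight_coe_coe ht]
  have h1 : t ^ (-p) * wB α k t ≤ t ^ (-r) * wB α k t :=
    mul_le_mul (rpow_neg_anti ht hp) le_rfl (wB_pos ht).le (by positivity)
  have h2 : t ^ (-q) * wT α k t ≤ t ^ (-r) * wB α k t :=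
    mul_le_mul (rpow_neg_anti ht hq) (wT_le_wB hα ht) (wT_pos ht).le (by positivity)
  nlinarith

/-- The integral operator with kernel `K` over the domain of a part. -/
noncomputable def comp (n : Part) (K : ℝ → ℝ → ℝ → ℂ) (f : ℝ → ℝ → ℂ) (k t : ℝ) : ℂ :=
  ∫ s in n.dom t, K k t s * f k s

lemma omegaC_eq (n : Part) (m : Fin 2) (f : Fin 2 → ℝ → ℝ → ℂ) : omegaC n m f
    = comp n (fun k t s => preK n k (t - 1) * kerF n m k (s - 1)) (f m) := by
  ext k t; simp only [omegaC, comp, mul_assoc, integral_const_mul]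

lemma etaC_eq (n : Part) (m : Fin 2) (f : Fin 2 → ℝ → ℝ → ℂ) : etaC n m f
    = comp n (fun k t s => preK n k (t - 1) * kerG n m k (s - 1)) (f m) := by
  ext k t; simp only [etaC, comp, mul_assoc, integral_const_mul]

lemma psiC_eq (n : Part) (m : Fin 2) (f : Fin 2 → ℝ → ℝ → ℂ) : psiC n m f
    = comp n (fun k t s => preH n k (t - 1) * kerH n m k (s - 1)) (f m) := by
  ext k t; simp only [psiC, comp, mul_assoc, integral_const_mul]

lemma phiC_eq (n : Part) (m : Fin 2) (f : Fin 2 → ℝ → ℝ → ℂ) : phiC n m f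
    = comp n (fun k t s => preH n k (t - 1) * kerK n m k (s - 1)) (f m) := by
  ext k t; simp only [phiC, comp, mul_assoc, integral_const_mul]

/-- Near the upper end of `[1,t]` the source at `s` is comparable to its bound at `t`. -/
lemma HasBound.near {f : ℝ → ℝ → ℂ} (hα : 0 ≤ α) (hp : 0 ≤ p) (hq : 0 ≤ q) (h : HasBound α p q f) :
    ∃ C, 0 ≤ C ∧ ∀ k s t, k ≠ 0 → 1 ≤ s → 1 ≤ t → t ≤ 2 * s →
      ‖f k s‖ ≤ C * weight α p q k t := by
  obtain ⟨C, hC, H⟩ := h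
  refine ⟨C * (2 ^ p * 2 ^ α + 2 ^ q * 4 ^ α), by positivity, fun k s t hk hs ht hst =>
    (H k s hk hs).trans ?_⟩
  rw [weight_coe_coe ht, weight_coe_coe hs]
  have e : ∀ r : ℝ, 0 ≤ r → s ^ (-r) ≤ 2 ^ r * t ^ (-r) := by
    intro r hr
    have h1 : s ^ (-r) ≤ (t / 2) ^ (-r) :=
      Real.rpow_le_rpow_of_nonpos (by linarith) (by linarith) (by linarith)
    refine h1.trans (le_of_eq ?_)
    rw [Real.div_rpow (by linarith) (by norm_num), Real.rpow_neg (by norm_num : (0:ℝ) ≤ 2)]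
    field_simp
  have b1 : s ^ (-p) * wB α k s ≤ (2 ^ p * t ^ (-p)) * (2 ^ α * wB α k t) :=
    mul_le_mul (e p hp) (wB_le_of_le_two_mul hα ht hst) (wB_pos hs).le (by positivity)
  have b2 : s ^ (-q) * wT α k s ≤ (2 ^ q * t ^ (-q)) * (4 ^ α * wT α k t) :=
    mul_le_mul (e q hq) (wT_le_of_le_two_mul hα ht hst) (wT_pos hs).le (by positivity)
  have p1 : 0 ≤ t ^ (-p) * wB α k t := mul_nonneg (by positivity) (wB_pos ht).le
  have p2 : 0 ≤ t ^ (-q) * wT α k t := mul_nonneg (by positivity) (wT_pos ht).le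
  rw [mul_assoc]
  gcongr
  have c1 : (0:ℝ) ≤ 2 ^ p * 2 ^ α := by positivity
  have c2 : (0:ℝ) ≤ 2 ^ q * 4 ^ α := by positivity
  nlinarith [mul_nonneg c1 p2, mul_nonneg c2 p1]

end

section

variable {α k t s p q : ℝ} {K : ℝ → ℝ → ℝ → ℂ} {f : ℝ → ℝ → ℂ}

/-! ### Bounds on the components -/

lemma weight_nonneg (ht : 1 ≤ t) : 0 ≤ weight α p q k t := by
  rw [weight_coe_coe ht]
  have := wB_pos (α := α) (k := k) ht
  have := wT_pos (α := α) (k := k) ht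
  positivity

lemma mul_weight (ht : 1 ≤ t) (e : ℝ) :
    t ^ e * weight α p q k t = weight α ((p - e : ℝ) : WithTop ℝ) ((q - e : ℝ) : WithTop ℝ) k t := by
  have h0 : 0 < t := by linarith
  rw [weight_coe_coe ht, weight_coe_coe ht, mul_add, ← mul_assoc, ← mul_assoc, ← Real.rpow_add h0,
    ← Real.rpow_add h0]
  congr 3 <;> ring_nf

/-- Far from the upper end, the propagator `e^{-κ(t-s)}` alone yields powers of `t` and the fast
weight. -/
lemma exists_far_kappa (hα : 0 ≤ α) {r : ℝ} (hr : 0 ≤ r) :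
    ∃ C, 0 < C ∧ ∀ k s t : ℝ, 1 ≤ s → 2 * s ≤ t →
      √|k| ^ r * Real.exp (-((kappa k).re * (t - s))) ≤ C * (t ^ (-r) * wT α k t) := by
  obtain ⟨C, hC, H⟩ := exists_rpow_mul_exp_le_br (α := 2 * α) hr (by norm_num : (0:ℝ) < 1 / 4)
    (by positivity)
  refine ⟨C, hC, fun k s t hs hst => ?_⟩
  have ht : 0 < t := by linarith
  have h0 := Real.sqrt_nonneg |k|
  have h1 := H (√|k| * t) (by positivity)
  rw [Real.mul_rpow h0 ht.le, ← wT_eq ht.le] at h1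
  have h2 : Real.exp (-((kappa k).re * (t - s))) ≤ Real.exp (-(1 / 4 * (√|k| * t))) := by
    apply Real.exp_le_exp.2
    have : √|k| / 2 * (t / 2) ≤ (kappa k).re * (t - s) := by
      gcongr
      · exact re_kappa_nonneg k
      · linarith [sqrt_le_two_mul_re_kappa k]
      · linarith
    linarith
  have h3 : t ^ (-r) * t ^ r = 1 := by rw [← Real.rpow_add ht]; simp
  calc _ ≤ √|k| ^ r * Real.exp (-(1 / 4 * (√|k| * t))) := by gcongr
    _ = t ^ (-r) * (√|k| ^ r * t ^ r * Real.exp (-(1 / 4 * (√|k| * t)))) := by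
        linear_combination (-(√|k| ^ r * Real.exp (-(1 / 4 * (√|k| * t))))) * h3
    _ ≤ t ^ (-r) * (C * wT α k t) := by gcongr
    _ = _ := by ring

/-- The analogue of `exists_far_kappa` for the propagator `e^{-|k|(t-s)}` and the slow weight. -/
lemma exists_far_abs (hα : 0 ≤ α) {r : ℝ} (hr : 0 ≤ r) :
    ∃ C, 0 < C ∧ ∀ k s t : ℝ, 1 ≤ s → 2 * s ≤ t →
      |k| ^ r * Real.exp (-(|k| * (t - s))) ≤ C * (t ^ (-r) * wB α k t) := by
  obtain ⟨C, hC, H⟩ := exists_rpow_mul_exp_le_br (α := α) hr (by norm_num : (0:ℝ) < 1 / 2) hα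
  refine ⟨C, hC, fun k s t hs hst => ?_⟩
  have ht : 0 < t := by linarith
  have h0 := abs_nonneg k
  have h1 := H (|k| * t) (by positivity)
  rw [Real.mul_rpow h0 ht.le] at h1
  have h2 : Real.exp (-(|k| * (t - s))) ≤ Real.exp (-(1 / 2 * (|k| * t))) := by
    apply Real.exp_le_exp.2
    have : |k| * (t / 2) ≤ |k| * (t - s) := by gcongr; linarith
    linarith
  have h3 : t ^ (-r) * t ^ r = 1 := by rw [← Real.rpow_add ht]; simp
  calc _ ≤ |k| ^ r * Real.exp (-(1 / 2 * (|k| * t))) := by gcongr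
    _ = t ^ (-r) * (|k| ^ r * t ^ r * Real.exp (-(1 / 2 * (|k| * t)))) := by
        linear_combination (-(|k| ^ r * Real.exp (-(1 / 2 * (|k| * t))))) * h3
    _ ≤ t ^ (-r) * (C * wB α k t) := mul_le_mul_of_nonneg_left h1 (by positivity)
    _ = _ := by ring

/-- Parts with `n = 1`: the region `s ≤ t/2` contributes the weight `V`, and the region `s ≥ t/2`
the weight of the source, times the mass of the kernel there. -/
lemma comp_one_bound (hα : 0 ≤ α) (hp : 0 ≤ p) (hq : 0 ≤ q) (hf : HasBound α p q f)
    {a A A' : ℝ} {V : ℝ → ℝ → ℝ} {ν : ℝ → ℝ} (ha : 1 < a) (hA : 0 ≤ A) (hA' : 0 ≤ A')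
    (hV : ∀ k t, 1 ≤ t → 0 ≤ V k t) (hν : ∀ t, 1 ≤ t → 0 ≤ ν t)
    (far : ∀ k s t, k ≠ 0 → 1 ≤ s → 2 * s ≤ t → ‖K k t s‖ * ‖f k s‖ ≤ A * s ^ (-a) * V k t)
    (near : ∀ k s t, k ≠ 0 → 1 ≤ s → s ≤ t → t ≤ 2 * s →
      ‖K k t s‖ ≤ A' * (ν t + (kappa k).re * Real.exp (-((kappa k).re * (t - s))))) :
    ∃ C, 0 ≤ C ∧ ∀ k t, k ≠ 0 → 1 ≤ t →
      ‖comp .one K f k t‖ ≤ C * (V k t + (ν t * t + 1) * weight α p q k t) := by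
  obtain ⟨C, hC, H⟩ := hf.near hα hp hq
  refine ⟨A / (a - 1) + A' * C, ?_, fun k t hk ht => ?_⟩
  · have : 0 ≤ A / (a - 1) := div_nonneg hA (by linarith)
    positivity
  have hw := weight_nonneg (α := α) (p := p) (q := q) (k := k) ht
  have hV' := hV k t ht
  have hν' := hν t ht
  have hρ := re_kappa_nonneg k
  have := norm_integral_Icc_le (g := fun s => K k t s * f k s) (ρ := (kappa k).re)
    (A := A * V k t) (B := A' * ν t * (C * weight α p q k t)) (D := A' * (C * weight α p q k t))
    ht ha (by positivity) (by positivity) (by positivity) (fun s hs hst => by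
      rw [norm_mul]
      have hs0 : 0 ≤ s ^ (-a) := by positivity
      rcases le_total (2 * s) t with h | h
      · have := far k s t hk hs h
        have e1 : 0 ≤ A' * ν t * (C * weight α p q k t) := by positivity
        have e2 : 0 ≤ A' * (C * weight α p q k t) *
          ((kappa k).re * Real.exp (-((kappa k).re * (t - s)))) := by positivity
        linarith
      · have e0 : 0 ≤ A * V k t * s ^ (-a) := by positivity
        calc _ ≤ (A' * (ν t + (kappa k).re * Real.exp (-((kappa k).re * (t - s))))) *
              (C * weight α p q k t) := by
              gcongr
              · exact near k s t hk hs hst h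
              · exact H k s t hk hs ht h
          _ ≤ _ := by linarith)
  refine this.trans ?_
  have h1 : 0 ≤ A / (a - 1) := div_nonneg hA (by linarith)
  have e : A * V k t / (a - 1) = A / (a - 1) * V k t := by ring
  rw [e]
  have h2 : 0 ≤ A / (a - 1) * ((ν t * t + 1) * weight α p q k t) := by positivity
  have h3 : 0 ≤ A' * C * V k t := by positivity
  nlinarith

/-- Parts with an integral over `[t,∞)`. -/
lemma comp_tail_bound {n : Part} (hn : ∀ t, n.dom t = Set.Ici t) (hα : 0 ≤ α) (hp : 1 < p)
    (hq : 1 < q) (hf : HasBound α p q f) {N : ℝ → ℝ → ℝ} (hN : ∀ k t, 1 ≤ t → 0 ≤ N k t)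
    (h : ∀ k t s, k ≠ 0 → 1 ≤ t → t ≤ s → ‖K k t s‖ ≤ N k t) :
    ∃ C, 0 ≤ C ∧ ∀ k t, k ≠ 0 → 1 ≤ t →
      ‖comp n K f k t‖ ≤ C * (N k t * weight α ((p - 1 : ℝ) : WithTop ℝ) ((q - 1 : ℝ) : WithTop ℝ) k t) := by
  obtain ⟨C, hC, H⟩ := hf
  have hp' : 0 < 1 / (p - 1) := one_div_pos.2 (by linarith)
  have hq' : 0 < 1 / (q - 1) := one_div_pos.2 (by linarith)
  refine ⟨C * (1 / (p - 1) + 1 / (q - 1)), by positivity, fun k t hk ht => ?_⟩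
  have hB := (wB_pos (α := α) (k := k) ht).le
  have hT := (wT_pos (α := α) (k := k) ht).le
  have hNk := hN k t ht
  have ht0 : 0 < t := by linarith
  unfold comp
  rw [hn, integral_Ici_eq_integral_Ioi]
  have i1 : IntegrableOn (fun s : ℝ => s ^ (-p)) (Set.Ioi t) :=
    integrableOn_Ioi_rpow_of_lt (by linarith) ht0
  have i2 : IntegrableOn (fun s : ℝ => s ^ (-q)) (Set.Ioi t) :=
    integrableOn_Ioi_rpow_of_lt (by linarith) ht0
  refine (norm_integral_le_of_norm_le ((i1.const_mul (C * N k t * wB α k t)).add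
    (i2.const_mul (C * N k t * wT α k t))) ?_).trans ?_
  · filter_upwards [ae_restrict_mem measurableSet_Ioi] with s hs
    have hts : t ≤ s := le_of_lt hs
    have hs1 : 1 ≤ s := ht.trans hts
    rw [norm_mul]
    calc _ ≤ N k t * (C * weight α p q k s) := by
          gcongr
          · exact h k t s hk ht hts
          · exact H k s hk hs1
      _ = C * N k t * (s ^ (-p) * wB α k s + s ^ (-q) * wT α k s) := by
          rw [weight_coe_coe hs1]; ring
      _ ≤ C * N k t * (s ^ (-p) * wB α k t + s ^ (-q) * wT α k t) := by
          gcongr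
          · exact wB_anti hα ht hts
          · exact wT_anti hα ht hts
      _ = _ := by simp only [Pi.add_apply]; ring
  · have s1 := integral_add (i1.const_mul (C * N k t * wB α k t))
      (i2.const_mul (C * N k t * wT α k t))
    simp only [Pi.add_apply] at s1 ⊢
    rw [s1, integral_const_mul, integral_const_mul, integral_Ioi_rpow_of_lt (by linarith) ht0,
      integral_Ioi_rpow_of_lt (by linarith) ht0, weight_coe_coe ht]
    have e5 : ∀ a : ℝ, -t ^ (-a + 1) / (-a + 1) = 1 / (a - 1) * t ^ (-(a - 1)) := by
      intro a
      rw [show -a + 1 = -(a - 1) by ring, neg_div_neg_eq]; ring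
    rw [e5, e5]
    have h1 : 0 ≤ C * N k t * (1 / (q - 1)) * (t ^ (-(p - 1)) * wB α k t) := by positivity
    have h2 : 0 ≤ C * N k t * (1 / (p - 1)) * (t ^ (-(q - 1)) * wT α k t) := by positivity
    nlinarith

lemma comp_tail_hasBound {n : Part} (hn : ∀ t, n.dom t = Set.Ici t) (hα : 0 ≤ α) (hp : 1 < p)
    (hq : 1 < q) (hf : HasBound α p q f) {A : ℝ} (hA : 0 ≤ A)
    (h : ∀ k t s, k ≠ 0 → 1 ≤ t → t ≤ s → ‖K k t s‖ ≤ A) :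
    HasBound α ((p - 1 : ℝ) : WithTop ℝ) ((q - 1 : ℝ) : WithTop ℝ) (comp n K f) := by
  obtain ⟨C, hC, H⟩ := comp_tail_bound hn hα hp hq hf (N := fun _ _ => A) (fun _ _ _ => hA) h
  exact ⟨C * A, by positivity, fun k t hk ht => (H k t hk ht).trans_eq (by ring)⟩

/-- At `s = 1` the two weights agree, and the heat factor `e^{-κ(t-1)}` propagates the fast one. -/
lemma exists_exp_mul_wB_le (hα : 0 ≤ α) : ∃ C, 0 ≤ C ∧ ∀ k t : ℝ, 1 ≤ t →
    Real.exp (-((kappa k).re * (t - 1))) * wB α k t ≤ C * wT α k t := by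
  obtain ⟨C, hC, H⟩ := exists_exp_mul_br_le (α := 2 * α) (by norm_num : (0:ℝ) < 1 / 2)
    (by positivity)
  refine ⟨C, by linarith, fun k t ht => ?_⟩
  have h1 := H √|k| 1 t (Real.sqrt_nonneg _) le_rfl ht
  rw [← wT_eq zero_le_one, ← wT_eq (by linarith), max_eq_left (by linarith)] at h1
  refine le_trans ?_ h1
  have h2 : wB α k t ≤ wT α k 1 := by
    have := wB_anti (k := k) hα le_rfl ht
    simpa [wT, wB] using this
  have h3 : 0 ≤ wT α k 1 := (wT_pos le_rfl).le
  have h4 := mul_le_mul_of_nonneg_right (sqrt_le_two_mul_re_kappa k) (by linarith : 0 ≤ t - 1)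
  refine mul_le_mul (Real.exp_le_exp.2 ?_) h2 (wB_pos ht).le (Real.exp_pos _).le
  linarith

lemma exists_min_mul_exp_mul_wB_le (hα : 0 ≤ α) : ∃ C, 0 ≤ C ∧ ∀ k t : ℝ, 1 ≤ t →
    min 1 √|k| * Real.exp (-((kappa k).re * (t - 1))) * wB α k t
      ≤ C * (t ^ (-1 : ℝ) * wT α k t) := by
  obtain ⟨C1, hC1, H1⟩ := exists_exp_mul_wB_le hα
  obtain ⟨C2, hC2, H2⟩ := exists_far_kappa hα zero_le_one
  refine ⟨2 * C1 + C2, by positivity, fun k t ht => ?_⟩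
  have hT := (wT_pos (α := α) (k := k) ht).le
  have hB := (wB_pos (α := α) (k := k) ht).le
  have hi : t ^ (-1 : ℝ) = 1 / t := by rw [Real.rpow_neg_one, one_div]
  have hi0 : 0 ≤ t ^ (-1 : ℝ) := by positivity
  rcases le_total t 2 with h | h
  · have h1 : 1 ≤ 2 * t ^ (-1 : ℝ) := by
      rw [hi, mul_one_div, le_div_iff₀ (by linarith)]; linarith
    calc _ ≤ 1 * Real.exp (-((kappa k).re * (t - 1))) * wB α k t := by
          gcongr; exact min_le_left _ _
      _ ≤ 1 * (C1 * wT α k t) := by rw [one_mul, one_mul]; exact H1 k t ht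
      _ ≤ (2 * t ^ (-1 : ℝ)) * (C1 * wT α k t) := by gcongr
      _ ≤ _ := by
        have : 0 ≤ C2 * (t ^ (-1 : ℝ) * wT α k t) := by positivity
        linarith
  · have h2 := H2 k 1 t le_rfl (by linarith)
    rw [Real.rpow_one] at h2
    calc _ ≤ √|k| * Real.exp (-((kappa k).re * (t - 1))) * 1 := by
          gcongr
          · exact min_le_right _ _
          · exact wB_le_one ht
      _ ≤ C2 * (t ^ (-1 : ℝ) * wT α k t) := by rw [mul_one]; exact h2
      _ ≤ _ := by
        have : 0 ≤ 2 * C1 * (t ^ (-1 : ℝ) * wT α k t) := by positivity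
        linarith

lemma comp_tail_hasBound_top {n : Part} (hn : ∀ t, n.dom t = Set.Ici t) (hα : 0 ≤ α) (hp : 1 < p)
    (hq : 1 < q) (hf : HasBound α p q f) {A r : ℝ} (hA : 0 ≤ A) (hrp : r ≤ p - 1) (hrq : r ≤ q - 1)
    (h : ∀ k t s, k ≠ 0 → 1 ≤ t → t ≤ s →
      ‖K k t s‖ ≤ A * Real.exp (-((kappa k).re * (t - 1)))) :
    HasBound α ⊤ r (comp n K f) := by
  obtain ⟨C, hC, H⟩ := comp_tail_bound hn hα hp hq hf
    (N := fun k t => A * Real.exp (-((kappa k).re * (t - 1)))) (fun _ _ _ => by positivity) h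
  obtain ⟨C1, hC1, H1⟩ := exists_exp_mul_wB_le hα
  refine ⟨C * (A * (2 * C1)), by positivity, fun k t hk ht => (H k t hk ht).trans ?_⟩
  rw [weight_coe_coe ht, weight_top_coe ht]
  have hT := (wT_pos (α := α) (k := k) ht).le
  have hB := (wB_pos (α := α) (k := k) ht).le
  have e0 := Real.exp_pos (-((kappa k).re * (t - 1)))
  have h1 := H1 k t ht
  have h2 : Real.exp (-((kappa k).re * (t - 1))) * wT α k t ≤ C1 * wT α k t :=
    le_trans (by gcongr; exact wT_le_wB hα ht) h1
  have r1 := rpow_neg_anti ht hrp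
  have r2 := rpow_neg_anti ht hrq
  rw [mul_assoc C, mul_assoc A, mul_assoc A]
  refine mul_le_mul_of_nonneg_left (mul_le_mul_of_nonneg_left ?_ hA) hC
  calc _ = t ^ (-(p - 1)) * (Real.exp (-((kappa k).re * (t - 1))) * wB α k t)
        + t ^ (-(q - 1)) * (Real.exp (-((kappa k).re * (t - 1))) * wT α k t) := by ring
    _ ≤ t ^ (-r) * (C1 * wT α k t) + t ^ (-r) * (C1 * wT α k t) := by gcongr
    _ = _ := by ring

lemma near_mass_le {e P R : ℝ} (ht : 1 ≤ t) (he : -1 ≤ e) (hP : P ≤ p - (1 + e))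
    (hR : R ≤ q - (1 + e)) : (t ^ e * t + 1) * weight α p q k t ≤ 2 * weight α P R k t := by
  have ht0 : 0 < t := by linarith
  have hT := (wT_pos (α := α) (k := k) ht).le
  have hB := (wB_pos (α := α) (k := k) ht).le
  have hw := weight_nonneg (α := α) (p := p) (q := q) (k := k) ht
  have m1 := mul_weight (α := α) (k := k) (p := p) (q := q) ht (1 + e)
  have e1 : 1 ≤ t ^ (1 + e) := Real.one_le_rpow ht (by linarith)
  have e2 : t ^ e * t = t ^ (1 + e) := by rw [Real.rpow_add ht0, Real.rpow_one, mul_comm]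
  have m2 : (t ^ e * t + 1) * weight α p q k t ≤
      2 * weight α ((p - (1 + e) : ℝ) : WithTop ℝ) ((q - (1 + e) : ℝ) : WithTop ℝ) k t := by
    rw [← m1, e2]; nlinarith
  have m3 : t ^ (-(p - (1 + e))) * wB α k t ≤ t ^ (-P) * wB α k t :=
    mul_le_mul_of_nonneg_right (rpow_neg_anti ht hP) hB
  have m5 : t ^ (-(q - (1 + e))) * wT α k t ≤ t ^ (-R) * wT α k t :=
    mul_le_mul_of_nonneg_right (rpow_neg_anti ht hR) hT
  rw [weight_coe_coe ht (p := p - (1 + e))] at m2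
  rw [weight_coe_coe ht (p := P)]
  linarith

/-- Parts with `n = 1` and the propagator `e^{-κ(t-s)}`. -/
lemma comp_one_kappa_hasBound (hα : 0 ≤ α) (hp : 0 ≤ p) (hq : 0 ≤ q) (hf : HasBound α p q f)
    {A A' r e e' m P R : ℝ} (hA : 0 ≤ A) (hA' : 0 ≤ A') (hr : 0 ≤ r) (hmp : m ≤ p) (hmq : m ≤ q)
    (hm : e' + 1 < m) (he : -1 ≤ e) (hP : P ≤ p - (1 + e)) (hR : R ≤ r) (hR' : R ≤ q - (1 + e))
    (far : ∀ k s t, k ≠ 0 → 1 ≤ s → 2 * s ≤ t →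
      ‖K k t s‖ ≤ A * (s ^ e' * (√|k| ^ r * Real.exp (-((kappa k).re * (t - s))))))
    (near : ∀ k s t, k ≠ 0 → 1 ≤ s → s ≤ t → t ≤ 2 * s →
      ‖K k t s‖ ≤ A' * (t ^ e + (kappa k).re * Real.exp (-((kappa k).re * (t - s))))) :
    HasBound α P R (comp .one K f) := by
  obtain ⟨C, hC, H⟩ := hf.norm_le_rpow hmp hmq
  obtain ⟨C2, hC2, H2⟩ := exists_far_kappa hα hr
  obtain ⟨C3, hC3, H3⟩ := comp_one_bound (K := K)
    (a := m - e') (A := A * C2 * C) (V := fun k t => t ^ (-r) * wT α k t) (ν := fun t => t ^ e)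
    hα hp hq hf (by linarith) (by positivity) hA'
    (fun k t ht => mul_nonneg (by positivity) (wT_pos ht).le) (fun t ht => by positivity)
    (fun k s t hk hs hst => by
      have hs0 : 0 < s := by linarith
      have h2 := H2 k s t hs hst
      calc _ ≤ (A * (s ^ e' * (√|k| ^ r * Real.exp (-((kappa k).re * (t - s)))))) *
            (C * s ^ (-m)) :=
            mul_le_mul (far k s t hk hs hst) (H k s hk hs) (norm_nonneg _) (by positivity)
        _ = A * C * (s ^ e' * s ^ (-m)) * (√|k| ^ r * Real.exp (-((kappa k).re * (t - s)))) := by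
            ring
        _ ≤ A * C * (s ^ e' * s ^ (-m)) * (C2 * (t ^ (-r) * wT α k t)) :=
            mul_le_mul_of_nonneg_left h2 (by positivity)
        _ = _ := by
          rw [← Real.rpow_add hs0, show e' + -m = -(m - e') by ring]; ring)
    near
  refine ⟨C3 * 3, by positivity, fun k t hk ht => (H3 k t hk ht).trans ?_⟩
  have m4 : t ^ (-r) * wT α k t ≤ t ^ (-R) * wT α k t :=
    mul_le_mul_of_nonneg_right (rpow_neg_anti ht hR) (wT_pos ht).le
  have m6 : 0 ≤ t ^ (-P) * wB α k t := mul_nonneg (by positivity) (wB_pos ht).le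
  have m7 := near_mass_le (α := α) (k := k) ht he hP hR'
  rw [mul_assoc]
  refine mul_le_mul_of_nonneg_left ?_ hC3
  rw [weight_coe_coe ht (p := P)] at m7 ⊢
  linarith

/-- Parts with `n = 1` and the propagator `e^{-|k|(t-s)}`. -/
lemma comp_one_abs_hasBound (hα : 0 ≤ α) (hp : 0 ≤ p) (hq : 0 ≤ q) (hf : HasBound α p q f)
    {A A' r e e' m P R : ℝ} (hA : 0 ≤ A) (hA' : 0 ≤ A') (hr : 0 ≤ r) (hmp : m ≤ p) (hmq : m ≤ q)
    (hm : e' + 1 < m) (he : -1 ≤ e) (hP : P ≤ r) (hP' : P ≤ p - (1 + e)) (hR : R ≤ q - (1 + e))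
    (far : ∀ k s t, k ≠ 0 → 1 ≤ s → 2 * s ≤ t →
      ‖K k t s‖ ≤ A * (s ^ e' * (|k| ^ r * Real.exp (-(|k| * (t - s))))))
    (near : ∀ k s t, k ≠ 0 → 1 ≤ s → s ≤ t → t ≤ 2 * s →
      ‖K k t s‖ ≤ A' * t ^ e) :
    HasBound α P R (comp .one K f) := by
  obtain ⟨C, hC, H⟩ := hf.norm_le_rpow hmp hmq
  obtain ⟨C2, hC2, H2⟩ := exists_far_abs hα hr
  obtain ⟨C3, hC3, H3⟩ := comp_one_bound (K := K)
    (a := m - e') (A := A * C2 * C) (V := fun k t => t ^ (-r) * wB α k t) (ν := fun t => t ^ e)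
    hα hp hq hf (by linarith) (by positivity) hA'
    (fun k t ht => mul_nonneg (by positivity) (wB_pos ht).le) (fun t ht => by positivity)
    (fun k s t hk hs hst => by
      have hs0 : 0 < s := by linarith
      have h2 := H2 k s t hs hst
      calc _ ≤ (A * (s ^ e' * (|k| ^ r * Real.exp (-(|k| * (t - s)))))) *
            (C * s ^ (-m)) :=
            mul_le_mul (far k s t hk hs hst) (H k s hk hs) (norm_nonneg _) (by positivity)
        _ = A * C * (s ^ e' * s ^ (-m)) * (|k| ^ r * Real.exp (-(|k| * (t - s)))) := by
            ring
        _ ≤ A * C * (s ^ e' * s ^ (-m)) * (C2 * (t ^ (-r) * wB α k t)) :=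
            mul_le_mul_of_nonneg_left h2 (by positivity)
        _ = _ := by
          rw [← Real.rpow_add hs0, show e' + -m = -(m - e') by ring]; ring)
    (fun k s t hk hs hst h => (near k s t hk hs hst h).trans (mul_le_mul_of_nonneg_left
      (le_add_of_nonneg_right (mul_nonneg (re_kappa_nonneg k) (Real.exp_pos _).le)) hA'))
  refine ⟨C3 * 3, by positivity, fun k t hk ht => (H3 k t hk ht).trans ?_⟩
  have m4 : t ^ (-r) * wB α k t ≤ t ^ (-P) * wB α k t :=
    mul_le_mul_of_nonneg_right (rpow_neg_anti ht hP) (wB_pos ht).le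
  have m6 : 0 ≤ t ^ (-R) * wT α k t := mul_nonneg (by positivity) (wT_pos ht).le
  have m7 := near_mass_le (α := α) (k := k) ht he hP' hR
  rw [mul_assoc]
  refine mul_le_mul_of_nonneg_left ?_ hC3
  rw [weight_coe_coe ht (p := P)] at m7 ⊢
  linarith


section Components

variable {Q : Fin 2 → ℝ → ℝ → ℂ}

lemma exp_abs_le_one (hst : s ≤ t) : Real.exp (-(|k| * (t - s))) ≤ 1 := by
  rw [Real.exp_le_one_iff]
  have := mul_nonneg (abs_nonneg k) (by linarith : 0 ≤ t - s)
  linarith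

lemma re_kappa_mul_exp_nonneg (k x : ℝ) :
    0 ≤ (kappa k).re * Real.exp (-((kappa k).re * x)) :=
  mul_nonneg (re_kappa_nonneg k) (Real.exp_pos _).le

lemma min_one_sq_le_rpow {r x : ℝ} (hr : 0 ≤ r) (hr2 : r ≤ 2) (hx : 0 ≤ x) :
    min 1 x ^ 2 ≤ x ^ r := by
  rcases hx.eq_or_lt with rfl | hx0
  · simp [Real.rpow_nonneg]
  have h0 : 0 < min 1 x := lt_min one_pos hx0
  calc min 1 x ^ 2 = min 1 x ^ (2 : ℝ) := by norm_cast
    _ ≤ min 1 x ^ r := Real.rpow_le_rpow_of_exponent_ge h0 (min_le_left _ _) hr2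
    _ ≤ _ := Real.rpow_le_rpow h0.le (min_le_right _ _) hr

lemma min_one_le_rpow {r x : ℝ} (hr : 0 ≤ r) (hr1 : r ≤ 1) (hx : 0 ≤ x) :
    min 1 x ≤ x ^ r := by
  rcases hx.eq_or_lt with rfl | hx0
  · simp [Real.rpow_nonneg]
  have h0 : 0 < min 1 x := lt_min one_pos hx0
  calc min 1 x = min 1 x ^ (1 : ℝ) := by rw [Real.rpow_one]
    _ ≤ min 1 x ^ r := Real.rpow_le_rpow_of_exponent_ge h0 (min_le_left _ _) hr1
    _ ≤ _ := Real.rpow_le_rpow h0.le (min_le_right _ _) hr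

lemma hasBound_omega_one_one (hα : 0 ≤ α) (hp : 2 < p) (hQ : HasBound α p p (Q 1)) :
    HasBound α ((p - 1 : ℝ) : WithTop ℝ) (1 : ℝ) (omegaC .one 1 Q) := by
  rw [omegaC_eq]
  refine comp_one_kappa_hasBound (A := 8) (A' := 8) (r := 1) (e := 0) (e' := 1) (m := p) hα
    (by linarith) (by linarith) hQ (by norm_num) (by norm_num) (by norm_num) le_rfl le_rfl
    (by linarith) (by norm_num) (by linarith) (by norm_num) (by linarith)
    (fun k s t hk hs hst => ?_) (fun k s t hk hs hst h => ?_)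
  · refine (norm_kerOmega_one_one_le hk hs).trans ?_
    rw [Real.rpow_one, Real.rpow_one, ← mul_assoc s, mul_comm s]
    gcongr
    exact min_le_right _ _
  · refine (norm_kerOmega_one_one_le hk hs).trans ?_
    have e1 : Real.exp (-((kappa k).re * (t - s))) ≤ 1 := exp_re_kappa_le_one hst
    have e3 : min 1 (√|k| * s) * Real.exp (-((kappa k).re * (t - s))) ≤ 1 * 1 := by
      gcongr; exact min_le_left _ _
    rw [Real.rpow_zero]
    linarith [re_kappa_mul_exp_nonneg k (t - s)]

lemma hasBound_eta_one_one (hα : 0 ≤ α) (hp : 2 < p) (hQ : HasBound α p p (Q 1)) :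
    HasBound α ((p - 2 : ℝ) : WithTop ℝ) (0 : ℝ) (etaC .one 1 Q) := by
  rw [etaC_eq]
  refine comp_one_kappa_hasBound (A := 16) (A' := 16) (r := 0) (e := 1) (e' := 1) (m := p) hα
    (by linarith) (by linarith) hQ (by norm_num) (by norm_num) (by norm_num) le_rfl le_rfl
    (by linarith) (by norm_num) (by linarith) (by norm_num) (by linarith)
    (fun k s t hk hs hst => ?_) (fun k s t hk hs hst h => ?_)
  · refine (norm_kerEta_one_one_le hk hs).trans (le_of_eq ?_)
    rw [Real.rpow_one, Real.rpow_zero, one_mul]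
  · refine (norm_kerEta_one_one_le hk hs).trans ?_
    have e1 : Real.exp (-((kappa k).re * (t - s))) ≤ 1 := exp_re_kappa_le_one hst
    rw [Real.rpow_one]
    nlinarith [re_kappa_mul_exp_nonneg k (t - s)]

lemma hasBound_eta_one_zero (hα : 0 ≤ α) (hp : 3 ≤ p) (hQ : HasBound α p (3 : ℝ) (Q 0)) {δ : ℝ}
    (hδ : 0 < δ) (hδ1 : δ ≤ 1) :
    HasBound α ((p - 1 : ℝ) : WithTop ℝ) ((2 - δ : ℝ) : WithTop ℝ) (etaC .one 0 Q) := by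
  rw [etaC_eq]
  refine comp_one_kappa_hasBound (A := 12) (A' := 12) (r := 2 - δ) (e := 0) (e' := 2 - δ) (m := 3)
    hα (by linarith) (by linarith) hQ (by norm_num) (by norm_num) (by linarith) hp le_rfl
    (by linarith) (by norm_num) (by linarith) (by linarith) (by linarith)
    (fun k s t hk hs hst => ?_) (fun k s t hk hs hst h => ?_)
  · refine (norm_kerEta_one_zero_le hk hs).trans ?_
    have := min_one_sq_le_rpow (r := 2 - δ) (by linarith) (by linarith)
      (by positivity : 0 ≤ √|k| * s)
    rw [Real.mul_rpow (Real.sqrt_nonneg _) (by linarith)] at this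
    rw [← mul_assoc (s ^ _), mul_comm (s ^ _)]
    gcongr
  · refine (norm_kerEta_one_zero_le hk hs).trans ?_
    have e1 : Real.exp (-((kappa k).re * (t - s))) ≤ 1 := exp_re_kappa_le_one hst
    have e3 : min 1 (√|k| * s) ^ 2 * Real.exp (-((kappa k).re * (t - s))) ≤ 1 * 1 := by
      gcongr; exact pow_le_one₀ (by positivity) (min_le_left _ _)
    rw [Real.rpow_zero]
    linarith [re_kappa_mul_exp_nonneg k (t - s)]

lemma hasBound_omega_one_zero (hα : 0 ≤ α) (hp : 3 ≤ p) (hQ : HasBound α p (3 : ℝ) (Q 0)) {δ : ℝ}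
    (hδ : 0 < δ) (hδ1 : δ ≤ 1) :
    HasBound α p ((3 - δ : ℝ) : WithTop ℝ) (omegaC .one 0 Q) := by
  rw [omegaC_eq]
  refine comp_one_kappa_hasBound (A := 12) (A' := 24) (r := 3 - δ) (e := -1) (e' := 2 - δ) (m := 3)
    hα (by linarith) (by linarith) hQ (by norm_num) (by norm_num) (by linarith) hp le_rfl
    (by linarith) (by norm_num) (by linarith) (by linarith) (by linarith)
    (fun k s t hk hs hst => ?_) (fun k s t hk hs hst h => ?_)
  · refine (norm_kerOmega_one_zero_le hk hs).trans ?_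
    have hs0 : 0 ≤ s := by linarith
    have h0 : 0 < √|k| := Real.sqrt_pos.2 (abs_pos.2 hk)
    have h1 := min_one_sq_le_rpow (r := 2 - δ) (by linarith) (by linarith)
      (by positivity : 0 ≤ √|k| * s)
    rw [Real.mul_rpow (Real.sqrt_nonneg _) (by linarith)] at h1
    have h2 := abs_div_norm_kappa_le_sqrt hk
    have h3 : √|k| ^ (3 - δ) = √|k| * √|k| ^ (2 - δ) := by
      rw [← Real.rpow_one_add' h0.le (by linarith)]; congr 1; ring
    calc _ ≤ 12 * (√|k| * ((√|k| ^ (2 - δ) * s ^ (2 - δ)) *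
          Real.exp (-((kappa k).re * (t - s))))) := by gcongr
      _ = _ := by rw [h3]; ring
  · refine (norm_kerOmega_one_zero_le hk hs).trans ?_
    have h2 : |k| / ‖kappa k‖ ≤ 2 * (kappa k).re :=
      ((abs_div_norm_kappa_le_sqrt hk).trans (sqrt_le_two_mul_re_kappa k))
    have ht0 : 0 ≤ t ^ (-1 : ℝ) := Real.rpow_nonneg (by linarith) _
    have h0 : 0 ≤ min 1 (√|k| * s) := by positivity
    have h3 : min 1 (√|k| * s) ^ 2 ≤ 1 := pow_le_one₀ h0 (min_le_left _ _)
    calc _ ≤ 12 * ((2 * (kappa k).re) * (1 * Real.exp (-((kappa k).re * (t - s))))) := by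
          gcongr
          linarith [re_kappa_nonneg k]
      _ ≤ _ := by linarith

lemma hasBound_psi_one_one (hα : 0 ≤ α) (hp : 2 < p) (hQ : HasBound α p p (Q 1)) :
    HasBound α (1 / 2 : ℝ) ((p - 1 : ℝ) : WithTop ℝ) (psiC .one 1 Q) := by
  rw [psiC_eq]
  refine comp_one_abs_hasBound (A := 8) (A' := 8) (r := 1 / 2) (e := 0) (e' := 1) (m := p) hα
    (by linarith) (by linarith) hQ (by norm_num) (by norm_num) (by norm_num) le_rfl le_rfl
    (by linarith) (by norm_num) (by norm_num) (by linarith) (by linarith)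
    (fun k s t hk hs hst => ?_) (fun k s t hk hs hst h => ?_)
  · refine (norm_kerPsi_one_one_le hk hs).trans ?_
    rw [Real.rpow_one, ← Real.sqrt_eq_rpow, ← mul_assoc s, mul_comm s]
    gcongr
    exact min_le_right _ _
  · refine (norm_kerPsi_one_one_le hk hs).trans ?_
    have e1 := exp_abs_le_one (k := k) hst
    have e3 : min 1 (√|k| * s) * Real.exp (-(|k| * (t - s))) ≤ 1 * 1 := by
      gcongr; exact min_le_left _ _
    rw [Real.rpow_zero]
    linarith

lemma hasBound_psi_one_zero (hα : 0 ≤ α) (hp : 3 ≤ p) (hQ : HasBound α p (3 : ℝ) (Q 0)) {δ : ℝ}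
    (hδ : 0 < δ) (hδ1 : δ ≤ 1) :
    HasBound α ((3 / 2 - δ : ℝ) : WithTop ℝ) (2 : ℝ) (psiC .one 0 Q) := by
  rw [psiC_eq]
  -- interpolation: `min(1, |k|^{3/2} s²) ≤ (|k|^{3/2} s²)^θ` with `θ = 1 - 2δ/3`
  refine comp_one_abs_hasBound (A := 106) (A' := 106) (r := 3 / 2 - δ) (e := 0)
    (e' := 2 * (1 - 2 / 3 * δ)) (m := 3) hα
    (by linarith) (by linarith) hQ (by norm_num) (by norm_num) (by linarith) hp le_rfl
    (by linarith) (by norm_num) (by linarith) (by linarith) (by norm_num)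
    (fun k s t hk hs hst => ?_) (fun k s t hk hs hst h => ?_)
  · refine (norm_kerPsi_one_zero_le hk hs).trans ?_
    have hs0 : 0 ≤ s := by linarith
    have h1 := min_one_le_rpow (r := 1 - 2 / 3 * δ) (by linarith) (by linarith)
      (by positivity : 0 ≤ √|k| ^ 3 * s ^ 2)
    have e1 : (√|k| ^ 3 * s ^ 2) ^ (1 - 2 / 3 * δ)
        = s ^ (2 * (1 - 2 / 3 * δ)) * |k| ^ (3 / 2 - δ) := by
      rw [Real.mul_rpow (by positivity) (by positivity), Real.sqrt_eq_rpow, ← Real.rpow_natCast,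
        ← Real.rpow_natCast, ← Real.rpow_mul (abs_nonneg _), ← Real.rpow_mul (abs_nonneg _),
        ← Real.rpow_mul hs0, mul_comm]
      congr 2; push_cast; ring
    rw [e1] at h1
    rw [← mul_assoc (s ^ _)]
    gcongr
  · refine (norm_kerPsi_one_zero_le hk hs).trans ?_
    have e1 := exp_abs_le_one (k := k) hst
    have e3 : min 1 (√|k| ^ 3 * s ^ 2) * Real.exp (-(|k| * (t - s))) ≤ 1 * 1 := by
      gcongr; exact min_le_left _ _
    rw [Real.rpow_zero]
    linarith

/-- The components `φ_{1,m}` and `ψ_{1,m}` differ by a factor of modulus `1`. -/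
lemma phiC_one_eq (m : Fin 2) (hk : k ≠ 0) :
    phiC .one m Q k t = I * sg k * psiC .one m Q k t := by
  rw [phiC_eq, psiC_eq]
  simp only [comp, kerPhi_one hk, mul_assoc, ← integral_const_mul]

lemma HasBound.phi_of_psi {p q : WithTop ℝ} {m : Fin 2} (h : HasBound α p q (psiC .one m Q)) :
    HasBound α p q (phiC .one m Q) := by
  obtain ⟨C, hC, H⟩ := h
  refine ⟨C, hC, fun k t hk ht => ?_⟩
  rw [phiC_one_eq m hk, norm_mul, norm_I_mul_sg hk, one_mul]
  exact H k t hk ht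

lemma hasBound_omega_two_zero (hα : 0 ≤ α) (hp : 3 ≤ p) (hQ : HasBound α p (3 : ℝ) (Q 0)) :
    HasBound α ⊤ (3 : ℝ) (omegaC .two 0 Q) := by
  rw [omegaC_eq]
  obtain ⟨C, hC, H⟩ := comp_tail_bound
    (K := fun k t s => preK .two k (t - 1) * kerF .two 0 k (s - 1)) dom_two hα (by linarith)
    (by norm_num) hQ
    (N := fun k t => 8 * (min 1 √|k| * Real.exp (-((kappa k).re * (t - 1)))))
    (fun _ _ _ => by positivity)
    (fun k t s hk ht hst => norm_kerOmega_two_zero_le hk (ht.trans hst))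
  obtain ⟨C1, hC1, H1⟩ := exists_min_mul_exp_mul_wB_le hα
  refine ⟨C * (8 * (2 * C1)), by positivity, fun k t hk ht => (H k t hk ht).trans ?_⟩
  rw [weight_coe_coe ht, weight_top_coe ht]
  have ht0 : 0 < t := by linarith
  have hT := (wT_pos (α := α) (k := k) ht).le
  have hB := (wB_pos (α := α) (k := k) ht).le
  have h1 := H1 k t ht
  set ν := min 1 √|k| * Real.exp (-((kappa k).re * (t - 1))) with hν
  have hν0 : 0 ≤ ν := by positivity
  have h2 : ν * wT α k t ≤ C1 * (t ^ (-1 : ℝ) * wT α k t) :=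
    (mul_le_mul_of_nonneg_left (wT_le_wB hα ht) hν0).trans h1
  have r1 : t ^ (-(p - 1)) ≤ t ^ (-2 : ℝ) := rpow_neg_anti ht (by linarith)
  have r2 : t ^ (-(3 - 1) : ℝ) = t ^ (-2 : ℝ) := by norm_num
  have r3 : t ^ (-2 : ℝ) * t ^ (-1 : ℝ) = t ^ (-3 : ℝ) := by
    rw [← Real.rpow_add ht0]; norm_num
  rw [mul_assoc C, mul_assoc 8, mul_assoc 8, r2]
  refine mul_le_mul_of_nonneg_left (mul_le_mul_of_nonneg_left ?_ (by norm_num)) hC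
  calc _ = t ^ (-(p - 1)) * (ν * wB α k t) + t ^ (-2 : ℝ) * (ν * wT α k t) := by ring
    _ ≤ t ^ (-2 : ℝ) * (C1 * (t ^ (-1 : ℝ) * wT α k t))
        + t ^ (-2 : ℝ) * (C1 * (t ^ (-1 : ℝ) * wT α k t)) := by gcongr
    _ = _ := by rw [← r3]; ring

lemma hasBound_omega_two_one (hα : 0 ≤ α) (hp : 1 < p) (hQ : HasBound α p p (Q 1)) :
    HasBound α ⊤ ((p - 1 : ℝ) : WithTop ℝ) (omegaC .two 1 Q) := by
  rw [omegaC_eq]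
  exact comp_tail_hasBound_top dom_two hα hp hp hQ (by norm_num) le_rfl le_rfl
    fun k t s hk ht hst => norm_kerOmega_two_one_le hk (ht.trans hst)

lemma hasBound_eta_two_zero (hα : 0 ≤ α) (hp : 3 ≤ p) (hQ : HasBound α p (3 : ℝ) (Q 0)) :
    HasBound α ⊤ (2 : ℝ) (etaC .two 0 Q) := by
  rw [etaC_eq]
  exact comp_tail_hasBound_top dom_two hα (by linarith) (by norm_num) hQ (by norm_num)
    (by linarith) (by norm_num) fun k t s hk ht hst => norm_kerEta_two_zero_le hk (ht.trans hst)

lemma hasBound_eta_two_one (hα : 0 ≤ α) (hp : 1 < p) (hQ : HasBound α p p (Q 1)) :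
    HasBound α ⊤ ((p - 1 : ℝ) : WithTop ℝ) (etaC .two 1 Q) := by
  rw [etaC_eq]
  exact comp_tail_hasBound_top dom_two hα hp hp hQ (by norm_num) le_rfl le_rfl
    fun k t s hk ht hst => norm_kerEta_two_one_le hk (ht.trans hst)

lemma hasBound_omega_three_zero (hα : 0 ≤ α) (hp : 3 ≤ p) (hQ : HasBound α p (3 : ℝ) (Q 0)) :
    HasBound α p (3 : ℝ) (omegaC .three 0 Q) := by
  rw [omegaC_eq]
  obtain ⟨C, hC, H⟩ := hQ
  refine ⟨2 * C, by positivity, fun k t hk ht => ?_⟩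
  have hρ : 0 < (kappa k).re := (abs_pos.2 hk).trans_le (abs_le_re_kappa k)
  have hw := weight_nonneg (α := α) (p := p) (q := 3) (k := k) ht
  have := norm_integral_Ici_le (a := 2) (A := 0) (D := 2 * C * weight α p (3 : ℝ) k t)
    (g := fun s => preK .three k (t - 1) * kerF .three 0 k (s - 1) * Q 0 k s) ht (by norm_num) hρ
    (fun s hst => by
      have hs := ht.trans hst
      have e1 : weight α p (3 : ℝ) k s ≤ weight α p (3 : ℝ) k t := by
        rw [weight_coe_coe ht, weight_coe_coe hs]
        have r : ∀ a : ℝ, 0 ≤ a → s ^ (-a) ≤ t ^ (-a) := fun a ha =>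
          Real.rpow_le_rpow_of_nonpos (by linarith) hst (by linarith)
        exact add_le_add
          (mul_le_mul (r _ (by linarith)) (wB_anti hα ht hst) (wB_pos hs).le (by positivity))
          (mul_le_mul (r _ (by norm_num)) (wT_anti hα ht hst) (wT_pos hs).le (by positivity))
      rw [norm_mul]
      calc _ ≤ (|k| / ‖kappa k‖ * Real.exp (-((kappa k).re * (s - t)))) *
            (C * weight α p (3 : ℝ) k t) :=
            mul_le_mul (norm_kerOmega_three_zero_le hk ht)
              ((H k s hk hs).trans (mul_le_mul_of_nonneg_left e1 hC)) (norm_nonneg _)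
              (by positivity)
        _ ≤ ((2 * (kappa k).re) * Real.exp (-((kappa k).re * (s - t)))) *
            (C * weight α p (3 : ℝ) k t) := by
            gcongr
            exact (abs_div_norm_kappa_le_sqrt hk).trans (sqrt_le_two_mul_re_kappa k)
        _ = _ := by ring)
  refine this.trans (le_of_eq ?_)
  ring

lemma hasBound_omega_three_one (hα : 0 ≤ α) (hp : 1 < p) (hQ : HasBound α p p (Q 1)) :
    HasBound α ((p - 1 : ℝ) : WithTop ℝ) ((p - 1 : ℝ) : WithTop ℝ) (omegaC .three 1 Q) := by
  rw [omegaC_eq]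
  exact comp_tail_hasBound dom_three hα hp hp hQ zero_le_one
    fun k t s hk ht hst => norm_kerOmega_three_one_le hk ht hst

lemma hasBound_eta_three_zero (hα : 0 ≤ α) (hp : 3 ≤ p) (hQ : HasBound α p (3 : ℝ) (Q 0)) :
    HasBound α ((p - 1 : ℝ) : WithTop ℝ) (2 : ℝ) (etaC .three 0 Q) := by
  rw [etaC_eq, show (2 : ℝ) = 3 - 1 by norm_num]
  exact comp_tail_hasBound dom_three hα (by linarith) (by norm_num) hQ zero_le_one
    fun k t s hk ht hst => norm_kerEta_three_zero_le hk ht hst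

lemma hasBound_eta_three_one (hα : 0 ≤ α) (hp : 1 < p) (hQ : HasBound α p p (Q 1)) :
    HasBound α ((p - 2 : ℝ) : WithTop ℝ) ((p - 2 : ℝ) : WithTop ℝ) (etaC .three 1 Q) := by
  rw [etaC_eq]
  obtain ⟨C, hC, H⟩ := comp_tail_bound
    (K := fun k t s => preK .three k (t - 1) * kerG .three 1 k (s - 1)) dom_three hα hp hp hQ
    (N := fun k t => 4 * t) (fun _ _ ht => by linarith)
    (fun k t s hk ht hst => norm_kerEta_three_one_le hk ht hst)
  refine ⟨C * 4, by positivity, fun k t hk ht => (H k t hk ht).trans (le_of_eq ?_)⟩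
  have := mul_weight (α := α) (k := k) (p := p - 1) (q := p - 1) ht 1
  rw [Real.rpow_one, show p - 1 - 1 = p - 2 by ring] at this
  rw [← this]; ring

lemma hasBound_psi_two_zero (hα : 0 ≤ α) (hp : 3 ≤ p) (hQ : HasBound α p (3 : ℝ) (Q 0)) :
    HasBound α ((p - 1 : ℝ) : WithTop ℝ) (2 : ℝ) (psiC .two 0 Q) := by
  rw [psiC_eq, show (2 : ℝ) = 3 - 1 by norm_num]
  exact comp_tail_hasBound dom_two hα (by linarith) (by norm_num) hQ zero_le_two
    fun k t s hk ht hst => norm_kerPsi_two_zero_le hk ht (ht.trans hst)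

lemma hasBound_psi_two_one (hα : 0 ≤ α) (hp : 1 < p) (hQ : HasBound α p p (Q 1)) :
    HasBound α ((p - 1 : ℝ) : WithTop ℝ) ((p - 1 : ℝ) : WithTop ℝ) (psiC .two 1 Q) := by
  rw [psiC_eq]
  exact comp_tail_hasBound dom_two hα hp hp hQ zero_le_three
    fun k t s hk ht hst => norm_kerPsi_two_one_le hk ht (ht.trans hst)

lemma hasBound_phi_two_zero (hα : 0 ≤ α) (hp : 3 ≤ p) (hQ : HasBound α p (3 : ℝ) (Q 0)) :
    HasBound α ((p - 1 : ℝ) : WithTop ℝ) (2 : ℝ) (phiC .two 0 Q) := by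
  rw [phiC_eq, show (2 : ℝ) = 3 - 1 by norm_num]
  exact comp_tail_hasBound dom_two hα (by linarith) (by norm_num) hQ zero_le_three
    fun k t s hk ht hst => norm_kerPhi_two_zero_le hk ht (ht.trans hst)

lemma hasBound_phi_two_one (hα : 0 ≤ α) (hp : 1 < p) (hQ : HasBound α p p (Q 1)) :
    HasBound α ((p - 1 : ℝ) : WithTop ℝ) ((p - 1 : ℝ) : WithTop ℝ) (phiC .two 1 Q) := by
  rw [phiC_eq]
  exact comp_tail_hasBound dom_two hα hp hp hQ zero_le_four
    fun k t s hk ht hst => norm_kerPhi_two_one_le hk ht (ht.trans hst)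

lemma hasBound_psi_three_zero (hα : 0 ≤ α) (hp : 3 ≤ p) (hQ : HasBound α p (3 : ℝ) (Q 0)) :
    HasBound α ((p - 1 : ℝ) : WithTop ℝ) (2 : ℝ) (psiC .three 0 Q) := by
  rw [psiC_eq, show (2 : ℝ) = 3 - 1 by norm_num]
  exact comp_tail_hasBound dom_three hα (by linarith) (by norm_num) hQ zero_le_one
    fun k t s hk ht hst => norm_kerPsi_three_zero_le hk ht hst

lemma hasBound_psi_three_one (hα : 0 ≤ α) (hp : 1 < p) (hQ : HasBound α p p (Q 1)) :
    HasBound α ((p - 1 : ℝ) : WithTop ℝ) ((p - 1 : ℝ) : WithTop ℝ) (psiC .three 1 Q) := by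
  rw [psiC_eq]
  exact comp_tail_hasBound dom_three hα hp hp hQ zero_le_one
    fun k t s hk ht hst => norm_kerPsi_three_one_le hk ht hst

lemma hasBound_phi_three_zero (hα : 0 ≤ α) (hp : 3 ≤ p) (hQ : HasBound α p (3 : ℝ) (Q 0)) :
    HasBound α ((p - 1 : ℝ) : WithTop ℝ) (2 : ℝ) (phiC .three 0 Q) := by
  rw [phiC_eq, show (2 : ℝ) = 3 - 1 by norm_num]
  exact comp_tail_hasBound dom_three hα (by linarith) (by norm_num) hQ zero_le_one
    fun k t s hk ht hst => norm_kerPhi_three_zero_le hk ht hst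

lemma hasBound_phi_three_one (hα : 0 ≤ α) (hp : 1 < p) (hQ : HasBound α p p (Q 1)) :
    HasBound α ((p - 1 : ℝ) : WithTop ℝ) ((p - 1 : ℝ) : WithTop ℝ) (phiC .three 1 Q) := by
  rw [phiC_eq]
  exact comp_tail_hasBound dom_three hα hp hp hQ zero_le_one
    fun k t s hk ht hst => norm_kerPhi_three_one_le hk ht hst

end Components

end

section

variable {α k t s p q : ℝ}

/-! ### Continuity of the components -/

/-- The domain `k ≠ 0`, `t ≥ 1`. -/
def dom₀ : Set (ℝ × ℝ) := {z | z.1 ≠ 0 ∧ 1 ≤ z.2}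

/-- Joint continuity of a kernel away from `k = 0`. -/
def KerCont (K : ℝ → ℝ → ℝ → ℂ) : Prop :=
  ∀ z : ℝ × ℝ × ℝ, z.1 ≠ 0 → ContinuousAt (fun z : ℝ × ℝ × ℝ => K z.1 z.2.1 z.2.2) z

section

variable {z : ℝ × ℝ × ℝ}

lemma continuousAt_kappa_fst (h : z.1 ≠ 0) : ContinuousAt (fun z : ℝ × ℝ × ℝ => kappa z.1) z :=
  ContinuousAt.comp (f := fun z : ℝ × ℝ × ℝ => z.1) (continuousAt_kappa h) continuousAt_fst

lemma continuousAt_preK (n : Part) (h : z.1 ≠ 0) :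
    ContinuousAt (fun z : ℝ × ℝ × ℝ => preK n z.1 (z.2.1 - 1)) z := by
  have h1 := continuousAt_kappa_fst h
  have h3 : I * (z.1 : ℂ) ≠ 0 := mul_ne_zero I_ne_zero (by exact_mod_cast h)
  cases n <;> simp only [preK] <;> fun_prop (disch := assumption)

lemma continuousAt_preH (n : Part) (h : z.1 ≠ 0) :
    ContinuousAt (fun z : ℝ × ℝ × ℝ => preH n z.1 (z.2.1 - 1)) z := by
  have h3 : I * (z.1 : ℂ) ≠ 0 := mul_ne_zero I_ne_zero (by exact_mod_cast h)
  cases n <;> simp only [preH] <;> fun_prop (disch := assumption)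

lemma continuousAt_kerF (n : Part) (m : Fin 2) (h : z.1 ≠ 0) :
    ContinuousAt (fun z : ℝ × ℝ × ℝ => kerF n m z.1 (z.2.2 - 1)) z := by
  have h1 := continuousAt_kappa_fst h
  have h2 := kappa_ne_zero h
  have h3 : I * (z.1 : ℂ) ≠ 0 := mul_ne_zero I_ne_zero (by exact_mod_cast h)
  cases n <;> fin_cases m <;> simp only [kerF] <;> fun_prop (disch := assumption)

lemma continuousAt_kerG (n : Part) (m : Fin 2) (h : z.1 ≠ 0) :
    ContinuousAt (fun z : ℝ × ℝ × ℝ => kerG n m z.1 (z.2.2 - 1)) z := by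
  have h1 := continuousAt_kappa_fst h
  have h2 := kappa_ne_zero h
  have h3 : I * (z.1 : ℂ) ≠ 0 := mul_ne_zero I_ne_zero (by exact_mod_cast h)
  have h4 := continuousAt_kerF .one m h
  cases n
  · simp only [kerG]; fun_prop (disch := assumption)
  all_goals fin_cases m <;> simp only [kerG] <;> fun_prop (disch := assumption)

lemma continuousAt_kerH (n : Part) (m : Fin 2) (h : z.1 ≠ 0) :
    ContinuousAt (fun z : ℝ × ℝ × ℝ => kerH n m z.1 (z.2.2 - 1)) z := by
  have h1 := continuousAt_kappa_fst h
  have h2 := ofReal_abs_ne_zero h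
  have h3 : I * (z.1 : ℂ) ≠ 0 := mul_ne_zero I_ne_zero (by exact_mod_cast h)
  cases n <;> fin_cases m <;> simp only [kerH] <;> fun_prop (disch := assumption)

lemma continuousAt_kerK (n : Part) (m : Fin 2) (h : z.1 ≠ 0) :
    ContinuousAt (fun z : ℝ × ℝ × ℝ => kerK n m z.1 (z.2.2 - 1)) z := by
  have h1 := continuousAt_kappa_fst h
  have h2 := ofReal_abs_ne_zero h
  have h3 : I * (z.1 : ℂ) ≠ 0 := mul_ne_zero I_ne_zero (by exact_mod_cast h)
  have h4 := continuousAt_kerH .one m h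
  cases n
  · simp only [kerK]; fun_prop (disch := assumption)
  all_goals fin_cases m <;> simp only [kerK] <;> fun_prop (disch := assumption)

end

lemma kerCont_omega (n : Part) (m : Fin 2) :
    KerCont fun k t s => preK n k (t - 1) * kerF n m k (s - 1) :=
  fun _ h => (continuousAt_preK n h).mul (continuousAt_kerF n m h)

lemma kerCont_eta (n : Part) (m : Fin 2) :
    KerCont fun k t s => preK n k (t - 1) * kerG n m k (s - 1) :=
  fun _ h => (continuousAt_preK n h).mul (continuousAt_kerG n m h)

lemma kerCont_psi (n : Part) (m : Fin 2) :
    KerCont fun k t s => preH n k (t - 1) * kerH n m k (s - 1) :=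
  fun _ h => (continuousAt_preH n h).mul (continuousAt_kerH n m h)

lemma kerCont_phi (n : Part) (m : Fin 2) :
    KerCont fun k t s => preH n k (t - 1) * kerK n m k (s - 1) :=
  fun _ h => (continuousAt_preH n h).mul (continuousAt_kerK n m h)

/-- A size bound on a kernel with the decay of the propagator `e^{-|k|(t-s)}`, at half the rate; for
`s ≥ t` it is a plain bound. -/
def KerExp (n : Part) (K : ℝ → ℝ → ℝ → ℂ) : Prop :=
  ∃ C, 0 ≤ C ∧ ∀ k t s : ℝ, k ≠ 0 → 1 ≤ t → 1 ≤ s → s ∈ n.dom t →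
    ‖K k t s‖ ≤ C * Real.exp (-(1 / 2 * (|k| * max (t - s) 0)))

/-- The weakest size bound on a kernel, which all kernels satisfy. -/
def KerLin (n : Part) (K : ℝ → ℝ → ℝ → ℂ) : Prop :=
  ∃ C, 0 ≤ C ∧ ∀ k t s : ℝ, k ≠ 0 → 1 ≤ t → 1 ≤ s → s ∈ n.dom t → ‖K k t s‖ ≤ C * s

lemma KerExp.kerLin {n : Part} {K : ℝ → ℝ → ℝ → ℂ} (h : KerExp n K) : KerLin n K := by
  obtain ⟨C, hC, H⟩ := h
  refine ⟨C, hC, fun k t s hk ht hs hst => (H k t s hk ht hs hst).trans ?_⟩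
  gcongr
  refine le_trans (Real.exp_le_one_iff.2 ?_) hs
  have : 0 ≤ |k| * max (t - s) 0 := by positivity
  linarith

lemma Part.one_le_of_mem_dom {n : Part} (ht : 1 ≤ t) (h : s ∈ n.dom t) : 1 ≤ s := by
  cases n
  · exact h.1
  · exact ht.trans h
  · exact ht.trans h

lemma Part.measurableSet_dom (n : Part) (t : ℝ) : MeasurableSet (n.dom t) := by
  cases n
  · exact measurableSet_Icc
  · exact measurableSet_Ici
  · exact measurableSet_Ici

/-- The domains of integration vary continuously: for `s ≠ t₀`, membership of `s` is locally constant
near `t₀`. -/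
lemma Part.eventually_mem_dom_iff (n : Part) {t₀ : ℝ} (h : s ≠ t₀) :
    ∀ᶠ t in nhds t₀, (s ∈ n.dom t ↔ s ∈ n.dom t₀) := by
  rcases lt_or_gt_of_ne h with h | h
  · filter_upwards [lt_mem_nhds h] with t ht
    cases n
    · exact ⟨fun h1 => ⟨h1.1, h.le⟩, fun h1 => ⟨h1.1, ht.le⟩⟩
    · exact ⟨fun h1 => absurd h1 ht.not_ge, fun h1 => absurd h1 h.not_ge⟩
    · exact ⟨fun h1 => absurd h1 ht.not_ge, fun h1 => absurd h1 h.not_ge⟩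
  · filter_upwards [gt_mem_nhds h] with t ht
    cases n
    · exact ⟨fun h1 => absurd h1.2 ht.not_ge, fun h1 => absurd h1.2 h.not_ge⟩
    · exact ⟨fun _ => h.le, fun _ => ht.le⟩
    · exact ⟨fun _ => h.le, fun _ => ht.le⟩

/-- The components are continuous by dominated convergence, with majorant `s^{-2}`. -/
lemma continuousOn_comp {n : Part} {K : ℝ → ℝ → ℝ → ℂ} {f : ℝ → ℝ → ℂ} (hK : KerCont K)
    (hKb : KerLin n K) (hf : ContinuousOn (fun z : ℝ × ℝ => f z.1 z.2) dom₀)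
    (hfb : ∃ C, 0 ≤ C ∧ ∀ k t, k ≠ 0 → 1 ≤ t → ‖f k t‖ ≤ C * t ^ (-3 : ℝ)) :
    ContinuousOn (fun z : ℝ × ℝ => comp n K f z.1 z.2) dom₀ := by
  obtain ⟨C, hC, H⟩ := hKb
  obtain ⟨C', hC', H'⟩ := hfb
  have e : ∀ z ∈ dom₀, comp n K f z.1 z.2
      = ∫ s in Set.Ici (1 : ℝ), (n.dom z.2).indicator (fun s => K z.1 z.2 s * f z.1 s) s := by
    intro z hz
    have hsub : n.dom z.2 ⊆ Set.Ici 1 := fun s hs => n.one_le_of_mem_dom hz.2 hs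
    rw [setIntegral_indicator (n.measurableSet_dom _), Set.inter_eq_self_of_subset_right hsub]
    rfl
  rw [continuousOn_congr e]
  intro z₀ hz₀
  have hfs : ∀ k : ℝ, k ≠ 0 → ContinuousOn (f k) (Set.Ici 1) := by
    intro k hk
    exact hf.comp (f := fun s : ℝ => (k, s)) (by fun_prop) fun s hs => ⟨hk, hs⟩
  refine tendsto_integral_filter_of_dominated_convergence (fun s => C * C' * s ^ (-2 : ℝ)) ?_ ?_ ?_ ?_
  · filter_upwards [self_mem_nhdsWithin] with z hz
    refine AEStronglyMeasurable.indicator ?_ (n.measurableSet_dom _)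
    refine ContinuousOn.aestronglyMeasurable ?_ measurableSet_Ici
    refine ContinuousOn.mul (fun s _ => ContinuousAt.continuousWithinAt ?_) (hfs _ hz.1)
    exact ContinuousAt.comp (f := fun s : ℝ => (z.1, z.2, s)) (hK (z.1, z.2, s) hz.1) (by fun_prop)
  · filter_upwards [self_mem_nhdsWithin] with z hz
    filter_upwards [ae_restrict_mem measurableSet_Ici] with s hs
    have hs : 1 ≤ s := hs
    have hs0 : 0 < s := by linarith
    by_cases h : s ∈ n.dom z.2
    · rw [Set.indicator_of_mem h, norm_mul]
      calc _ ≤ (C * s) * (C' * s ^ (-3 : ℝ)) :=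
            mul_le_mul (H _ _ _ hz.1 hz.2 hs h) (H' _ _ hz.1 hs) (norm_nonneg _) (by positivity)
        _ = C * C' * (s ^ (1 : ℝ) * s ^ (-3 : ℝ)) := by rw [Real.rpow_one]; ring
        _ = _ := by rw [← Real.rpow_add hs0]; norm_num
    · rw [Set.indicator_of_notMem h, norm_zero]; positivity
  · refine (integrableOn_Ici_iff_integrableOn_Ioi (μ := volume)).2 ?_
    exact (integrableOn_Ioi_rpow_of_lt (by norm_num) one_pos).const_mul _
  · have hne : ∀ᵐ s ∂(volume.restrict (Set.Ici (1 : ℝ))), s ≠ z₀.2 :=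
      ae_restrict_of_ae (by simp [ae_iff])
    filter_upwards [hne, ae_restrict_mem measurableSet_Ici] with s hs hs1
    have h1 : ∀ᶠ z in nhdsWithin z₀ dom₀, (s ∈ n.dom z.2 ↔ s ∈ n.dom z₀.2) :=
      nhdsWithin_le_nhds (continuousAt_snd.eventually (n.eventually_mem_dom_iff hs))
    by_cases h : s ∈ n.dom z₀.2
    · rw [Set.indicator_of_mem h]
      have c : ContinuousWithinAt (fun z : ℝ × ℝ => K z.1 z.2 s * f z.1 s) dom₀ z₀ := by
        refine ContinuousWithinAt.mul (ContinuousAt.continuousWithinAt ?_) ?_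
        · exact ContinuousAt.comp (f := fun z : ℝ × ℝ => (z.1, z.2, s)) (hK (z₀.1, z₀.2, s) hz₀.1)
            (by fun_prop)
        · exact ContinuousWithinAt.comp (f := fun z : ℝ × ℝ => (z.1, s)) (hf (z₀.1, s) ⟨hz₀.1, hs1⟩)
            (by fun_prop) fun z hz => ⟨hz.1, hs1⟩
      refine c.tendsto.congr' ?_
      filter_upwards [h1] with z hz
      rw [Set.indicator_of_mem (hz.2 h)]
    · rw [Set.indicator_of_notMem h]
      refine tendsto_const_nhds.congr' ?_
      filter_upwards [h1] with z hz
      rw [Set.indicator_of_notMem (fun h' => h (hz.1 h'))]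

/-! ### Uniform size bounds on the kernels -/

lemma KerExp.of_one {K : ℝ → ℝ → ℝ → ℂ} {C : ℝ} (hC : 0 ≤ C)
    (H : ∀ k t s : ℝ, k ≠ 0 → 1 ≤ s → s ≤ t → ‖K k t s‖ ≤ C * Real.exp (-(|k| * (t - s)))) :
    KerExp .one K := by
  refine ⟨C, hC, fun k t s hk _ hs hst => (H k t s hk hs hst.2).trans ?_⟩
  rw [max_eq_left (by linarith [hst.2])]
  have : 0 ≤ |k| * (t - s) := mul_nonneg (abs_nonneg k) (by linarith [hst.2])
  exact mul_le_mul_of_nonneg_left (Real.exp_le_exp.2 (by linarith)) hC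

lemma KerExp.of_ge {n : Part} (hn : ∀ t, n.dom t = Set.Ici t) {K : ℝ → ℝ → ℝ → ℂ} {C : ℝ}
    (hC : 0 ≤ C) (H : ∀ k t s : ℝ, k ≠ 0 → 1 ≤ t → t ≤ s → ‖K k t s‖ ≤ C) : KerExp n K := by
  refine ⟨C, hC, fun k t s hk ht hs hst => ?_⟩
  rw [hn] at hst
  rw [max_eq_right (by linarith [show t ≤ s from hst])]
  simpa using H k t s hk ht hst

lemma mul_exp_re_kappa_le {m c : ℝ} (hm : m ≤ 1) (hc : 0 ≤ c) (hst : s ≤ t) :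
    c * (m * Real.exp (-((kappa k).re * (t - s)))) ≤ c * Real.exp (-(|k| * (t - s))) := by
  have h1 : Real.exp (-((kappa k).re * (t - s))) ≤ Real.exp (-(|k| * (t - s))) :=
    Real.exp_le_exp.2 (by
      have := mul_le_mul_of_nonneg_right (abs_le_re_kappa k) (by linarith : 0 ≤ t - s)
      linarith)
  gcongr
  nlinarith [Real.exp_pos (-((kappa k).re * (t - s)))]

lemma mul_exp_re_kappa_le_const {c : ℝ} (hc : 0 ≤ c) (hst : s ≤ t) :
    c * Real.exp (-((kappa k).re * (t - s))) ≤ c :=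
  mul_le_of_le_one_right hc (exp_re_kappa_le_one hst)

lemma kerExp_omega (n : Part) (m : Fin 2) :
    KerExp n fun k t s => preK n k (t - 1) * kerF n m k (s - 1) := by
  cases n <;> fin_cases m
  · refine .of_one (C := 12) (by norm_num) fun k t s hk hs hst =>
      (norm_kerOmega_one_zero_le hk hs).trans ?_
    rw [← mul_assoc (|k| / ‖kappa k‖)]
    refine mul_exp_re_kappa_le ?_ (by norm_num) hst
    have h0 : 0 ≤ min 1 (√|k| * s) := by positivity
    exact mul_le_one₀ (abs_div_norm_kappa_le_one hk) (by positivity)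
      (pow_le_one₀ h0 (min_le_left _ _))
  · exact .of_one (C := 8) (by norm_num) fun k t s hk hs hst =>
      (norm_kerOmega_one_one_le hk hs).trans
        (mul_exp_re_kappa_le (min_le_left _ _) (by norm_num) hst)
  · refine .of_ge dom_two (C := 8) (by norm_num) fun k t s hk ht hst =>
      (norm_kerOmega_two_zero_le hk (ht.trans hst)).trans ?_
    refine mul_le_of_le_one_right (by norm_num) ?_
    exact mul_le_one₀ (min_le_left _ _) (Real.exp_pos _).le (exp_re_kappa_le_one ht)
  · exact .of_ge dom_two (C := 3) (by norm_num) fun k t s hk ht hst =>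
      (norm_kerOmega_two_one_le hk (ht.trans hst)).trans (mul_exp_re_kappa_le_const (by norm_num) ht)
  · exact .of_ge dom_three (C := 1) (by norm_num) fun k t s hk ht hst =>
      (norm_kerOmega_three_zero_le hk ht).trans
        (mul_le_one₀ (abs_div_norm_kappa_le_one hk) (Real.exp_pos _).le (exp_re_kappa_le_one hst))
  · exact .of_ge dom_three (C := 1) (by norm_num) fun k t s hk ht hst =>
      norm_kerOmega_three_one_le hk ht hst

lemma kerExp_psi (n : Part) (m : Fin 2) :
    KerExp n fun k t s => preH n k (t - 1) * kerH n m k (s - 1) := by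
  cases n <;> fin_cases m
  · refine .of_one (C := 106) (by norm_num) fun k t s hk hs hst =>
      (norm_kerPsi_one_zero_le hk hs).trans ?_
    have : min 1 (√|k| ^ 3 * s ^ 2) ≤ 1 := min_le_left _ _
    nlinarith [Real.exp_pos (-(|k| * (t - s)))]
  · refine .of_one (C := 8) (by norm_num) fun k t s hk hs hst =>
      (norm_kerPsi_one_one_le hk hs).trans ?_
    have : min 1 (√|k| * s) ≤ 1 := min_le_left _ _
    nlinarith [Real.exp_pos (-(|k| * (t - s)))]
  · exact .of_ge dom_two (C := 2) (by norm_num) fun k t s hk ht hst =>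
      norm_kerPsi_two_zero_le hk ht (ht.trans hst)
  · exact .of_ge dom_two (C := 3) (by norm_num) fun k t s hk ht hst =>
      norm_kerPsi_two_one_le hk ht (ht.trans hst)
  · exact .of_ge dom_three (C := 1) (by norm_num) fun k t s hk ht hst =>
      norm_kerPsi_three_zero_le hk ht hst
  · exact .of_ge dom_three (C := 1) (by norm_num) fun k t s hk ht hst =>
      norm_kerPsi_three_one_le hk ht hst

lemma kerExp_phi (n : Part) (m : Fin 2) :
    KerExp n fun k t s => preH n k (t - 1) * kerK n m k (s - 1) := by
  cases n
  · obtain ⟨C, hC, H⟩ := kerExp_psi .one m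
    refine ⟨C, hC, fun k t s hk ht hs hst => ?_⟩
    simp only [kerPhi_one hk, norm_mul (I * sg k), norm_I_mul_sg hk, one_mul]
    exact H k t s hk ht hs hst
  all_goals fin_cases m
  · exact .of_ge dom_two (C := 3) (by norm_num) fun k t s hk ht hst =>
      norm_kerPhi_two_zero_le hk ht (ht.trans hst)
  · exact .of_ge dom_two (C := 4) (by norm_num) fun k t s hk ht hst =>
      norm_kerPhi_two_one_le hk ht (ht.trans hst)
  · exact .of_ge dom_three (C := 1) (by norm_num) fun k t s hk ht hst =>
      norm_kerPhi_three_zero_le hk ht hst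
  · exact .of_ge dom_three (C := 1) (by norm_num) fun k t s hk ht hst =>
      norm_kerPhi_three_one_le hk ht hst

lemma kerLin_eta (n : Part) (m : Fin 2) :
    KerLin n fun k t s => preK n k (t - 1) * kerG n m k (s - 1) := by
  cases n <;> fin_cases m
  · refine KerExp.kerLin (.of_one (C := 12) (by norm_num) fun k t s hk hs hst =>
      (norm_kerEta_one_zero_le hk hs).trans ?_)
    have h0 : 0 ≤ min 1 (√|k| * s) := by positivity
    exact mul_exp_re_kappa_le (pow_le_one₀ h0 (min_le_left _ _)) (by norm_num) hst
  · refine ⟨16, by norm_num, fun k t s hk ht hs hst => (norm_kerEta_one_one_le hk hs).trans ?_⟩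
    have := exp_re_kappa_le_one (k := k) hst.2
    have : s * Real.exp (-((kappa k).re * (t - s))) ≤ s * 1 := by gcongr
    linarith
  · exact KerExp.kerLin (.of_ge dom_two (C := 3) (by norm_num) fun k t s hk ht hst =>
      (norm_kerEta_two_zero_le hk (ht.trans hst)).trans (mul_exp_re_kappa_le_const (by norm_num) ht))
  · exact KerExp.kerLin (.of_ge dom_two (C := 8) (by norm_num) fun k t s hk ht hst =>
      (norm_kerEta_two_one_le hk (ht.trans hst)).trans (mul_exp_re_kappa_le_const (by norm_num) ht))
  · exact KerExp.kerLin (.of_ge dom_three (C := 1) (by norm_num) fun k t s hk ht hst =>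
      norm_kerEta_three_zero_le hk ht hst)
  · refine ⟨4, by norm_num, fun k t s hk ht hs hst => (norm_kerEta_three_one_le hk ht hst).trans ?_⟩
    have : t ≤ s := hst
    linarith

/-! ### Membership in the spaces `𝓑_{α,p,q}` -/

lemma weight_pos_of_coe (P : WithTop ℝ) (ht : 1 ≤ t) : 0 < weight α P q k t := by
  have h1 := wT_pos (α := α) (k := k) ht
  have h2 := wB_pos (α := α) (k := k) ht
  have h0 : 0 < t := by linarith
  induction P with
  | top => rw [weight_top_coe ht]; positivity
  | coe p => rw [weight_coe_coe ht]; positivity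

lemma norm_le_of_normB_le {P : WithTop ℝ} {f : ℝ → ℝ → ℂ} {ε : ℝ} (hε : 0 ≤ ε)
    (h : normB α P q f ≤ ENNReal.ofReal ε) (hk : k ≠ 0) (ht : 1 ≤ t) :
    ‖f k t‖ ≤ ε * weight α P q k t := by
  have hw := weight_pos_of_coe (α := α) (k := k) (q := q) P ht
  have h1 : ENNReal.ofReal ‖f k t‖ / ENNReal.ofReal (weight α P q k t) ≤ ENNReal.ofReal ε := by
    refine le_trans ?_ h
    unfold normB
    exact le_iSup₂_of_le t ht (le_iSup₂_of_le k hk le_rfl)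
  rw [ENNReal.div_le_iff (by simpa using hw) ENNReal.ofReal_ne_top, ← ENNReal.ofReal_mul hε,
    ENNReal.ofReal_le_ofReal_iff (by positivity)] at h1
  exact h1

lemma hasBound_of_mem_BSpace {P : WithTop ℝ} {f : ℝ → ℝ → ℂ} (h : f ∈ BSpace α P q) :
    HasBound α P q f :=
  ⟨(normB α P q f).toReal, ENNReal.toReal_nonneg, fun _ _ hk ht =>
    norm_le_of_normB_le ENNReal.toReal_nonneg (ENNReal.ofReal_toReal h.2.ne).ge hk ht⟩

lemma weight_le_two_mul_weight_sub_one {P : WithTop ℝ} (hα : 1 ≤ α) (ht : 1 ≤ t) :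
    weight α P q k t ≤ 2 * weight (α - 1) P q k t := by
  have h1 : wT α k t ≤ 2 * wT (α - 1) k t := br_le_two_mul_br_sub_one hα (by positivity)
  have h2 : wB α k t ≤ 2 * wB (α - 1) k t := br_le_two_mul_br_sub_one hα (by positivity)
  have a1 : t ^ (-q) * wT α k t ≤ t ^ (-q) * (2 * wT (α - 1) k t) := by gcongr
  induction P with
  | top =>
    rw [weight_top_coe ht, weight_top_coe ht]
    linarith
  | coe p =>
    have a2 : t ^ (-p) * wB α k t ≤ t ^ (-p) * (2 * wB (α - 1) k t) := by gcongr
    rw [weight_coe_coe ht, weight_coe_coe ht]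
    linarith

lemma mem_BSpace_sub_one {P : WithTop ℝ} {f : ℝ → ℝ → ℂ} (hα : 1 ≤ α)
    (hc : ContinuousOn (fun z : ℝ × ℝ => f z.1 z.2) dom₀) (h : HasBound α P q f) :
    f ∈ BSpace (α - 1) P q := by
  obtain ⟨C, hC, H⟩ := h
  refine ⟨hc, lt_of_le_of_lt (b := ENNReal.ofReal (C * 2)) ?_ ENNReal.ofReal_lt_top⟩
  unfold normB
  refine iSup₂_le fun t ht => iSup₂_le fun k hk => ?_
  have hw := weight_pos_of_coe (α := α - 1) (k := k) (q := q) P ht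
  rw [ENNReal.div_le_iff (by simpa using hw) ENNReal.ofReal_ne_top,
    ← ENNReal.ofReal_mul (by positivity)]
  refine ENNReal.ofReal_le_ofReal ((H k t hk ht).trans ?_)
  have := weight_le_two_mul_weight_sub_one (k := k) (q := q) (P := P) hα ht
  rw [mul_assoc]
  gcongr

end

section

variable {α k l t s p q p' q' c : ℝ}

/-! ### Integrals of the weights in `k` -/

lemma continuous_br_abs (hα : 0 ≤ α) (hc : 0 ≤ c) : Continuous fun x : ℝ => br α (|x| * c) := by
  unfold br
  refine Continuous.div continuous_const (Continuous.add continuous_const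
    (Continuous.rpow_const (by fun_prop) fun _ => Or.inr hα)) fun x => ?_
  positivity

lemma continuous_wB (hα : 0 ≤ α) (ht : 1 ≤ t) : Continuous fun k => wB α k t :=
  continuous_br_abs hα (by linarith)

lemma continuous_wT (hα : 0 ≤ α) (ht : 1 ≤ t) : Continuous fun k => wT α k t :=
  continuous_br_abs hα (by positivity)

lemma integrable_br_abs (hα : 1 < α) : Integrable fun x : ℝ => br α |x| := by
  have h := (integrable_one_add_norm (E := ℝ) (μ := volume) (r := α) (by simpa using hα)).const_mul
    (2 ^ α)
  refine h.mono' ?_ (Filter.Eventually.of_forall fun x => ?_)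
  · have := continuous_br_abs (c := 1) (by linarith : 0 ≤ α) zero_le_one
    simp only [mul_one] at this
    exact this.aestronglyMeasurable
  · have h0 : 0 ≤ |x| := abs_nonneg x
    have h1 := add_rpow_le_two_rpow (by linarith : 0 ≤ α) zero_le_one h0
    have h2 : 0 < (1 + |x|) ^ α := by positivity
    rw [Real.one_rpow] at h1
    rw [Real.norm_of_nonneg (br_pos h0).le, Real.norm_eq_abs, Real.rpow_neg (by positivity),
      ← div_eq_mul_inv, br, div_le_div_iff₀ (by positivity) h2]
    linarith

/-- The total mass of the bracket. -/
noncomputable def brI (α : ℝ) : ℝ := ∫ x : ℝ, br α |x|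

lemma brI_nonneg (α : ℝ) : 0 ≤ brI α := integral_nonneg fun x => (br_pos (abs_nonneg x)).le

lemma integrable_br_abs_mul (hα : 1 < α) (hc : 0 < c) : Integrable fun x : ℝ => br α (|x| * c) := by
  have h := (integrable_br_abs hα).comp_mul_right' hc.ne'
  simpa [abs_mul, abs_of_pos hc] using h

lemma integral_br_abs_mul (hc : 0 < c) : ∫ x : ℝ, br α (|x| * c) = c⁻¹ * brI α := by
  have h := Measure.integral_comp_mul_right (fun x : ℝ => br α |x|) c
  simpa [abs_mul, abs_of_pos hc, brI] using h

lemma integrable_wB (hα : 1 < α) (ht : 1 ≤ t) : Integrable fun k => wB α k t :=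
  integrable_br_abs_mul hα (by linarith)

lemma integrable_wT (hα : 1 < α) (ht : 1 ≤ t) : Integrable fun k => wT α k t :=
  integrable_br_abs_mul hα (by positivity)

lemma integral_wB (ht : 1 ≤ t) : ∫ k, wB α k t = t⁻¹ * brI α :=
  integral_br_abs_mul (by linarith)

lemma integral_wT (ht : 1 ≤ t) : ∫ k, wT α k t = (t ^ 2)⁻¹ * brI α :=
  integral_br_abs_mul (by positivity)

/-! ### Convolutions of the weights -/

lemma br_abs_sub_mul_br_le (hα : 0 ≤ α) (hc : 0 ≤ c) :
    br α (|k - l| * c) * br α (|l| * c)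
      ≤ 2 ^ α * br α (|k| * c) * (br α (|k - l| * c) + br α (|l| * c)) := by
  refine (br_mul_br_le_add hα (by positivity) (by positivity)).trans ?_
  have h1 : br α (|k - l| * c + |l| * c) ≤ br α (|k| * c) := by
    refine br_anti hα (by positivity) ?_
    rw [← add_mul]
    gcongr
    simpa using abs_add_le (k - l) l
  have h2 : 0 ≤ br α (|k - l| * c) := (br_pos (by positivity)).le
  have h3 : 0 ≤ br α (|l| * c) := (br_pos (by positivity)).le
  gcongr

lemma wB_sub_mul_wB_le (hα : 0 ≤ α) (ht : 1 ≤ t) :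
    wB α (k - l) t * wB α l t ≤ 2 ^ α * wB α k t * (wB α (k - l) t + wB α l t) :=
  br_abs_sub_mul_br_le hα (by linarith)

lemma wT_sub_mul_wT_le (hα : 0 ≤ α) (ht : 1 ≤ t) :
    wT α (k - l) t * wT α l t ≤ 2 ^ α * wT α k t * (wT α (k - l) t + wT α l t) :=
  br_abs_sub_mul_br_le hα (by positivity)

/-- The fast weight is the slow one times a factor that is integrable uniformly in `t`. -/
lemma wT_le_wB_mul (hα : 1 ≤ α) (ht : 1 ≤ t) : wT α k t ≤ wB α k t * (wT α k t + t⁻¹) := by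
  have h0 : 0 < t := by linarith
  have hX : 0 ≤ (|k| * t) ^ α := by positivity
  have hA : t ≤ t ^ α := by
    calc t = t ^ (1 : ℝ) := (Real.rpow_one t).symm
      _ ≤ _ := Real.rpow_le_rpow_of_exponent_le ht hα
  have e : (|k| * t ^ 2) ^ α = (|k| * t) ^ α * t ^ α := by
    rw [← Real.mul_rpow (by positivity) h0.le]; congr 1; ring
  unfold wT wB br
  rw [e]
  set X := (|k| * t) ^ α
  set A := t ^ α
  rw [div_mul_eq_mul_div, one_mul, le_div_iff₀ (by positivity), inv_eq_one_div, div_add_div _ _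
    (by positivity) h0.ne', one_div_mul_eq_div, div_le_div_iff₀ (by positivity) (by positivity)]
  have : X * t ≤ X * A := by gcongr
  have h3 : 0 ≤ (1 + X * A) * (X * A - X * t) := mul_nonneg (by positivity) (by linarith)
  nlinarith

lemma wB_sub_mul_wT_le (hα : 1 ≤ α) (ht : 1 ≤ t) :
    wB α (k - l) t * wT α l t
      ≤ 2 ^ α * wB α k t * (2 * (wT α (k - l) t + wT α l t)
        + t⁻¹ * (wB α (k - l) t + wB α l t)) := by
  have hα0 : 0 ≤ α := by linarith
  have ht0 : 0 < t := by linarith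
  have b1 := wB_pos (α := α) (k := k - l) ht
  have b2 := wB_pos (α := α) (k := l) ht
  have b3 := wB_pos (α := α) (k := k) ht
  have t1 := wT_pos (α := α) (k := k - l) ht
  have t2 := wT_pos (α := α) (k := l) ht
  have c1 := wB_le_one (α := α) (k := k - l) ht
  have c2 := wB_le_one (α := α) (k := l) ht
  calc wB α (k - l) t * wT α l t
      ≤ wB α (k - l) t * (wB α l t * (wT α l t + t⁻¹)) := by gcongr; exact wT_le_wB_mul hα ht
    _ = (wB α (k - l) t * wB α l t) * (wT α l t + t⁻¹) := by ring
    _ ≤ (2 ^ α * wB α k t * (wB α (k - l) t + wB α l t)) * (wT α l t + t⁻¹) := by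
        exact mul_le_mul_of_nonneg_right (wB_sub_mul_wB_le hα0 ht) (by positivity)
    _ = 2 ^ α * wB α k t * ((wB α (k - l) t + wB α l t) * wT α l t
          + t⁻¹ * (wB α (k - l) t + wB α l t)) := by ring
    _ ≤ _ := by
        refine mul_le_mul_of_nonneg_left ?_ (by positivity)
        nlinarith

lemma wT_sub_mul_wB_le (hα : 1 ≤ α) (ht : 1 ≤ t) :
    wT α (k - l) t * wB α l t
      ≤ 2 ^ α * wB α k t * (2 * (wT α (k - l) t + wT α l t)
        + t⁻¹ * (wB α (k - l) t + wB α l t)) := by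
  have := wB_sub_mul_wT_le (k := k) (l := k - l) hα ht
  rw [sub_sub_cancel] at this
  rw [mul_comm (wT α (k - l) t), add_comm (wT α (k - l) t), add_comm (wB α (k - l) t)]
  exact this

lemma continuous_weight (hα : 0 ≤ α) (ht : 1 ≤ t) : Continuous fun k => weight α p q k t := by
  simp only [weight_coe_coe ht]
  have := continuous_wB hα ht
  have := continuous_wT hα ht
  fun_prop

/-- The weight that bounds a convolution. -/
noncomputable def convWeight (α p q p' q' k t : ℝ) : ℝ :=
  (t ^ (-(p + p' + 1)) + t ^ (-(p + q' + 2)) + t ^ (-(q + p' + 2))) * wB α k t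
    + t ^ (-(q + q' + 2)) * wT α k t

lemma integral_weight_mul_weight (hα : 1 < α) (ht : 1 ≤ t) :
    Integrable (fun l => weight α p q (k - l) t * weight α p' q' l t) ∧
    ∫ l, weight α p q (k - l) t * weight α p' q' l t
      ≤ 6 * 2 ^ α * brI α * convWeight α p q p' q' k t := by
  have hα0 : 0 ≤ α := by linarith
  have ht0 : 0 < t := by linarith
  have iS : Integrable fun l => wB α (k - l) t + wB α l t :=
    ((integrable_wB hα ht).comp_sub_left k).add (integrable_wB hα ht)
  have iU : Integrable fun l => wT α (k - l) t + wT α l t :=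
    ((integrable_wT hα ht).comp_sub_left k).add (integrable_wT hα ht)
  have eS : ∫ l, (wB α (k - l) t + wB α l t) = 2 * t⁻¹ * brI α := by
    rw [integral_add ((integrable_wB hα ht).comp_sub_left k) (integrable_wB hα ht),
      integral_sub_left_eq_self (fun l => wB α l t), integral_wB ht]; ring
  have eU : ∫ l, (wT α (k - l) t + wT α l t) = 2 * (t ^ 2)⁻¹ * brI α := by
    rw [integral_add ((integrable_wT hα ht).comp_sub_left k) (integrable_wT hα ht),
      integral_sub_left_eq_self (fun l => wT α l t), integral_wT ht]; ring
  have hb : ∀ l, weight α p q (k - l) t * weight α p' q' l t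
      ≤ (2 ^ α * (t ^ (-(p + p')) + t⁻¹ * (t ^ (-(p + q')) + t ^ (-(q + p')))) * wB α k t)
          * (wB α (k - l) t + wB α l t)
        + (2 ^ α * (2 * (t ^ (-(p + q')) + t ^ (-(q + p'))) * wB α k t
          + t ^ (-(q + q')) * wT α k t)) * (wT α (k - l) t + wT α l t) := by
    intro l
    rw [weight_coe_coe ht, weight_coe_coe ht]
    have e : ∀ a b : ℝ, t ^ (-(a + b)) = t ^ (-a) * t ^ (-b) := fun a b => by
      rw [← Real.rpow_add ht0]; congr 1; ring
    simp only [e]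
    have a1 := mul_le_mul_of_nonneg_left (wB_sub_mul_wB_le (k := k) (l := l) hα0 ht)
      (by positivity : 0 ≤ t ^ (-p) * t ^ (-p'))
    have a2 := mul_le_mul_of_nonneg_left (wB_sub_mul_wT_le (k := k) (l := l) hα.le ht)
      (by positivity : 0 ≤ t ^ (-p) * t ^ (-q'))
    have a3 := mul_le_mul_of_nonneg_left (wT_sub_mul_wB_le (k := k) (l := l) hα.le ht)
      (by positivity : 0 ≤ t ^ (-q) * t ^ (-p'))
    have a4 := mul_le_mul_of_nonneg_left (wT_sub_mul_wT_le (k := k) (l := l) hα0 ht)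
      (by positivity : 0 ≤ t ^ (-q) * t ^ (-q'))
    linear_combination a1 + a2 + a3 + a4
  have i0 := (iS.const_mul
    (2 ^ α * (t ^ (-(p + p')) + t⁻¹ * (t ^ (-(p + q')) + t ^ (-(q + p')))) * wB α k t)).add
    (iU.const_mul (2 ^ α * (2 * (t ^ (-(p + q')) + t ^ (-(q + p'))) * wB α k t
          + t ^ (-(q + q')) * wT α k t)))
  have i1 : Integrable (fun l => weight α p q (k - l) t * weight α p' q' l t) := by
    refine i0.mono' (Continuous.aestronglyMeasurable ?_) (Filter.Eventually.of_forall fun l => ?_)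
    · exact ((continuous_weight hα0 ht).comp (by fun_prop)).mul (continuous_weight hα0 ht)
    · rw [Real.norm_of_nonneg (mul_nonneg (weight_nonneg ht) (weight_nonneg ht))]
      exact hb l
  refine ⟨i1, (integral_mono i1 i0 hb).trans ?_⟩
  simp only [Pi.add_apply]
  rw [integral_add (iS.const_mul _) (iU.const_mul _), integral_const_mul, integral_const_mul, eS, eU]
  have e1 : ∀ a : ℝ, t ^ (-(a + 1)) = t ^ (-a) * t⁻¹ := fun a => by
    rw [← Real.rpow_neg_one, ← Real.rpow_add ht0]; congr 1; ring
  have e2 : ∀ a : ℝ, t ^ (-(a + 2)) = t ^ (-a) * (t ^ 2)⁻¹ := fun a => by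
    rw [← Real.rpow_natCast, ← Real.rpow_neg ht0.le, ← Real.rpow_add ht0]; congr 1; push_cast; ring
  unfold convWeight
  simp only [e1, e2]
  have hB := wB_pos (α := α) (k := k) ht
  have hT := wT_pos (α := α) (k := k) ht
  have hI := brI_nonneg α
  have n1 : 0 ≤ 2 ^ α * t ^ (-(p + p')) * wB α k t * t⁻¹ * brI α := by positivity
  have n2 : 0 ≤ 2 ^ α * t ^ (-(q + q')) * wT α k t * (t ^ 2)⁻¹ * brI α := by positivity
  have e3 : (t ^ 2)⁻¹ = t⁻¹ * t⁻¹ := by rw [pow_two, mul_inv]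
  rw [e3] at n2 ⊢
  linear_combination 4 * n1 + 4 * n2

lemma convWeight_le {P R : ℝ} (ht : 1 ≤ t) (h1 : P ≤ p + p' + 1) (h2 : P ≤ p + q' + 2)
    (h3 : P ≤ q + p' + 2) (h4 : R ≤ q + q' + 2) :
    convWeight α p q p' q' k t ≤ 3 * weight α P R k t := by
  rw [weight_coe_coe ht]
  unfold convWeight
  have := rpow_neg_anti ht h1
  have := rpow_neg_anti ht h2
  have := rpow_neg_anti ht h3
  have a4 := mul_le_mul_of_nonneg_right (rpow_neg_anti ht h4) (wT_pos (α := α) (k := k) ht).le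
  have a5 : (t ^ (-(p + p' + 1)) + t ^ (-(p + q' + 2)) + t ^ (-(q + p' + 2))) * wB α k t
      ≤ (3 * t ^ (-P)) * wB α k t :=
    mul_le_mul_of_nonneg_right (by linarith) (wB_pos ht).le
  have : 0 ≤ t ^ (-R) * wT α k t := mul_nonneg (by positivity) (wT_pos ht).le
  linarith

end

section

variable {α k k' l t s p q p' q' c A A' : ℝ} {f g : ℝ → ℝ → ℂ}

/-! ### Convolutions -/

/-- Joint continuity on the domain `k ≠ 0`, `t ≥ 1`. -/
def ContDom (f : ℝ → ℝ → ℂ) : Prop := ContinuousOn (fun z : ℝ × ℝ => f z.1 z.2) dom₀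

/-- A pointwise bound with explicit constant. -/
def BoundBy (A α p q : ℝ) (f : ℝ → ℝ → ℂ) : Prop :=
  ∀ k t, k ≠ 0 → 1 ≤ t → ‖f k t‖ ≤ A * weight α p q k t

lemma ContDom.continuousOn_left (hf : ContDom f) (ht : 1 ≤ t) :
    ContinuousOn (fun k => f k t) {0}ᶜ :=
  ContinuousOn.comp (f := fun k : ℝ => (k, t)) hf (by fun_prop) fun _ hk => ⟨hk, ht⟩

lemma ContDom.continuousOn_right (hf : ContDom f) (hk : k ≠ 0) :
    ContinuousOn (f k) (Set.Ici 1) :=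
  ContinuousOn.comp (f := fun t : ℝ => (k, t)) hf (by fun_prop) fun _ ht => ⟨hk, ht⟩

lemma ae_ne (a : ℝ) : ∀ᵐ l : ℝ, l ≠ a := by simp [ae_iff]

lemma ContDom.aestronglyMeasurable (hf : ContDom f) (ht : 1 ≤ t) :
    AEStronglyMeasurable fun k => f k t := by
  have h := (hf.continuousOn_left ht).aestronglyMeasurable (μ := volume)
    (measurableSet_singleton 0).compl
  rwa [restrict_compl_singleton] at h

lemma ContDom.aestronglyMeasurable_sub (hf : ContDom f) (ht : 1 ≤ t) (k : ℝ) :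
    AEStronglyMeasurable fun l => f (k - l) t :=
  (hf.aestronglyMeasurable ht).comp_measurePreserving (Measure.measurePreserving_sub_left volume k)

lemma norm_mul_le_weight (hA : 0 ≤ A) (hf : BoundBy A α p q f) (hg : BoundBy A' α p' q' g)
    (ht : 1 ≤ t) (h1 : k - l ≠ 0) (h2 : l ≠ 0) :
    ‖f (k - l) t * g l t‖ ≤ A * A' * (weight α p q (k - l) t * weight α p' q' l t) := by
  rw [norm_mul]
  refine (mul_le_mul (hf _ _ h1 ht) (hg _ _ h2 ht) (norm_nonneg _)
    (mul_nonneg hA (weight_nonneg ht))).trans (le_of_eq (by ring))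

lemma integrable_conv (hα : 1 < α) (hA : 0 ≤ A) (hf : BoundBy A α p q f) (hg : BoundBy A' α p' q' g)
    (cf : ContDom f) (cg : ContDom g) (ht : 1 ≤ t) :
    Integrable fun l => f (k - l) t * g l t := by
  refine ((integral_weight_mul_weight (p := p) (q := q) (p' := p') (q' := q') (k := k) hα ht).1.const_mul
    (A * A')).mono' ((cf.aestronglyMeasurable_sub ht k).mul (cg.aestronglyMeasurable ht)) ?_
  filter_upwards [ae_ne 0, ae_ne k] with l h1 h2
  exact norm_mul_le_weight hA hf hg ht (sub_ne_zero.2 h2.symm) h1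

lemma norm_inv_two_pi_le_one : ‖1 / (2 * (Real.pi : ℂ))‖ ≤ 1 := by
  rw [norm_div, norm_one, norm_mul, Complex.norm_real, Real.norm_of_nonneg Real.pi_pos.le]
  rw [div_le_one (by simp [Real.pi_pos])]
  have := Real.pi_gt_three
  norm_num
  linarith

/-- The constant in the bounds on convolutions. -/
noncomputable def convC (α : ℝ) : ℝ := 6 * 2 ^ α * brI α

lemma convC_nonneg (α : ℝ) : 0 ≤ convC α := by
  have := brI_nonneg α
  unfold convC; positivity

lemma norm_conv_le (hα : 1 < α) (hA : 0 ≤ A) (hA' : 0 ≤ A') (hf : BoundBy A α p q f)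
    (hg : BoundBy A' α p' q' g) (ht : 1 ≤ t) :
    ‖conv f g k t‖ ≤ A * A' * (convC α * convWeight α p q p' q' k t) := by
  have h := integral_weight_mul_weight (p := p) (q := q) (p' := p') (q' := q') (k := k) hα ht
  unfold conv
  rw [norm_mul]
  refine (mul_le_of_le_one_left (norm_nonneg _) norm_inv_two_pi_le_one).trans ?_
  refine (norm_integral_le_of_norm_le (h.1.const_mul (A * A')) ?_).trans ?_
  · filter_upwards [ae_ne 0, ae_ne k] with l h1 h2
    exact norm_mul_le_weight hA hf hg ht (sub_ne_zero.2 h2.symm) h1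
  · rw [integral_const_mul]
    exact mul_le_mul_of_nonneg_left h.2 (by positivity)

lemma conv_comm (f g : ℝ → ℝ → ℂ) (k t : ℝ) : conv f g k t = conv g f k t := by
  unfold conv
  rw [← integral_sub_left_eq_self _ volume k]
  simp only [sub_sub_cancel, mul_comm]

lemma HasBound.conv (hα : 1 < α) (hf : HasBound α p q f) (hg : HasBound α p' q' g) {P R : ℝ}
    (h1 : P ≤ p + p' + 1) (h2 : P ≤ p + q' + 2)
    (h3 : P ≤ q + p' + 2) (h4 : R ≤ q + q' + 2) : HasBound α P R (conv f g) := by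
  obtain ⟨A, hA, H⟩ := hf
  obtain ⟨A', hA', H'⟩ := hg
  have := convC_nonneg α
  refine ⟨A * A' * (convC α * 3), by positivity, fun k t _ ht =>
    (norm_conv_le hα hA hA' H H' ht).trans ?_⟩
  rw [mul_assoc (A * A'), mul_assoc (convC α)]
  gcongr
  exact convWeight_le ht h1 h2 h3 h4

lemma weight_le_two_mul_wB (hα : 0 ≤ α) {r : ℝ} (ht : 1 ≤ t) (hp : r ≤ p) (hq : r ≤ q) :
    weight α p q k t ≤ 2 * (t ^ (-r) * wB α k t) := by
  rw [weight_coe_coe ht]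
  have h1 : t ^ (-p) * wB α k t ≤ t ^ (-r) * wB α k t :=
    mul_le_mul (rpow_neg_anti ht hp) le_rfl (wB_pos ht).le (by positivity)
  have h2 : t ^ (-q) * wT α k t ≤ t ^ (-r) * wB α k t :=
    mul_le_mul (rpow_neg_anti ht hq) (wT_le_wB hα ht) (wT_pos ht).le (by positivity)
  linarith

lemma weight_le_two_mul_wB_one (hα : 0 ≤ α) (ht : 1 ≤ t) (hp : 0 ≤ p) (hq : 0 ≤ q) :
    weight α p q k t ≤ 2 * wB α k 1 := by
  refine (weight_le_two_mul_wB hα ht hp hq).trans ?_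
  have := wB_anti (k := k) hα le_rfl ht
  simpa using this

lemma contDom_conv (hα : 1 < α) (hf : HasBound α p q f) (hg : HasBound α p' q' g) (hp : 0 ≤ p)
    (hq : 0 ≤ q) (hp' : 0 ≤ p') (hq' : 0 ≤ q') (cf : ContDom f) (cg : ContDom g) :
    ContDom (conv f g) := by
  have hα0 : 0 ≤ α := by linarith
  obtain ⟨A, hA, H⟩ := hf
  obtain ⟨A', hA', H'⟩ := hg
  refine ContinuousOn.mul continuousOn_const fun z₀ hz₀ => ?_
  refine tendsto_integral_filter_of_dominated_convergence
    (fun l => (A * 2) * (A' * (2 * wB α l 1))) ?_ ?_ ?_ ?_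
  · filter_upwards [self_mem_nhdsWithin] with z hz
    exact (cf.aestronglyMeasurable_sub hz.2 _).mul (cg.aestronglyMeasurable hz.2)
  · filter_upwards [self_mem_nhdsWithin] with z hz
    filter_upwards [ae_ne 0, ae_ne z.1] with l h1 h2
    rw [norm_mul]
    have a1 := H _ _ (sub_ne_zero.2 h2.symm) hz.2
    have a2 := H' _ _ h1 hz.2
    have b1 := weight_le_two_mul_wB_one (k := z.1 - l) hα0 hz.2 hp hq
    have b2 := weight_le_two_mul_wB_one (k := l) hα0 hz.2 hp' hq'
    have b3 := wB_le_one (α := α) (k := z.1 - l) le_rfl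
    refine mul_le_mul (a1.trans ?_) (a2.trans ?_) (norm_nonneg _) (by positivity)
    · gcongr; linarith
    · gcongr
  · exact (((integrable_wB hα le_rfl).const_mul _).const_mul _).const_mul _
  · filter_upwards [ae_ne 0, ae_ne z₀.1] with l h1 h2
    refine ContinuousWithinAt.mul ?_ ?_
    · have hne : z₀.1 - l ≠ 0 := sub_ne_zero.2 h2.symm
      have c1 : ContinuousWithinAt (fun z : ℝ × ℝ => (z.1 - l, z.2)) dom₀ z₀ := by fun_prop
      refine ContinuousWithinAt.tendsto (f := fun z : ℝ × ℝ => f (z.1 - l) z.2) ?_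
      have c3 := ContinuousWithinAt.comp_inter
        (f := fun z : ℝ × ℝ => (z.1 - l, z.2)) (x := z₀) (s := dom₀) (t := dom₀)
        (cf (z₀.1 - l, z₀.2) ⟨hne, hz₀.2⟩) c1
      refine c3.mono_of_mem_nhdsWithin ?_
      have c2 : ∀ᶠ z : ℝ × ℝ in nhdsWithin z₀ dom₀, z.1 - l ≠ 0 := by
        refine nhdsWithin_le_nhds (ContinuousAt.eventually_ne (by fun_prop) hne)
      filter_upwards [c2, self_mem_nhdsWithin] with z h3 h4 using ⟨h4, h3, h4.2⟩
    · exact ContinuousWithinAt.comp (f := fun z : ℝ × ℝ => (l, z.2)) (cg (l, z₀.2) ⟨h1, hz₀.2⟩)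
        (by fun_prop) fun z hz => ⟨h1, hz.2⟩

/-- Hölder continuity of exponent `1/2` in `k`, up to an error proportional to `η`, at distances up
to `1`. -/
def Hol (α η N : ℝ) (f : ℝ → ℝ → ℂ) : Prop :=
  ∀ k k' t, k ≠ 0 → k' ≠ 0 → |k - k'| ≤ 1 → 1 ≤ t →
    ‖f k t - f k' t‖ ≤ N * ((√|k - k'| + η) * (wB α k t + wB α k' t))

/-- A convolution inherits Hölder continuity from one factor and gains decay in `t` from the other. No
condition is imposed on the wave numbers: they may be `0`. -/
lemma norm_conv_sub_le (hα : 1 < α) {η N P : ℝ} (hη : 0 ≤ η) (hN : 0 ≤ N) (hA : 0 ≤ A)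
    (hg : BoundBy A α p q g) (hf : Hol α η N f) (bf : HasBound α p' q' f) (cf : ContDom f)
    (cg : ContDom g) (hP : P ≤ p + 1) (hP' : P ≤ q + 2) (h : |k - k'| ≤ 1) (ht : 1 ≤ t) :
    ‖conv f g k t - conv f g k' t‖
      ≤ 6 * convC α * A * N * ((√|k - k'| + η) * (t ^ (-P) * (wB α k t + wB α k' t))) := by
  have hα0 : 0 ≤ α := by linarith
  obtain ⟨B, hB, bf⟩ := bf
  have hc := convC_nonneg α
  have i1 := integrable_conv (k := k) hα hB bf hg cf cg ht
  have i2 := integrable_conv (k := k') hα hB bf hg cf cg ht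
  unfold conv
  rw [← mul_sub, ← integral_sub i1 i2, norm_mul]
  refine (mul_le_of_le_one_left (norm_nonneg _) norm_inv_two_pi_le_one).trans ?_
  have h1 := integral_weight_mul_weight (p := 0) (q := 0) (p' := p) (q' := q) (k := k) hα ht
  have h2 := integral_weight_mul_weight (p := 0) (q := 0) (p' := p) (q' := q) (k := k') hα ht
  have e : k - k' = k - k' := rfl
  set D := √|k - k'| + η with hD
  have hD0 : 0 ≤ D := by positivity
  have hw : ∀ k : ℝ, wB α k t ≤ weight α (0 : ℝ) (0 : ℝ) k t := fun k => by
    rw [weight_coe_coe ht]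
    have := wT_pos (α := α) (k := k) ht
    simp only [neg_zero, Real.rpow_zero]; linarith
  refine (norm_integral_le_of_norm_le ((h1.1.add h2.1).const_mul (N * D * A)) ?_).trans ?_
  · filter_upwards [ae_ne 0, ae_ne k, ae_ne k'] with l h3 h4 h5
    rw [← sub_mul, norm_mul]
    have a1 := hf (k - l) (k' - l) t (sub_ne_zero.2 h4.symm) (sub_ne_zero.2 h5.symm)
      (by rwa [sub_sub_sub_cancel_right]) ht
    rw [sub_sub_sub_cancel_right, ← hD] at a1
    have a2 := hg l t h3 ht
    have a3 := weight_nonneg (α := α) (p := p) (q := q) (k := l) ht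
    have a4 : N * (D * (wB α (k - l) t + wB α (k' - l) t)) ≤ N * (D *
        (weight α (0 : ℝ) (0 : ℝ) (k - l) t + weight α (0 : ℝ) (0 : ℝ) (k' - l) t)) := by
      have := hw (k - l)
      have := hw (k' - l)
      gcongr
    refine (mul_le_mul (a1.trans a4) a2 (norm_nonneg _) ?_).trans (le_of_eq ?_)
    · have := weight_nonneg (α := α) (p := 0) (q := 0) (k := k - l) ht
      have := weight_nonneg (α := α) (p := 0) (q := 0) (k := k' - l) ht
      positivity
    · simp only [Pi.add_apply]; ring
  · rw [integral_const_mul]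
    simp only [Pi.add_apply]
    rw [integral_add h1.1 h2.1]
    have b : ∀ k, convWeight α 0 0 p q k t ≤ 6 * (t ^ (-P) * wB α k t) := fun k =>
      (convWeight_le (P := P) (R := P) ht (by linarith) (by linarith) (by linarith)
        (by linarith)).trans (by
          have := weight_le_two_mul_wB (k := k) (r := P) hα0 ht le_rfl le_rfl; linarith)
    have b1 := h1.2.trans (mul_le_mul_of_nonneg_left (b k) hc)
    have b2 := h2.2.trans (mul_le_mul_of_nonneg_left (b k') hc)
    calc _ ≤ (N * D * A) * (convC α * (6 * (t ^ (-P) * wB α k t))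
          + convC α * (6 * (t ^ (-P) * wB α k' t))) := by
          refine mul_le_mul_of_nonneg_left (add_le_add b1 b2) (by positivity)
      _ = _ := by ring

end

section

variable {α k k' l t s p q : ℝ} {F : ℝ × ℝ → ℝ}

/-! ### The Fourier transform of the force -/

/-- A test function vanishes outside a square and is bounded. -/
lemma exists_support_bound (hF : Continuous F) (hc : HasCompactSupport F) :
    ∃ R S, 1 ≤ R ∧ 0 ≤ S ∧ (∀ x t, R < |x| → F (x, t) = 0) ∧ (∀ x t, R < t → F (x, t) = 0) ∧
      ∀ z, |F z| ≤ S := by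
  obtain ⟨R, hR⟩ := hc.isCompact.isBounded.subset_closedBall (0 : ℝ × ℝ)
  obtain ⟨S, hS⟩ := hF.bounded_above_of_compact_support hc
  have h0 : ∀ z : ℝ × ℝ, max R 1 < ‖z‖ → F z = 0 := fun z hz => by
    by_contra h
    have := hR (subset_tsupport F h)
    rw [mem_closedBall_zero_iff] at this
    exact absurd (this.trans (le_max_left R 1)) hz.not_ge
  refine ⟨max R 1, S, le_max_right _ _, (norm_nonneg _).trans (hS 0), fun x t hx => h0 _ ?_,
    fun x t ht => h0 _ ?_, hS⟩
  · exact hx.trans_le (norm_fst_le (x, t))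
  · exact ht.trans_le ((le_abs_self t).trans (norm_snd_le (x, t)))

lemma fourierX_eq {R : ℝ} (h : ∀ x t, R < |x| → F (x, t) = 0) (k t : ℝ) :
    fourierX F k t = ∫ x in Set.Icc (-R) R, cexp (I * k * x) * (F (x, t) : ℂ) := by
  unfold fourierX
  rw [setIntegral_eq_integral_of_forall_compl_eq_zero]
  intro x hx
  rw [h x t (not_le.1 fun h' => hx (abs_le.1 h')), ofReal_zero, mul_zero]

lemma continuous_fourierX (hF : Continuous F) (hc : HasCompactSupport F) :
    Continuous fun z : ℝ × ℝ => fourierX F z.1 z.2 := by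
  obtain ⟨R, S, -, -, h, -, -⟩ := exists_support_bound hF hc
  simp only [fourierX_eq h]
  refine continuous_parametric_integral_of_continuous ?_ isCompact_Icc
  unfold Function.uncurry
  fun_prop

lemma norm_cexp_I_mul (k x : ℝ) : ‖cexp (I * k * x)‖ = 1 := by
  rw [mul_assoc, mul_comm, ← ofReal_mul]; exact norm_exp_ofReal_mul_I _

lemma exists_norm_fourierX_le (hF : Continuous F) (hc : HasCompactSupport F) :
    ∃ C, 0 ≤ C ∧ ∀ k t, ‖fourierX F k t‖ ≤ C := by
  obtain ⟨R, S, hR, hS, h, -, hb⟩ := exists_support_bound hF hc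
  refine ⟨S * volume.real (Set.Icc (-R) R), by positivity, fun k t => ?_⟩
  rw [fourierX_eq h]
  refine norm_setIntegral_le_of_norm_le_const (by simp) fun x _ => ?_
  rw [norm_mul, norm_cexp_I_mul, one_mul, Complex.norm_real]
  exact hb _

lemma exists_norm_fourierX_sub_le (hF : Continuous F) (hc : HasCompactSupport F) :
    ∃ C, 0 ≤ C ∧ ∀ k k' t, ‖fourierX F k t - fourierX F k' t‖ ≤ C * |k - k'| := by
  obtain ⟨R, S, hR, hS, h, -, hb⟩ := exists_support_bound hF hc
  refine ⟨R * S * volume.real (Set.Icc (-R) R), by positivity, fun k k' t => ?_⟩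
  rw [fourierX_eq h, fourierX_eq h, ← integral_sub]
  · refine (norm_setIntegral_le_of_norm_le_const (C := |k - k'| * R * S) (by simp) fun x hx => ?_).trans
      (le_of_eq (by ring))
    rw [← sub_mul, norm_mul, Complex.norm_real]
    refine mul_le_mul ?_ (hb _) (norm_nonneg _) (by positivity)
    have e : cexp (I * k * x) - cexp (I * k' * x)
        = cexp (I * k' * x) * (cexp (I * (((k - k') * x : ℝ) : ℂ)) - 1) := by
      rw [mul_sub, ← Complex.exp_add, mul_one]; congr 2; push_cast; ring
    rw [e, norm_mul, norm_cexp_I_mul, one_mul]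
    refine (Real.norm_exp_I_mul_ofReal_sub_one_le).trans ?_
    rw [norm_mul, Real.norm_eq_abs, Real.norm_eq_abs]
    gcongr
    exact abs_le.2 hx
  all_goals exact (Continuous.continuousOn (by fun_prop)).integrableOn_Icc

/-- The partial derivative in the first variable. -/
noncomputable def partialX (F : ℝ × ℝ → ℝ) (z : ℝ × ℝ) : ℝ := fderiv ℝ F z (1, 0)

lemma contDiff_partialX (hF : ContDiff ℝ ((⊤ : ℕ∞) : WithTop ℕ∞) F) :
    ContDiff ℝ ((⊤ : ℕ∞) : WithTop ℕ∞) (partialX F) := by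
  have := hF.fderiv_right (m := ((⊤ : ℕ∞) : WithTop ℕ∞)) (by simp)
  exact this.clm_apply contDiff_const

lemma hasCompactSupport_partialX (hc : HasCompactSupport F) : HasCompactSupport (partialX F) :=
  hc.fderiv_apply ℝ _

lemma fourierX_partialX (hF : ContDiff ℝ ((⊤ : ℕ∞) : WithTop ℕ∞) F) (hc : HasCompactSupport F)
    (k t : ℝ) : fourierX (partialX F) k t = -(I * k * fourierX F k t) := by
  have hd : ∀ x, HasDerivAt (fun x : ℝ => ((F (x, t) : ℝ) : ℂ)) (partialX F (x, t) : ℝ) x := by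
    intro x
    have h1 : HasFDerivAt F (fderiv ℝ F (x, t)) (x, t) :=
      (hF.differentiable (by simp)).differentiableAt.hasFDerivAt
    have h2 : HasDerivAt (fun x : ℝ => (x, t)) (1, 0) x :=
      (hasDerivAt_id' x).prodMk (hasDerivAt_const x t)
    exact (h1.comp_hasDerivAt x h2).ofReal_comp
  have he : ∀ x : ℝ, HasDerivAt (fun x : ℝ => cexp (I * k * x)) (I * k * cexp (I * k * x)) x := by
    intro x
    have : HasDerivAt (fun x : ℝ => I * k * (x : ℂ)) (I * k) x := by
      simpa using (Complex.ofRealCLM.hasDerivAt (x := x)).const_mul (I * k)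
    simpa [mul_comm] using this.cexp
  have hcs : ∀ G : ℝ × ℝ → ℝ, HasCompactSupport G →
      HasCompactSupport fun x : ℝ => ((G (x, t) : ℝ) : ℂ) := fun G hG => by
    refine HasCompactSupport.comp_left (g := fun y : ℝ => (y : ℂ)) ?_ ofReal_zero
    exact hG.comp_isClosedEmbedding (g := fun x : ℝ => (x, t))
      (Topology.IsClosedEmbedding.of_continuous_injective_isClosedMap (by fun_prop)
        (fun a b h => (Prod.ext_iff.1 h).1) (isClosedMap_prodMk_right t))
  have c0 := hF.continuous
  have c1 := (contDiff_partialX hF).continuous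
  have h := integral_mul_deriv_eq_deriv_mul_of_integrable (fun x _ => he x) (fun x _ => hd x) ?_ ?_ ?_
  · unfold fourierX
    rw [h, ← integral_const_mul]
    congr 1
    simp only [mul_assoc]
  · exact Continuous.integrable_of_hasCompactSupport (by fun_prop)
      (hcs _ (hasCompactSupport_partialX hc)).mul_left
  · exact Continuous.integrable_of_hasCompactSupport (by fun_prop) (hcs _ hc).mul_left
  · exact Continuous.integrable_of_hasCompactSupport (by fun_prop) (hcs _ hc).mul_left

lemma exists_pow_mul_norm_fourierX_le (n : ℕ) : ∀ {F : ℝ × ℝ → ℝ},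
    ContDiff ℝ ((⊤ : ℕ∞) : WithTop ℕ∞) F → HasCompactSupport F →
    ∃ C, 0 ≤ C ∧ ∀ k t, |k| ^ n * ‖fourierX F k t‖ ≤ C := by
  induction n with
  | zero => intro F hF hc; simpa using exists_norm_fourierX_le hF.continuous hc
  | succ n ih =>
    intro F hF hc
    obtain ⟨C, hC, H⟩ := ih (contDiff_partialX hF) (hasCompactSupport_partialX hc)
    refine ⟨C, hC, fun k t => le_trans (le_of_eq ?_) (H k t)⟩
    rw [fourierX_partialX hF hc, norm_neg, norm_mul, norm_mul, norm_I, one_mul, Complex.norm_real,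
      Real.norm_eq_abs, pow_succ, mul_assoc]

/-- The Fourier transform of a test function decays faster than all weights. -/
lemma exists_norm_fourierX_le_wB (hα : 0 ≤ α) (M : ℝ)
    (hF : ContDiff ℝ ((⊤ : ℕ∞) : WithTop ℕ∞) F) (hc : HasCompactSupport F) :
    ∃ C, 0 ≤ C ∧ ∀ k t, 1 ≤ t → ‖fourierX F k t‖ ≤ C * (t ^ (-M) * wB α k t) := by
  obtain ⟨n, hn⟩ := exists_nat_ge α
  obtain ⟨R, S, hR, -, -, h, -⟩ := exists_support_bound hF.continuous hc
  obtain ⟨C0, hC0, H0⟩ := exists_pow_mul_norm_fourierX_le 0 hF hc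
  obtain ⟨C1, hC1, H1⟩ := exists_pow_mul_norm_fourierX_le n hF hc
  refine ⟨(2 * C0 + C1) * (R ^ |M| * R ^ α), by positivity, fun k t ht => ?_⟩
  have ht0 : 0 < t := by linarith
  have hB := wB_pos (α := α) (k := k) ht
  rcases lt_or_ge R t with hRt | hRt
  · have e : fourierX F k t = 0 := by simp [fourierX, h _ t hRt]
    rw [e, norm_zero]; positivity
  have hk := abs_nonneg k
  have hkα : 0 ≤ |k| ^ α := by positivity
  have a1 : ‖fourierX F k t‖ ≤ (2 * C0 + C1) * br α |k| := by
    have h0 := H0 k t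
    have h1 := H1 k t
    rw [pow_zero, one_mul] at h0
    have h2 : |k| ^ α * ‖fourierX F k t‖ ≤ C0 + C1 := by
      rcases le_total |k| 1 with hk1 | hk1
      · have := Real.rpow_le_one hk hk1 hα
        nlinarith [norm_nonneg (fourierX F k t)]
      · have : |k| ^ α ≤ |k| ^ n := by
          rw [← Real.rpow_natCast]; exact Real.rpow_le_rpow_of_exponent_le hk1 hn
        nlinarith [norm_nonneg (fourierX F k t)]
    rw [br, mul_one_div, le_div_iff₀ (by positivity)]
    linarith
  have a2 : br α |k| ≤ t ^ α * wB α k t := by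
    refine (br_mul_le hα ht hk).trans (le_of_eq ?_)
    rw [mul_comm t]; rfl
  have a3 : 1 ≤ R ^ |M| * t ^ (-M) := by
    have : R ^ |M| * t ^ (-M) ≥ t ^ |M| * t ^ (-M) := by gcongr
    refine le_trans ?_ this
    rw [← Real.rpow_add ht0]
    exact Real.one_le_rpow ht (by linarith [le_abs_self M])
  have a4 : t ^ α ≤ R ^ α := by gcongr
  calc _ ≤ (2 * C0 + C1) * (t ^ α * wB α k t) := a1.trans (by gcongr)
    _ ≤ (2 * C0 + C1) * ((R ^ |M| * t ^ (-M)) * (R ^ α * wB α k t)) := by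
        refine mul_le_mul_of_nonneg_left ?_ (by positivity)
        calc t ^ α * wB α k t ≤ R ^ α * wB α k t := by gcongr
          _ ≤ _ := le_mul_of_one_le_left (by positivity) a3
    _ = _ := by ring

lemma br_two_mul_le_sq {x : ℝ} (hx : 0 ≤ x) : br (2 * α) x ≤ 2 * br α x ^ 2 := by
  have h : x ^ (2 * α) = (x ^ α) ^ 2 := by
    rw [mul_comm, Real.rpow_mul hx]; norm_cast
  have h0 : 0 ≤ x ^ α := Real.rpow_nonneg hx _
  unfold br
  rw [h, div_pow, one_pow, mul_one_div, div_le_div_iff₀ (by positivity) (by positivity)]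
  nlinarith [sq_nonneg (x ^ α - 1)]

/-- Interpolation between the Lipschitz bound and the decay of twice the order. -/
lemma exists_norm_fourierX_sub_le_wB (hα : 0 ≤ α) (M : ℝ)
    (hF : ContDiff ℝ ((⊤ : ℕ∞) : WithTop ℕ∞) F) (hc : HasCompactSupport F) :
    ∃ C, 0 ≤ C ∧ ∀ k k' t, 1 ≤ t → ‖fourierX F k t - fourierX F k' t‖
      ≤ C * (√|k - k'| * (t ^ (-M) * (wB α k t + wB α k' t))) := by
  obtain ⟨L, hL, H⟩ := exists_norm_fourierX_sub_le hF.continuous hc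
  obtain ⟨C, hC, H'⟩ := exists_norm_fourierX_le_wB (α := 2 * α) (by positivity) (2 * M) hF hc
  refine ⟨√(L * (2 * C)), Real.sqrt_nonneg _, fun k k' t ht => ?_⟩
  have ht0 : 0 < t := by linarith
  have b1 := wB_pos (α := α) (k := k) ht
  have b2 := wB_pos (α := α) (k := k') ht
  refine abs_le_of_sq_le_sq' ?_ (by positivity) |>.2
  have e : t ^ (-(2 * M)) = (t ^ (-M)) ^ 2 := by
    rw [show -(2 * M) = (-M) * 2 by ring, Real.rpow_mul ht0.le]; norm_cast
  have d : ∀ k, ‖fourierX F k t‖ ≤ 2 * C * (t ^ (-M) * wB α k t) ^ 2 := fun k => by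
    refine (H' k t ht).trans ?_
    rw [e, mul_pow]
    have := br_two_mul_le_sq (α := α) (x := |k| * t) (by positivity)
    calc C * ((t ^ (-M)) ^ 2 * wB (2 * α) k t) ≤ C * ((t ^ (-M)) ^ 2 * (2 * wB α k t ^ 2)) := by
          gcongr; exact this
      _ = _ := by ring
  have d1 : ‖fourierX F k t - fourierX F k' t‖
      ≤ 2 * C * (t ^ (-M) * (wB α k t + wB α k' t)) ^ 2 := by
    refine (norm_sub_le _ _).trans ((add_le_add (d k) (d k')).trans ?_)
    rw [← mul_add]
    gcongr
    have h1 : 0 ≤ t ^ (-M) * wB α k t := by positivity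
    have h2 : 0 ≤ t ^ (-M) * wB α k' t := by positivity
    nlinarith [mul_nonneg h1 h2]
  have d2 := H k k' t
  rw [mul_pow, mul_pow, Real.sq_sqrt (by positivity), Real.sq_sqrt (abs_nonneg _), pow_two]
  refine (mul_le_mul d2 d1 (norm_nonneg _) (by positivity)).trans (le_of_eq (by ring))

end

section

variable {α k k' l t s p q p' q' c A A' : ℝ} {f g : ℝ → ℝ → ℂ}

/-! ### Hölder continuity of the components in `k` -/

lemma wB_anti_abs (hα : 0 ≤ α) (ht : 1 ≤ t) (h : |k| ≤ |k'|) : wB α k' t ≤ wB α k t :=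
  br_anti hα (by positivity) (by gcongr)

lemma integrableOn_comp {n : Part} {K : ℝ → ℝ → ℝ → ℂ} (hK : KerCont K)
    (hKb : KerLin n K) (hf : ContDom f) {C' : ℝ}
    (hfb : ∀ k t, k ≠ 0 → 1 ≤ t → ‖f k t‖ ≤ C' * t ^ (-3 : ℝ)) (hk : k ≠ 0) (ht : 1 ≤ t) :
    IntegrableOn (fun s => K k t s * f k s) (n.dom t) := by
  obtain ⟨C, hC, H⟩ := hKb
  have hsub : n.dom t ⊆ Set.Ici 1 := fun s hs => n.one_le_of_mem_dom ht hs
  have hm : AEStronglyMeasurable (fun s => K k t s * f k s) (volume.restrict (n.dom t)) := by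
    refine AEStronglyMeasurable.mono_set hsub ?_
    refine ContinuousOn.aestronglyMeasurable ?_ measurableSet_Ici
    refine ContinuousOn.mul (fun s _ => ContinuousAt.continuousWithinAt ?_)
      (hf.continuousOn_right hk)
    exact ContinuousAt.comp (f := fun s : ℝ => (k, t, s)) (hK (k, t, s) hk) (by fun_prop)
  have hi : IntegrableOn (fun s : ℝ => C * C' * s ^ (-2 : ℝ)) (n.dom t) := by
    refine IntegrableOn.mono_set ?_ hsub
    refine (integrableOn_Ici_iff_integrableOn_Ioi (μ := volume)).2 ?_
    exact (integrableOn_Ioi_rpow_of_lt (by norm_num) one_pos).const_mul _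
  refine hi.mono' hm ?_
  filter_upwards [ae_restrict_mem (n.measurableSet_dom t)] with s hs
  have hs1 : 1 ≤ s := hsub hs
  have hs0 : 0 < s := by linarith
  rw [norm_mul]
  calc _ ≤ (C * s) * (C' * s ^ (-3 : ℝ)) :=
        mul_le_mul (H _ _ _ hk ht hs1 hs) (hfb _ _ hk hs1) (norm_nonneg _) (by positivity)
    _ = C * C' * (s ^ (1 : ℝ) * s ^ (-3 : ℝ)) := by rw [Real.rpow_one]; ring
    _ = _ := by rw [← Real.rpow_add hs0]; norm_num

/-- The transfer of Hölder continuity from the source to a component. The source needs a difference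
bound that is integrable in `s`, and the decay `s^{-3}` compensates the growth of the difference of
the kernels. -/
lemma exists_comp_sub_le_of_abs_le (hα : 0 ≤ α) {n : Part} {K : ℝ → ℝ → ℝ → ℂ} (hK : KerCont K)
    (hKe : KerExp n K) (hKh : KerHolder n K) :
    ∃ C, 0 ≤ C ∧ ∀ (f : ℝ → ℝ → ℂ) (B D k k' t : ℝ), 0 ≤ B → 0 ≤ D → ContDom f →
      (∀ k t, k ≠ 0 → 1 ≤ t → ‖f k t‖ ≤ B * (t ^ (-3 : ℝ) * wB α k t)) →
      k ≠ 0 → k' ≠ 0 → |k| ≤ |k'| → |k - k'| ≤ 1 → 1 ≤ t →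
      (∀ s, 1 ≤ s → ‖f k s - f k' s‖ ≤ D * (s ^ (-3 / 2 : ℝ) * (wB α k s + wB α k' s))) →
      ‖comp n K f k t - comp n K f k' t‖ ≤ C * ((D + B * √|k - k'|) * wB α k t) := by
  obtain ⟨CE, hCE, HE⟩ := hKe
  obtain ⟨CH, hCH, HH⟩ := hKh
  obtain ⟨CP, hCP, HP⟩ := exists_exp_mul_br_le (α := α) (by norm_num : (0:ℝ) < 1 / 2) hα
  refine ⟨2 * ((CH + 2 * CE) * CP), by positivity,
    fun f B D k k' t hB hD cf hf hk hk' hkk h ht hd => ?_⟩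
  have hf' : ∀ k t, k ≠ 0 → 1 ≤ t → ‖f k t‖ ≤ B * t ^ (-3 : ℝ) := fun k t hk ht => by
    refine (hf k t hk ht).trans ?_
    have : 0 < t := by linarith
    gcongr
    exact mul_le_of_le_one_right (by positivity) (wB_le_one ht)
  have hKl : KerLin n K := KerExp.kerLin ⟨CE, hCE, HE⟩
  have i1 := integrableOn_comp hK hKl cf hf' hk ht
  have i2 := integrableOn_comp hK hKl cf hf' hk' ht
  have hsub : n.dom t ⊆ Set.Ici 1 := fun s hs => n.one_le_of_mem_dom ht hs
  have i3 : IntegrableOn (fun s : ℝ => s ^ (-3 / 2 : ℝ)) (Set.Ici 1) :=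
    (integrableOn_Ici_iff_integrableOn_Ioi (μ := volume)).2
      (integrableOn_Ioi_rpow_of_lt (by norm_num) one_pos)
  have e3 : ∫ s in n.dom t, s ^ (-3 / 2 : ℝ) ≤ 2 := by
    calc ∫ s in n.dom t, s ^ (-3 / 2 : ℝ) ≤ ∫ s in Set.Ici (1 : ℝ), s ^ (-3 / 2 : ℝ) := by
          refine setIntegral_mono_set i3 ?_ hsub.eventuallyLE
          filter_upwards [ae_restrict_mem measurableSet_Ici] with s hs
          exact Real.rpow_nonneg (zero_le_one.trans hs) _
      _ = 2 := by
          rw [integral_Ici_eq_integral_Ioi, integral_Ioi_rpow_of_lt (by norm_num) one_pos]; norm_num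
  set Δ := √|k - k'|
  have hΔ : 0 ≤ Δ := Real.sqrt_nonneg _
  have hBt := wB_pos (α := α) (k := k) ht
  set M := (CH + 2 * CE) * CP * ((D + B * Δ) * wB α k t) with hM
  have hM0 : 0 ≤ M := by positivity
  unfold comp
  rw [← integral_sub i1 i2]
  refine (norm_integral_le_of_norm_le ((i3.mono_set hsub).const_mul M) ?_).trans ?_
  · filter_upwards [ae_restrict_mem (n.measurableSet_dom t)] with s hs
    have hs1 : 1 ≤ s := hsub hs
    have hs0 : 0 < s := by linarith
    have hBs := wB_pos (α := α) (k := k) hs1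
    have hBs' := wB_anti_abs hα hs1 hkk
    have a1 := HH k k' t s hk hk' hkk h ht hs1 hs
    have a2 := HE k' t s hk' ht hs1 hs
    have a3 := hf k s hk hs1
    have a4 := hd s hs1
    have a5 : Real.exp (-(1 / 2 * (|k'| * max (t - s) 0)))
        ≤ Real.exp (-(1 / 2 * (|k| * max (t - s) 0))) := by
      apply Real.exp_le_exp.2
      have : |k| * max (t - s) 0 ≤ |k'| * max (t - s) 0 := by gcongr
      linarith
    have a6 : Real.exp (-(1 / 2 * (|k| * max (t - s) 0))) * wB α k s ≤ CP * wB α k t :=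
      HP |k| s t (abs_nonneg _) hs1 ht
    set X := Real.exp (-(1 / 2 * (|k| * max (t - s) 0)))
    have hX : 0 < X := Real.exp_pos _
    have r1 : s * s ^ (-3 : ℝ) ≤ s ^ (-3 / 2 : ℝ) := by
      rw [mul_comm, ← Real.rpow_add_one hs0.ne']
      exact Real.rpow_le_rpow_of_exponent_le hs1 (by norm_num)
    have e : K k t s * f k s - K k' t s * f k' s
        = (K k t s - K k' t s) * f k s + K k' t s * (f k s - f k' s) := by ring
    rw [e]
    refine (norm_add_le _ _).trans ?_
    rw [norm_mul, norm_mul]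
    have b1 : ‖K k t s - K k' t s‖ * ‖f k s‖
        ≤ CH * (B * Δ) * (s ^ (-3 / 2 : ℝ) * (CP * wB α k t)) := by
      calc _ ≤ (CH * (Δ * s * X)) * (B * (s ^ (-3 : ℝ) * wB α k s)) := by gcongr
        _ = CH * (B * Δ) * ((s * s ^ (-3 : ℝ)) * (X * wB α k s)) := by ring
        _ ≤ _ := by gcongr
    have b2 : ‖K k' t s‖ * ‖f k s - f k' s‖
        ≤ 2 * CE * D * (s ^ (-3 / 2 : ℝ) * (CP * wB α k t)) := by
      calc _ ≤ (CE * X) * (D * (s ^ (-3 / 2 : ℝ) * (wB α k s + wB α k s))) := by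
            refine mul_le_mul (a2.trans (by gcongr)) (a4.trans (by gcongr)) (norm_nonneg _)
              (by positivity)
        _ = 2 * CE * D * (s ^ (-3 / 2 : ℝ) * (X * wB α k s)) := by ring
        _ ≤ _ := by gcongr
    have b3 : 0 ≤ CH * D * (s ^ (-3 / 2 : ℝ) * (CP * wB α k t)) := by positivity
    have b4 : 0 ≤ 2 * CE * (B * Δ) * (s ^ (-3 / 2 : ℝ) * (CP * wB α k t)) := by positivity
    rw [hM]
    linear_combination b1 + b2 + b3 + b4
  · rw [integral_const_mul]
    calc M * ∫ s in n.dom t, s ^ (-3 / 2 : ℝ) ≤ M * 2 := by gcongr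
      _ = _ := by rw [hM]; ring

lemma exists_comp_sub_le (hα : 0 ≤ α) {n : Part} {K : ℝ → ℝ → ℝ → ℂ} (hK : KerCont K)
    (hKe : KerExp n K) (hKh : KerHolder n K) :
    ∃ C, 0 ≤ C ∧ ∀ (f : ℝ → ℝ → ℂ) (B D k k' t : ℝ), 0 ≤ B → 0 ≤ D → ContDom f →
      (∀ k t, k ≠ 0 → 1 ≤ t → ‖f k t‖ ≤ B * (t ^ (-3 : ℝ) * wB α k t)) →
      k ≠ 0 → k' ≠ 0 → |k - k'| ≤ 1 → 1 ≤ t →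
      (∀ s, 1 ≤ s → ‖f k s - f k' s‖ ≤ D * (s ^ (-3 / 2 : ℝ) * (wB α k s + wB α k' s))) →
      ‖comp n K f k t - comp n K f k' t‖
        ≤ C * ((D + B * √|k - k'|) * (wB α k t + wB α k' t)) := by
  obtain ⟨C, hC, H⟩ := exists_comp_sub_le_of_abs_le hα hK hKe hKh
  refine ⟨C, hC, fun f B D k k' t hB hD cf hf hk hk' h ht hd => ?_⟩
  have b1 := wB_pos (α := α) (k := k) ht
  have b2 := wB_pos (α := α) (k := k') ht
  rcases le_total |k| |k'| with hkk | hkk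
  · refine (H f B D k k' t hB hD cf hf hk hk' hkk h ht hd).trans ?_
    gcongr; linarith
  · rw [norm_sub_rev, abs_sub_comm]
    refine (H f B D k' k t hB hD cf hf hk' hk hkk (by rwa [abs_sub_comm]) ht fun s hs => ?_).trans ?_
    · rw [norm_sub_rev, add_comm (wB α k' s)]; exact hd s hs
    · gcongr; linarith

/-- A pair of sources of size `O(s^{-3})` whose differences in `k` decay integrably in `s` produces,
through the sum `total c` of all components, a function with the same differences in `k`. -/
def TransfersHol (α : ℝ) (c : Part → Fin 2 → (Fin 2 → ℝ → ℝ → ℂ) → ℝ → ℝ → ℂ) : Prop :=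
  ∃ C, 0 ≤ C ∧ ∀ (Q : Fin 2 → ℝ → ℝ → ℂ) (B D k k' t : ℝ), 0 ≤ B → 0 ≤ D →
    (∀ m, ContDom (Q m)) →
    (∀ m k t, k ≠ 0 → 1 ≤ t → ‖Q m k t‖ ≤ B * (t ^ (-3 : ℝ) * wB α k t)) →
    k ≠ 0 → k' ≠ 0 → |k - k'| ≤ 1 → 1 ≤ t →
    (∀ m s, 1 ≤ s → ‖Q m k s - Q m k' s‖ ≤ D * (s ^ (-3 / 2 : ℝ) * (wB α k s + wB α k' s))) →
    ‖total c Q k t - total c Q k' t‖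
      ≤ C * ((D + B * √|k - k'|) * (wB α k t + wB α k' t))

/-- The transfer of Hölder continuity from the two sources to the sum of all components. -/
lemma transfersHol_total (hα : 0 ≤ α) {c : Part → Fin 2 → (Fin 2 → ℝ → ℝ → ℂ) → ℝ → ℝ → ℂ}
    {K : Part → Fin 2 → ℝ → ℝ → ℝ → ℂ} (hc : ∀ n m Q, c n m Q = comp n (K n m) (Q m))
    (hK : ∀ n m, KerCont (K n m)) (hKe : ∀ n m, KerExp n (K n m))
    (hKh : ∀ n m, KerHolder n (K n m)) :
    TransfersHol α c := by
  choose C hC H using fun n m => exists_comp_sub_le hα (hK n m) (hKe n m) (hKh n m)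
  refine ⟨∑ m, (C .one m + C .two m + C .three m), Finset.sum_nonneg fun m _ => ?_,
    fun Q B D k k' t hB hD cQ hQ hk hk' h ht hd => ?_⟩
  · have := hC .one m
    have := hC .two m
    have := hC .three m
    positivity
  · unfold total
    rw [← Finset.sum_sub_distrib, Finset.sum_mul]
    refine norm_sum_le_of_le _ fun m _ => ?_
    have h1 := H .one m (Q m) B D k k' t hB hD (cQ m) (hQ m) hk hk' h ht (hd m)
    have h2 := H .two m (Q m) B D k k' t hB hD (cQ m) (hQ m) hk hk' h ht (hd m)
    have h3 := H .three m (Q m) B D k k' t hB hD (cQ m) (hQ m) hk hk' h ht (hd m)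
    rw [hc, hc, hc]
    have e : ∀ a b c a' b' c' : ℂ, a + b + c - (a' + b' + c') = a - a' + (b - b') + (c - c') :=
      fun _ _ _ _ _ _ => by ring
    rw [e]
    refine norm_add₃_le.trans ?_
    linarith

lemma transfersHol_omega (hα : 0 ≤ α) : TransfersHol α omegaC := by
  refine transfersHol_total hα omegaC_eq (fun n m => kerCont_omega n m)
    (fun n m => kerExp_omega n m) fun n m => ?_
  cases n <;> fin_cases m
  exacts [kerHolder_omega_one_zero, kerHolder_omega_one_one, kerHolder_omega_two_zero,
    kerHolder_omega_two_one, kerHolder_omega_three_zero, kerHolder_omega_three_one]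

lemma transfersHol_psi (hα : 0 ≤ α) : TransfersHol α psiC := by
  refine transfersHol_total hα psiC_eq (fun n m => kerCont_psi n m)
    (fun n m => kerExp_psi n m) fun n m => ?_
  cases n <;> fin_cases m
  exacts [kerHolder_psi_one_zero, kerHolder_psi_one_one, kerHolder_psi_two_zero,
    kerHolder_psi_two_one, kerHolder_psi_three_zero, kerHolder_psi_three_one]

lemma transfersHol_phi (hα : 0 ≤ α) : TransfersHol α phiC := by
  refine transfersHol_total hα phiC_eq (fun n m => kerCont_phi n m)
    (fun n m => kerExp_phi n m) fun n m => ?_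
  cases n <;> fin_cases m
  exacts [kerHolder_phi_one_zero, kerHolder_phi_one_one, kerHolder_phi_two_zero,
    kerHolder_phi_two_one, kerHolder_phi_three_zero, kerHolder_phi_three_one]

end

section

variable {α k k' l t s p q p' q' c A A' : ℝ} {f g : ℝ → ℝ → ℂ} {F₁ F₂ : ℝ × ℝ → ℝ}
  {ω u v : ℝ → ℝ → ℂ}

/-! ### A priori bounds on the nonlinear terms -/

lemma hasBound_fourierX {F : ℝ × ℝ → ℝ} (hα : 0 ≤ α) (hF : ContDiff ℝ ((⊤ : ℕ∞) : WithTop ℕ∞) F)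
    (hc : HasCompactSupport F) (p q : ℝ) : HasBound α p q (fourierX F) := by
  obtain ⟨C, hC, H⟩ := exists_norm_fourierX_le_wB hα p hF hc
  refine ⟨C, hC, fun k t _ ht => (H k t ht).trans ?_⟩
  rw [weight_coe_coe ht]
  have := wT_pos (α := α) (k := k) ht
  gcongr
  have : 0 ≤ t ^ (-q) * wT α k t := by positivity
  linarith

lemma contDom_fourierX {F : ℝ × ℝ → ℝ} (hF : ContDiff ℝ ((⊤ : ℕ∞) : WithTop ℕ∞) F)
    (hc : HasCompactSupport F) : ContDom (fourierX F) :=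
  (continuous_fourierX hF.continuous hc).continuousOn

lemma contDom_Q (hα : 1 < α) (hF : IsForce F₁ F₂) (h : IsSolution α F₁ F₂ ω u v) (m : Fin 2) :
    ContDom (Q F₁ F₂ ω u v m) := by
  have bω := hasBound_of_mem_BSpace h.mem_ω
  have bu := hasBound_of_mem_BSpace h.mem_u
  have bv := hasBound_of_mem_BSpace h.mem_v
  fin_cases m
  · exact ContinuousOn.add (contDom_conv hα bu bω (by norm_num) (by norm_num) (by norm_num)
      (by norm_num) h.mem_u.1 h.mem_ω.1) (contDom_fourierX hF.smooth₂ hF.compact₂)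
  · exact ContinuousOn.sub (contDom_conv hα bv bω (by norm_num) (by norm_num) (by norm_num)
      (by norm_num) h.mem_v.1 h.mem_ω.1) (contDom_fourierX hF.smooth₁ hF.compact₁)

lemma hasBound_Q_zero (hα : 1 < α) (hF : IsForce F₁ F₂) (h : IsSolution α F₁ F₂ ω u v) :
    HasBound α (7 / 2 : ℝ) (3 : ℝ) (Q F₁ F₂ ω u v 0) :=
  (HasBound.conv hα (hasBound_of_mem_BSpace h.mem_u) (hasBound_of_mem_BSpace h.mem_ω)
    (by norm_num) (by norm_num) (by norm_num) (by norm_num)).add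
    (hasBound_fourierX (by linarith) hF.smooth₂ hF.compact₂ _ _)

lemma hasBound_Q_one (hα : 1 < α) (hF : IsForce F₁ F₂) (h : IsSolution α F₁ F₂ ω u v) :
    HasBound α (7 / 2 : ℝ) (7 / 2 : ℝ) (Q F₁ F₂ ω u v 1) :=
  (HasBound.conv hα (hasBound_of_mem_BSpace h.mem_v) (hasBound_of_mem_BSpace h.mem_ω)
    (by norm_num) (by norm_num) (by norm_num) (by norm_num)).sub
    (hasBound_fourierX (by linarith) hF.smooth₁ hF.compact₁ _ _)

lemma exists_norm_Q_le (hα : 1 < α) (hF : IsForce F₁ F₂) (h : IsSolution α F₁ F₂ ω u v) :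
    ∃ B, 0 ≤ B ∧ ∀ m k t, k ≠ 0 → 1 ≤ t →
      ‖Q F₁ F₂ ω u v m k t‖ ≤ B * (t ^ (-3 : ℝ) * wB α k t) := by
  have hα0 : 0 ≤ α := by linarith
  obtain ⟨B0, hB0, H0⟩ := (hasBound_Q_zero hα hF h).norm_le_wB hα0 (r := 3) (by norm_num) le_rfl
  obtain ⟨B1, hB1, H1⟩ := (hasBound_Q_one hα hF h).norm_le_wB hα0 (r := 3) (by norm_num)
    (by norm_num)
  refine ⟨B0 + B1, by positivity, fun m k t hk ht => ?_⟩
  have hB := wB_pos (α := α) (k := k) ht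
  have : 0 < t := by linarith
  have n0 : 0 ≤ B0 * (t ^ (-3 : ℝ) * wB α k t) := by positivity
  have n1 : 0 ≤ B1 * (t ^ (-3 : ℝ) * wB α k t) := by positivity
  rw [add_mul]
  fin_cases m
  · exact (H0 k t hk ht).trans (by linarith)
  · exact (H1 k t hk ht).trans (by linarith)

/-! ### Hölder continuity of the solution -/

/-- The differences of the nonlinear terms in `k`, if the vorticity is Hölder continuous. The force
contributes a constant `C` of its own; the vorticity enters through the product of its constant `N` with
the size `A` of the velocity. -/
lemma exists_norm_Q_sub_le (hα : 1 < α) (hF : IsForce F₁ F₂) (h : IsSolution α F₁ F₂ ω u v)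
    (hA : 0 ≤ A) (hu : BoundBy A α (1 / 2) 0 u) (hv : BoundBy A α (1 / 2) 1 v) :
    ∃ C, 0 ≤ C ∧ ∀ N η, 0 ≤ N → 0 ≤ η → Hol α η N ω → ∀ m k k' t, |k - k'| ≤ 1 → 1 ≤ t →
      ‖Q F₁ F₂ ω u v m k t - Q F₁ F₂ ω u v m k' t‖
        ≤ (6 * convC α * A * N * (√|k - k'| + η) + C * √|k - k'|) *
          (t ^ (-3 / 2 : ℝ) * (wB α k t + wB α k' t)) := by
  have hα0 : 0 ≤ α := by linarith
  obtain ⟨C1, hC1, H1⟩ := exists_norm_fourierX_sub_le_wB hα0 (3 / 2) hF.smooth₁ hF.compact₁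
  obtain ⟨C2, hC2, H2⟩ := exists_norm_fourierX_sub_le_wB hα0 (3 / 2) hF.smooth₂ hF.compact₂
  have e3 : (-(3 / 2) : ℝ) = -3 / 2 := by norm_num
  rw [e3] at H1 H2
  refine ⟨C1 + C2, by positivity, fun N η hN hη hω m k k' t hkk ht => ?_⟩
  have bω := hasBound_of_mem_BSpace h.mem_ω
  have cω : ContDom ω := h.mem_ω.1
  have b1 := wB_pos (α := α) (k := k) ht
  have b2 := wB_pos (α := α) (k := k') ht
  have ht0 : 0 < t := by linarith
  have n : 0 ≤ √|k - k'| * (t ^ (-3 / 2 : ℝ) * (wB α k t + wB α k' t)) := by positivity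
  have n1 := mul_nonneg hC1 n
  have n2 := mul_nonneg hC2 n
  have e : ∀ a b c d : ℂ, ‖a - b - (c - d)‖ ≤ ‖a - c‖ + ‖b - d‖ := fun a b c d => by
    rw [sub_sub_sub_comm]; exact norm_sub_le _ _
  have e' : ∀ a b c d : ℂ, ‖a + b - (c + d)‖ ≤ ‖a - c‖ + ‖b - d‖ := fun a b c d => by
    rw [add_sub_add_comm]; exact norm_add_le _ _
  fin_cases m
  · have h1 := norm_conv_sub_le (P := 3 / 2) hα hη hN hA hu hω bω cω h.mem_u.1 (by norm_num)
      (by norm_num) hkk ht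
    have h2 := H2 k k' t ht
    rw [e3] at h1
    refine (e' _ _ _ _).trans ?_
    rw [conv_comm u, conv_comm u]
    linear_combination h1 + h2 + n1
  · have h1 := norm_conv_sub_le (P := 3 / 2) hα hη hN hA hv hω bω cω h.mem_v.1 (by norm_num)
      (by norm_num) hkk ht
    have h2 := H1 k k' t ht
    rw [e3] at h1
    refine (e _ _ _ _).trans ?_
    rw [conv_comm v, conv_comm v]
    linear_combination h1 + h2 + n2

lemma Hol.of_forall {N : ℝ} (η : ℝ) (h : ∀ n : ℕ, Hol α (η / 2 ^ n) N f) : Hol α 0 N f := by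
  intro k k' t hk hk' hkk ht
  have ht' : Filter.Tendsto (fun n : ℕ => N * ((√|k - k'| + η / 2 ^ n) * (wB α k t + wB α k' t)))
      Filter.atTop (nhds (N * ((√|k - k'| + 0) * (wB α k t + wB α k' t)))) := by
    refine Filter.Tendsto.const_mul _ (Filter.Tendsto.mul_const _ (Filter.Tendsto.const_add _ ?_))
    have := (tendsto_pow_atTop_nhds_zero_of_lt_one (by norm_num : (0:ℝ) ≤ 1 / 2)
      (by norm_num)).const_mul η
    simpa [div_eq_mul_inv] using this
  exact ge_of_tendsto' ht' fun n => h n k k' t hk hk' hkk ht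

/-- For small data the vorticity is Hölder continuous in `k`: the fixed-point equation improves a Hölder
bound up to an error `η` to the same bound with error `η / 2`. -/
lemma exists_hol_omega (hα : 1 < α) : ∃ ε, 0 < ε ∧ ∀ (F₁ F₂ : ℝ × ℝ → ℝ) (ω u v : ℝ → ℝ → ℂ),
    IsForce F₁ F₂ → IsSolution α F₁ F₂ ω u v → IsSmall α ε F₁ F₂ ω u v →
    ∃ N, 0 ≤ N ∧ Hol α 0 N ω := by
  have hα0 : 0 ≤ α := by linarith
  obtain ⟨C, hC, H⟩ := transfersHol_omega hα0
  have hcC := convC_nonneg α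
  set E := C * (6 * convC α) with hE
  have hE0 : 0 ≤ E := by positivity
  -- this choice makes the contribution of the vorticity itself at most one half
  refine ⟨1 / (2 * (E + 1)), by positivity, fun F₁ F₂ ω u v hF h hs => ?_⟩
  set ε := 1 / (2 * (E + 1)) with hε
  have hε0 : 0 < ε := by positivity
  have hEε : E * ε ≤ 1 / 2 := by
    rw [hε, mul_one_div, div_le_div_iff₀ (by positivity) (by norm_num)]; linarith
  obtain ⟨B, hB, HB⟩ := exists_norm_Q_le hα hF h
  obtain ⟨CQ, hCQ, HQ⟩ := exists_norm_Q_sub_le hα hF h hε0.le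
    (fun k t hk ht => norm_le_of_normB_le hε0.le hs.small_u hk ht)
    (fun k t hk ht => norm_le_of_normB_le hε0.le hs.small_v hk ht)
  set N := 2 * (C * (CQ + B)) + 1 with hN
  have hN0 : 0 < N := by positivity
  refine ⟨N, hN0.le, Hol.of_forall (2 * ε / N) fun n => ?_⟩
  induction n with
  | zero =>
    intro k k' t hk hk' hkk ht
    have b : ∀ k, k ≠ 0 → ‖ω k t‖ ≤ ε * (2 * wB α k t) := fun k hk => by
      refine (norm_le_of_normB_le hε0.le hs.small_ω hk ht).trans ?_
      have := weight_le_two_mul_wB (k := k) (p := 5 / 2) (q := 1) (r := 0) hα0 ht (by norm_num)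
        (by norm_num)
      rw [neg_zero, Real.rpow_zero, one_mul] at this
      gcongr
    have b1 := wB_pos (α := α) (k := k) ht
    have b2 := wB_pos (α := α) (k := k') ht
    refine (norm_sub_le _ _).trans ((add_le_add (b k hk) (b k' hk')).trans ?_)
    have e : N * ((√|k - k'| + 2 * ε / N / 2 ^ 0) * (wB α k t + wB α k' t))
        = N * √|k - k'| * (wB α k t + wB α k' t) + 2 * ε * (wB α k t + wB α k' t) := by
      rw [pow_zero]; field_simp
    rw [e]
    have : 0 ≤ N * √|k - k'| * (wB α k t + wB α k' t) := by positivity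
    linarith
  | succ n ih =>
    intro k k' t hk hk' hkk ht
    set η := 2 * ε / N / 2 ^ n with hη
    have hη0 : 0 ≤ η := by positivity
    have b1 := wB_pos (α := α) (k := k) ht
    have b2 := wB_pos (α := α) (k := k') ht
    rw [h.eq_ω k t hk ht, h.eq_ω k' t hk' ht]
    set Δ := √|k - k'| with hΔ
    have hΔ0 : 0 ≤ Δ := Real.sqrt_nonneg _
    have h1 := H (Q F₁ F₂ ω u v) B (6 * convC α * ε * N * (Δ + η) + CQ * Δ) k k' t hB
      (by positivity) (contDom_Q hα hF h) HB hk hk' hkk ht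
      (fun m s hs => HQ N η hN0.le hη0 ih m k k' s hkk hs)
    refine h1.trans ?_
    have e : 2 * ε / N / 2 ^ (n + 1) = η / 2 := by rw [hη, pow_succ, div_div _ (2 ^ n)]
    rw [e, ← mul_assoc, ← mul_assoc]
    refine mul_le_mul_of_nonneg_right ?_ (by positivity)
    have a1 : E * ε * (N * (Δ + η)) ≤ 1 / 2 * (N * (Δ + η)) := by gcongr
    have a2 : 2 * (C * (CQ + B)) * Δ ≤ N * Δ := by gcongr; linarith
    rw [hE] at a1
    linear_combination a1 + a2 / 2

end

section

variable {α k k' l t s p q p' q' c A A' N : ℝ} {f g : ℝ → ℝ → ℂ} {F₁ F₂ : ℝ × ℝ → ℝ}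
  {ω u v : ℝ → ℝ → ℂ}

lemma exists_hol_total {c : Part → Fin 2 → (Fin 2 → ℝ → ℝ → ℂ) → ℝ → ℝ → ℂ} (hα : 1 < α)
    (hF : IsForce F₁ F₂) (h : IsSolution α F₁ F₂ ω u v) (hN : 0 ≤ N) (hω : Hol α 0 N ω)
    (hc : TransfersHol α c) : ∃ N', 0 ≤ N' ∧ Hol α 0 N' (total c (Q F₁ F₂ ω u v)) := by
  obtain ⟨C, hC, H⟩ := hc
  obtain ⟨B, hB, HB⟩ := exists_norm_Q_le hα hF h
  obtain ⟨A, hA, hu⟩ := hasBound_of_mem_BSpace h.mem_u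
  obtain ⟨A', hA', hv⟩ := hasBound_of_mem_BSpace h.mem_v
  have hu' : BoundBy (A + A') α (1 / 2) 0 u := fun k t hk ht => (hu k t hk ht).trans (by
    have := weight_nonneg (α := α) (k := k) (p := 1 / 2) (q := 0) ht
    gcongr; linarith)
  have hv' : BoundBy (A + A') α (1 / 2) 1 v := fun k t hk ht => (hv k t hk ht).trans (by
    have := weight_nonneg (α := α) (k := k) (p := 1 / 2) (q := 1) ht
    gcongr; linarith)
  obtain ⟨CQ, hCQ, HQ⟩ := exists_norm_Q_sub_le hα hF h (by positivity) hu' hv'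
  have hcC := convC_nonneg α
  refine ⟨C * (6 * convC α * (A + A') * N + CQ + B), by positivity, fun k k' t hk hk' hkk ht => ?_⟩
  refine (H (Q F₁ F₂ ω u v) B (6 * convC α * (A + A') * N * (√|k - k'| + 0) + CQ * √|k - k'|) k k' t hB
    (by positivity) (contDom_Q hα hF h) HB hk hk' hkk ht
    (fun m s hs => HQ N 0 hN le_rfl hω m k k' s hkk hs)).trans (le_of_eq (by ring))

lemma exists_hol_v (hα : 1 < α) (hF : IsForce F₁ F₂) (h : IsSolution α F₁ F₂ ω u v) (hN : 0 ≤ N)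
    (hω : Hol α 0 N ω) : ∃ N', 0 ≤ N' ∧ Hol α 0 N' v := by
  obtain ⟨N1, hN1, H1⟩ := exists_hol_total hα hF h hN hω (transfersHol_psi (by linarith))
  refine ⟨N + N1, by positivity, fun k k' t hk hk' hkk ht => ?_⟩
  rw [h.eq_v k t hk ht, h.eq_v k' t hk' ht, ← h.eq_ω k t hk ht, ← h.eq_ω k' t hk' ht,
    add_sub_add_comm, add_mul]
  exact (norm_add_le _ _).trans (add_le_add (hω k k' t hk hk' hkk ht) (H1 k k' t hk hk' hkk ht))

/-- The nonlinear term `Q₁` is Hölder continuous in `k` up to `k = 0`, with the decay `s^{-3}` that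
comes from the decay of the vorticity. -/
lemma exists_norm_Q_one_sub_zero_le (hα : 1 < α) (hF : IsForce F₁ F₂)
    (h : IsSolution α F₁ F₂ ω u v) (hN : 0 ≤ N) (hω : Hol α 0 N ω) :
    ∃ C, 0 ≤ C ∧ (∀ s, 1 ≤ s → ‖Q F₁ F₂ ω u v 1 0 s‖ ≤ C * s ^ (-3 : ℝ)) ∧
      ∀ k s, k ≠ 0 → 1 ≤ s →
        ‖Q F₁ F₂ ω u v 1 k s - Q F₁ F₂ ω u v 1 0 s‖ ≤ C * (√|k| * s ^ (-3 : ℝ)) := by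
  have hα0 : 0 ≤ α := by linarith
  obtain ⟨N', hN', hv⟩ := exists_hol_v hα hF h hN hω
  obtain ⟨A, hA, bω⟩ := hasBound_of_mem_BSpace h.mem_ω
  obtain ⟨C1, hC1, H1⟩ := exists_norm_fourierX_sub_le_wB hα0 3 hF.smooth₁ hF.compact₁
  obtain ⟨B, hB, HB⟩ := exists_norm_Q_le hα hF h
  have bv := hasBound_of_mem_BSpace h.mem_v
  have hcC := convC_nonneg α
  set C := 2 * (6 * convC α * A * N' + C1) with hC
  have hC0 : 0 ≤ C := by positivity
  have near : ∀ k s, |k| ≤ 1 → 1 ≤ s →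
      ‖Q F₁ F₂ ω u v 1 k s - Q F₁ F₂ ω u v 1 0 s‖ ≤ C * (√|k| * s ^ (-3 : ℝ)) := by
    intro k s hk hs
    have h1 := norm_conv_sub_le (P := 3) (k := k) (k' := 0) hα le_rfl hN' hA bω hv bv h.mem_v.1
      h.mem_ω.1 (by norm_num) (by norm_num) (by simpa using hk) hs
    have h2 := H1 k 0 s hs
    rw [sub_zero, add_zero] at h1
    rw [sub_zero] at h2
    have b1 := wB_le_one (α := α) (k := k) hs
    have b2 := wB_le_one (α := α) (k := 0) hs
    have hs0 : 0 < s := by linarith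
    have h3 : √|k| * (s ^ (-3 : ℝ) * (wB α k s + wB α 0 s)) ≤ √|k| * (s ^ (-3 : ℝ) * 2) := by
      gcongr; linarith
    have h4 := mul_le_mul_of_nonneg_left h3 (by positivity : 0 ≤ 6 * convC α * A * N')
    have h5 := mul_le_mul_of_nonneg_left h3 hC1
    have e : ∀ a b c d : ℂ, ‖a - b - (c - d)‖ ≤ ‖a - c‖ + ‖b - d‖ := fun a b c d => by
      rw [sub_sub_sub_comm]; exact norm_sub_le _ _
    refine (e _ _ _ _).trans ?_
    rw [hC]
    linear_combination h1 + h2 + h4 + h5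
  have size : ∀ k s, k ≠ 0 → 1 ≤ s → ‖Q F₁ F₂ ω u v 1 k s‖ ≤ B * s ^ (-3 : ℝ) := by
    intro k s hk hs
    refine (HB 1 k s hk hs).trans ?_
    have hs0 : 0 < s := by linarith
    gcongr
    exact mul_le_of_le_one_right (by positivity) (wB_le_one hs)
  have zero : ∀ s, 1 ≤ s → ‖Q F₁ F₂ ω u v 1 0 s‖ ≤ (B + C) * s ^ (-3 : ℝ) := by
    intro s hs
    have h1 := near 1 s (by simp) hs
    have h2 := size 1 s one_ne_zero hs
    have h3 := norm_sub_norm_le (Q F₁ F₂ ω u v 1 0 s) (Q F₁ F₂ ω u v 1 1 s)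
    rw [norm_sub_rev] at h3
    simp only [abs_one, Real.sqrt_one, one_mul] at h1
    linarith
  refine ⟨2 * B + C, by positivity, fun s hs => (zero s hs).trans ?_, fun k s hk hs => ?_⟩
  · have hs0 : 0 < s := by linarith
    gcongr; linarith
  · have hs0 : 0 < s := by linarith
    have hs3 : 0 < s ^ (-3 : ℝ) := by positivity
    rcases le_total |k| 1 with hk1 | hk1
    · refine (near k s hk1 hs).trans ?_
      gcongr; linarith
    · have h1 : 1 ≤ √|k| := Real.one_le_sqrt.2 hk1
      refine (norm_sub_le _ _).trans ((add_le_add (size k s hk hs) (zero s hs)).trans ?_)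
      have h2 : s ^ (-3 : ℝ) ≤ √|k| * s ^ (-3 : ℝ) := le_mul_of_one_le_left hs3.le h1
      have h3 := mul_le_mul_of_nonneg_left h2 (by positivity : 0 ≤ 2 * B + C)
      linarith

end

section

variable {α k k' l t s p q p' q' c A A' N : ℝ} {f g : ℝ → ℝ → ℂ}

/-! ### The asymptotic profile of the kernels -/

lemma sqrtNegI_sq (k : ℝ) : sqrtNegI k ^ 2 = -(I * k) := by
  unfold sqrtNegI
  rw [one_div]
  exact Complex.cpow_ofNat_inv_pow _ 2

lemma norm_sqrtNegI (k : ℝ) : ‖sqrtNegI k‖ = √|k| := by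
  have h : ‖sqrtNegI k‖ ^ 2 = |k| := by
    rw [← norm_pow, sqrtNegI_sq]; simp
  rw [← h, Real.sqrt_sq (norm_nonneg _)]

lemma re_sqrtNegI (k : ℝ) : (sqrtNegI k).re = √(|k| / 2) := by
  unfold sqrtNegI
  rw [one_div, Complex.cpow_inv_two_re]
  simp

lemma sqrt_le_two_mul_re_sqrtNegI (k : ℝ) : √|k| ≤ 2 * (sqrtNegI k).re := by
  rw [re_sqrtNegI]
  have e : √|k| = √(|k| / 2) * √2 := by
    rw [← Real.sqrt_mul (by positivity)]; congr 1; ring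
  rw [e, mul_comm]
  have : √2 ≤ 2 := by rw [Real.sqrt_le_left] <;> norm_num
  gcongr

lemma re_sqrtNegI_nonneg (k : ℝ) : 0 ≤ (sqrtNegI k).re := by
  rw [re_sqrtNegI]; exact Real.sqrt_nonneg _

lemma sqrtNegI_ne_zero (hk : k ≠ 0) : sqrtNegI k ≠ 0 := by
  rw [← norm_pos_iff, norm_sqrtNegI]; exact Real.sqrt_pos.2 (abs_pos.2 hk)

lemma norm_kappa_le_norm_add (k : ℝ) : ‖kappa k‖ ≤ 2 * ‖kappa k + sqrtNegI k‖ := by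
  refine (norm_kappa_le_two_mul_re k).trans ?_
  have h1 := Complex.re_le_norm (kappa k + sqrtNegI k)
  rw [add_re] at h1
  linarith [re_sqrtNegI_nonneg k]

lemma norm_kappa_sub_mul (k : ℝ) :
    ‖kappa k - sqrtNegI k‖ * ‖kappa k + sqrtNegI k‖ = |k| ^ 2 := by
  rw [← norm_mul]
  have e : (kappa k - sqrtNegI k) * (kappa k + sqrtNegI k) = (k : ℂ) ^ 2 := by
    linear_combination kappa_sq k - sqrtNegI_sq k
  rw [e, norm_pow, Complex.norm_real, Real.norm_eq_abs]

lemma norm_kappa_sub_sqrtNegI_le (hk : k ≠ 0) : ‖kappa k - sqrtNegI k‖ ≤ 2 * |k| := by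
  have h1 := norm_kappa_sub_mul k
  have h2 := (abs_le_norm_kappa k).trans (norm_kappa_le_norm_add k)
  have h0 := abs_pos.2 hk
  refine le_of_mul_le_mul_right (a := |k|) ?_ h0
  nlinarith [norm_nonneg (kappa k - sqrtNegI k)]

lemma norm_kappa_sub_sqrtNegI_le' (hk : k ≠ 0) : ‖kappa k - sqrtNegI k‖ ≤ 2 * √|k| ^ 3 := by
  have h1 := norm_kappa_sub_mul k
  have h2 := (sqrt_le_norm_kappa k).trans (norm_kappa_le_norm_add k)
  have h0 : 0 < √|k| := Real.sqrt_pos.2 (abs_pos.2 hk)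
  have h3 : |k| = √|k| ^ 2 := (Real.sq_sqrt (abs_nonneg k)).symm
  refine le_of_mul_le_mul_right (a := √|k|) ?_ h0
  calc _ ≤ ‖kappa k - sqrtNegI k‖ * (2 * ‖kappa k + sqrtNegI k‖) := by gcongr
    _ = 2 * |k| ^ 2 := by rw [← h1]; ring
    _ = 2 * (√|k| ^ 2) ^ 2 := by rw [← h3]
    _ = _ := by ring

/-- The common decay of all exponentials in the comparison, for `s ≤ t/2`. -/
lemma exp_re_kappa_le_far (hs : 1 ≤ s) (hst : 2 * s ≤ t) :
    Real.exp (-((kappa k).re * (t - s))) ≤ Real.exp (-(√|k| * t / 4)) := by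
  apply Real.exp_le_exp.2
  have h1 := sqrt_le_two_mul_re_kappa k
  have h2 : √|k| / 2 * (t / 2) ≤ (kappa k).re * (t - s) := by
    have := re_kappa_nonneg k
    gcongr <;> linarith
  linarith

lemma norm_exp_sqrtNegI_le (ht : 0 ≤ t) :
    ‖cexp (-(sqrtNegI k * t))‖ ≤ Real.exp (-(√|k| * t / 4)) := by
  rw [norm_exp_neg_mul]
  apply Real.exp_le_exp.2
  have h1 := sqrt_le_two_mul_re_sqrtNegI k
  have h2 : √|k| / 2 * t ≤ (sqrtNegI k).re * t := by gcongr; linarith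
  have : 0 ≤ √|k| * t := by positivity
  linarith

/-- Taylor expansion of the first factor of the kernel. -/
lemma norm_bOmega_one_sub_id_le (hk : k ≠ 0) (hs : 1 ≤ s) (h : √|k| * s ≤ 1) :
    ‖bOmega 1 k (s - 1) - 2 * (kappa k * ((s - 1 : ℝ) : ℂ))‖ ≤ 52 * (√|k| * s) ^ 2 := by
  obtain ⟨h1, h2, h3⟩ := small_of_sqrt_mul_le_one hs h
  have hσ : 0 ≤ s - 1 := by linarith
  have e : bOmega 1 k (s - 1) - 2 * (kappa k * ((s - 1 : ℝ) : ℂ))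
      = -(cexp (-(2 * (kappa k * ((s - 1 : ℝ) : ℂ)))) - 1 - (-(2 * (kappa k * ((s - 1 : ℝ) : ℂ)))))
        - 2 * (I * sg k) * (eK k (s - 1) * wW k (s - 1)) := by
    have : eK k (s - 1) ^ 2 = cexp (-(2 * (kappa k * ((s - 1 : ℝ) : ℂ)))) := by
      unfold eK; rw [← Complex.exp_nat_mul]; congr 1; push_cast; ring
    simp only [bOmega, this]; ring
  rw [e]
  refine (norm_sub_le _ _).trans ?_
  rw [norm_neg, norm_two_mul_I_sg_mul hk, norm_mul (eK k (s - 1))]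
  have a1 := norm_exp_sub_one_sub_id_le_of_re_nonpos
    (z := -(2 * (kappa k * ((s - 1 : ℝ) : ℂ)))) (by
      have := mul_nonneg (re_kappa_nonneg k) hσ
      simpa using this)
  have a2 : ‖-(2 * (kappa k * ((s - 1 : ℝ) : ℂ)))‖ ≤ 4 * (√|k| * s) := by
    rw [norm_neg, norm_mul, norm_mul, Complex.norm_real, Real.norm_of_nonneg hσ]
    have : ‖kappa k‖ * (s - 1) ≤ (2 * √|k|) * s := by gcongr; linarith
    norm_num
    linarith
  have a3 : ‖-(2 * (kappa k * ((s - 1 : ℝ) : ℂ)))‖ ^ 2 ≤ (4 * (√|k| * s)) ^ 2 := by gcongr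
  have a4 := norm_eK_le_one (k := k) hσ
  have a5 := norm_wW_le (k := k) hσ
  have a6 : ‖eK k (s - 1)‖ * ‖wW k (s - 1)‖ ≤ 1 * (2 * (√|k| * s) ^ 2) := by
    refine mul_le_mul a4 (a5.trans ?_) (norm_nonneg _) zero_le_one
    have : |k| * (s - 1) ≤ |k| * s := by gcongr; linarith
    linarith
  nlinarith

lemma mul_exp_neg_half_le (x : ℝ) :
    x * Real.exp (-(x / 2)) ≤ 4 * Real.exp (-(x / 4)) := by
  have h := mul_exp_neg_le_one (x / 4)
  have e : Real.exp (-(x / 2)) = Real.exp (-(x / 4)) * Real.exp (-(x / 4)) := by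
    rw [← Real.exp_add]; congr 1; ring
  rw [e]
  nlinarith [Real.exp_pos (-(x / 4))]

/-- For `s ≤ t/2` the kernel of `ω_{1,1}` is `(s-1) √(-ik) e^{-√(-ik)t}` up to an error that is of second
order in the scaled frequency `√|k| s`. -/
lemma norm_kerOmega_one_one_sub_le (hk : k ≠ 0) (hs : 1 ≤ s) (hst : 2 * s ≤ t) :
    ‖preK .one k (t - 1) * kerF .one 1 k (s - 1)
        - ((s - 1 : ℝ) : ℂ) * (sqrtNegI k * cexp (-(sqrtNegI k * t)))‖
      ≤ 50 * (√|k| ^ 2 * s ^ 2 * Real.exp (-(√|k| * t / 4))) := by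
  have h0 : 0 < √|k| := Real.sqrt_pos.2 (abs_pos.2 hk)
  have hσ : 0 ≤ s - 1 := by linarith
  have ht : 0 ≤ t := by linarith
  have hE := exp_re_kappa_le_far (k := k) hs hst
  have hZ := norm_exp_sqrtNegI_le (k := k) ht
  set X := Real.exp (-(√|k| * t / 4)) with hX
  have hX0 : 0 < X := Real.exp_pos _
  rcases le_total 1 (√|k| * s) with h | h
  · -- here both terms are separately small enough
    have a1 : √|k| * s ≤ √|k| ^ 2 * s ^ 2 := by nlinarith
    refine (norm_sub_le _ _).trans ?_
    have b1 : ‖preK .one k (t - 1) * kerF .one 1 k (s - 1)‖ ≤ 8 * (√|k| ^ 2 * s ^ 2 * X) := by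
      refine (norm_kerOmega_one_one_le hk hs).trans ?_
      have : min 1 (√|k| * s) ≤ √|k| ^ 2 * s ^ 2 := (min_le_right _ _).trans a1
      gcongr
    have b2 : ‖((s - 1 : ℝ) : ℂ) * (sqrtNegI k * cexp (-(sqrtNegI k * t)))‖
        ≤ √|k| ^ 2 * s ^ 2 * X := by
      rw [norm_mul, norm_mul, Complex.norm_real, Real.norm_of_nonneg hσ, norm_sqrtNegI]
      calc _ ≤ s * (√|k| * X) := by gcongr; linarith
        _ = (√|k| * s) * X := by ring
        _ ≤ _ := by gcongr
    have : 0 ≤ √|k| ^ 2 * s ^ 2 * X := by positivity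
    linarith
  · obtain ⟨h1, h2, h3⟩ := small_of_sqrt_mul_le_one hs h
    have hl1 : √|k| ≤ 1 := by nlinarith
    rw [kerOmega_one_one hk]
    set z := sqrtNegI k with hz
    have e : 1 / 2 * (eK k (t - s) * bOmega 1 k (s - 1))
          - ((s - 1 : ℝ) : ℂ) * (z * cexp (-(z * t)))
        = 1 / 2 * (eK k (t - s) * (bOmega 1 k (s - 1) - 2 * (kappa k * ((s - 1 : ℝ) : ℂ))))
          + ((s - 1 : ℝ) : ℂ) * ((kappa k - z) * eK k (t - s))
          + ((s - 1 : ℝ) : ℂ) * (z * (eK k (t - s) * (1 - eK k s)))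
          + ((s - 1 : ℝ) : ℂ) * (z * (cexp (-(kappa k * t)) - cexp (-(z * t)))) := by
      have : eK k (t - s) * eK k s = cexp (-(kappa k * t)) := by
        unfold eK; rw [← Complex.exp_add]; congr 1; push_cast; ring
      rw [← this]; ring
    have hE' : ‖eK k (t - s)‖ ≤ X := by rw [norm_eK]; exact hE
    have c1 : ‖1 / 2 * (eK k (t - s) * (bOmega 1 k (s - 1) - 2 * (kappa k * ((s - 1 : ℝ) : ℂ))))‖
        ≤ 26 * (√|k| ^ 2 * s ^ 2 * X) := by
      rw [norm_half_mul, norm_mul]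
      have := mul_le_mul hE' (norm_bOmega_one_sub_id_le hk hs h) (norm_nonneg _) hX0.le
      nlinarith
    have hq : √|k| ^ 3 ≤ √|k| ^ 2 := pow_le_pow_of_le_one h0.le hl1 (by norm_num)
    have hs2 : s ≤ s ^ 2 := by nlinarith
    have c2 : ‖((s - 1 : ℝ) : ℂ) * ((kappa k - z) * eK k (t - s))‖ ≤ 2 * (√|k| ^ 2 * s ^ 2 * X) := by
      rw [norm_mul, norm_mul, Complex.norm_real, Real.norm_of_nonneg hσ]
      calc _ ≤ s ^ 2 * ((2 * √|k| ^ 2) * X) := by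
            gcongr
            · linarith
            · exact (norm_kappa_sub_sqrtNegI_le' hk).trans (by linarith)
        _ = _ := by ring
    have c3 : ‖((s - 1 : ℝ) : ℂ) * (z * (eK k (t - s) * (1 - eK k s)))‖
        ≤ 4 * (√|k| ^ 2 * s ^ 2 * X) := by
      rw [norm_mul, norm_mul, norm_mul, Complex.norm_real, Real.norm_of_nonneg hσ, hz, norm_sqrtNegI]
      have : ‖1 - eK k s‖ ≤ 4 * (√|k| * s) := by
        refine (norm_one_sub_eK_le (by linarith)).trans ?_
        have : ‖kappa k‖ * s ≤ (2 * √|k|) * s := by gcongr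
        linarith
      calc _ ≤ s * (√|k| * (X * (4 * (√|k| * s)))) := by gcongr; linarith
        _ = _ := by ring
    have c4 : ‖((s - 1 : ℝ) : ℂ) * (z * (cexp (-(kappa k * t)) - cexp (-(z * t))))‖
        ≤ 16 * (√|k| ^ 2 * s ^ 2 * X) := by
      rw [norm_mul, norm_mul, Complex.norm_real, Real.norm_of_nonneg hσ, hz, norm_sqrtNegI]
      have d1 := norm_exp_neg_mul_sub_le (a := kappa k) (b := sqrtNegI k) (m := √|k| / 2) ht
        (by linarith [sqrt_le_two_mul_re_kappa k]) (by linarith [sqrt_le_two_mul_re_sqrtNegI k])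
      have d2 := mul_exp_neg_half_le (√|k| * t)
      have d3 : ‖cexp (-(kappa k * t)) - cexp (-(sqrtNegI k * t))‖ ≤ 16 * (√|k| ^ 2 * X) := by
        refine d1.trans ?_
        calc 2 * ‖kappa k - sqrtNegI k‖ * t * Real.exp (-(√|k| / 2 * t))
            ≤ 2 * (2 * √|k| ^ 3) * t * Real.exp (-(√|k| / 2 * t)) := by
              gcongr; exact norm_kappa_sub_sqrtNegI_le' hk
          _ = 4 * √|k| ^ 2 * (√|k| * t * Real.exp (-(√|k| * t / 2))) := by
              rw [show -(√|k| / 2 * t) = -(√|k| * t / 2) by ring]; ring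
          _ ≤ 4 * √|k| ^ 2 * (4 * X) := by gcongr
          _ = _ := by ring
      calc _ ≤ s ^ 2 * (1 * (16 * (√|k| ^ 2 * X))) := by gcongr; linarith
        _ = _ := by ring
    rw [e]
    have := norm_add_le (1 / 2 * (eK k (t - s) * (bOmega 1 k (s - 1) - 2 * (kappa k * ((s - 1 : ℝ) : ℂ))))
          + ((s - 1 : ℝ) : ℂ) * ((kappa k - z) * eK k (t - s))
          + ((s - 1 : ℝ) : ℂ) * (z * (eK k (t - s) * (1 - eK k s))))
        (((s - 1 : ℝ) : ℂ) * (z * (cexp (-(kappa k * t)) - cexp (-(z * t)))))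
    refine (this.trans (add_le_add_left norm_add₃_le _)).trans ?_
    have : 0 ≤ √|k| ^ 2 * s ^ 2 * X := by positivity
    linarith

/-- The corresponding statement for `η_{1,1}`, whose kernel is larger by the factor `κ/(ik)`. -/
lemma norm_kerEta_one_one_sub_le (hk : k ≠ 0) (hs : 1 ≤ s) (hst : 2 * s ≤ t) :
    ‖preK .one k (t - 1) * kerG .one 1 k (s - 1) - ((s - 1 : ℝ) : ℂ) * -cexp (-(sqrtNegI k * t))‖
      ≤ 102 * (√|k| * s ^ 2 * Real.exp (-(√|k| * t / 4))) := by
  have h0 : 0 < √|k| := Real.sqrt_pos.2 (abs_pos.2 hk)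
  have hk2 : |k| = √|k| ^ 2 := (Real.sq_sqrt (abs_nonneg k)).symm
  have hσ : 0 ≤ s - 1 := by linarith
  have ht : 0 ≤ t := by linarith
  have hE := exp_re_kappa_le_far (k := k) hs hst
  have hZ := norm_exp_sqrtNegI_le (k := k) ht
  have hM := norm_kerOmega_one_one_sub_le hk hs hst
  set X := Real.exp (-(√|k| * t / 4)) with hX
  have hX0 : 0 < X := Real.exp_pos _
  rcases le_total 1 (√|k| * s) with h | h
  · have a1 : s ≤ √|k| * s ^ 2 := by nlinarith
    refine (norm_sub_le _ _).trans ?_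
    have b1 : ‖preK .one k (t - 1) * kerG .one 1 k (s - 1)‖ ≤ 16 * (√|k| * s ^ 2 * X) := by
      refine (norm_kerEta_one_one_le hk hs).trans ?_
      gcongr
    have b2 : ‖((s - 1 : ℝ) : ℂ) * -cexp (-(sqrtNegI k * t))‖ ≤ √|k| * s ^ 2 * X := by
      rw [norm_mul, norm_neg, Complex.norm_real, Real.norm_of_nonneg hσ]
      gcongr
      linarith
    have : 0 ≤ √|k| * s ^ 2 * X := by positivity
    linarith
  · obtain ⟨h1, h2, h3⟩ := small_of_sqrt_mul_le_one hs h
    have hz0 := sqrtNegI_ne_zero hk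
    have hk0 : (k : ℂ) ≠ 0 := by exact_mod_cast hk
    rw [kerEta_one]
    set z := sqrtNegI k with hz
    have e : kappa k / (I * k) * (preK .one k (t - 1) * kerF .one 1 k (s - 1))
          - ((s - 1 : ℝ) : ℂ) * -cexp (-(z * t))
        = kappa k / (I * k) * (preK .one k (t - 1) * kerF .one 1 k (s - 1)
            - ((s - 1 : ℝ) : ℂ) * (z * cexp (-(z * t))))
          - ((s - 1 : ℝ) : ℂ) * ((kappa k - z) / z * cexp (-(z * t))) := by
      have h5 : kappa k / (I * k) * z = -(kappa k / z) := by
        rw [div_mul_eq_mul_div, ← neg_div, div_eq_div_iff (mul_ne_zero I_ne_zero hk0) hz0]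
        linear_combination kappa k * sqrtNegI_sq k
      have h6 : (kappa k - z) / z = kappa k / z - 1 := by rw [sub_div, div_self hz0]
      rw [h6]
      linear_combination (((s - 1 : ℝ) : ℂ) * cexp (-(z * t))) * h5
    rw [e]
    refine (norm_sub_le _ _).trans ?_
    rw [norm_mul, norm_kappa_div_I_mul, norm_mul ((s - 1 : ℝ) : ℂ), norm_mul, norm_div,
      Complex.norm_real, Real.norm_of_nonneg hσ, hz, norm_sqrtNegI]
    have c1 : ‖kappa k‖ / |k| ≤ 2 / √|k| := by
      rw [div_le_div_iff₀ (abs_pos.2 hk) h0]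
      calc ‖kappa k‖ * √|k| ≤ (2 * √|k|) * √|k| := by gcongr
        _ = 2 * |k| := by rw [mul_assoc, Real.mul_self_sqrt (abs_nonneg k)]
    have c2 : ‖kappa k - sqrtNegI k‖ / √|k| ≤ 2 * √|k| := by
      rw [div_le_iff₀ h0]
      refine (norm_kappa_sub_sqrtNegI_le hk).trans (le_of_eq ?_)
      rw [mul_assoc, Real.mul_self_sqrt (abs_nonneg k)]
    have c3 : 2 / √|k| * (50 * (√|k| ^ 2 * s ^ 2 * X)) = 100 * (√|k| * s ^ 2 * X) := by
      field_simp; ring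
    have c4 : (s - 1) * (‖kappa k - sqrtNegI k‖ / √|k| * ‖cexp (-(sqrtNegI k * t))‖)
        ≤ 2 * (√|k| * s ^ 2 * X) := by
      calc _ ≤ s ^ 2 * (2 * √|k| * X) := by gcongr; nlinarith
        _ = _ := by ring
    have c5 := mul_le_mul c1 hM (norm_nonneg _) (by positivity)
    rw [c3] at c5
    linarith

end

section

variable {α k k' l t s p q p' q' c A A' N : ℝ} {f g : ℝ → ℝ → ℂ}

/-! ### Asymptotics of the leading components -/

/-- A function of `√|k| t` that decays exponentially is bounded by the fast weight. -/
lemma exists_sqrt_rpow_mul_exp_le (hα : 0 ≤ α) {r : ℝ} (hr : 0 ≤ r) :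
    ∃ C, 0 ≤ C ∧ ∀ k t : ℝ, 1 ≤ t →
      √|k| ^ r * Real.exp (-(√|k| * t / 4)) ≤ C * (t ^ (-r) * wT α k t) := by
  obtain ⟨C, hC, H⟩ := exists_rpow_mul_exp_le_br (α := 2 * α) hr (by norm_num : (0:ℝ) < 1 / 4)
    (by positivity)
  refine ⟨C, hC.le, fun k t ht => ?_⟩
  have ht0 : 0 < t := by linarith
  have h1 := H (√|k| * t) (by positivity)
  rw [← wT_eq ht0.le, Real.mul_rpow (Real.sqrt_nonneg _) ht0.le] at h1
  have e : t ^ (-r) * t ^ r = 1 := by rw [← Real.rpow_add ht0]; simp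
  have h2 := mul_le_mul_of_nonneg_left h1 (by positivity : 0 ≤ t ^ (-r))
  calc _ = (t ^ (-r) * t ^ r) * (√|k| ^ r * Real.exp (-(√|k| * t / 4))) := by rw [e, one_mul]
    _ = t ^ (-r) * (√|k| ^ r * t ^ r * Real.exp (-(1 / 4 * (√|k| * t)))) := by
        rw [show -(√|k| * t / 4) = -(1 / 4 * (√|k| * t)) by ring]; ring
    _ ≤ _ := h2.trans (le_of_eq (by ring))

/-- If, for `s ≤ t/2`, a kernel is `(s-1) Z(k,t)` up to second order, then the integral over `[1,t]` is
`Z(k,t)` times the first moment of the source at `k = 0`, up to a gain of one power of `t`. Here `Z` has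
the size of `√|k|^r e^{-√|k| t/4}`; the cases `r = 1` and `r = 0` occur. -/
lemma comp_one_sub_asymptotic (hα : 0 ≤ α) (hp : 7 / 2 ≤ p) {K : ℝ → ℝ → ℝ → ℂ} {f : ℝ → ℝ → ℂ}
    {Z : ℝ → ℝ → ℂ} (hK : KerCont K) (hKl : KerLin .one K) (hf : HasBound α p p f) (cf : ContDom f)
    {r : ℝ} (hr : 0 ≤ r) {C₀ C₁ C₂ : ℝ} (hC₀ : 0 ≤ C₀) (hC₁ : 0 ≤ C₁) (hC₂ : 0 ≤ C₂)
    (hf0 : ∀ s, 1 ≤ s → ‖f 0 s‖ ≤ C₀ * s ^ (-3 : ℝ))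
    (hfd : ∀ k s, k ≠ 0 → 1 ≤ s → ‖f k s - f 0 s‖ ≤ C₀ * (√|k| * s ^ (-3 : ℝ)))
    (hZ : ∀ k t, k ≠ 0 → 1 ≤ t → ‖Z k t‖ ≤ √|k| ^ r * Real.exp (-(√|k| * t / 4)))
    (far : ∀ k t s, k ≠ 0 → 1 ≤ s → 2 * s ≤ t → ‖K k t s - ((s - 1 : ℝ) : ℂ) * Z k t‖
      ≤ C₁ * (√|k| ^ (r + 1) * s ^ 2 * Real.exp (-(√|k| * t / 4))))
    (near : ∀ k t s, k ≠ 0 → 1 ≤ s → s ≤ t → ‖K k t s‖ ≤ C₂ * t ^ (1 - r)) :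
    HasBound α ((p - 2 + r : ℝ) : WithTop ℝ) ((r + 1 : ℝ) : WithTop ℝ) (fun k t =>
      comp .one K f k t - (∫ s in Set.Ici (1 : ℝ), ((s : ℂ) - 1) * f 0 s) * Z k t) := by
  obtain ⟨C3, hC3, H3⟩ := HasBound.near hα (by linarith) (by linarith) hf
  obtain ⟨CZ, hCZ, HZ⟩ := exists_sqrt_rpow_mul_exp_le hα hr
  obtain ⟨CV, hCV, HV⟩ := exists_sqrt_rpow_mul_exp_le hα (by linarith : 0 ≤ r + 1)
  obtain ⟨B, hB, HB⟩ := hf.norm_le_rpow (r := p) le_rfl le_rfl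
  -- the source at `k = 0` is measurable as a limit
  have hm0 : AEStronglyMeasurable (f 0) (volume.restrict (Set.Ici 1)) := by
    refine aestronglyMeasurable_of_tendsto_ae Filter.atTop
      (f := fun (n : ℕ) s => f (1 / ((n : ℝ) + 1)) s) (fun n => ?_) ?_
    · exact (cf.continuousOn_right (by positivity)).aestronglyMeasurable measurableSet_Ici
    · filter_upwards [ae_restrict_mem measurableSet_Ici] with s hs
      rw [tendsto_iff_norm_sub_tendsto_zero]
      have h1 : Filter.Tendsto (fun n : ℕ => C₀ * (√|1 / ((n : ℝ) + 1)| * s ^ (-3 : ℝ)))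
          Filter.atTop (nhds (C₀ * (√|0| * s ^ (-3 : ℝ)))) :=
        Filter.Tendsto.const_mul _ (Filter.Tendsto.mul_const _
          (tendsto_one_div_add_atTop_nhds_zero_nat.abs.sqrt))
      simp only [abs_zero, Real.sqrt_zero, zero_mul, mul_zero] at h1
      exact squeeze_zero (fun _ => norm_nonneg _) (fun n => hfd _ s (by positivity) hs) h1
  have hg0 : ∀ s : ℝ, 1 ≤ s → ‖((s : ℂ) - 1) * f 0 s‖ ≤ C₀ * s ^ (-2 : ℝ) := fun s hs => by
    have hs0 : 0 < s := by linarith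
    have e : ((s : ℂ) - 1) = ((s - 1 : ℝ) : ℂ) := by push_cast; rfl
    rw [norm_mul, e, Complex.norm_real, Real.norm_of_nonneg (by linarith)]
    calc _ ≤ s * (C₀ * s ^ (-3 : ℝ)) := by gcongr; linarith; exact hf0 s hs
      _ = C₀ * (s ^ (1 : ℝ) * s ^ (-3 : ℝ)) := by rw [Real.rpow_one]; ring
      _ = _ := by rw [← Real.rpow_add hs0]; norm_num
  have hi0 : IntegrableOn (fun s : ℝ => ((s : ℂ) - 1) * f 0 s) (Set.Ici 1) := by
    have hi : IntegrableOn (fun s : ℝ => C₀ * s ^ (-2 : ℝ)) (Set.Ici 1) :=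
      (integrableOn_Ici_iff_integrableOn_Ioi (μ := volume)).2
        ((integrableOn_Ioi_rpow_of_lt (by norm_num) one_pos).const_mul _)
    refine hi.mono' ?_ ?_
    · exact (Continuous.aestronglyMeasurable (by fun_prop)).mul hm0
    · filter_upwards [ae_restrict_mem measurableSet_Ici] with s hs using hg0 s hs
  refine ⟨2 * (C₁ * B * CV + C₀ * CV) + (C₂ * C3 + 4 * C₀ * CZ) + C₀ * CZ, by positivity,
    fun k t hk ht => ?_⟩
  have ht0 : 0 < t := by linarith
  have hB' := wB_pos (α := α) (k := k) ht
  have hT' := wT_pos (α := α) (k := k) ht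
  have hk0 : 0 < √|k| := Real.sqrt_pos.2 (abs_pos.2 hk)
  set V := √|k| ^ r * Real.exp (-(√|k| * t / 4)) with hV
  have hV0 : 0 ≤ V := by positivity
  set W := √|k| ^ (r + 1) * Real.exp (-(√|k| * t / 4)) with hW
  have hW0 : 0 ≤ W := by positivity
  have hWV : W = V * √|k| := by rw [hW, hV, Real.rpow_add_one hk0.ne']; ring
  have hVle := HZ k t ht
  have hWle := HV k t ht
  have hZk := hZ k t hk ht
  set w := weight α p p k t with hw
  have hw0 : 0 ≤ w := weight_nonneg ht
  -- the part over `[1,t]`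
  have i1 : IntegrableOn (fun s => K k t s * f k s) (Set.Icc 1 t) :=
    integrableOn_comp (n := .one) hK hKl cf (C' := B) (fun k t hk ht => (HB k t hk ht).trans (by
      have := rpow_neg_anti ht (by linarith : (3:ℝ) ≤ p); gcongr)) hk ht
  have i2 : IntegrableOn (fun s : ℝ => ((s : ℂ) - 1) * f 0 s * Z k t) (Set.Icc 1 t) :=
    (hi0.mono_set fun s hs => hs.1).mul_const _
  have hmain : ‖∫ s in Set.Icc 1 t, (K k t s * f k s - ((s : ℂ) - 1) * f 0 s * Z k t)‖
      ≤ (C₁ * B * W + C₀ * W) / (3 / 2 - 1)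
        + (C₂ * C3 * (t ^ (1 - r) * w) + 4 * C₀ * (t ^ (-2 : ℝ) * V)) * t + 0 := by
    refine norm_integral_Icc_le (a := 3 / 2) (ρ := 0) ht (by norm_num) (by positivity)
      (by positivity) le_rfl fun s hs hst => ?_
    have hs0 : 0 < s := by linarith
    have e1 : ((s : ℂ) - 1) = ((s - 1 : ℝ) : ℂ) := by push_cast; rfl
    rcases le_total (2 * s) t with h2 | h2
    · have e : K k t s * f k s - ((s : ℂ) - 1) * f 0 s * Z k t
          = (K k t s - ((s - 1 : ℝ) : ℂ) * Z k t) * f k s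
            + ((s - 1 : ℝ) : ℂ) * (Z k t * (f k s - f 0 s)) := by rw [e1]; ring
      have a1 : ‖(K k t s - ((s - 1 : ℝ) : ℂ) * Z k t) * f k s‖ ≤ C₁ * B * W * s ^ (-(3 / 2) : ℝ) := by
        rw [norm_mul]
        have r1 : s ^ 2 * s ^ (-p) ≤ s ^ (-(3 / 2) : ℝ) := by
          rw [← Real.rpow_natCast, ← Real.rpow_add hs0]
          exact Real.rpow_le_rpow_of_exponent_le hs (by push_cast; linarith)
        calc _ ≤ (C₁ * (√|k| ^ (r + 1) * s ^ 2 * Real.exp (-(√|k| * t / 4)))) * (B * s ^ (-p)) :=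
              mul_le_mul (far k t s hk hs h2) (HB k s hk hs) (norm_nonneg _) (by positivity)
          _ = C₁ * B * W * (s ^ 2 * s ^ (-p)) := by rw [hW]; ring
          _ ≤ _ := by gcongr
      have a2 : ‖((s - 1 : ℝ) : ℂ) * (Z k t * (f k s - f 0 s))‖ ≤ C₀ * W * s ^ (-(3 / 2) : ℝ) := by
        rw [norm_mul, norm_mul, Complex.norm_real, Real.norm_of_nonneg (by linarith)]
        have r1 : s * s ^ (-3 : ℝ) ≤ s ^ (-(3 / 2) : ℝ) := by
          rw [mul_comm, ← Real.rpow_add_one hs0.ne']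
          exact Real.rpow_le_rpow_of_exponent_le hs (by norm_num)
        calc _ ≤ s * (V * (C₀ * (√|k| * s ^ (-3 : ℝ)))) :=
              mul_le_mul (by linarith) (mul_le_mul hZk (hfd k s hk hs) (norm_nonneg _) hV0)
                (by positivity) hs0.le
          _ = C₀ * W * (s * s ^ (-3 : ℝ)) := by rw [hWV]; ring
          _ ≤ _ := by gcongr
      rw [e]
      refine (norm_add_le _ _).trans ((add_le_add a1 a2).trans ?_)
      have : 0 ≤ C₂ * C3 * (t ^ (1 - r) * w) + 4 * C₀ * (t ^ (-2 : ℝ) * V) := by positivity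
      linarith
    · have a1 : ‖K k t s * f k s‖ ≤ C₂ * C3 * (t ^ (1 - r) * w) := by
        rw [norm_mul]
        calc _ ≤ (C₂ * t ^ (1 - r)) * (C3 * w) :=
              mul_le_mul (near k t s hk hs hst) (H3 k s t hk hs ht h2) (norm_nonneg _)
                (by positivity)
          _ = _ := by ring
      have a2 : ‖((s : ℂ) - 1) * f 0 s * Z k t‖ ≤ 4 * C₀ * (t ^ (-2 : ℝ) * V) := by
        rw [norm_mul]
        have r1 : s ^ (-2 : ℝ) ≤ 4 * t ^ (-2 : ℝ) := by
          rw [Real.rpow_neg hs0.le, Real.rpow_neg ht0.le, ← div_eq_mul_inv, inv_eq_one_div,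
            div_le_div_iff₀ (by positivity) (by positivity)]
          rw [Real.rpow_two, Real.rpow_two]
          nlinarith
        calc _ ≤ (C₀ * s ^ (-2 : ℝ)) * V := mul_le_mul (hg0 s hs) hZk (norm_nonneg _) (by positivity)
          _ ≤ (C₀ * (4 * t ^ (-2 : ℝ))) * V := by gcongr
          _ = _ := by ring
      refine (norm_sub_le _ _).trans ((add_le_add a1 a2).trans ?_)
      have : 0 ≤ (C₁ * B * W + C₀ * W) * s ^ (-(3 / 2) : ℝ) := by positivity
      linarith
  -- the tail of the moment
  have htail : ‖∫ s in Set.Ici t, ((s : ℂ) - 1) * f 0 s‖ ≤ C₀ * t ^ (-1 : ℝ) := by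
    have := norm_integral_Ici_le (g := fun s : ℝ => ((s : ℂ) - 1) * f 0 s) (a := 2) (A := C₀) (D := 0)
      (ρ := 1) ht (by norm_num) one_pos (fun s hs => by simpa using hg0 s (ht.trans hs))
    norm_num at this
    exact this
  have hsplit : ∫ s in Set.Ici (1 : ℝ), ((s : ℂ) - 1) * f 0 s
      = (∫ s in Set.Icc 1 t, ((s : ℂ) - 1) * f 0 s) + ∫ s in Set.Ici t, ((s : ℂ) - 1) * f 0 s := by
    rw [integral_Ici_eq_integral_Ioi (x := t), ← setIntegral_union ?_ measurableSet_Ioi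
      (hi0.mono_set fun s hs => hs.1) (hi0.mono_set fun s hs => ht.trans (le_of_lt hs)),
      Set.Icc_union_Ioi_eq_Ici ht]
    exact Set.disjoint_left.2 fun s h1 h2 => absurd h1.2 (not_le.2 h2)
  have e : comp .one K f k t - (∫ s in Set.Ici (1 : ℝ), ((s : ℂ) - 1) * f 0 s) * Z k t
      = (∫ s in Set.Icc 1 t, (K k t s * f k s - ((s : ℂ) - 1) * f 0 s * Z k t))
        - (∫ s in Set.Ici t, ((s : ℂ) - 1) * f 0 s) * Z k t := by
    rw [integral_sub i1 i2, integral_mul_const, hsplit]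
    unfold comp Part.dom
    ring
  simp only [e]
  refine (norm_sub_le _ _).trans ?_
  rw [norm_mul]
  have htail' := mul_le_mul htail hZk (norm_nonneg _) (by positivity)
  rw [weight_coe_coe ht]
  set b := t ^ (-(p - 2 + r)) * wB α k t with hb
  set τ := t ^ (-(r + 1)) * wT α k t with hτ
  have hb0 : 0 ≤ b := by positivity
  have hτ0 : 0 ≤ τ := by positivity
  -- the powers of `t` in the individual contributions
  have p1 : t ^ (-1 : ℝ) * V ≤ CZ * τ := by
    calc _ ≤ t ^ (-1 : ℝ) * (CZ * (t ^ (-r) * wT α k t)) := by gcongr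
      _ = CZ * ((t ^ (-1 : ℝ) * t ^ (-r)) * wT α k t) := by ring
      _ = _ := by rw [← Real.rpow_add ht0, hτ]; congr 3; ring
  have p2 : t ^ (-2 : ℝ) * V * t = t ^ (-1 : ℝ) * V := by
    have : t ^ (-2 : ℝ) * t = t ^ (-1 : ℝ) := by
      rw [← Real.rpow_add_one ht0.ne']; norm_num
    rw [← this]; ring
  have p3 : t ^ (1 - r) * w * t ≤ b + τ := by
    have e3 : t ^ (1 - r) * w * t = t ^ (2 - r) * w := by
      rw [mul_right_comm, ← Real.rpow_add_one ht0.ne']; congr 2; ring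
    rw [e3, hw, mul_weight ht, weight_coe_coe ht, hb, hτ]
    have : t ^ (-(p - (2 - r))) ≤ t ^ (-(r + 1)) := rpow_neg_anti ht (by linarith)
    have e4 : -(p - (2 - r)) = -(p - 2 + r) := by ring
    rw [e4] at this ⊢
    gcongr
  have q1 : (C₁ * B * W + C₀ * W) / (3 / 2 - 1) ≤ 2 * (C₁ * B * CV + C₀ * CV) * τ := by
    have : C₁ * B * W + C₀ * W ≤ C₁ * B * (CV * τ) + C₀ * (CV * τ) := by gcongr
    rw [show (3 / 2 - 1 : ℝ) = 1 / 2 by norm_num]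
    linarith
  have q2 : (C₂ * C3 * (t ^ (1 - r) * w) + 4 * C₀ * (t ^ (-2 : ℝ) * V)) * t
      ≤ (C₂ * C3 + 4 * C₀ * CZ) * (b + τ) := by
    have h1 : C₂ * C3 * (t ^ (1 - r) * w * t) ≤ C₂ * C3 * (b + τ) := by gcongr
    have h2 : 4 * C₀ * (t ^ (-2 : ℝ) * V * t) ≤ 4 * C₀ * (CZ * τ) := by rw [p2]; gcongr
    have h3 : 0 ≤ 4 * C₀ * CZ * b := by positivity
    linear_combination h1 + h2 + h3
  have q3 : C₀ * t ^ (-1 : ℝ) * V ≤ C₀ * CZ * τ := by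
    have := mul_le_mul_of_nonneg_left p1 hC₀
    linarith
  have n1 : 0 ≤ 2 * (C₁ * B * CV + C₀ * CV) * b := by positivity
  have n2 : 0 ≤ C₀ * CZ * b := by positivity
  linear_combination hmain + htail' + q1 + q2 + q3 + n1 + n2

lemma omega_one_one_sub_asymptotic (hα : 0 ≤ α) (hp : 7 / 2 ≤ p) {Q : Fin 2 → ℝ → ℝ → ℂ}
    (hQ : HasBound α p p (Q 1)) (cQ : ContDom (Q 1)) {C₀ : ℝ} (hC₀ : 0 ≤ C₀)
    (hf0 : ∀ s, 1 ≤ s → ‖Q 1 0 s‖ ≤ C₀ * s ^ (-3 : ℝ))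
    (hfd : ∀ k s, k ≠ 0 → 1 ≤ s → ‖Q 1 k s - Q 1 0 s‖ ≤ C₀ * (√|k| * s ^ (-3 : ℝ))) :
    HasBound α ((p - 1 : ℝ) : WithTop ℝ) (2 : ℝ)
      (fun k t => omegaC .one 1 Q k t - omegaAs Q k t) := by
  have h := comp_one_sub_asymptotic (r := 1) (C₁ := 50) (C₂ := 8)
    (Z := fun k t => sqrtNegI k * cexp (-(sqrtNegI k * t))) hα hp (kerCont_omega .one 1)
    (kerExp_omega .one 1).kerLin hQ cQ zero_le_one hC₀ (by norm_num) (by norm_num) hf0 hfd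
    (fun k t hk ht => ?_) (fun k t s hk hs hst => ?_) (fun k t s hk hs hst => ?_)
  · rw [show p - 2 + 1 = p - 1 by ring, show (1 : ℝ) + 1 = 2 by norm_num] at h
    refine h.congr fun k t _ _ => ?_
    rw [omegaC_eq, omegaAs, c₁]
    ring
  · rw [norm_mul, norm_sqrtNegI, Real.rpow_one]
    gcongr
    exact norm_exp_sqrtNegI_le (by linarith)
  · refine (norm_kerOmega_one_one_sub_le hk hs hst).trans (le_of_eq ?_)
    rw [show (1 : ℝ) + 1 = 2 by norm_num]; norm_cast
  · refine (norm_kerOmega_one_one_le hk hs).trans ?_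
    rw [sub_self, Real.rpow_zero]
    have := mul_le_one₀ (min_le_left 1 (√|k| * s)) (Real.exp_pos _).le
      (exp_re_kappa_le_one (k := k) hst)
    linarith

lemma eta_one_one_sub_asymptotic (hα : 0 ≤ α) (hp : 7 / 2 ≤ p) {Q : Fin 2 → ℝ → ℝ → ℂ}
    (hQ : HasBound α p p (Q 1)) (cQ : ContDom (Q 1)) {C₀ : ℝ} (hC₀ : 0 ≤ C₀)
    (hf0 : ∀ s, 1 ≤ s → ‖Q 1 0 s‖ ≤ C₀ * s ^ (-3 : ℝ))
    (hfd : ∀ k s, k ≠ 0 → 1 ≤ s → ‖Q 1 k s - Q 1 0 s‖ ≤ C₀ * (√|k| * s ^ (-3 : ℝ))) :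
    HasBound α ((p - 2 : ℝ) : WithTop ℝ) (1 : ℝ)
      (fun k t => etaC .one 1 Q k t - etaAs Q k t) := by
  have h := comp_one_sub_asymptotic (r := 0) (C₁ := 102) (C₂ := 16)
    (Z := fun k t => -cexp (-(sqrtNegI k * t))) hα hp (kerCont_eta .one 1)
    (kerLin_eta .one 1) hQ cQ le_rfl hC₀ (by norm_num) (by norm_num) hf0 hfd
    (fun k t hk ht => ?_) (fun k t s hk hs hst => ?_) (fun k t s hk hs hst => ?_)
  · rw [show p - 2 + 0 = p - 2 by ring, show (0 : ℝ) + 1 = 1 by norm_num] at h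
    refine h.congr fun k t _ _ => ?_
    rw [etaC_eq, etaAs, c₁]
    ring
  · rw [norm_neg, Real.rpow_zero, one_mul]
    exact norm_exp_sqrtNegI_le (by linarith)
  · refine (norm_kerEta_one_one_sub_le hk hs hst).trans (le_of_eq ?_)
    rw [zero_add, Real.rpow_one]
  · refine (norm_kerEta_one_one_le hk hs).trans ?_
    rw [sub_zero, Real.rpow_one]
    have := mul_le_mul hst (exp_re_kappa_le_one (k := k) hst) (Real.exp_pos _).le
      (by linarith : 0 ≤ t)
    linarith

end

section

variable {α k k' l t s p q p' q' c A A' N : ℝ} {f g : ℝ → ℝ → ℂ}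

/-! ### The leading profile has mean zero -/

lemma continuous_sqrtNegI : Continuous sqrtNegI := by
  rw [continuous_iff_continuousAt]
  intro k
  by_cases hk : k = 0
  · subst hk
    have h0 : sqrtNegI 0 = 0 := by rw [← norm_eq_zero, norm_sqrtNegI]; simp
    unfold ContinuousAt
    rw [h0, tendsto_zero_iff_norm_tendsto_zero]
    simp only [norm_sqrtNegI]
    have : Continuous fun k : ℝ => √|k| := by fun_prop
    simpa using this.tendsto 0
  · unfold sqrtNegI
    refine ContinuousAt.cpow (by fun_prop) continuousAt_const (Or.inr ?_)
    simpa using hk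

lemma hasDerivAt_sqrtNegI (hk : k ≠ 0) :
    HasDerivAt sqrtNegI (-I / (2 * sqrtNegI k)) k := by
  have hk0 : (k : ℂ) ≠ 0 := by exact_mod_cast hk
  have hx : -(I * (k : ℂ)) ≠ 0 := neg_ne_zero.2 (mul_ne_zero I_ne_zero hk0)
  have h1 : HasDerivAt (fun k : ℝ => -(I * (k : ℂ))) (-I) k := by
    simpa using ((Complex.ofRealCLM.hasDerivAt (x := k)).const_mul I).fun_neg
  have hs : -(I * (k : ℂ)) ∈ slitPlane := Or.inr (by simpa using hk)
  have h2 := (Complex.hasStrictDerivAt_cpow_const (c := (1 / 2 : ℂ)) hs).hasDerivAt.comp k h1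
  refine h2.congr_deriv ?_
  rw [Complex.cpow_sub _ _ hx, Complex.cpow_one]
  change 1 / 2 * (sqrtNegI k / -(I * k)) * -I = -I / (2 * sqrtNegI k)
  rw [← sqrtNegI_sq k]
  have := sqrtNegI_ne_zero hk
  field_simp

/-- An antiderivative in `k` of `√(-ik) e^{-√(-ik)t}`, obtained from `dk = 2iz dz` for `z = √(-ik)`. -/
noncomputable def profilePrim (t k : ℝ) : ℂ :=
  -2 * I * (cexp (-(sqrtNegI k * t)) *
    (sqrtNegI k ^ 2 / t + 2 * sqrtNegI k / t ^ 2 + 2 / t ^ 3))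

lemma hasDerivAt_profilePrim (hk : k ≠ 0) (ht : 0 < t) :
    HasDerivAt (profilePrim t) (sqrtNegI k * cexp (-(sqrtNegI k * t))) k := by
  have hz := hasDerivAt_sqrtNegI hk
  have hz0 := sqrtNegI_ne_zero hk
  have ht0 : (t : ℂ) ≠ 0 := by exact_mod_cast ht.ne'
  have h1 := (hz.mul_const (t : ℂ)).fun_neg.cexp
  have h2 := (((hz.fun_pow 2).div_const (t : ℂ)).fun_add
    ((hz.const_mul 2).div_const ((t : ℂ) ^ 2))).fun_add (hasDerivAt_const k (2 / (t : ℂ) ^ 3))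
  have h3 := (h1.fun_mul h2).const_mul (-2 * I)
  refine h3.congr_deriv ?_
  field_simp
  ring_nf
  rw [I_sq]
  ring

lemma tendsto_profilePrim {F : Filter ℝ} (ht : 1 ≤ t)
    (hF : Filter.Tendsto (fun k : ℝ => |k|) F Filter.atTop) :
    Filter.Tendsto (profilePrim t) F (nhds 0) := by
  have ht0 : 0 < t := by linarith
  have hx : Filter.Tendsto (fun k : ℝ => √|k| * t / 4) F Filter.atTop := by
    simp only [mul_div_assoc]
    exact (Real.tendsto_sqrt_atTop.comp hF).atTop_mul_const (by positivity)
  have h : ∀ n : ℕ, Filter.Tendsto (fun k : ℝ => (√|k| * t / 4) ^ n * Real.exp (-(√|k| * t / 4))) F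
      (nhds 0) := fun n => (Real.tendsto_pow_mul_exp_neg_atTop_nhds_zero n).comp hx
  have hs := (((h 2).const_mul 32).add ((h 1).const_mul 16)).add ((h 0).const_mul 4)
  simp only [mul_zero, add_zero] at hs
  refine squeeze_zero_norm (fun k => ?_) hs
  set x := √|k| * t / 4 with hxd
  have h1 := norm_exp_sqrtNegI_le (k := k) ht0.le
  rw [← hxd] at h1
  have hl : √|k| ≤ 4 * x := by
    rw [hxd]; nlinarith [Real.sqrt_nonneg |k|]
  have i1 : t⁻¹ ≤ 1 := inv_le_one_of_one_le₀ ht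
  have hti : ∀ n : ℕ, (t ^ n)⁻¹ ≤ 1 := fun n => inv_le_one_of_one_le₀ (one_le_pow₀ ht)
  have h2 : ‖sqrtNegI k ^ 2 / t + 2 * sqrtNegI k / t ^ 2 + 2 / t ^ 3‖ ≤ 16 * x ^ 2 + 8 * x + 2 := by
    refine norm_add₃_le.trans ?_
    simp only [div_eq_mul_inv, norm_mul, norm_inv, norm_pow, norm_sqrtNegI, Complex.norm_real,
      Real.norm_of_nonneg ht0.le]
    rw [show ‖(2 : ℂ)‖ = 2 by norm_num]
    have a1 : √|k| ^ 2 * t⁻¹ ≤ (4 * x) ^ 2 * 1 := by gcongr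
    have a2 : 2 * √|k| * (t ^ 2)⁻¹ ≤ 2 * (4 * x) * 1 := by gcongr; exact hti 2
    have a3 : 2 * (t ^ 3)⁻¹ ≤ 2 * 1 := by gcongr; exact hti 3
    linarith
  unfold profilePrim
  rw [norm_mul (-2 * I), norm_mul (cexp _), show ‖-2 * I‖ = 2 by simp]
  have := mul_le_mul h1 h2 (norm_nonneg _) (Real.exp_pos _).le
  linear_combination 2 * this

lemma continuous_profilePrim (t : ℝ) : Continuous (profilePrim t) := by
  have := continuous_sqrtNegI
  unfold profilePrim
  fun_prop

lemma integrable_profile (hα : 1 < α) (ht : 1 ≤ t) :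
    Integrable fun k : ℝ => sqrtNegI k * cexp (-(sqrtNegI k * t)) := by
  obtain ⟨C, hC, H⟩ := exists_sqrt_rpow_mul_exp_le (α := α) (by linarith) zero_le_one
  refine (((integrable_wT hα ht).const_mul (t ^ (-1 : ℝ))).const_mul C).mono' ?_
    (Filter.Eventually.of_forall fun k => ?_)
  · have := continuous_sqrtNegI
    exact Continuous.aestronglyMeasurable (by fun_prop)
  · rw [norm_mul, norm_sqrtNegI]
    refine le_trans ?_ (H k t ht)
    rw [Real.rpow_one]
    gcongr
    exact norm_exp_sqrtNegI_le (by linarith)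

/-- The profile `√(-ik) e^{-√(-ik)t}` has mean zero: its antiderivative vanishes at both ends. -/
lemma integral_profile (ht : 1 ≤ t) :
    ∫ k : ℝ, sqrtNegI k * cexp (-(sqrtNegI k * t)) = 0 := by
  have ht0 : 0 < t := by linarith
  have hi := integrable_profile (α := 2) (by norm_num) ht
  have hc := continuous_profilePrim t
  have h1 := integral_Ioi_of_hasDerivAt_of_tendsto (a := 0) hc.continuousWithinAt
    (fun k hk => hasDerivAt_profilePrim (ne_of_gt hk) ht0) hi.integrableOn
    (tendsto_profilePrim ht Filter.tendsto_abs_atTop_atTop)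
  have h2 := integral_Iic_of_hasDerivAt_of_tendsto (a := 0) hc.continuousWithinAt
    (fun k hk => hasDerivAt_profilePrim (ne_of_lt hk) ht0) hi.integrableOn
    (tendsto_profilePrim ht Filter.tendsto_abs_atBot_atTop)
  rw [← intervalIntegral.integral_Iic_add_Ioi hi.integrableOn hi.integrableOn (b := 0), h1, h2]
  ring

end

section

variable {α k k' l t s p q p' q' c A A' N : ℝ} {f g : ℝ → ℝ → ℂ} {F₁ F₂ : ℝ × ℝ → ℝ}
  {ω u v : ℝ → ℝ → ℂ}

lemma HasBound.neg {p q : WithTop ℝ} (hf : HasBound α p q f) :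
    HasBound α p q (fun k t => -f k t) := by
  obtain ⟨C, hC, H⟩ := hf
  exact ⟨C, hC, fun k t hk ht => by rw [norm_neg]; exact H k t hk ht⟩

/-! ### Sums of the components -/

section Total

variable {Q : Fin 2 → ℝ → ℝ → ℂ}

lemma hasBound_total_eta (hα : 0 ≤ α) (hp : 3 ≤ p) (hQ0 : HasBound α p (3 : ℝ) (Q 0))
    (hQ1 : HasBound α p p (Q 1)) :
    HasBound α ((p - 2 : ℝ) : WithTop ℝ) (0 : ℝ) (total etaC Q) := by
  refine HasBound.congr (((((((hasBound_eta_one_zero hα hp hQ0 one_pos le_rfl).mono ?_ ?_).add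
    ((hasBound_eta_two_zero hα hp hQ0).of_top ?_)).add
    ((hasBound_eta_three_zero hα hp hQ0).mono ?_ ?_)).add
    ((hasBound_eta_one_one hα (by linarith) hQ1)))).add
    (((hasBound_eta_two_one hα (by linarith) hQ1).of_top ?_).add
    ((hasBound_eta_three_one hα (by linarith) hQ1).mono ?_ ?_))) fun k t _ _ => ?_
  on_goal 9 =>
    simp only [total, Fin.sum_univ_two]
    ring
  all_goals linarith

lemma hasBound_total_psi (hα : 0 ≤ α) (hp : 3 ≤ p) (hQ0 : HasBound α p (3 : ℝ) (Q 0))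
    (hQ1 : HasBound α p p (Q 1)) :
    HasBound α (1 / 2 : ℝ) (2 : ℝ) (total psiC Q) := by
  refine HasBound.congr (((((((hasBound_psi_one_zero hα hp hQ0 one_pos le_rfl).mono ?_ ?_).add
    ((hasBound_psi_two_zero hα hp hQ0).mono ?_ ?_)).add
    ((hasBound_psi_three_zero hα hp hQ0).mono ?_ ?_)).add
    ((hasBound_psi_one_one hα (by linarith) hQ1).mono ?_ ?_))).add
    (((hasBound_psi_two_one hα (by linarith) hQ1).mono ?_ ?_).add
    ((hasBound_psi_three_one hα (by linarith) hQ1).mono ?_ ?_))) fun k t _ _ => ?_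
  on_goal 13 =>
    simp only [total, Fin.sum_univ_two]
    ring
  all_goals linarith

lemma hasBound_total_phi (hα : 0 ≤ α) (hp : 3 ≤ p) (hQ0 : HasBound α p (3 : ℝ) (Q 0))
    (hQ1 : HasBound α p p (Q 1)) :
    HasBound α (1 / 2 : ℝ) (2 : ℝ) (total phiC Q) := by
  refine HasBound.congr (((((((hasBound_psi_one_zero hα hp hQ0 one_pos le_rfl).phi_of_psi.mono ?_ ?_).add
    ((hasBound_phi_two_zero hα hp hQ0).mono ?_ ?_)).add
    ((hasBound_phi_three_zero hα hp hQ0).mono ?_ ?_)).add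
    ((hasBound_psi_one_one hα (by linarith) hQ1).phi_of_psi.mono ?_ ?_))).add
    (((hasBound_phi_two_one hα (by linarith) hQ1).mono ?_ ?_).add
    ((hasBound_phi_three_one hα (by linarith) hQ1).mono ?_ ?_))) fun k t _ _ => ?_
  on_goal 13 =>
    simp only [total, Fin.sum_univ_two]
    ring
  all_goals linarith

lemma hasBound_total_omega_sub (hα : 0 ≤ α) (hp : 7 / 2 ≤ p) (hQ0 : HasBound α p (3 : ℝ) (Q 0))
    (hQ1 : HasBound α p p (Q 1)) (cQ : ContDom (Q 1)) {C₀ : ℝ} (hC₀ : 0 ≤ C₀)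
    (hf0 : ∀ s, 1 ≤ s → ‖Q 1 0 s‖ ≤ C₀ * s ^ (-3 : ℝ))
    (hfd : ∀ k s, k ≠ 0 → 1 ≤ s → ‖Q 1 k s - Q 1 0 s‖ ≤ C₀ * (√|k| * s ^ (-3 : ℝ))) :
    HasBound α ((p - 1 : ℝ) : WithTop ℝ) (2 : ℝ) (fun k t => total omegaC Q k t - omegaAs Q k t) := by
  have hp3 : 3 ≤ p := by linarith
  refine HasBound.congr (((((((hasBound_omega_one_zero hα hp3 hQ0 one_pos le_rfl).mono ?_ ?_).add
    ((hasBound_omega_two_zero hα hp3 hQ0).of_top ?_)).add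
    ((hasBound_omega_three_zero hα hp3 hQ0).mono ?_ ?_)).add
    (omega_one_one_sub_asymptotic hα hp hQ1 cQ hC₀ hf0 hfd))).add
    (((hasBound_omega_two_one hα (by linarith) hQ1).of_top ?_).add
    ((hasBound_omega_three_one hα (by linarith) hQ1).mono ?_ ?_))) fun k t _ _ => ?_
  on_goal 9 =>
    simp only [total, Fin.sum_univ_two]
    ring
  all_goals linarith

lemma hasBound_total_eta_sub (hα : 0 ≤ α) (hp : 7 / 2 ≤ p) (hQ0 : HasBound α p (3 : ℝ) (Q 0))
    (hQ1 : HasBound α p p (Q 1)) (cQ : ContDom (Q 1)) {C₀ : ℝ} (hC₀ : 0 ≤ C₀)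
    (hf0 : ∀ s, 1 ≤ s → ‖Q 1 0 s‖ ≤ C₀ * s ^ (-3 : ℝ))
    (hfd : ∀ k s, k ≠ 0 → 1 ≤ s → ‖Q 1 k s - Q 1 0 s‖ ≤ C₀ * (√|k| * s ^ (-3 : ℝ))) :
    HasBound α ((p - 2 : ℝ) : WithTop ℝ) (1 : ℝ) (fun k t => total etaC Q k t - etaAs Q k t) := by
  have hp3 : 3 ≤ p := by linarith
  refine HasBound.congr (((((((hasBound_eta_one_zero hα hp3 hQ0 one_pos le_rfl).mono ?_ ?_).add
    ((hasBound_eta_two_zero hα hp3 hQ0).of_top ?_)).add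
    ((hasBound_eta_three_zero hα hp3 hQ0).mono ?_ ?_)).add
    (eta_one_one_sub_asymptotic hα hp hQ1 cQ hC₀ hf0 hfd))).add
    (((hasBound_eta_two_one hα (by linarith) hQ1).of_top ?_).add
    ((hasBound_eta_three_one hα (by linarith) hQ1).mono ?_ ?_))) fun k t _ _ => ?_
  on_goal 9 =>
    simp only [total, Fin.sum_univ_two]
    ring
  all_goals linarith

end Total

/-! ### Improved decay of the nonlinear terms -/

/-- Hölder continuity extends to increments larger than `1`, where it follows from boundedness. -/
lemma exists_norm_sub_le_sqrt (hα : 0 ≤ α) (hN : 0 ≤ N) (hf : Hol α 0 N f)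
    (bf : HasBound α p q f) (hp : 0 ≤ p) (hq : 0 ≤ q) :
    ∃ M, 0 ≤ M ∧ ∀ k l t, k ≠ 0 → l ≠ k → 1 ≤ t →
      ‖f (k - l) t - f k t‖ ≤ M * (√|l| * (wB α (k - l) t + wB α k t)) := by
  obtain ⟨C, hC, H⟩ := bf.norm_le_wB hα hp hq
  refine ⟨N + C, by positivity, fun k l t hk hl ht => ?_⟩
  have hkl : k - l ≠ 0 := sub_ne_zero.2 hl.symm
  have h1 := wB_pos (α := α) (k := k - l) ht
  have h2 := wB_pos (α := α) (k := k) ht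
  have h3 := Real.sqrt_nonneg |l|
  rcases le_total |l| 1 with h | h
  · have h4 := hf (k - l) k t hkl hk (by simpa using h) ht
    rw [sub_sub_cancel_left, abs_neg, add_zero] at h4
    refine h4.trans ?_
    gcongr
    linarith
  · have h4 := H (k - l) t hkl ht
    have h5 := H k t hk ht
    simp only [neg_zero, Real.rpow_zero, one_mul] at h4 h5
    have h6 : 1 ≤ √|l| := Real.one_le_sqrt.2 h
    calc _ ≤ C * (wB α (k - l) t + wB α k t) := (norm_sub_le _ _).trans (by linarith)
      _ ≤ (N + C) * (√|l| * (wB α (k - l) t + wB α k t)) := by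
        gcongr
        · linarith
        · exact le_mul_of_one_le_left (by positivity) h6

/-- Since the leading profile of the vorticity has mean zero, its convolution with the slowly decaying
part `a₂` of the velocity only sees the increments of `a₂`, which are controlled by Hölder
continuity; this gains a factor `t^{-1/2}`. -/
lemma hasBound_conv_of_meanZero (hα : 1 < α) {a a₁ a₂ w : ℝ → ℝ → ℂ} {c : ℂ} {q₀ : ℝ}
    (hq : 0 ≤ q) (hq1 : q ≤ 1) (ba : HasBound α (1 / 2 : ℝ) q₀ a) (ca : ContDom a)
    (ha : ∀ k t, k ≠ 0 → 1 ≤ t → a k t = a₁ k t + a₂ k t)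
    (h1 : HasBound α (3 / 2 : ℝ) q a₁) (h2 : HasBound α (1 / 2 : ℝ) (2 : ℝ) a₂) (hN : 0 ≤ N)
    (hol : Hol α 0 N a₂) (bw : HasBound α (5 / 2 : ℝ) (1 : ℝ) w) (cw : ContDom w)
    (hd : HasBound α (5 / 2 : ℝ) (2 : ℝ)
      (fun k t => w k t - c * sqrtNegI k * cexp (-(sqrtNegI k * t)))) :
    HasBound α (4 : ℝ) ((q + 3 : ℝ) : WithTop ℝ) (conv a w) := by
  have hα0 : 0 ≤ α := by linarith
  obtain ⟨M, hM, HM⟩ := exists_norm_sub_le_sqrt hα0 hN hol h2 (by norm_num) (by norm_num)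
  obtain ⟨C, hC, HC⟩ := exists_sqrt_rpow_mul_exp_le hα0 zero_le_two
  obtain ⟨A, hA, HA⟩ := ba
  obtain ⟨A1, hA1, H1⟩ := h1
  obtain ⟨A2, hA2, H2⟩ := h2
  obtain ⟨Aw, hAw, Hw⟩ := bw
  obtain ⟨Ad, hAd, Hd⟩ := hd
  have hcC := convC_nonneg α
  have hbr := brI_nonneg α
  set D := M * (‖c‖ * C) with hD
  have hD0 : 0 ≤ D := by positivity
  refine ⟨A1 * Aw * (convC α * 3) + A2 * Ad * (convC α * 3) + D * (convC α * 3) + D * brI α,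
    by positivity, fun k t hk ht => ?_⟩
  have ht0 : 0 < t := by linarith
  set P : ℝ → ℂ := fun l => c * sqrtNegI l * cexp (-(sqrtNegI l * t)) with hP
  have iP : Integrable P := by
    simpa only [hP, mul_assoc] using (integrable_profile (α := 2) (by norm_num) ht).const_mul c
  have eP : ∫ l, P l = 0 := by
    simp only [hP, mul_assoc, integral_const_mul, integral_profile ht, mul_zero]
  have iF := integrable_conv (k := k) hα hA HA Hw ca cw ht
  -- a multiple of the profile may be subtracted, since its integral is zero
  have e : ∫ l, a (k - l) t * w l t = ∫ l, (a (k - l) t * w l t - a₂ k t * P l) := by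
    rw [integral_sub iF (iP.const_mul _), integral_const_mul, eP, mul_zero, sub_zero]
  unfold conv
  rw [norm_mul, e]
  refine (mul_le_of_le_one_left (norm_nonneg _) norm_inv_two_pi_le_one).trans ?_
  have w1 := integral_weight_mul_weight (p := 3 / 2) (q := q) (p' := 5 / 2) (q' := 1) (k := k) hα ht
  have w2 := integral_weight_mul_weight (p := 1 / 2) (q := 2) (p' := 5 / 2) (q' := 2) (k := k) hα ht
  have w3 := integral_weight_mul_weight (p := 0) (q := 1) (p' := 3) (q' := 2) (k := k) hα ht
  have v1 := convWeight_le (α := α) (p := 3 / 2) (q := q) (p' := 5 / 2) (q' := 1) (P := 4)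
    (R := q + 3) (k := k) ht (by linarith) (by linarith) (by linarith) (by linarith)
  have v2 := convWeight_le (α := α) (p := 1 / 2) (q := 2) (p' := 5 / 2) (q' := 2) (P := 4)
    (R := q + 3) (k := k) ht (by linarith) (by linarith) (by linarith) (by linarith)
  have v3 := convWeight_le (α := α) (p := 0) (q := 1) (p' := 3) (q' := 2) (P := 4)
    (R := q + 3) (k := k) ht (by linarith) (by linarith) (by linarith) (by linarith)
  have i4 := ((integrable_wT hα ht).const_mul (t ^ (-2 : ℝ))).const_mul (wB α k t)
  refine (norm_integral_le_of_norm_le ((((w1.1.const_mul (A1 * Aw)).add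
    (w2.1.const_mul (A2 * Ad))).add (w3.1.const_mul D)).add (i4.const_mul D)) ?_).trans ?_
  · filter_upwards [ae_ne 0, ae_ne k] with l hl hlk
    have hkl : k - l ≠ 0 := sub_ne_zero.2 hlk.symm
    simp only [Pi.add_apply]
    have b1 := norm_mul_le_weight (k := k) (l := l) hA1 H1 Hw ht hkl hl
    have b2 := norm_mul_le_weight (k := k) (l := l) hA2 H2 Hd ht hkl hl
    have b3 : ‖(a₂ (k - l) t - a₂ k t) * P l‖ ≤ D * (weight α (0 : ℝ) (1 : ℝ) (k - l) t *
        weight α (3 : ℝ) (2 : ℝ) l t) + D * (wB α k t * (t ^ (-2 : ℝ) * wT α l t)) := by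
      have x1 : ‖P l‖ ≤ ‖c‖ * (√|l| * Real.exp (-(√|l| * t / 4))) := by
        rw [hP, norm_mul, norm_mul, norm_sqrtNegI, mul_assoc]
        gcongr
        exact norm_exp_sqrtNegI_le ht0.le
      have x2 := HC l t ht
      rw [Real.rpow_two] at x2
      have x3 : wB α (k - l) t ≤ weight α (0 : ℝ) (1 : ℝ) (k - l) t := by
        rw [weight_coe_coe ht, neg_zero, Real.rpow_zero, one_mul]
        have := wT_pos (α := α) (k := k - l) ht
        have : 0 ≤ t ^ (-1 : ℝ) * wT α (k - l) t := by positivity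
        linarith
      have x4 : t ^ (-2 : ℝ) * wT α l t ≤ weight α (3 : ℝ) (2 : ℝ) l t := by
        rw [weight_coe_coe ht]
        have := wB_pos (α := α) (k := l) ht
        have : 0 ≤ t ^ (-3 : ℝ) * wB α l t := by positivity
        linarith
      have y1 := wB_pos (α := α) (k := k - l) ht
      have y2 := wB_pos (α := α) (k := k) ht
      have y3 := wT_pos (α := α) (k := l) ht
      rw [norm_mul]
      calc _ ≤ M * (√|l| * (wB α (k - l) t + wB α k t)) *
            (‖c‖ * (√|l| * Real.exp (-(√|l| * t / 4)))) :=
          mul_le_mul (HM k l t hk hlk ht) x1 (norm_nonneg _) (by positivity)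
        _ = M * ‖c‖ * (wB α (k - l) t + wB α k t) * (√|l| ^ 2 * Real.exp (-(√|l| * t / 4))) := by
          ring
        _ ≤ M * ‖c‖ * (wB α (k - l) t + wB α k t) * (C * (t ^ (-2 : ℝ) * wT α l t)) := by gcongr
        _ = D * (wB α (k - l) t * (t ^ (-2 : ℝ) * wT α l t)) +
            D * (wB α k t * (t ^ (-2 : ℝ) * wT α l t)) := by rw [hD]; ring
        _ ≤ _ := by
          have y4 := weight_nonneg (α := α) (p := 0) (q := 1) (k := k - l) ht
          gcongr
    have e2 : a (k - l) t * w l t - a₂ k t * P l = a₁ (k - l) t * w l t +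
        a₂ (k - l) t * (w l t - P l) + (a₂ (k - l) t - a₂ k t) * P l := by
      rw [ha _ _ hkl ht]; ring
    rw [e2]
    refine norm_add₃_le.trans ?_
    linarith
  · have j1 := w1.1.const_mul (A1 * Aw)
    have j2 := w2.1.const_mul (A2 * Ad)
    have j3 := w3.1.const_mul D
    rw [integral_add' ((j1.add j2).add j3) (i4.const_mul D), integral_add' (j1.add j2) j3,
      integral_add' j1 j2]
    simp only [integral_const_mul, integral_wT ht]
    have z1 := mul_le_mul_of_nonneg_left (w1.2.trans (mul_le_mul_of_nonneg_left v1 hcC))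
      (by positivity : 0 ≤ A1 * Aw)
    have z2 := mul_le_mul_of_nonneg_left (w2.2.trans (mul_le_mul_of_nonneg_left v2 hcC))
      (by positivity : 0 ≤ A2 * Ad)
    have z3 := mul_le_mul_of_nonneg_left (w3.2.trans (mul_le_mul_of_nonneg_left v3 hcC)) hD0
    have z4 : wB α k t * (t ^ (-2 : ℝ) * ((t ^ 2)⁻¹ * brI α))
        ≤ brI α * weight α (4 : ℝ) ((q + 3 : ℝ) : WithTop ℝ) k t := by
      rw [weight_coe_coe ht, ← Real.rpow_two, ← Real.rpow_neg ht0.le]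
      have x : t ^ (-4 : ℝ) = t ^ (-2 : ℝ) * t ^ (-2 : ℝ) := by
        rw [← Real.rpow_add ht0]; norm_num
      rw [x]
      have := wT_pos (α := α) (k := k) ht
      have : 0 ≤ brI α * (t ^ (-(q + 3)) * wT α k t) := by positivity
      linarith
    have z5 := mul_le_mul_of_nonneg_left z4 hD0
    unfold convC
    linarith

/-- First information on a solution beyond its definition: the vorticity approaches its leading
profile at the rate that the a priori decay of the nonlinear terms allows. -/
lemma hasBound_omega_sub_first (hα : 1 < α) (hF : IsForce F₁ F₂) (h : IsSolution α F₁ F₂ ω u v)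
    (hN : 0 ≤ N) (hω : Hol α 0 N ω) :
    HasBound α (5 / 2 : ℝ) (2 : ℝ) (fun k t => ω k t -
      c₁ (Q F₁ F₂ ω u v) * sqrtNegI k * cexp (-(sqrtNegI k * t))) := by
  obtain ⟨C, hC, H0, Hd⟩ := exists_norm_Q_one_sub_zero_le hα hF h hN hω
  have := hasBound_total_omega_sub (by linarith) le_rfl (hasBound_Q_zero hα hF h)
    (hasBound_Q_one hα hF h) (contDom_Q hα hF h 1) hC H0 Hd
  rw [show (7 / 2 - 1 : ℝ) = 5 / 2 by norm_num] at this
  exact this.congr fun k t hk ht => by rw [h.eq_ω k t hk ht, omegaAs]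

/-- In `v = ω + ψ` only `ψ` decays slowly. -/
lemma hasBound_Q_one_improved (hα : 1 < α) (hF : IsForce F₁ F₂) (h : IsSolution α F₁ F₂ ω u v)
    (hN : 0 ≤ N) (hω : Hol α 0 N ω) :
    HasBound α (4 : ℝ) (4 : ℝ) (Q F₁ F₂ ω u v 1) := by
  have hα0 : 0 ≤ α := by linarith
  obtain ⟨N', hN', hψ⟩ := exists_hol_total hα hF h hN hω (transfersHol_psi hα0)
  have bω := hasBound_of_mem_BSpace h.mem_ω
  have hc := hasBound_conv_of_meanZero (a₁ := ω) (a₂ := total psiC (Q F₁ F₂ ω u v)) hα zero_le_one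
    le_rfl (hasBound_of_mem_BSpace h.mem_v) h.mem_v.1
    (fun k t hk ht => by rw [h.eq_v k t hk ht, h.eq_ω k t hk ht])
    (bω.mono (by norm_num) le_rfl)
    (hasBound_total_psi hα0 (by norm_num) (hasBound_Q_zero hα hF h)
      ((hasBound_Q_one hα hF h))) hN' hψ bω h.mem_ω.1
    (hasBound_omega_sub_first hα hF h hN hω)
  rw [show (1 + 3 : ℝ) = 4 by norm_num] at hc
  exact hc.sub (hasBound_fourierX hα0 hF.smooth₁ hF.compact₁ _ _)

/-- In `u = -η + φ` only `φ` decays slowly. -/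
lemma hasBound_Q_zero_improved (hα : 1 < α) (hF : IsForce F₁ F₂) (h : IsSolution α F₁ F₂ ω u v)
    (hN : 0 ≤ N) (hω : Hol α 0 N ω) :
    HasBound α (4 : ℝ) (3 : ℝ) (Q F₁ F₂ ω u v 0) := by
  have hα0 : 0 ≤ α := by linarith
  obtain ⟨N', hN', hφ⟩ := exists_hol_total hα hF h hN hω (transfersHol_phi hα0)
  have bη := hasBound_total_eta hα0 (by norm_num) (hasBound_Q_zero hα hF h)
    (hasBound_Q_one hα hF h)
  rw [show (7 / 2 - 2 : ℝ) = 3 / 2 by norm_num] at bη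
  have hc := hasBound_conv_of_meanZero (a₁ := fun k t => -total etaC (Q F₁ F₂ ω u v) k t)
    (a₂ := total phiC (Q F₁ F₂ ω u v)) hα le_rfl
    zero_le_one (hasBound_of_mem_BSpace h.mem_u) h.mem_u.1 h.eq_u bη.neg
    (hasBound_total_phi hα0 (by norm_num) (hasBound_Q_zero hα hF h) (hasBound_Q_one hα hF h))
    hN' hφ (hasBound_of_mem_BSpace h.mem_ω) h.mem_ω.1
    (hasBound_omega_sub_first hα hF h hN hω)
  rw [zero_add] at hc
  exact hc.add (hasBound_fourierX hα0 hF.smooth₂ hF.compact₂ _ _)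

end

section

variable {α N : ℝ} {F₁ F₂ : ℝ × ℝ → ℝ} {ω u v : ℝ → ℝ → ℂ}

/-! ### Components of a solution in the spaces `𝓑_{α-1,p,q}` -/

/-- The decay that makes all component integrals converge absolutely, in spite of the linear growth of the
kernels in `s`. -/
def DecayThree (Q : Fin 2 → ℝ → ℝ → ℂ) : Prop :=
  ∀ m, ∃ C, 0 ≤ C ∧ ∀ k t, k ≠ 0 → 1 ≤ t → ‖Q m k t‖ ≤ C * t ^ (-3 : ℝ)

section Continuity

variable {Q : Fin 2 → ℝ → ℝ → ℂ}

lemma contDom_omegaC (cQ : ∀ m, ContDom (Q m)) (bQ : DecayThree Q) (n : Part) (m : Fin 2) :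
    ContDom (omegaC n m Q) := by
  rw [omegaC_eq]
  exact continuousOn_comp (kerCont_omega n m) (kerExp_omega n m).kerLin (cQ m) (bQ m)

lemma contDom_etaC (cQ : ∀ m, ContDom (Q m)) (bQ : DecayThree Q) (n : Part) (m : Fin 2) :
    ContDom (etaC n m Q) := by
  rw [etaC_eq]
  exact continuousOn_comp (kerCont_eta n m) (kerLin_eta n m) (cQ m) (bQ m)

lemma contDom_psiC (cQ : ∀ m, ContDom (Q m)) (bQ : DecayThree Q) (n : Part) (m : Fin 2) :
    ContDom (psiC n m Q) := by
  rw [psiC_eq]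
  exact continuousOn_comp (kerCont_psi n m) (kerExp_psi n m).kerLin (cQ m) (bQ m)

lemma contDom_phiC (cQ : ∀ m, ContDom (Q m)) (bQ : DecayThree Q) (n : Part) (m : Fin 2) :
    ContDom (phiC n m Q) := by
  rw [phiC_eq]
  exact continuousOn_comp (kerCont_phi n m) (kerExp_phi n m).kerLin (cQ m) (bQ m)

lemma contDom_total_etaC (cQ : ∀ m, ContDom (Q m)) (bQ : DecayThree Q) :
    ContDom (total etaC Q) := by
  have h := contDom_etaC cQ bQ
  unfold ContDom at h ⊢
  simp only [total]
  exact continuousOn_finsetSum _ fun m _ => ((h .one m).add (h .two m)).add (h .three m)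

lemma contDom_omegaAs (Q : Fin 2 → ℝ → ℝ → ℂ) : ContDom (omegaAs Q) := by
  have := continuous_sqrtNegI
  unfold ContDom omegaAs
  exact Continuous.continuousOn (by fun_prop)

lemma contDom_etaAs (Q : Fin 2 → ℝ → ℝ → ℂ) : ContDom (etaAs Q) := by
  have := continuous_sqrtNegI
  unfold ContDom etaAs
  exact Continuous.continuousOn (by fun_prop)

end Continuity

lemma HasBound.mem_BSpace {p q p' q' : ℝ} {f : ℝ → ℝ → ℂ} (h : HasBound α p q f) (hα : 1 < α)
    (hc : ContDom f) (hp : p' ≤ p) (hq : q' ≤ q) : f ∈ BSpace (α - 1) p' q' :=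
  mem_BSpace_sub_one hα.le hc (h.mono hp hq)

lemma HasBound.mono_right {q q' : ℝ} {f : ℝ → ℝ → ℂ} (h : HasBound α ⊤ q f) (hq : q' ≤ q) :
    HasBound α ⊤ q' f := by
  obtain ⟨C, hC, H⟩ := h
  refine ⟨C, hC, fun k t hk ht => (H k t hk ht).trans ?_⟩
  rw [weight_top_coe ht, weight_top_coe ht]
  have := wT_pos (α := α) (k := k) ht
  have := rpow_neg_anti ht hq
  gcongr

lemma decayThree_Q (hα : 1 < α) (hF : IsForce F₁ F₂) (h : IsSolution α F₁ F₂ ω u v) :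
    DecayThree (Q F₁ F₂ ω u v) := by
  obtain ⟨B, hB, HB⟩ := exists_norm_Q_le hα hF h
  refine fun m => ⟨B, hB, fun k t hk ht => (HB m k t hk ht).trans ?_⟩
  have ht0 : 0 < t := by linarith
  gcongr
  exact mul_le_of_le_one_right (by positivity) (wB_le_one ht)

end

end WallFlow

open WallFlow in
theorem mainTheorem4 (α : ℝ) (hα : 1 < α - 1) :
    ∃ ε : ℝ, 0 < ε ∧
      ∀ (F₁ F₂ : ℝ × ℝ → ℝ) (ω u v : ℝ → ℝ → ℂ),
        IsForce F₁ F₂ → IsSolution α F₁ F₂ ω u v → IsSmall α ε F₁ F₂ ω u v →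
        -- the improved bounds on the nonlinear terms
        (Q F₁ F₂ ω u v 1 ∈ BSpace (α - 1) (4 : ℝ) (4 : ℝ) ∧
          Q F₁ F₂ ω u v 0 ∈ BSpace (α - 1) (4 : ℝ) (3 : ℝ)) ∧
        -- the bounds on all components
        (∀ δ : ℝ, 0 < δ →
          (psiC .one 0 (Q F₁ F₂ ω u v) ∈ BSpace (α - 1) (3 / 2 - δ : ℝ) (2 : ℝ) ∧
            psiC .two 0 (Q F₁ F₂ ω u v) ∈ BSpace (α - 1) (3 : ℝ) (2 : ℝ) ∧
            psiC .three 0 (Q F₁ F₂ ω u v) ∈ BSpace (α - 1) (3 : ℝ) (2 : ℝ) ∧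
            psiC .one 1 (Q F₁ F₂ ω u v) ∈ BSpace (α - 1) (1 / 2 : ℝ) (3 : ℝ) ∧
            psiC .two 1 (Q F₁ F₂ ω u v) ∈ BSpace (α - 1) (3 : ℝ) (3 : ℝ) ∧
            psiC .three 1 (Q F₁ F₂ ω u v) ∈ BSpace (α - 1) (3 : ℝ) (3 : ℝ)) ∧
          (phiC .one 0 (Q F₁ F₂ ω u v) ∈ BSpace (α - 1) (3 / 2 - δ : ℝ) (2 : ℝ) ∧
            phiC .two 0 (Q F₁ F₂ ω u v) ∈ BSpace (α - 1) (3 : ℝ) (2 : ℝ) ∧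
            phiC .three 0 (Q F₁ F₂ ω u v) ∈ BSpace (α - 1) (3 : ℝ) (2 : ℝ) ∧
            phiC .one 1 (Q F₁ F₂ ω u v) ∈ BSpace (α - 1) (1 / 2 : ℝ) (3 : ℝ) ∧
            phiC .two 1 (Q F₁ F₂ ω u v) ∈ BSpace (α - 1) (3 : ℝ) (3 : ℝ) ∧
            phiC .three 1 (Q F₁ F₂ ω u v) ∈ BSpace (α - 1) (3 : ℝ) (3 : ℝ)) ∧
          (omegaC .one 0 (Q F₁ F₂ ω u v) ∈ BSpace (α - 1) (4 : ℝ) (3 - δ : ℝ) ∧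
            omegaC .two 0 (Q F₁ F₂ ω u v) ∈ BSpace (α - 1) ⊤ (3 : ℝ) ∧
            omegaC .three 0 (Q F₁ F₂ ω u v) ∈ BSpace (α - 1) (4 : ℝ) (3 : ℝ) ∧
            omegaC .one 1 (Q F₁ F₂ ω u v) ∈ BSpace (α - 1) (3 : ℝ) (1 : ℝ) ∧
            omegaC .two 1 (Q F₁ F₂ ω u v) ∈ BSpace (α - 1) ⊤ (3 : ℝ) ∧
            omegaC .three 1 (Q F₁ F₂ ω u v) ∈ BSpace (α - 1) (3 : ℝ) (3 : ℝ)) ∧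
          (etaC .one 0 (Q F₁ F₂ ω u v) ∈ BSpace (α - 1) (3 : ℝ) (2 - δ : ℝ) ∧
            etaC .two 0 (Q F₁ F₂ ω u v) ∈ BSpace (α - 1) ⊤ (2 : ℝ) ∧
            etaC .three 0 (Q F₁ F₂ ω u v) ∈ BSpace (α - 1) (3 : ℝ) (2 : ℝ) ∧
            etaC .one 1 (Q F₁ F₂ ω u v) ∈ BSpace (α - 1) (2 : ℝ) (0 : ℝ) ∧
            etaC .two 1 (Q F₁ F₂ ω u v) ∈ BSpace (α - 1) ⊤ (3 : ℝ) ∧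
            etaC .three 1 (Q F₁ F₂ ω u v) ∈ BSpace (α - 1) (2 : ℝ) (2 : ℝ))) ∧
        -- the consequence for the leading asymptotic terms
        (fun k t => ω k t - omegaAs (Q F₁ F₂ ω u v) k t) ∈
          BSpace (α - 1) (3 : ℝ) (2 : ℝ) ∧
        (fun k t => total etaC (Q F₁ F₂ ω u v) k t - etaAs (Q F₁ F₂ ω u v) k t) ∈
          BSpace (α - 1) (2 : ℝ) (1 : ℝ) := by
  have hα1 : 1 < α := by linarith
  have hα0 : 0 ≤ α := by linarith
  obtain ⟨ε, hε, H⟩ := exists_hol_omega hα1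
  refine ⟨ε, hε, fun F₁ F₂ ω u v hF h hs => ?_⟩
  obtain ⟨N, hN, hω⟩ := H F₁ F₂ ω u v hF h hs
  obtain ⟨C, hC, H0, Hd⟩ := exists_norm_Q_one_sub_zero_le hα1 hF h hN hω
  -- with the improved bounds on the sources, the component bounds apply at the exponent `4`
  have b1 := hasBound_Q_one_improved hα1 hF h hN hω
  have b0 := hasBound_Q_zero_improved hα1 hF h hN hω
  have cQ := contDom_Q hα1 hF h
  have bQ := decayThree_Q hα1 hF h
  have h3 : (3 : ℝ) ≤ 4 := by norm_num
  have h2 : (2 : ℝ) < 4 := by norm_num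
  have h1 : (1 : ℝ) < 4 := by norm_num
  have h72 : (7 / 2 : ℝ) ≤ 4 := by norm_num
  have s1 := hasBound_total_omega_sub hα0 h72 b0 b1 (cQ 1) hC H0 Hd
  have s2 := hasBound_total_eta_sub hα0 h72 b0 b1 (cQ 1) hC H0 Hd
  refine ⟨⟨mem_BSpace_sub_one hα1.le (cQ 1) b1, mem_BSpace_sub_one hα1.le (cQ 0) b0⟩,
    fun δ hδ => ?_, ?_, ?_⟩
  · have hd1 : min δ 1 ≤ 1 := min_le_right _ _
    -- for `δ > 1` the claim is weaker than for `δ = 1`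
    have hd : 0 < min δ 1 := lt_min hδ one_pos
    have hdd : min δ 1 ≤ δ := min_le_left _ _
    set Q₀ := Q F₁ F₂ ω u v
    have cω := contDom_omegaC cQ bQ
    have cη := contDom_etaC cQ bQ
    have cψ := contDom_psiC cQ bQ
    have cφ := contDom_phiC cQ bQ
    have ψ10 := hasBound_psi_one_zero hα0 h3 b0 hd hd1
    have ψ11 := hasBound_psi_one_one hα0 h2 b1
    refine ⟨⟨?_, ?_, ?_, ?_, ?_, ?_⟩, ⟨?_, ?_, ?_, ?_, ?_, ?_⟩, ⟨?_, ?_, ?_, ?_, ?_, ?_⟩,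
      ⟨?_, ?_, ?_, ?_, ?_, ?_⟩⟩
    · exact ψ10.mem_BSpace hα1 (cψ _ _) (by linarith) (by linarith)
    · exact (hasBound_psi_two_zero hα0 h3 b0).mem_BSpace hα1 (cψ _ _) (by linarith) (by linarith)
    · exact (hasBound_psi_three_zero hα0 h3 b0).mem_BSpace hα1 (cψ _ _) (by linarith) (by linarith)
    · exact ψ11.mem_BSpace hα1 (cψ _ _) (by linarith) (by linarith)
    · exact (hasBound_psi_two_one hα0 h1 b1).mem_BSpace hα1 (cψ _ _) (by linarith) (by linarith)
    · exact (hasBound_psi_three_one hα0 h1 b1).mem_BSpace hα1 (cψ _ _) (by linarith) (by linarith)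
    · exact ψ10.phi_of_psi.mem_BSpace hα1 (cφ _ _) (by linarith) (by linarith)
    · exact (hasBound_phi_two_zero hα0 h3 b0).mem_BSpace hα1 (cφ _ _) (by linarith) (by linarith)
    · exact (hasBound_phi_three_zero hα0 h3 b0).mem_BSpace hα1 (cφ _ _) (by linarith) (by linarith)
    · exact ψ11.phi_of_psi.mem_BSpace hα1 (cφ _ _) (by linarith) (by linarith)
    · exact (hasBound_phi_two_one hα0 h1 b1).mem_BSpace hα1 (cφ _ _) (by linarith) (by linarith)
    · exact (hasBound_phi_three_one hα0 h1 b1).mem_BSpace hα1 (cφ _ _) (by linarith) (by linarith)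
    · exact (hasBound_omega_one_zero hα0 h3 b0 hd hd1).mem_BSpace hα1 (cω _ _) (by linarith)
        (by linarith)
    · exact mem_BSpace_sub_one hα1.le (cω _ _) (hasBound_omega_two_zero hα0 h3 b0)
    · exact (hasBound_omega_three_zero hα0 h3 b0).mem_BSpace hα1 (cω _ _) (by linarith)
        (by linarith)
    · exact (hasBound_omega_one_one hα0 h2 b1).mem_BSpace hα1 (cω _ _) (by linarith) (by linarith)
    · exact mem_BSpace_sub_one hα1.le (cω _ _) ((hasBound_omega_two_one hα0 h1 b1).mono_right
        (by linarith))
    · exact (hasBound_omega_three_one hα0 h1 b1).mem_BSpace hα1 (cω _ _) (by linarith)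
        (by linarith)
    · exact (hasBound_eta_one_zero hα0 h3 b0 hd hd1).mem_BSpace hα1 (cη _ _) (by linarith)
        (by linarith)
    · exact mem_BSpace_sub_one hα1.le (cη _ _) (hasBound_eta_two_zero hα0 h3 b0)
    · exact (hasBound_eta_three_zero hα0 h3 b0).mem_BSpace hα1 (cη _ _) (by linarith) (by linarith)
    · exact (hasBound_eta_one_one hα0 h2 b1).mem_BSpace hα1 (cη _ _) (by linarith) (by linarith)
    · exact mem_BSpace_sub_one hα1.le (cη _ _) ((hasBound_eta_two_one hα0 h1 b1).mono_right
        (by linarith))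
    · exact (hasBound_eta_three_one hα0 h1 b1).mem_BSpace hα1 (cη _ _) (by linarith) (by linarith)
  · exact (s1.congr fun k t hk ht => by rw [h.eq_ω k t hk ht]).mem_BSpace hα1
      (h.mem_ω.1.sub (contDom_omegaAs _)) (by linarith) (by linarith)
  · exact s2.mem_BSpace hα1 ((contDom_total_etaC cQ bQ).sub (contDom_etaAs _)) (by linarith)
      (by linarith)
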